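/- Let $d\ge 5$ and let $M$ be a smooth $d$-manifold with boundary $\Sigma=\partial M$ (Hausdorff and $\sigma$-compact; in particular $M$ may be any compact manifold with boundary). Let $\boldsymbol c$ be a conformal class of smooth Riemannian metrics on $M$. A section of weight $w$ of a vector bundle $E$ over $M$ is a family of smooth sections $f_g$ of $E$, one for each $g\in\boldsymbol c$, with $f_{\Omega^2 g}=\Omega^{w}f_g$ for every smooth $\Omega>0$; weight $w$ sections of bundles over $\Sigma$ are defined in the same way, with $\Omega|_\Sigma$ in place of $\Omega$. Let $\sigma$ be a defining density for $\Sigma$: a function of weight $1$ with $\sigma_g\ge 0$, $\sigma_g^{-1}(0)=\Sigma$ and $\mathrm d\sigma_g\neq0$ at all points of $\Sigma$. Let $\mathcal VM\to M$ be a smooth real vector bundle of finite rank, $\mathcal V\Sigma$ its restriction to $\Sigma$, and let $\bar A$ be a smooth connection on $\mathcal V\Sigma$. For a smooth connection $A$ on $\mathcal VM$ with curvature $F$ and for $g\in\boldsymbol c$, define the conformally compact Yang–Mills current $$ j_b[A]\stackrel g= \sigma_g\,\nabla^aF_{ab}-(d-4)\,n^aF_{ab},\qquad n=\mathrm d\sigma_g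 , $$ where $\nabla$ is the Levi-Civita connection of $g$ coupled to $A$ and indices are raised with $g$. Call $A$ an asymptotically Yang–Mills extension of $\bar A$ if $A$ is smooth, $\nabla^A_v=\bar\nabla^{\bar A}_v$ along $\Sigma$ for all $v$ tangent to $\Sigma$, and $$ j[A]=\sigma^{d-4}\,k \quad\text{(that is, } j[A]\stackrel g=\sigma_g^{\,d-4}k_g \text{ for all } g\in\boldsymbol c)$$ for a smooth section $k$ of $T^*M\otimes\operatorname{End}\mathcal VM$ of weight $3-d$. Then $\bar A$ has an asymptotically Yang–Mills extension, and there is exactly one smooth section $\bar k$ of $T^*\Sigma\otimes\operatorname{End}\mathcal V\Sigma$ of weight $3-d$ such that, for every asymptotically Yang–Mills extension $A$ of $\bar A$ and every $k$ as above with $j[A]=\sigma^{d-4}k$, one has $k|_\Sigma=\bar k$; that is, the component of $k$ normal to $\Sigma$ vanishes along $\Sigma$, and the tangential part of $k|_\Sigma$ is $\bar k$. Thus $(M,\boldsymbol c,\sigma,\bar A)\mapsto\bar k$, the obstruction current, is well defined and does not depend on the choice of $A$. -/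

import Mathlib

open Bundle Manifold Set
open scoped ContDiff Topology

namespace ConformalYangMills

section Metric

variable {d : ℕ} [NeZero d]

/-- A smooth Riemannian metric on the `d`-manifold with boundary `M`, smooth up to the boundary. -/
abbrev Metric (d : ℕ) [NeZero d] (M : Type*) [TopologicalSpace M]
    [ChartedSpace (EuclideanHalfSpace d) M] [IsManifold (𝓡∂ d) ∞ M] :=
  ContMDiffRiemannianMetric (𝓡∂ d) ∞ (EuclideanSpace ℝ (Fin d))
    (fun x : M ↦ TangentSpace (𝓡∂ d) x)

variable {M : Type*} [TopologicalSpace M] [ChartedSpace (EuclideanHalfSpace d) M]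

/-- The `i`-th vector of a basis of the tangent space at `x`: the coordinate vector `∂ᵢ` of the
preferred chart at `x`. -/
noncomputable def tangentBasis (x : M) (i : Fin d) : TangentSpace (𝓡∂ d) x :=
  EuclideanSpace.single i (1 : ℝ)

variable [IsManifold (𝓡∂ d) ∞ M]

/-- An extension of a tangent vector at `x` to a vector field which is smooth near `x`. -/
noncomputable abbrev extendVector {x : M} (v : TangentSpace (𝓡∂ d) x) :
    Π y : M, TangentSpace (𝓡∂ d) y :=
  FiberBundle.extend (EuclideanSpace ℝ (Fin d)) v

/-- The components `g^{ij}` of the inverse metric in the basis `tangentBasis x`. -/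
noncomputable def inverseMetric (g : Metric d M) (x : M) : Matrix (Fin d) (Fin d) ℝ :=
  (Matrix.of fun i j ↦ g.inner x (tangentBasis x i) (tangentBasis x j))⁻¹

/-- The derivative at `x` of the real function `f` along `v`. -/
noncomputable def dirDeriv (f : M → ℝ) (x : M) (v : TangentSpace (𝓡∂ d) x) : ℝ :=
  mfderiv (𝓡∂ d) 𝓘(ℝ, ℝ) f x v

/-- The gradient vector `n^a = g^{ab} ∂_b f`. -/
noncomputable def gradient (g : Metric d M) (f : M → ℝ) (x : M) : TangentSpace (𝓡∂ d) x :=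
  ∑ i, ∑ j, (inverseMetric g x i j * dirDeriv f x (tangentBasis x j)) • tangentBasis x i

/-- The right hand side of the Koszul formula: the value of `g (∇_X Y, Z)` at `x`. -/
noncomputable def koszul (g : Metric d M) (X Y Z : Π y : M, TangentSpace (𝓡∂ d) y) (x : M) : ℝ :=
  (1 / 2) * (dirDeriv (fun y ↦ g.inner y (Y y) (Z y)) x (X x)
    + dirDeriv (fun y ↦ g.inner y (X y) (Z y)) x (Y x)
    - dirDeriv (fun y ↦ g.inner y (X y) (Y y)) x (Z x)
    + g.inner x (VectorField.mlieBracket (𝓡∂ d) X Y x) (Z x)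
    - g.inner x (VectorField.mlieBracket (𝓡∂ d) X Z x) (Y x)
    - g.inner x (VectorField.mlieBracket (𝓡∂ d) Y Z x) (X x))

/-- The Levi-Civita covariant derivative `∇_v Y` at `x`, for a tangent vector `v` at `x` and a
vector field `Y` which is differentiable at `x`: the vector at `x` determined by the Koszul
formula. -/
noncomputable def leviCivita (g : Metric d M) (Y : Π y : M, TangentSpace (𝓡∂ d) y) (x : M)
    (v : TangentSpace (𝓡∂ d) x) : TangentSpace (𝓡∂ d) x :=
  ∑ i, ∑ j, (inverseMetric g x i j *
    koszul g (extendVector v) Y (extendVector (tangentBasis x j)) x) • tangentBasis x i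

/-- The metric `g'` equals `Ω² g`, where `Ω` is a smooth positive function. -/
structure IsRescaling (Ω : M → ℝ) (g g' : Metric d M) : Prop where
  smooth : ContMDiff (𝓡∂ d) 𝓘(ℝ, ℝ) ∞ Ω
  pos : ∀ x, 0 < Ω x
  eq : ∀ x (v w : TangentSpace (𝓡∂ d) x), g'.inner x v w = Ω x ^ 2 * g.inner x v w

end Metric

/-- A conformal class of metrics on `M`: all the metrics `Ω² g` for one metric `g`. -/
structure ConformalClass (d : ℕ) [NeZero d] (M : Type*) [TopologicalSpace M]
    [ChartedSpace (EuclideanHalfSpace d) M] [IsManifold (𝓡∂ d) ∞ M] where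
  metrics : Set (Metric d M)
  nonempty : metrics.Nonempty
  mem_iff : ∀ g ∈ metrics, ∀ g', g' ∈ metrics ↔ ∃ Ω, IsRescaling Ω g g'

section Bulk

variable {d : ℕ} [NeZero d] {M : Type*} [TopologicalSpace M]
  [ChartedSpace (EuclideanHalfSpace d) M] [IsManifold (𝓡∂ d) ∞ M]

/-- A smooth conformal density of weight `w`: a smooth function `f_g` for each metric `g` in the
conformal class, with `f_{Ω² g} = Ω^w f_g`. -/
structure Density (c : ConformalClass d M) (w : ℤ) where
  val : c.metrics → M → ℝ
  smooth : ∀ g, ContMDiff (𝓡∂ d) 𝓘(ℝ, ℝ) ∞ (val g)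
  rescale : ∀ (g g' : c.metrics) (Ω : M → ℝ), IsRescaling Ω g.1 g'.1 →
    ∀ x, val g' x = Ω x ^ w * val g x

/-- The weight one density `σ` is a defining density for the boundary of `M`: it is nonnegative,
its zero set is the boundary, and its differential vanishes at no point of the boundary. -/
structure IsDefiningDensity {c : ConformalClass d M} (σ : Density c 1) : Prop where
  nonneg : ∀ g x, 0 ≤ σ.val g x
  zero_iff : ∀ g x, σ.val g x = 0 ↔ x ∈ (𝓡∂ d).boundary M
  deriv_ne_zero : ∀ g, ∀ x ∈ (𝓡∂ d).boundary M, mfderiv (𝓡∂ d) 𝓘(ℝ, ℝ) (σ.val g) x ≠ 0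

variable {F : Type*} [NormedAddCommGroup F] [NormedSpace ℝ F]
  {V : M → Type*} [TopologicalSpace (TotalSpace F V)]
  [∀ x, AddCommGroup (V x)] [∀ x, Module ℝ (V x)] [∀ x, TopologicalSpace (V x)]
  [∀ x, IsTopologicalAddGroup (V x)] [∀ x, ContinuousSMul ℝ (V x)]
  [FiberBundle F V]

/-- The curvature `F(u, v) s = ∇_u ∇_v s - ∇_v ∇_u s - ∇_[u, v] s` at `x`, computed with extensions
of `u`, `v`, `s` to a neighbourhood of `x` (it depends on the values at `x` only). -/
noncomputable def curvature (A : CovariantDerivative (𝓡∂ d) F V) (x : M)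
    (u v : TangentSpace (𝓡∂ d) x) (s : V x) : V x :=
  A (fun y ↦ A (FiberBundle.extend F s) y (extendVector v y)) x u
    - A (fun y ↦ A (FiberBundle.extend F s) y (extendVector u y)) x v
    - A (FiberBundle.extend F s) x
        (VectorField.mlieBracket (𝓡∂ d) (extendVector u) (extendVector v) x)

/-- The covariant derivative `(∇_u F)(v, w) s` at `x` of the curvature, for the connection `A` on
`V` coupled to the Levi-Civita connection of `g`. -/
noncomputable def covDerivCurvature (g : Metric d M) (A : CovariantDerivative (𝓡∂ d) F V) (x : M)
    (u v w : TangentSpace (𝓡∂ d) x) (s : V x) : V x :=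
  A (fun y ↦ curvature A y (extendVector v y) (extendVector w y) (FiberBundle.extend F s y)) x u
    - curvature A x (leviCivita g (extendVector v) x u) w s
    - curvature A x v (leviCivita g (extendVector w) x u) s
    - curvature A x v w (A (FiberBundle.extend F s) x u)

/-- The divergence `∇^a F_{ab}` of the curvature, evaluated on a tangent vector and a vector of
the fibre of `V`. -/
noncomputable def divCurvature (g : Metric d M) (A : CovariantDerivative (𝓡∂ d) F V) (x : M)
    (v : TangentSpace (𝓡∂ d) x) (s : V x) : V x :=
  ∑ i, ∑ j, inverseMetric g x i j •
    covDerivCurvature g A x (tangentBasis x i) (tangentBasis x j) v s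

/-- The conformally compact Yang-Mills current `j_b[A] = r ∇^a F_{ab} - (d - 4) n^a F_{ab}` in the
scale `g`, where `r` is the defining function representing `σ` in this scale and `n = dr`. -/
noncomputable def current (g : Metric d M) (r : M → ℝ) (A : CovariantDerivative (𝓡∂ d) F V)
    (x : M) (v : TangentSpace (𝓡∂ d) x) (s : V x) : V x :=
  r x • divCurvature g A x v s - ((d : ℝ) - 4) • curvature A x (gradient g r x) v s

variable [VectorBundle ℝ F V] [ContMDiffVectorBundle ∞ F V (𝓡∂ d)]

/-- A smooth section of `T*M ⊗ End V` of conformal weight `w`. -/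
structure WeightedEndForm (F : Type*) [NormedAddCommGroup F] [NormedSpace ℝ F]
    (V : M → Type*) [TopologicalSpace (TotalSpace F V)]
    [∀ x, AddCommGroup (V x)] [∀ x, Module ℝ (V x)] [∀ x, TopologicalSpace (V x)]
    [∀ x, IsTopologicalAddGroup (V x)] [∀ x, ContinuousSMul ℝ (V x)]
    [FiberBundle F V] [VectorBundle ℝ F V] [ContMDiffVectorBundle ∞ F V (𝓡∂ d)]
    (c : ConformalClass d M) (w : ℤ) where
  val : c.metrics → Π x : M, TangentSpace (𝓡∂ d) x →L[ℝ] (V x →L[ℝ] V x)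
  smooth : ∀ g, ContMDiff (𝓡∂ d)
    ((𝓡∂ d).prod 𝓘(ℝ, EuclideanSpace ℝ (Fin d) →L[ℝ] (F →L[ℝ] F))) ∞
    (fun x ↦ TotalSpace.mk' (EuclideanSpace ℝ (Fin d) →L[ℝ] (F →L[ℝ] F)) x (val g x))
  rescale : ∀ (g g' : c.metrics) (Ω : M → ℝ), IsRescaling Ω g.1 g'.1 →
    ∀ x, val g' x = Ω x ^ w • val g x

/-- The connection `A` on `V` is asymptotically Yang-Mills with `j[A] = σ^(d-4) k`: it is smooth,
and the identity holds in each scale, for the smooth section `k` of `T*M ⊗ End V` of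
weight `3 - d`. -/
structure IsAsymptoticallyYangMills {c : ConformalClass d M} (σ : Density c 1)
    (A : CovariantDerivative (𝓡∂ d) F V) (k : WeightedEndForm F V c (3 - (d : ℤ))) : Prop where
  smooth : A.ContMDiffCovariantDerivative ∞
  current_eq : ∀ (g : c.metrics) (x : M) (v : TangentSpace (𝓡∂ d) x) (s : V x),
    current g.1 (σ.val g) A x v s = σ.val g x ^ (d - 4) • k.val g x v s

end Bulk

section Restriction

variable {d : ℕ} [NeZero d] {M : Type*} [TopologicalSpace M]
  [ChartedSpace (EuclideanHalfSpace d) M]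
  {S : Type*} [TopologicalSpace S] [ChartedSpace (EuclideanSpace ℝ (Fin (d - 1))) S]

/-- The restriction `V|_S` of the bundle `V` to the boundary, with the structure of a smooth vector
bundle over `S` of the pullback `ι *ᵖ V`. -/
def RestrictedBundle (ι : C^∞⟮𝓡 (d - 1), S; 𝓡∂ d, M⟯) (V : M → Type*) : S → Type _ :=
  ι *ᵖ V

variable (ι : C^∞⟮𝓡 (d - 1), S; 𝓡∂ d, M⟯)
  (F : Type*) [NormedAddCommGroup F] [NormedSpace ℝ F]
  (V : M → Type*) [TopologicalSpace (TotalSpace F V)]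
  [∀ x, AddCommGroup (V x)] [∀ x, Module ℝ (V x)] [∀ x, TopologicalSpace (V x)]

noncomputable instance (p : S) : AddCommGroup (RestrictedBundle ι V p) :=
  (inferInstance : AddCommGroup (V (ι p)))

noncomputable instance (p : S) : Module ℝ (RestrictedBundle ι V p) :=
  (inferInstance : Module ℝ (V (ι p)))

noncomputable instance (p : S) : TopologicalSpace (RestrictedBundle ι V p) :=
  (inferInstance : TopologicalSpace (V (ι p)))

instance [∀ x, IsTopologicalAddGroup (V x)] (p : S) :
    IsTopologicalAddGroup (RestrictedBundle ι V p) :=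
  (inferInstance : IsTopologicalAddGroup (V (ι p)))

instance [∀ x, ContinuousSMul ℝ (V x)] (p : S) :
    ContinuousSMul ℝ (RestrictedBundle ι V p) :=
  (inferInstance : ContinuousSMul ℝ (V (ι p)))

noncomputable instance : TopologicalSpace (TotalSpace F (RestrictedBundle ι V)) :=
  (inferInstance : TopologicalSpace (TotalSpace F (ι *ᵖ V)))

noncomputable instance [FiberBundle F V] : FiberBundle F (RestrictedBundle ι V) :=
  (inferInstance : FiberBundle F (ι *ᵖ V))

instance [FiberBundle F V] [VectorBundle ℝ F V] :
    VectorBundle ℝ F (RestrictedBundle ι V) :=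
  (inferInstance : VectorBundle ℝ F (ι *ᵖ V))

instance [IsManifold (𝓡∂ d) ∞ M] [FiberBundle F V] [VectorBundle ℝ F V]
    [ContMDiffVectorBundle ∞ F V (𝓡∂ d)] :
    ContMDiffVectorBundle ∞ F (RestrictedBundle ι V) (𝓡 (d - 1)) :=
  (inferInstance : ContMDiffVectorBundle ∞ F (ι *ᵖ V) (𝓡 (d - 1)))

end Restriction

section Boundary

variable {d : ℕ} [NeZero d] {M : Type*} [TopologicalSpace M]
  [ChartedSpace (EuclideanHalfSpace d) M] [IsManifold (𝓡∂ d) ∞ M]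
  {S : Type*} [TopologicalSpace S] [ChartedSpace (EuclideanSpace ℝ (Fin (d - 1))) S]

/-- The smooth map `ι` exhibits the `(d-1)`-manifold `S` as the boundary of `M`. -/
structure IsBoundaryInclusion (ι : C^∞⟮𝓡 (d - 1), S; 𝓡∂ d, M⟯) : Prop where
  isSmoothEmbedding : IsSmoothEmbedding (𝓡 (d - 1)) (𝓡∂ d) ∞ ι
  range_eq : range ι = (𝓡∂ d).boundary M

variable [IsManifold (𝓡 (d - 1)) ∞ S]
  {F : Type*} [NormedAddCommGroup F] [NormedSpace ℝ F]
  {V : M → Type*} [TopologicalSpace (TotalSpace F V)]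
  [∀ x, AddCommGroup (V x)] [∀ x, Module ℝ (V x)] [∀ x, TopologicalSpace (V x)]
  [∀ x, IsTopologicalAddGroup (V x)] [∀ x, ContinuousSMul ℝ (V x)]
  [FiberBundle F V] [VectorBundle ℝ F V] [ContMDiffVectorBundle ∞ F V (𝓡∂ d)]

/-- The connection `A` on `V` induces the connection `B` on the restriction of `V` to the
boundary: `∇^A_v = ∇^B_v` for all vectors `v` tangent to the boundary. -/
def HasBoundaryCondition (ι : C^∞⟮𝓡 (d - 1), S; 𝓡∂ d, M⟯)
    (A : CovariantDerivative (𝓡∂ d) F V)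
    (B : CovariantDerivative (𝓡 (d - 1)) F (RestrictedBundle ι V)) : Prop :=
  ∀ (p : S) (s : Π x : M, V x),
    MDifferentiableAt (𝓡∂ d) ((𝓡∂ d).prod 𝓘(ℝ, F)) (fun x ↦ TotalSpace.mk' F x (s x)) (ι p) →
    ∀ v : TangentSpace (𝓡 (d - 1)) p,
      A s (ι p) (mfderiv (𝓡 (d - 1)) (𝓡∂ d) ι p v) = B (fun q ↦ s (ι q)) p v

/-- A smooth section of `T*S ⊗ End (V|_S)` of conformal weight `w` along the boundary `S`. The
metrics of the conformal class label the scales, which rescale by the restriction of `Ω`. -/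
@[ext]
structure BoundaryWeightedEndForm (F : Type*) [NormedAddCommGroup F] [NormedSpace ℝ F]
    (V : M → Type*) [TopologicalSpace (TotalSpace F V)]
    [∀ x, AddCommGroup (V x)] [∀ x, Module ℝ (V x)] [∀ x, TopologicalSpace (V x)]
    [∀ x, IsTopologicalAddGroup (V x)] [∀ x, ContinuousSMul ℝ (V x)]
    [FiberBundle F V] [VectorBundle ℝ F V] [ContMDiffVectorBundle ∞ F V (𝓡∂ d)]
    (c : ConformalClass d M) (ι : C^∞⟮𝓡 (d - 1), S; 𝓡∂ d, M⟯) (w : ℤ) where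
  val : c.metrics →
    Π p : S, TangentSpace (𝓡 (d - 1)) p →L[ℝ] (RestrictedBundle ι V p →L[ℝ] RestrictedBundle ι V p)
  smooth : ∀ g, ContMDiff (𝓡 (d - 1))
    ((𝓡 (d - 1)).prod 𝓘(ℝ, EuclideanSpace ℝ (Fin (d - 1)) →L[ℝ] (F →L[ℝ] F))) ∞
    (fun p ↦ TotalSpace.mk' (EuclideanSpace ℝ (Fin (d - 1)) →L[ℝ] (F →L[ℝ] F)) p (val g p))
  rescale : ∀ (g g' : c.metrics) (Ω : M → ℝ), IsRescaling Ω g.1 g'.1 →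
    ∀ p, val g' p = Ω (ι p) ^ w • val g p

/-- The section `κ` of `T*S ⊗ End (V|_S)` is the restriction of `k` to the boundary: the normal
component of `k` vanishes there, and its tangential components are those of `κ`. -/
structure RestrictsTo {c : ConformalClass d M} (σ : Density c 1)
    {ι : C^∞⟮𝓡 (d - 1), S; 𝓡∂ d, M⟯} {w : ℤ}
    (k : WeightedEndForm F V c w) (κ : BoundaryWeightedEndForm F V c ι w) : Prop where
  normal : ∀ (g : c.metrics) (p : S), k.val g (ι p) (gradient g.1 (σ.val g) (ι p)) = 0
  tangential : ∀ (g : c.metrics) (p : S) (v : TangentSpace (𝓡 (d - 1)) p) (s : V (ι p)),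
    k.val g (ι p) (mfderiv (𝓡 (d - 1)) (𝓡∂ d) ι p v) s = κ.val g p v s

end Boundary

end ConformalYangMills

set_option linter.unusedSectionVars false

/-! In a chart and a trivialization everything takes place over the ring `R` of smooth functions and
the noncommutative algebra `𝔄` of endomorphism valued functions. Write r for the defining function,
n = dr, κ = d - 4, and J^b = r ∇_a F^{ab} - κ n_a F^{ab} for the current with its index raised. Two
identities carry the proof.

Comparison. Regard an endomorphism h as a homomorphism from a connection θ to a connection θ', with
induced derivative D. The Ricci identity D_i D_j h - D_j D_i h = F'_{ij} h - h F_{ij} expresses J' h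
- h J through D h alone. If D h = r^(m+1) β, then J' h - h J = (m+1)(m-κ) r^m (|n|² β^b - (n·β) n^b)
+ O(r^(m+1)); this is `exists_upperCurrent_mul_sub`. The factor m - κ is what makes the order κ
special.

Divergence. The double divergence of the curvature vanishes, hence r ∇_b J^b = (κ+1) n_b J^b
(`smul_divergence_upperCurrent`). If J = r^m k with m ≤ κ, cancelling r^m gives (κ+1-m) n·k = r ∇·k,
so n·k vanishes where r does (`exists_normal_eq_smul`). For m = κ this is the claim about the normal
component.

Existence. Partitions of unity and local retractions onto the boundary give some smooth connection
which extends the given one (`exists_hasBoundaryCondition`). If its current is r^m k with m < κ, add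
r^(m+1) times a suitable multiple of k. With h = 1 the comparison identity shows that the leading
term cancels r^m k: the part |n|² k by the choice of the factor, the part (n·k) n because n·k =
O(r). So the current becomes O(r^(m+1)), and boundary values do not change
(`exists_lowerCurrent_eq_pow_succ`, `exists_current_eq_pow`).

Independence. By Hadamard's lemma two extensions differ by dr χ + r c. Gauge transformations h = 1 +
r η remove dr χ to leading order, so that D h = r β. Inductively, if D h = r^(m+1) β with m < κ,
both currents being O(r^κ) forces |n|² β - (n·β) n = O(r), so β is again normal up to O(r) and can
be removed by changing η. At m = κ the coefficient m - κ vanishes, and the comparison reads k' h - h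
k = O(r); since h = 1 on the boundary, k' = k there (`exists_sub_eq_smul_of_lowerCurrent`).

Scales. The current has conformal weight -1 (`current_rescaling`), so divisibility in one scale
gives it in all scales, with k of weight -1 - (d-4) = 3 - d. The remainder is the dictionary between
the invariant definitions and the algebra (`current_frame`), and gluing of local factors k, which is
possible because the condition on k is convex. -/

namespace ConformalYangMills

/-! ### Algebra of the contravariant current: comparison identity and divergence identity. -/

section DifferentialAlgebra

/-- Commuting partial derivatives on a commutative algebra `R` of scalars and on a (noncommutative)
`R`-algebra `𝔄`. -/
structure PartialDerivatives (ι R 𝔄 : Type*) [CommRing R] [Algebra ℝ R] [Ring 𝔄]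
    [Algebra R 𝔄] where
  dR : ι → Derivation ℝ R R
  dA : ι → 𝔄 →+ 𝔄
  dA_mul : ∀ i x y, dA i (x * y) = dA i x * y + x * dA i y
  dA_smul : ∀ i (f : R) x, dA i (f • x) = dR i f • x + f • dA i x
  dR_comm : ∀ i j f, dR i (dR j f) = dR j (dR i f)
  dA_comm : ∀ i j x, dA i (dA j x) = dA j (dA i x)

namespace PartialDerivatives

variable {ι R 𝔄 : Type*} [CommRing R] [Algebra ℝ R] [Ring 𝔄] [Algebra R 𝔄]
  (P : PartialDerivatives ι R 𝔄)

/-- The covariant derivative of a homomorphism from the connection `θ` to the connection `θ'`. -/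
def cov (θ' θ : ι → 𝔄) (i : ι) (X : 𝔄) : 𝔄 := P.dA i X + θ' i * X - X * θ i

/-- The curvature of the connection form `θ`. -/
def curv (θ : ι → 𝔄) (i j : ι) : 𝔄 :=
  P.dA i (θ j) - P.dA j (θ i) + θ i * θ j - θ j * θ i


/-- Exchanging the summation indices shows that the sum is its own negative, and 2 is invertible
because `R` is an algebra over the reals. -/
lemma sum_antisymm (R : Type*) {ι 𝔄 : Type*} [CommRing R] [Algebra ℝ R] [Ring 𝔄] [Algebra R 𝔄]
    [Fintype ι] {s : ι → ι → 𝔄} (hs : ∀ a b, s b a = -s a b) :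
    ∑ a, ∑ b, s a b = 0 := by
  have h : ∑ a, ∑ b, s a b = -∑ a, ∑ b, s a b := by
    conv_lhs => rw [Finset.sum_comm]
    simp only [← Finset.sum_neg_distrib]
    exact Finset.sum_congr rfl fun a _ ↦ Finset.sum_congr rfl fun b _ ↦ hs a b
  have h2 : (2 : R) • ∑ a, ∑ b, s a b = 0 := by
    rw [two_smul]; exact add_eq_zero_iff_eq_neg.mpr h
  have h3 : (algebraMap ℝ R (1 / 2)) * 2 = 1 := by
    have : (2 : R) = algebraMap ℝ R 2 := (map_ofNat (algebraMap ℝ R) 2).symm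
    rw [this, ← map_mul]; norm_num
  have := congrArg (fun x ↦ algebraMap ℝ R (1 / 2) • x) h2
  simpa only [smul_smul, h3, one_smul, smul_zero] using this

lemma curv_antisymm (θ : ι → 𝔄) (i j : ι) : P.curv θ j i = -P.curv θ i j := by
  simp only [curv]; abel

lemma cov_add (θ' θ : ι → 𝔄) (i : ι) (X Y : 𝔄) :
    P.cov θ' θ i (X + Y) = P.cov θ' θ i X + P.cov θ' θ i Y := by
  simp only [cov, map_add, mul_add, add_mul]; abel

lemma cov_sub (θ' θ : ι → 𝔄) (i : ι) (X Y : 𝔄) :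
    P.cov θ' θ i (X - Y) = P.cov θ' θ i X - P.cov θ' θ i Y := by
  simp only [cov, map_sub, mul_sub, sub_mul]; abel

lemma cov_neg (θ' θ : ι → 𝔄) (i : ι) (X : 𝔄) :
    P.cov θ' θ i (-X) = -P.cov θ' θ i X := by
  simp only [cov, map_neg, mul_neg, neg_mul]; abel

lemma cov_sum {α : Type*} (s : Finset α) (θ' θ : ι → 𝔄) (i : ι) (X : α → 𝔄) :
    P.cov θ' θ i (∑ a ∈ s, X a) = ∑ a ∈ s, P.cov θ' θ i (X a) := by
  simp only [cov, map_sum, Finset.mul_sum, Finset.sum_mul, Finset.sum_add_distrib,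
    Finset.sum_sub_distrib]

lemma cov_smul (θ' θ : ι → 𝔄) (i : ι) (f : R) (X : 𝔄) :
    P.cov θ' θ i (f • X) = P.dR i f • X + f • P.cov θ' θ i X := by
  simp only [cov, P.dA_smul, mul_smul_comm, smul_mul_assoc]; module

/-- Leibniz rule for a composition of homomorphisms; the connection in the middle is arbitrary
because its two contributions cancel. -/
lemma cov_mul (θ₁ θ₂ θ₃ : ι → 𝔄) (i : ι) (X Y : 𝔄) :
    P.cov θ₁ θ₃ i (X * Y) = P.cov θ₁ θ₂ i X * Y + X * P.cov θ₂ θ₃ i Y := by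
  simp only [cov, P.dA_mul]; noncomm_ring

/-- The identity, as a homomorphism between different connections, is not parallel. This lets a
change of connection be treated as the case h = 1 of the comparison identity. -/
lemma cov_one (θ' θ : ι → 𝔄) (i : ι) : P.cov θ' θ i 1 = θ' i - θ i := by
  have h : P.dA i 1 = 0 := by simpa using P.dA_mul i 1 1
  simp [cov, h]

/-- The Ricci identity on the bundle of homomorphisms; it turns a difference of curvatures into
second derivatives of the homomorphism. -/
lemma cov_cov_sub (θ' θ : ι → 𝔄) (i j : ι) (X : 𝔄) :
    P.cov θ' θ i (P.cov θ' θ j X) - P.cov θ' θ j (P.cov θ' θ i X) =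
      P.curv θ' i j * X - X * P.curv θ i j := by
  simp only [cov, curv, map_add, map_sub, P.dA_mul, P.dA_comm i j X]; noncomm_ring

/-- Raising both indices with the inverse metric `G`. -/
def raise [Fintype ι] (G : Matrix ι ι R) (X : ι → ι → 𝔄) (a b : ι) : 𝔄 :=
  ∑ c, ∑ e, (G a c * G b e) • X c e

/-- The divergence on the first index of a contravariant tensor, where `γ` is the logarithmic
derivative of the volume density. -/
def divergence [Fintype ι] (γ : ι → R) (θ' θ : ι → 𝔄) (X : ι → ι → 𝔄) (b : ι) : 𝔄 :=
  ∑ a, (P.cov θ' θ a (X a b) + γ a • X a b)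

/-- The contravariant conformally compact Yang-Mills current `J^b`. -/
def upperCurrent [Fintype ι] (G : Matrix ι ι R) (γ : ι → R) (r : R) (κ : ℕ) (θ : ι → 𝔄)
    (b : ι) : 𝔄 :=
  r • P.divergence γ θ θ (raise G (P.curv θ)) b
    - (κ : R) • ∑ a, P.dR a r • raise G (P.curv θ) a b

variable [Fintype ι]

lemma raise_antisymm (G : Matrix ι ι R) {X : ι → ι → 𝔄} (hX : ∀ i j, X j i = -X i j) (a b : ι) :
    raise G X b a = -raise G X a b := by
  simp only [raise]
  rw [Finset.sum_comm]
  simp only [← Finset.sum_neg_distrib]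
  refine Finset.sum_congr rfl fun c _ ↦ Finset.sum_congr rfl fun e _ ↦ ?_
  rw [hX, smul_neg, mul_comm]

lemma raise_add (G : Matrix ι ι R) (X Y : ι → ι → 𝔄) (a b : ι) :
    raise G (fun i j ↦ X i j + Y i j) a b = raise G X a b + raise G Y a b := by
  simp only [raise, smul_add, Finset.sum_add_distrib]

lemma raise_sub (G : Matrix ι ι R) (X Y : ι → ι → 𝔄) (a b : ι) :
    raise G (fun i j ↦ X i j - Y i j) a b = raise G X a b - raise G Y a b := by
  simp only [raise, smul_sub, Finset.sum_sub_distrib]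

lemma raise_smul (G : Matrix ι ι R) (f : R) (X : ι → ι → 𝔄) (a b : ι) :
    raise G (fun i j ↦ f • X i j) a b = f • raise G X a b := by
  simp only [raise, Finset.smul_sum, smul_comm f]

lemma raise_mul (G : Matrix ι ι R) (X : ι → ι → 𝔄) (h : 𝔄) (a b : ι) :
    raise G (fun i j ↦ X i j * h) a b = raise G X a b * h := by
  simp only [raise, Finset.sum_mul, smul_mul_assoc]

lemma mul_raise (G : Matrix ι ι R) (X : ι → ι → 𝔄) (h : 𝔄) (a b : ι) :
    raise G (fun i j ↦ h * X i j) a b = h * raise G X a b := by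
  simp only [raise, Finset.mul_sum, mul_smul_comm]

lemma divergence_add (γ : ι → R) (θ' θ : ι → 𝔄) (X Y : ι → ι → 𝔄) (b : ι) :
    P.divergence γ θ' θ (fun i j ↦ X i j + Y i j) b =
      P.divergence γ θ' θ X b + P.divergence γ θ' θ Y b := by
  simp only [divergence, cov_add, smul_add, ← Finset.sum_add_distrib]
  exact Finset.sum_congr rfl fun _ _ ↦ by abel

lemma divergence_sub (γ : ι → R) (θ' θ : ι → 𝔄) (X Y : ι → ι → 𝔄) (b : ι) :
    P.divergence γ θ' θ (fun i j ↦ X i j - Y i j) b =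
      P.divergence γ θ' θ X b - P.divergence γ θ' θ Y b := by
  simp only [divergence, cov_sub, smul_sub, ← Finset.sum_sub_distrib]
  exact Finset.sum_congr rfl fun _ _ ↦ by abel

lemma divergence_smul (γ : ι → R) (θ' θ : ι → 𝔄) (f : R) (X : ι → ι → 𝔄) (b : ι) :
    P.divergence γ θ' θ (fun i j ↦ f • X i j) b =
      f • P.divergence γ θ' θ X b + ∑ a, P.dR a f • X a b := by
  simp only [divergence, cov_smul, Finset.smul_sum, ← Finset.sum_add_distrib]
  exact Finset.sum_congr rfl fun _ _ ↦ by module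

lemma divergence_mul (γ : ι → R) (θ₁ θ₂ : ι → 𝔄) (X : ι → ι → 𝔄) (h : 𝔄) (b : ι) :
    P.divergence γ θ₁ θ₂ (fun i j ↦ X i j * h) b =
      P.divergence γ θ₁ θ₁ X b * h + ∑ a, X a b * P.cov θ₁ θ₂ a h := by
  simp only [divergence, P.cov_mul θ₁ θ₁ θ₂, Finset.sum_mul, ← Finset.sum_add_distrib, add_mul,
    smul_mul_assoc]
  exact Finset.sum_congr rfl fun _ _ ↦ by abel

lemma mul_divergence (γ : ι → R) (θ₁ θ₂ : ι → 𝔄) (X : ι → ι → 𝔄) (h : 𝔄) (b : ι) :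
    P.divergence γ θ₁ θ₂ (fun i j ↦ h * X i j) b =
      h * P.divergence γ θ₂ θ₂ X b + ∑ a, P.cov θ₁ θ₂ a h * X a b := by
  simp only [divergence, P.cov_mul θ₁ θ₂ θ₂, Finset.mul_sum, ← Finset.sum_add_distrib, mul_add,
    mul_smul_comm]
  exact Finset.sum_congr rfl fun _ _ ↦ by abel

/-- The change of the current under a homomorphism `h` of connections, in terms of the covariant
derivative of `h`. -/
lemma upperCurrent_mul_sub (G : Matrix ι ι R) (γ : ι → R) (r : R) (κ : ℕ) (θ' θ : ι → 𝔄) (h : 𝔄)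
    (b : ι) {Y : ι → ι → 𝔄}
    (hY : ∀ i j, Y i j = P.cov θ' θ i (P.cov θ' θ j h) - P.cov θ' θ j (P.cov θ' θ i h)) :
    P.upperCurrent G γ r κ θ' b * h - h * P.upperCurrent G γ r κ θ b =
      r • P.divergence γ θ' θ (raise G Y) b - (κ : R) • ∑ a, P.dR a r • raise G Y a b
        - r • ∑ a, (raise G (P.curv θ') a b * P.cov θ' θ a h
          - P.cov θ' θ a h * raise G (P.curv θ) a b) := by
  have hY' : raise G Y =
      fun a b ↦ raise G (P.curv θ') a b * h - h * raise G (P.curv θ) a b := by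
    funext a b
    rw [← raise_mul, ← mul_raise, ← raise_sub]
    congr 1; funext i j
    rw [hY, cov_cov_sub]
  rw [hY', divergence_sub, divergence_mul, mul_divergence]
  simp only [upperCurrent, sub_mul, mul_sub, smul_mul_assoc, mul_smul_comm, Finset.sum_mul,
    Finset.mul_sum, smul_sub, smul_add, Finset.sum_sub_distrib]
  abel

/-- The extra factor r avoids the exponent m - 1, so that the formula also holds for m = 0. -/
lemma mul_dR_pow (r : R) (m : ℕ) (a : ι) :
    r * P.dR a (r ^ m) = (m : R) * r ^ m * P.dR a r := by
  rcases m with _ | m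
  · simp
  · rw [Derivation.leibniz_pow]
    simp only [Nat.add_sub_cancel, nsmul_eq_mul, smul_eq_mul]
    ring

lemma dR_pow_succ (r : R) (m : ℕ) (a : ι) :
    P.dR a (r ^ (m + 1)) = ((m + 1 : ℕ) : R) * r ^ m * P.dR a r := by
  rw [Derivation.leibniz_pow]
  simp only [Nat.add_sub_cancel, nsmul_eq_mul, smul_eq_mul]
  ring

/-- The leading term of the change of the current: `|n|² b^b - (n · b) n^b`. -/
def leadingTerm (G : Matrix ι ι R) (r : R) (β : ι → 𝔄) (b : ι) : 𝔄 :=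
  ∑ a, P.dR a r • raise G (fun i j ↦ P.dR i r • β j - P.dR j r • β i) a b

/-- If a homomorphism `h` of connections is covariantly constant to order `m + 1`, the currents
agree to order `m`, with an explicit leading term. -/
lemma exists_upperCurrent_mul_sub (G : Matrix ι ι R) (γ : ι → R) (r : R) (κ m : ℕ) (θ' θ : ι → 𝔄)
    (h : 𝔄) {β : ι → 𝔄} (hβ : ∀ i, P.cov θ' θ i h = r ^ (m + 1) • β i) :
    ∃ K : ι → 𝔄, ∀ b,
      P.upperCurrent G γ r κ θ' b * h - h * P.upperCurrent G γ r κ θ b =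
        (((m + 1 : ℕ) : R) * ((m : R) - κ) * r ^ m) • P.leadingTerm G r β b
          + r ^ (m + 1) • K b := by
  set W : ι → ι → 𝔄 := fun i j ↦ P.dR i r • β j - P.dR j r • β i with hW
  set H : ι → ι → 𝔄 := fun i j ↦ P.cov θ' θ i (β j) - P.cov θ' θ j (β i) with hH
  -- In the commutator of derivatives of h, a derivative falling on r^(m+1) yields `W` at order r^m;
  -- everything else is `H` at order r^(m+1).
  have hY : ∀ i j, (((m + 1 : ℕ) : R) * r ^ m) • W i j + r ^ (m + 1) • H i j =
      P.cov θ' θ i (P.cov θ' θ j h) - P.cov θ' θ j (P.cov θ' θ i h) := by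
    intro i j
    simp only [hβ, cov_smul, dR_pow_succ, hW, hH]
    module
  set Q : ι → 𝔄 := fun b ↦ ∑ a, (raise G (P.curv θ') a b * β a - β a * raise G (P.curv θ) a b)
    with hQ
  -- All contributions of order r^(m+1) and higher, with r^(m+1) divided out. The order r^m receives
  -- (m+1)m from differentiating r^m and -(m+1)κ from the second term of the current.
  refine ⟨fun b ↦ ((m + 1 : ℕ) : R) • P.divergence γ θ' θ (raise G W) b
      + r • P.divergence γ θ' θ (raise G H) b
      + (((m + 1 : ℕ) : R) - κ) • ∑ a, P.dR a r • raise G H a b - r • Q b, fun b ↦ ?_⟩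
  rw [P.upperCurrent_mul_sub G γ r κ θ' θ h b hY]
  have h1 : raise G (fun i j ↦ (((m + 1 : ℕ) : R) * r ^ m) • W i j + r ^ (m + 1) • H i j) =
      fun a b ↦ (((m + 1 : ℕ) : R) * r ^ m) • raise G W a b + r ^ (m + 1) • raise G H a b := by
    funext a b
    rw [raise_add, raise_smul, raise_smul]
  have h2 : ∑ a, (raise G (P.curv θ') a b * P.cov θ' θ a h
          - P.cov θ' θ a h * raise G (P.curv θ) a b) = r ^ (m + 1) • Q b := by
    simp only [hβ, hQ, Finset.smul_sum, smul_sub, mul_smul_comm, smul_mul_assoc]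
  -- The prefactor r of the divergence restores the power lost by differentiation; this is the
  -- origin of the summand m in the factor m - κ.
  have h3 : r • ∑ a, P.dR a (((m + 1 : ℕ) : R) * r ^ m) • raise G W a b =
      (((m + 1 : ℕ) : R) * m * r ^ m) • P.leadingTerm G r β b := by
    simp only [leadingTerm, ← hW, Finset.smul_sum, smul_smul]
    refine Finset.sum_congr rfl fun a _ ↦ ?_
    congr 1
    rw [Derivation.leibniz, Derivation.map_natCast, smul_zero, add_zero, smul_eq_mul,
      mul_left_comm, mul_dR_pow]
    ring
  have h4 : ∑ a, P.dR a (r ^ (m + 1)) • raise G H a b =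
      (((m + 1 : ℕ) : R) * r ^ m) • ∑ a, P.dR a r • raise G H a b := by
    simp only [dR_pow_succ, Finset.smul_sum, smul_smul]
  rw [h1, divergence_add, divergence_smul, divergence_smul, h2, h4, smul_add, smul_add r, h3]
  simp only [smul_add, Finset.sum_add_distrib, smul_comm (P.dR _ r), ← Finset.smul_sum]
  have hL : ∑ a, P.dR a r • raise G W a b = P.leadingTerm G r β b := rfl
  rw [hL]
  simp only [pow_succ]
  module

lemma raise_smul_left (G : Matrix ι ι R) (u : ι → R) (β : ι → 𝔄) (a b : ι) :
    raise G (fun i j ↦ u i • β j) a b = (∑ c, G a c * u c) • ∑ e, G b e • β e := by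
  rw [raise, Finset.sum_smul]
  refine Finset.sum_congr rfl fun c _ ↦ ?_
  rw [Finset.smul_sum]
  exact Finset.sum_congr rfl fun e _ ↦ by module

lemma raise_smul_right (G : Matrix ι ι R) (u : ι → R) (β : ι → 𝔄) (a b : ι) :
    raise G (fun i j ↦ u j • β i) a b = (∑ e, G b e * u e) • ∑ c, G a c • β c := by
  rw [raise, Finset.sum_comm, Finset.sum_smul]
  refine Finset.sum_congr rfl fun c _ ↦ ?_
  rw [Finset.smul_sum]
  exact Finset.sum_congr rfl fun e _ ↦ by module

lemma leadingTerm_eq (G : Matrix ι ι R) (r : R) (β : ι → 𝔄) (b : ι) :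
    P.leadingTerm G r β b =
      (∑ a, P.dR a r * ∑ c, G a c * P.dR c r) • ∑ e, G b e • β e
        - (∑ e, G b e * P.dR e r) • ∑ a, P.dR a r • ∑ c, G a c • β c := by
  simp only [leadingTerm, raise_sub, raise_smul_left, raise_smul_right, smul_sub,
    Finset.sum_sub_distrib]
  congr 1
  · rw [Finset.sum_smul]
    exact Finset.sum_congr rfl fun a _ ↦ (mul_smul _ _ _).symm
  · rw [Finset.smul_sum]
    exact Finset.sum_congr rfl fun a _ ↦ smul_comm _ _ _

/-- The inverse of a nonzero constant. -/
lemma exists_const_mul_eq_one {t : ℝ} (ht : t ≠ 0) : ∃ u : R, u * algebraMap ℝ R t = 1 ∧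
    ∀ i, P.dR i u = 0 :=
  ⟨algebraMap ℝ R t⁻¹, by rw [← map_mul, inv_mul_cancel₀ ht, map_one],
    fun i ↦ Derivation.map_algebraMap _ _⟩

/-- Symmetry of `G` moves the raised indices from one factor to the other without changing the order
of multiplication, which matters since `𝔄` is noncommutative. -/
lemma sum_mul_raise (G : Matrix ι ι R) (hG : ∀ i j, G i j = G j i) (X Y : ι → ι → 𝔄) :
    ∑ a, ∑ b, X a b * raise G Y a b = ∑ a, ∑ b, raise G X a b * Y a b := by
  have h1 : ∀ Z : ι → ι → ι → ι → 𝔄, ∑ a, ∑ b, ∑ c, ∑ e, Z a b c e =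
      ∑ a, ∑ b, ∑ c, ∑ e, Z c e a b := by
    intro Z
    simp only [← Fintype.sum_prod_type']
    exact Fintype.sum_equiv ⟨fun p ↦ (p.2.2.1, p.2.2.2, p.1, p.2.1),
      fun p ↦ (p.2.2.1, p.2.2.2, p.1, p.2.1), fun _ ↦ rfl, fun _ ↦ rfl⟩ _ _ fun _ ↦ rfl
  simp only [raise, Finset.mul_sum, Finset.sum_mul, mul_smul_comm, smul_mul_assoc]
  rw [h1]
  simp only [hG]

/-- The double divergence of the curvature vanishes. -/
lemma divergence_divergence_curv {G : Matrix ι ι R} (hG : ∀ i j, G i j = G j i) {γ : ι → R}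
    (hγ : ∀ i j, P.dR i (γ j) = P.dR j (γ i)) (θ : ι → 𝔄) :
    ∑ b, (P.cov θ θ b (P.divergence γ θ θ (raise G (P.curv θ)) b)
      + γ b • P.divergence γ θ θ (raise G (P.curv θ)) b) = 0 := by
  set X := raise G (P.curv θ) with hX
  have hXa : ∀ a b, X b a = -X a b := raise_antisymm G (P.curv_antisymm θ)
  set T : ι → ι → 𝔄 := fun b a ↦ P.cov θ θ b (P.cov θ θ a (X a b)) + P.dR b (γ a) • X a b
    + (γ a * γ b) • X a b + (γ a • P.cov θ θ b (X a b) + γ b • P.cov θ θ a (X a b)) with hT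
  have hsum : ∑ b, (P.cov θ θ b (P.divergence γ θ θ X b) + γ b • P.divergence γ θ θ X b) =
      ∑ b, ∑ a, T b a := by
    simp only [divergence, cov_sum, Finset.smul_sum, ← Finset.sum_add_distrib, cov_add, cov_smul]
    refine Finset.sum_congr rfl fun b _ ↦ Finset.sum_congr rfl fun a _ ↦ ?_
    simp only [hT]; module
  -- Symmetrizing in a and b against the antisymmetric `X` kills the terms in γ, by `hγ` and
  -- commutativity of the scalars, and leaves the Ricci commutator.
  have hcomm : ∀ a b, T b a + T a b = P.curv θ b a * X a b - X a b * P.curv θ b a := by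
    intro a b
    rw [← P.cov_cov_sub θ θ b a (X a b)]
    simp only [hT, hXa a b, cov_neg, hγ a b, mul_comm (γ b)]
    module
  -- The contractions F_{ab} F^{ab} and F^{ab} F_{ab} agree although the factors do not commute,
  -- because the raising can be moved across.
  have hcancel : ∑ b, ∑ a, (P.curv θ b a * X a b - X a b * P.curv θ b a) = 0 := by
    have e1 : ∀ a b, P.curv θ b a * X a b = -(P.curv θ a b * X a b) := by
      intro a b; rw [P.curv_antisymm θ a b]; simp
    have e2 : ∀ a b, X a b * P.curv θ b a = -(X a b * P.curv θ a b) := by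
      intro a b; rw [P.curv_antisymm θ a b]; simp
    simp only [e1, e2, Finset.sum_sub_distrib, Finset.sum_neg_distrib]
    rw [Finset.sum_comm, hX, sum_mul_raise G hG, Finset.sum_comm, sub_self]
  have h2 : (2 : R) • ∑ b, ∑ a, T b a = 0 := by
    rw [two_smul]
    nth_rewrite 2 [Finset.sum_comm]
    simp only [← Finset.sum_add_distrib]
    rw [← hcancel]
    exact Finset.sum_congr rfl fun b _ ↦ Finset.sum_congr rfl fun a _ ↦ hcomm a b
  obtain ⟨u, hu, -⟩ := P.exists_const_mul_eq_one (t := 2) two_ne_zero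
  rw [map_ofNat] at hu
  rw [hsum, ← one_smul R (∑ b, ∑ a, T b a), ← hu, mul_smul, h2, smul_zero]

/-- The divergence of the current is proportional to its normal component. -/
lemma smul_divergence_upperCurrent {G : Matrix ι ι R} (hG : ∀ i j, G i j = G j i) {γ : ι → R}
    (hγ : ∀ i j, P.dR i (γ j) = P.dR j (γ i)) (r : R) (κ : ℕ) (θ : ι → 𝔄) :
    r • ∑ b, (P.cov θ θ b (P.upperCurrent G γ r κ θ b) + γ b • P.upperCurrent G γ r κ θ b) =
      ((κ : R) + 1) • ∑ b, P.dR b r • P.upperCurrent G γ r κ θ b := by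
  set X := raise G (P.curv θ) with hX
  have hXa : ∀ a b, X b a = -X a b := raise_antisymm G (P.curv_antisymm θ)
  set D := P.divergence γ θ θ X with hD
  have h0 : ∑ b, (P.cov θ θ b (D b) + γ b • D b) = 0 := P.divergence_divergence_curv hG hγ θ
  have h1 : ∑ a, ∑ b, (P.dR a r * P.dR b r) • X a b = 0 :=
    sum_antisymm R fun a b ↦ by rw [hXa, smul_neg, mul_comm]
  have h2 : ∑ b, ∑ a, P.dR b (P.dR a r) • X a b = 0 :=
    sum_antisymm R fun a b ↦ by rw [hXa a b, smul_neg, P.dR_comm, neg_neg]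
  -- The term with κ drops out of n·J, being n_a n_b contracted with an antisymmetric tensor.
  have h3 : ∑ b, P.dR b r • P.upperCurrent G γ r κ θ b = r • ∑ b, P.dR b r • D b := by
    have : ∑ b, P.dR b r • P.upperCurrent G γ r κ θ b = r • ∑ b, P.dR b r • D b
        - (κ : R) • ∑ a, ∑ b, (P.dR a r * P.dR b r) • X a b := by
      rw [Finset.sum_comm]
      simp only [upperCurrent, ← hX, ← hD, smul_sub, Finset.sum_sub_distrib, Finset.smul_sum,
        smul_smul]
      congr 1
      · exact Finset.sum_congr rfl fun b _ ↦ by rw [mul_comm]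
      · exact Finset.sum_congr rfl fun b _ ↦ Finset.sum_congr rfl fun a _ ↦ by congr 1; ring
    rw [this, h1, smul_zero, sub_zero]
  -- Taking the divergence on the second index costs a sign. Therefore div J = (1 + κ) n·div F, to
  -- be compared with n·J = r n·div F from `h3`.
  have h4 : ∑ b, ∑ a, P.dR a r • (P.cov θ θ b (X a b) + γ b • X a b) =
      -∑ b, P.dR b r • D b := by
    rw [Finset.sum_comm, ← Finset.sum_neg_distrib]
    refine Finset.sum_congr rfl fun a _ ↦ ?_
    rw [hD, divergence, Finset.smul_sum, ← Finset.sum_neg_distrib]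
    refine Finset.sum_congr rfl fun b _ ↦ ?_
    rw [hXa a b, cov_neg]; module
  have h5 : ∑ b, (P.cov θ θ b (P.upperCurrent G γ r κ θ b) + γ b • P.upperCurrent G γ r κ θ b) =
      ∑ b, P.dR b r • D b + r • ∑ b, (P.cov θ θ b (D b) + γ b • D b)
        - (κ : R) • ∑ b, ∑ a, P.dR b (P.dR a r) • X a b
        - (κ : R) • ∑ b, ∑ a, P.dR a r • (P.cov θ θ b (X a b) + γ b • X a b) := by
    have hκ : ∀ i, P.dR i (κ : R) = 0 := fun i ↦ Derivation.map_natCast _ _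
    simp only [upperCurrent, ← hX, ← hD, cov_sub, cov_smul, cov_sum, hκ, zero_smul, zero_add,
      smul_sub, smul_add, Finset.sum_add_distrib, Finset.sum_sub_distrib, Finset.smul_sum,
      smul_comm (γ _)]
    abel
  rw [h5, h0, h2, h4, h3]
  module

/-- If `J = r^m k` with `m ≤ κ`, then the normal component of `k` is divisible by `r`. -/
lemma exists_normal_eq_smul {G : Matrix ι ι R} (hG : ∀ i j, G i j = G j i) {γ : ι → R}
    (hγ : ∀ i j, P.dR i (γ j) = P.dR j (γ i)) {r : R} (hr : ∀ x : 𝔄, r • x = 0 → x = 0)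
    {κ m : ℕ} (hm : m ≤ κ) (θ : ι → 𝔄) {k : ι → 𝔄}
    (hk : ∀ b, P.upperCurrent G γ r κ θ b = r ^ m • k b) :
    ∃ q : 𝔄, ∑ b, P.dR b r • k b = r • q := by
  have hrm : ∀ (m : ℕ) (x : 𝔄), r ^ m • x = 0 → x = 0 := by
    intro m
    induction m with
    | zero => intro x hx; simpa using hx
    | succ m ih => intro x hx; rw [pow_succ, mul_smul] at hx; exact hr x (ih _ hx)
  have h := P.smul_divergence_upperCurrent hG hγ r κ θ
  have h1 : r • ∑ b, (P.cov θ θ b (r ^ m • k b) + γ b • r ^ m • k b) =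
      r ^ m • ((m : R) • ∑ b, P.dR b r • k b + r • ∑ b, (P.cov θ θ b (k b) + γ b • k b)) := by
    simp only [cov_smul, Finset.smul_sum, ← Finset.sum_add_distrib]
    refine Finset.sum_congr rfl fun b _ ↦ ?_
    simp only [smul_add, smul_smul, mul_dR_pow]
    module
  have h2 : ((κ : R) + 1) • ∑ b, P.dR b r • r ^ m • k b =
      r ^ m • (((κ : R) + 1) • ∑ b, P.dR b r • k b) := by
    simp only [Finset.smul_sum]
    exact Finset.sum_congr rfl fun b _ ↦ by module
  simp only [hk] at h
  rw [h1, h2, ← sub_eq_zero, ← smul_sub] at h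
  have h3 := hrm m _ h
  -- The constant κ + 1 - m comes from (κ+1) n·J minus the contribution m n·k of differentiating
  -- r^m; it is at least 1 because m ≤ κ.
  obtain ⟨u, hu, -⟩ := P.exists_const_mul_eq_one (t := (κ : ℝ) + 1 - m) (by
    have : (m : ℝ) ≤ κ := by exact_mod_cast hm
    linarith)
  simp only [map_sub, map_add, map_natCast, map_one] at hu
  refine ⟨u • ∑ b, (P.cov θ θ b (k b) + γ b • k b), ?_⟩
  have h4 : ((κ : R) + 1 - m) • ∑ b, P.dR b r • k b =
      r • ∑ b, (P.cov θ θ b (k b) + γ b • k b) := by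
    rw [← sub_eq_zero] at h3 ⊢
    rw [sub_zero] at h3
    rw [← neg_eq_zero, ← h3]; module
  rw [smul_comm, ← h4, smul_smul, hu, one_smul]

end PartialDerivatives
end DifferentialAlgebra
end ConformalYangMills

/-! ### Christoffel symbols, and the current with a lower index. -/

namespace ConformalYangMills

section DifferentialAlgebra

namespace PartialDerivatives

lemma sum_rotate {ι A : Type*} [Fintype ι] [AddCommMonoid A] (Z : ι → ι → ι → A) :
    ∑ j, ∑ k, ∑ l, Z j k l = ∑ l, ∑ j, ∑ k, Z j k l := by
  rw [Finset.sum_congr rfl fun j _ ↦ Finset.sum_comm, Finset.sum_comm]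

variable {ι R 𝔄 : Type*} [CommRing R] [Algebra ℝ R] [Ring 𝔄] [Algebra R 𝔄]
  (P : PartialDerivatives ι R 𝔄) [Fintype ι] [DecidableEq ι]

/-- The entrywise derivative of a matrix. -/
def dM (a : ι) (g : Matrix ι ι R) : Matrix ι ι R := g.map (P.dR a)

lemma dM_apply (a : ι) (g : Matrix ι ι R) (i j : ι) : P.dM a g i j = P.dR a (g i j) := rfl

lemma dM_mul (a : ι) (g h : Matrix ι ι R) : P.dM a (g * h) = P.dM a g * h + g * P.dM a h := by
  ext i j
  simp only [dM_apply, Matrix.mul_apply, Matrix.add_apply, map_sum, Derivation.leibniz,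
    smul_eq_mul, ← Finset.sum_add_distrib]
  exact Finset.sum_congr rfl fun _ _ ↦ by ring

lemma dM_one (a : ι) : P.dM a (1 : Matrix ι ι R) = 0 := by
  ext i j
  rcases eq_or_ne i j with rfl | h
  · simp [dM_apply]
  · simp [dM_apply, Matrix.one_apply_ne h]

lemma dM_inv {g G : Matrix ι ι R} (h : g * G = 1) (a : ι) :
    P.dM a G = -(G * P.dM a g * G) := by
  have h1 : P.dM a g * G + g * P.dM a G = 0 := by rw [← dM_mul, h, dM_one]
  have h2 : G * g = 1 := mul_eq_one_comm.mp h
  calc P.dM a G = G * (g * P.dM a G) := by rw [← mul_assoc, h2, one_mul]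
    _ = -(G * P.dM a g * G) := by rw [eq_neg_of_add_eq_zero_right h1]; noncomm_ring

/-- The real number `1 / 2` as a scalar. -/
noncomputable def half (R : Type*) [CommRing R] [Algebra ℝ R] : R := algebraMap ℝ R (1 / 2)

lemma two_mul_half : (2 : R) * half R = 1 := by
  rw [half, ← map_ofNat (algebraMap ℝ R) 2, ← map_mul]; norm_num

lemma half_mul_two : half R * 2 = 1 := by rw [mul_comm, two_mul_half]

lemma dR_half (i : ι) : P.dR i (half R) = 0 := Derivation.map_algebraMap _ _

/-- The logarithmic derivative of the volume density. -/
noncomputable def logVol (g G : Matrix ι ι R) (a : ι) : R := half R * (G * P.dM a g).trace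

/-- The Christoffel symbol `Γ^k_{ij}`. -/
noncomputable def christoffel (g G : Matrix ι ι R) (i j k : ι) : R :=
  half R * ∑ l, G k l * (P.dR i (g j l) + P.dR j (g i l) - P.dR l (g i j))

/-- The covariant derivative `∇_i F_{jb}` of the curvature. -/
noncomputable def covCurv (g G : Matrix ι ι R) (θ : ι → 𝔄) (i j b : ι) : 𝔄 :=
  P.cov θ θ i (P.curv θ j b) - ∑ k, P.christoffel g G i j k • P.curv θ k b
    - ∑ k, P.christoffel g G i b k • P.curv θ j k

/-- The conformally compact Yang-Mills current `j_b`. -/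
noncomputable def lowerCurrent (g G : Matrix ι ι R) (r : R) (κ : ℕ) (θ : ι → 𝔄) (b : ι) : 𝔄 :=
  r • ∑ i, ∑ j, G i j • P.covCurv g G θ i j b
    - (κ : R) • ∑ a, (∑ c, G a c * P.dR c r) • P.curv θ a b

lemma dM_comm (a b : ι) (g : Matrix ι ι R) : P.dM a (P.dM b g) = P.dM b (P.dM a g) := by
  ext i j; exact P.dR_comm _ _ _

lemma dR_trace (a : ι) (g : Matrix ι ι R) : P.dR a g.trace = (P.dM a g).trace := by
  simp [Matrix.trace, dM_apply]

/-- The form γ is closed without recourse to the logarithm of a determinant: second derivatives of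
the metric commute, and the remaining trace of G ∂_a g G ∂_b g is symmetric by cyclicity. -/
lemma dR_logVol {g G : Matrix ι ι R} (h : g * G = 1) (a b : ι) :
    P.dR a (P.logVol g G b) = P.dR b (P.logVol g G a) := by
  have key : ∀ a b, P.dR a (P.logVol g G b) =
      half R * ((G * P.dM a (P.dM b g)).trace - (G * P.dM a g * G * P.dM b g).trace) := by
    intro a b
    rw [logVol, Derivation.leibniz, dR_half, smul_zero, add_zero, dR_trace, dM_mul,
      P.dM_inv h, Matrix.trace_add, neg_mul, Matrix.trace_neg, smul_eq_mul]
    ring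
  rw [key, key, P.dM_comm a b, Matrix.mul_assoc (G * P.dM a g),
    Matrix.trace_mul_comm (G * P.dM a g), ← Matrix.mul_assoc (G * P.dM b g)]

lemma isSymm_inv {g G : Matrix ι ι R} (hg : g.IsSymm) (h : g * G = 1) : G.IsSymm := by
  have h2 : G * g = 1 := mul_eq_one_comm.mp h
  have h3 : G.transpose * g = 1 := by
    rw [← hg.eq, ← Matrix.transpose_mul, h, Matrix.transpose_one]
  calc G.transpose = G.transpose * g * G := by rw [Matrix.mul_assoc, h, Matrix.mul_one]
    _ = G := by rw [h3, Matrix.one_mul]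

/-- The first two terms of the Christoffel symbol each contract to minus the divergence of the
inverse metric, the third to twice the logarithmic derivative of the volume density. -/
lemma sum_christoffel {g G : Matrix ι ι R} (hg : g.IsSymm) (h : g * G = 1) (k : ι) :
    ∑ i, ∑ j, G i j * P.christoffel g G i j k =
      -∑ a, (P.dR a (G a k) + P.logVol g G a * G a k) := by
  have hG := isSymm_inv hg h
  have t1 : ∑ i, ∑ j, ∑ l, G i j * (G k l * P.dR i (g j l)) = -∑ a, P.dR a (G a k) := by
    rw [← Finset.sum_neg_distrib]
    refine Finset.sum_congr rfl fun a _ ↦ ?_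
    rw [← dM_apply, P.dM_inv h, Matrix.neg_apply, neg_neg, Matrix.mul_apply, Finset.sum_comm]
    refine Finset.sum_congr rfl fun l _ ↦ ?_
    rw [Matrix.mul_apply, Finset.sum_mul]
    refine Finset.sum_congr rfl fun j _ ↦ ?_
    rw [dM_apply, hG.apply l k]; ring
  have t2 : ∑ i, ∑ j, ∑ l, G i j * (G k l * P.dR j (g i l)) =
      ∑ i, ∑ j, ∑ l, G i j * (G k l * P.dR i (g j l)) := by
    rw [Finset.sum_comm]
    refine Finset.sum_congr rfl fun i _ ↦ Finset.sum_congr rfl fun j _ ↦ ?_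
    rw [hG.apply]
  have t3 : ∑ i, ∑ j, ∑ l, G i j * (G k l * P.dR l (g i j)) =
      2 * ∑ a, P.logVol g G a * G a k := by
    have : ∀ l, ∑ i, ∑ j, G i j * (G k l * P.dR l (g i j)) = 2 * (P.logVol g G l * G l k) := by
      intro l
      have e : (G * P.dM l g).trace = ∑ i, ∑ j, G i j * P.dR l (g i j) := by
        simp only [Matrix.trace, Matrix.diag, Matrix.mul_apply, dM_apply]
        refine Finset.sum_congr rfl fun i _ ↦ Finset.sum_congr rfl fun j _ ↦ ?_
        rw [hg.apply]
      rw [logVol, e, hG.apply k l, ← mul_assoc, ← mul_assoc, two_mul_half, one_mul,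
        Finset.sum_mul]
      refine Finset.sum_congr rfl fun i _ ↦ ?_
      rw [Finset.sum_mul]
      exact Finset.sum_congr rfl fun j _ ↦ by ring
    rw [Finset.mul_sum, ← Finset.sum_congr rfl fun l _ ↦ this l]
    conv_rhs => rw [Finset.sum_comm]
    exact Finset.sum_congr rfl fun i _ ↦ Finset.sum_comm
  have t4 : ∑ i, ∑ j, G i j * P.christoffel g G i j k =
      half R * (∑ i, ∑ j, ∑ l, G i j * (G k l * P.dR i (g j l))
        + ∑ i, ∑ j, ∑ l, G i j * (G k l * P.dR j (g i l))
        - ∑ i, ∑ j, ∑ l, G i j * (G k l * P.dR l (g i j))) := by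
    simp only [christoffel, Finset.mul_sum, ← Finset.sum_add_distrib, ← Finset.sum_sub_distrib]
    exact Finset.sum_congr rfl fun i _ ↦ Finset.sum_congr rfl fun j _ ↦
      Finset.sum_congr rfl fun l _ ↦ by ring
  rw [t4, t2, t1, t3, Finset.sum_add_distrib]
  linear_combination (-∑ a, P.dR a (G a k) - ∑ a, P.logVol g G a * G a k) *
    (half_mul_two (R := R))

/-- Only the part of the Christoffel symbol which is antisymmetric in the indices contracted with F
survives: the derivative in the free direction drops out, and the other two terms coincide and
cancel the factor 1/2. What is left is the derivative of the inverse metric, by ∂G = -G ∂g G. -/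
lemma sum_dR_inv_smul {g G : Matrix ι ι R} (hg : g.IsSymm) (h : g * G = 1) {F : ι → ι → 𝔄}
    (hF : ∀ i j, F j i = -F i j) (e : ι) :
    ∑ a, ∑ i, ∑ b, (G a i * P.dR a (G e b)) • F i b =
      -∑ b, G e b • ∑ i, ∑ j, G i j • ∑ k, P.christoffel g G i b k • F j k := by
  have hG := isSymm_inv hg h
  have hY := raise_antisymm G hF
  have l1 : ∑ a, ∑ i, ∑ b, (G a i * P.dR a (G e b)) • F i b =
      -∑ p, G e p • ∑ a, ∑ q, P.dR a (g p q) • raise G F a q := by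
    have : ∀ a i b, (G a i * P.dR a (G e b)) • F i b =
        -∑ p, ∑ q, (G e p * P.dR a (g p q) * (G a i * G q b)) • F i b := by
      intro a i b
      rw [← dM_apply, P.dM_inv h, Matrix.neg_apply, Matrix.mul_apply]
      simp only [Matrix.mul_apply, Finset.sum_mul, dM_apply]
      rw [mul_neg, neg_smul, Finset.sum_comm, Finset.mul_sum, Finset.sum_smul]
      congr 1
      refine Finset.sum_congr rfl fun p _ ↦ ?_
      rw [Finset.mul_sum, Finset.sum_smul]
      exact Finset.sum_congr rfl fun q _ ↦ by congr 1; ring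
    simp only [this, Finset.sum_neg_distrib, raise, Finset.smul_sum, smul_smul]
    refine congrArg Neg.neg ?_
    set Z : ι → ι → ι → ι → ι → 𝔄 := fun a i b p q ↦
      (G e p * P.dR a (g p q) * (G a i * G q b)) • F i b with hZ
    have r1 : ∀ a, ∑ i, ∑ b, ∑ p, ∑ q, Z a i b p q = ∑ p, ∑ i, ∑ b, ∑ q, Z a i b p q :=
      fun a ↦ sum_rotate fun i b p ↦ ∑ q, Z a i b p q
    have r2 : ∀ a p, ∑ i, ∑ b, ∑ q, Z a i b p q = ∑ q, ∑ i, ∑ b, Z a i b p q :=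
      fun a p ↦ sum_rotate fun i b q ↦ Z a i b p q
    rw [Finset.sum_congr rfl fun a _ ↦ r1 a, Finset.sum_comm]
    refine Finset.sum_congr rfl fun p _ ↦ Finset.sum_congr rfl fun a _ ↦ ?_
    rw [r2]
    simp only [hZ, mul_assoc]
  rw [l1]
  congr 1
  refine Finset.sum_congr rfl fun b _ ↦ ?_
  congr 1
  have l2 : ∑ i, ∑ j, G i j • ∑ k, P.christoffel g G i b k • F j k =
      half R • ∑ i, ∑ l, (P.dR i (g b l) + P.dR b (g i l) - P.dR l (g i b)) • raise G F i l := by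
    simp only [christoffel, raise, Finset.smul_sum, Finset.mul_sum, Finset.sum_smul, smul_smul]
    refine Finset.sum_congr rfl fun i _ ↦ ?_
    rw [sum_rotate]
    refine Finset.sum_congr rfl fun l _ ↦ Finset.sum_congr rfl fun j _ ↦
      Finset.sum_congr rfl fun k _ ↦ ?_
    rw [hG.apply l k]; congr 1; ring
  rw [l2]
  simp only [sub_smul, add_smul, Finset.sum_add_distrib, Finset.sum_sub_distrib]
  have z1 : ∑ i, ∑ l, P.dR b (g i l) • raise G F i l = 0 :=
    sum_antisymm R fun i l ↦ by rw [hY, hg.apply, smul_neg]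
  have z2 : ∑ i, ∑ l, P.dR l (g i b) • raise G F i l =
      -∑ i, ∑ l, P.dR i (g b l) • raise G F i l := by
    rw [Finset.sum_comm]
    simp only [← Finset.sum_neg_distrib]
    refine Finset.sum_congr rfl fun i _ ↦ Finset.sum_congr rfl fun l _ ↦ ?_
    rw [hY, hg.apply, smul_neg]
  rw [z1, z2, add_zero, sub_neg_eq_add, ← two_smul R, smul_smul, half_mul_two, one_smul]

/-- The contravariant current is obtained by raising the index of the current. -/
lemma sum_smul_lowerCurrent {g G : Matrix ι ι R} (hg : g.IsSymm) (h : g * G = 1) (r : R) (κ : ℕ)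
    (θ : ι → 𝔄) (e : ι) :
    ∑ b, G e b • P.lowerCurrent g G r κ θ b = P.upperCurrent G (P.logVol g G) r κ θ e := by
  have hG := isSymm_inv hg h
  set F := P.curv θ with hF
  have p2 : ∑ b, G e b • ∑ a, (∑ c, G a c * P.dR c r) • F a b =
      ∑ a, P.dR a r • raise G F a e := by
    simp only [raise, Finset.smul_sum, Finset.sum_smul, smul_smul]
    rw [sum_rotate, Finset.sum_congr rfl fun c _ ↦ Finset.sum_comm]
    refine Finset.sum_congr rfl fun c _ ↦ Finset.sum_congr rfl fun a _ ↦
      Finset.sum_congr rfl fun b _ ↦ ?_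
    rw [hG.apply c a]; congr 1; ring
  have p1 : ∑ b, G e b • ∑ i, ∑ j, G i j • P.covCurv g G θ i j b =
      P.divergence (P.logVol g G) θ θ (raise G F) e := by
    -- Leibniz rule for F^{ae} with both inverse metrics differentiated. The second sum will be the
    -- Christoffel term on the contracted index, the third the one on the free index.
    have q1 : P.divergence (P.logVol g G) θ θ (raise G F) e =
        ∑ a, ∑ i, ∑ b, (G a i * G e b) • P.cov θ θ a (F i b)
        + ∑ a, ∑ i, ∑ b, ((P.dR a (G a i) + P.logVol g G a * G a i) * G e b) • F i b
        + ∑ a, ∑ i, ∑ b, (G a i * P.dR a (G e b)) • F i b := by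
      simp only [divergence, raise, cov_sum, cov_smul, Finset.smul_sum,
        ← Finset.sum_add_distrib, Derivation.leibniz, smul_eq_mul]
      exact Finset.sum_congr rfl fun i _ ↦ Finset.sum_congr rfl fun j _ ↦
        Finset.sum_congr rfl fun l _ ↦ by module
    have q2 : ∑ a, ∑ i, ∑ b, ((P.dR a (G a i) + P.logVol g G a * G a i) * G e b) • F i b =
        -∑ b, G e b • ∑ i, ∑ j, G i j • ∑ k, P.christoffel g G i j k • F k b := by
      have s1 : ∑ b, G e b • ∑ i, ∑ j, G i j • ∑ k, P.christoffel g G i j k • F k b =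
          ∑ b, ∑ k, ((∑ i, ∑ j, G i j * P.christoffel g G i j k) * G e b) • F k b := by
        refine Finset.sum_congr rfl fun b _ ↦ ?_
        simp only [Finset.smul_sum, Finset.sum_smul, Finset.sum_mul, smul_smul]
        rw [sum_rotate]
        exact Finset.sum_congr rfl fun l _ ↦ Finset.sum_congr rfl fun j _ ↦
          Finset.sum_congr rfl fun k _ ↦ by congr 1; ring
      rw [s1]
      simp only [P.sum_christoffel hg h, neg_mul, neg_smul, Finset.sum_neg_distrib, neg_neg,
        Finset.sum_mul, Finset.sum_smul]
      rw [Finset.sum_comm]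
      conv_rhs => rw [Finset.sum_comm]
      exact Finset.sum_congr rfl fun _ _ ↦ Finset.sum_comm
    rw [q1, q2, P.sum_dR_inv_smul hg h (P.curv_antisymm θ)]
    have q3 : ∑ a, ∑ i, ∑ b, (G a i * G e b) • P.cov θ θ a (F i b) =
        ∑ b, G e b • ∑ i, ∑ j, G i j • P.cov θ θ i (F j b) := by
      simp only [Finset.smul_sum, smul_smul]
      conv_rhs => rw [Finset.sum_comm]
      refine Finset.sum_congr rfl fun a _ ↦ ?_
      conv_rhs => rw [Finset.sum_comm]
      exact Finset.sum_congr rfl fun i _ ↦ Finset.sum_congr rfl fun b _ ↦ by rw [mul_comm]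
    rw [q3]
    simp only [covCurv, ← hF, smul_sub, Finset.sum_sub_distrib]
    abel
  simp only [lowerCurrent, smul_sub, Finset.sum_sub_distrib, smul_comm (G e _),
    ← Finset.smul_sum]
  rw [p1, p2]
  rfl

end PartialDerivatives
end DifferentialAlgebra
end ConformalYangMills

/-! ### Conformal covariance, the inductive step, and independence of the extension, algebraically.
-/

namespace ConformalYangMills

section DifferentialAlgebra

namespace PartialDerivatives

variable {ι R 𝔄 : Type*} [CommRing R] [Algebra ℝ R] [Ring 𝔄] [Algebra R 𝔄]
  (P : PartialDerivatives ι R 𝔄) [Fintype ι] [DecidableEq ι]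

lemma lower_raise {g G : Matrix ι ι R} (h : g * G = 1) (x : ι → 𝔄) (b : ι) :
    ∑ e, g b e • ∑ c, G e c • x c = x b := by
  have : ∑ e, g b e • ∑ c, G e c • x c = ∑ c, (g * G) b c • x c := by
    simp only [Finset.smul_sum, smul_smul, Matrix.mul_apply, Finset.sum_smul]
    rw [Finset.sum_comm]
  rw [this, h]
  simp [Matrix.one_apply, ite_smul]

/-- The square of the norm of `dr`. -/
def normSq (G : Matrix ι ι R) (r : R) : R := ∑ a, P.dR a r * ∑ c, G a c * P.dR c r

lemma lowerCurrent_eq {g G : Matrix ι ι R} (hg : g.IsSymm) (h : g * G = 1) (r : R) (κ : ℕ)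
    (θ : ι → 𝔄) (b : ι) :
    P.lowerCurrent g G r κ θ b =
      ∑ e, g b e • P.upperCurrent G (P.logVol g G) r κ θ e := by
  simp only [← P.sum_smul_lowerCurrent hg h]
  exact (lower_raise h _ b).symm

/-- F^{ab} scales by w^4, which contributes -4 dΩ/Ω to the divergence, while the volume density
contributes d dΩ/Ω. With d = κ + 4 the remainder κ dΩ/Ω is cancelled by the derivative of Ω in d(Ω
r). -/
lemma upperCurrent_conformal {g G : Matrix ι ι R} (h : g * G = 1) (r : R) {κ : ℕ}
    (hκ : κ + 4 = Fintype.card ι) (θ : ι → 𝔄) {Ω w : R} (hw : w * Ω = 1) (b : ι) :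
    P.upperCurrent (w ^ 2 • G) (P.logVol (Ω ^ 2 • g) (w ^ 2 • G)) (Ω * r) κ θ b =
      w ^ 3 • P.upperCurrent G (P.logVol g G) r κ θ b := by
  have hGg : G * g = 1 := mul_eq_one_comm.mp h
  have hdw : ∀ a, P.dR a w = -(w ^ 2 * P.dR a Ω) := by
    intro a
    have h1 := congrArg (P.dR a) hw
    rw [Derivation.leibniz, Derivation.map_one_eq_zero, smul_eq_mul, smul_eq_mul] at h1
    linear_combination w * h1 - P.dR a w * hw
  have hγ : ∀ a, P.logVol (Ω ^ 2 • g) (w ^ 2 • G) a =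
      P.logVol g G a + ((κ : R) + 4) * (w * P.dR a Ω) := by
    intro a
    have h1 : P.dM a (Ω ^ 2 • g) = Ω ^ 2 • P.dM a g + (2 * Ω * P.dR a Ω) • g := by
      ext i j
      simp only [dM_apply, Matrix.smul_apply, Matrix.add_apply, smul_eq_mul, Derivation.leibniz,
        Derivation.leibniz_pow, nsmul_eq_mul]
      push_cast
      ring
    have h2 : ((w ^ 2 • G) * P.dM a (Ω ^ 2 • g)).trace =
        (G * P.dM a g).trace + 2 * (((κ : R) + 4) * (w * P.dR a Ω)) := by
      rw [h1, Matrix.mul_add, Matrix.trace_add, Matrix.smul_mul, Matrix.mul_smul, Matrix.smul_mul,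
        Matrix.mul_smul, hGg, smul_smul, smul_smul, Matrix.trace_smul, Matrix.trace_smul,
        Matrix.trace_one, ← hκ]
      push_cast
      simp only [smul_eq_mul]
      linear_combination ((G * P.dM a g).trace * (w * Ω + 1)
        + 2 * ((κ : R) + 4) * w * P.dR a Ω) * hw
    rw [logVol, h2, logVol]
    linear_combination ((κ : R) + 4) * (w * P.dR a Ω) * half_mul_two (R := R)
  set F := P.curv θ
  have hX : raise (w ^ 2 • G) F = fun i j ↦ w ^ 4 • raise G F i j := by
    funext i j
    simp only [raise, Finset.smul_sum, smul_smul, Matrix.smul_apply, smul_eq_mul]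
    exact Finset.sum_congr rfl fun _ _ ↦ Finset.sum_congr rfl fun _ _ ↦ by congr 1; ring
  have hdw4 : ∀ a, P.dR a (w ^ 4) = -(4 * w ^ 5 * P.dR a Ω) := by
    intro a
    rw [Derivation.leibniz_pow, hdw]
    simp only [nsmul_eq_mul, smul_eq_mul]
    push_cast
    ring
  simp only [upperCurrent]
  change (Ω * r) • P.divergence _ θ θ (raise (w ^ 2 • G) F) b
    - (κ : R) • ∑ a, P.dR a (Ω * r) • raise (w ^ 2 • G) F a b = _
  rw [hX]
  simp only [divergence, hγ, cov_smul, hdw4, Derivation.leibniz, Finset.smul_sum, smul_sub,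
    ← Finset.sum_sub_distrib]
  refine Finset.sum_congr rfl fun a _ ↦ ?_
  change _ = w ^ 3 • r • (P.cov θ θ a (raise G F a b) + P.logVol g G a • raise G F a b) -
    w ^ 3 • (κ : R) • P.dR a r • raise G F a b
  generalize P.cov θ θ a (raise G F a b) = Z
  generalize raise G F a b = X
  have hw3 : Ω * w ^ 4 = w ^ 3 := by linear_combination w ^ 3 * hw
  have hw4 : Ω * w ^ 5 = w ^ 4 := by linear_combination w ^ 4 * hw
  simp only [smul_eq_mul]
  match_scalars
  · linear_combination (r * P.logVol g G a - κ * P.dR a r) * hw3 + κ * r * P.dR a Ω * hw4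
  · linear_combination r * hw3

lemma lowerCurrent_conformal {g G : Matrix ι ι R} (hg : g.IsSymm) (h : g * G = 1) (r : R) {κ : ℕ}
    (hκ : κ + 4 = Fintype.card ι) (θ : ι → 𝔄) {Ω w : R} (hw : w * Ω = 1) (b : ι) :
    P.lowerCurrent (Ω ^ 2 • g) (w ^ 2 • G) (Ω * r) κ θ b = w • P.lowerCurrent g G r κ θ b := by
  have hg' : (Ω ^ 2 • g).IsSymm := hg.smul _
  have h' : (Ω ^ 2 • g) * (w ^ 2 • G) = 1 := by
    rw [Matrix.smul_mul, Matrix.mul_smul, h, smul_smul, ← mul_pow, mul_comm Ω, hw, one_pow,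
      one_smul]
  rw [P.lowerCurrent_eq hg' h', P.lowerCurrent_eq hg h, Finset.smul_sum]
  refine Finset.sum_congr rfl fun e _ ↦ ?_
  rw [P.upperCurrent_conformal h r hκ θ hw, smul_smul, smul_smul, Matrix.smul_apply, smul_eq_mul]
  congr 1
  linear_combination (w ^ 2 * Ω + w) * g b e * hw

/-- The inductive step in the construction of asymptotically Yang-Mills connections. -/
lemma exists_lowerCurrent_eq_pow_succ {g G : Matrix ι ι R} (hg : g.IsSymm) (h : g * G = 1) {r : R}
    (hr : ∀ x : 𝔄, r • x = 0 → x = 0) {κ m : ℕ} (hm : m < κ) {θ θ' k : ι → 𝔄}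
    (hk : ∀ b, P.lowerCurrent g G r κ θ b = r ^ m • k b) {φ ψ : R}
    (hφ : φ * P.normSq G r = 1 + r * ψ)
    (hθ' : ∀ i, θ' i = θ i +
      r ^ (m + 1) • (algebraMap ℝ R (-1 / (((m : ℝ) + 1) * (m - κ))) * φ) • k i) :
    ∃ k' : ι → 𝔄, ∀ b, P.lowerCurrent g G r κ θ' b = r ^ (m + 1) • k' b := by
  have hG := isSymm_inv hg h
  set u := algebraMap ℝ R (-1 / (((m : ℝ) + 1) * (m - κ))) with hu
  -- The constant is chosen so that the coefficient (m+1)(m-κ) of the leading term becomes -1; it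
  -- exists because m < κ.
  have hu1 : ((m + 1 : ℕ) : R) * ((m : R) - κ) * u = -1 := by
    have : ((m + 1 : ℕ) : R) * ((m : R) - κ) = algebraMap ℝ R (((m : ℝ) + 1) * (m - κ)) := by
      simp
    rw [this, hu, ← map_mul, mul_div_cancel₀, map_neg, map_one]
    have h1 : (m : ℝ) < κ := by exact_mod_cast hm
    have h2 : (m : ℝ) - κ ≠ 0 := by linarith
    positivity
  set kup : ι → 𝔄 := fun b ↦ ∑ e, G b e • k e with hkup
  have hJ : ∀ b, P.upperCurrent G (P.logVol g G) r κ θ b = r ^ m • kup b := by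
    intro b
    rw [← P.sum_smul_lowerCurrent hg h]
    simp only [hk, hkup, Finset.smul_sum, smul_comm (r ^ m)]
  -- The correction can cancel only |n|² k - (n·k) n. That this suffices rests on n·k being
  -- divisible by r.
  obtain ⟨q, hq⟩ := P.exists_normal_eq_smul (fun i j ↦ hG.apply j i) (P.dR_logVol h) hr hm.le θ hJ
  have hβ : ∀ i, P.cov θ' θ i 1 = r ^ (m + 1) • ((u * φ) • k i) := by
    intro i; rw [cov_one, hθ', add_sub_cancel_left]
  obtain ⟨K, hK⟩ := P.exists_upperCurrent_mul_sub G (P.logVol g G) r κ m θ' θ 1 hβ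
  have hL : ∀ b, P.leadingTerm G r (fun i ↦ (u * φ) • k i) b =
      (u * φ) • (P.normSq G r • kup b - (∑ e, G b e * P.dR e r) • r • q) := by
    intro b
    rw [leadingTerm_eq, ← hq, smul_sub]
    simp only [smul_comm _ (u * φ), ← Finset.smul_sum]
    rw [normSq]
  -- The old term r^m k meets -r^m φ|n|² k = -r^m (1 + rψ) k; the remainder -ψ k and the normal part
  -- φ n q carry an additional r.
  have hJ' : ∀ b, P.upperCurrent G (P.logVol g G) r κ θ' b = r ^ (m + 1) •
      (K b - ψ • kup b + (φ * ∑ e, G b e * P.dR e r) • q) := by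
    intro b
    have := hK b
    rw [mul_one, one_mul, hJ, hL, sub_eq_iff_eq_add] at this
    rw [this]
    generalize ∑ e, G b e * P.dR e r = nb
    push_cast at hu1 ⊢
    match_scalars
    · linear_combination (r ^ m * φ * P.normSq G r) * hu1 - r ^ m * hφ
    · linear_combination (-r ^ (m + 1) * φ * nb) * hu1
    · ring
  refine ⟨fun b ↦ ∑ e, g b e • (K e - ψ • kup e + (φ * ∑ i, G e i * P.dR i r) • q), fun b ↦ ?_⟩
  rw [P.lowerCurrent_eq hg h, Finset.smul_sum]
  exact Finset.sum_congr rfl fun e _ ↦ by rw [hJ', smul_comm]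

/-- If two connections have the same tangential part on the boundary, then the leading terms of
their currents agree there. -/
lemma exists_sub_eq_smul_of_lowerCurrent {g G : Matrix ι ι R} (hg : g.IsSymm) (h : g * G = 1)
    {r : R} (hr : ∀ x : 𝔄, r • x = 0 → x = 0) {κ : ℕ} {θ θ' k k' : ι → 𝔄}
    (hk : ∀ b, P.lowerCurrent g G r κ θ b = r ^ κ • k b)
    (hk' : ∀ b, P.lowerCurrent g G r κ θ' b = r ^ κ • k' b)
    {φ ψ : R} (hφ : φ * P.normSq G r = 1 + r * ψ) {χ : 𝔄} {c : ι → 𝔄}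
    (hc : ∀ i, θ' i - θ i = P.dR i r • χ + r • c i) (b : ι) :
    ∃ q : 𝔄, k' b - k b = r • q := by
  have hrm : ∀ (m : ℕ) (x y : 𝔄), r ^ m • x = r ^ m • y → x = y := by
    intro m
    induction m with
    | zero => intro x y hx; simpa using hx
    | succ m ih =>
      intro x y hx
      rw [pow_succ, mul_smul, mul_smul] at hx
      have := ih _ _ hx
      rw [← sub_eq_zero, ← smul_sub] at this
      exact sub_eq_zero.mp (hr _ this)
  set kup : ι → 𝔄 := fun b ↦ ∑ e, G b e • k e with hkup
  set kup' : ι → 𝔄 := fun b ↦ ∑ e, G b e • k' e with hkup'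
  have hJ : ∀ b, P.upperCurrent G (P.logVol g G) r κ θ b = r ^ κ • kup b := by
    intro b
    rw [← P.sum_smul_lowerCurrent hg h]
    simp only [hk, hkup, Finset.smul_sum, smul_comm (r ^ κ)]
  have hJ' : ∀ b, P.upperCurrent G (P.logVol g G) r κ θ' b = r ^ κ • kup' b := by
    intro b
    rw [← P.sum_smul_lowerCurrent hg h]
    simp only [hk', hkup', Finset.smul_sum, smul_comm (r ^ κ)]
  -- absorbing the normal component into the homomorphism
  have step : ∀ (m : ℕ) (η : 𝔄) (χ : 𝔄) (c : ι → 𝔄),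
      (∀ i, P.cov θ' θ i (1 + r • η) = r ^ m • (P.dR i r • χ + r • c i)) →
      ∃ (η' : 𝔄) (β : ι → 𝔄), ∀ i, P.cov θ' θ i (1 + r • η') = r ^ (m + 1) • β i := by
    intro m η χ c hη
    obtain ⟨u, hu, hdu⟩ := P.exists_const_mul_eq_one (t := ((m + 1 : ℕ) : ℝ))
      (by positivity)
    rw [map_natCast] at hu
    push_cast at hu
    -- Here u = 1/(m+1): the derivative of r^(m+1) χ/(m+1) has leading part r^m dr χ, precisely the
    -- term to be removed.
    refine ⟨η - (u * r ^ m) • χ, fun i ↦ c i - u • P.cov θ' θ i χ, fun i ↦ ?_⟩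
    have e : 1 + r • (η - (u * r ^ m) • χ) = (1 + r • η) - (u * r ^ (m + 1)) • χ := by
      rw [pow_succ]; module
    rw [e, cov_sub, hη, cov_smul, Derivation.leibniz, hdu, dR_pow_succ]
    push_cast
    simp only [smul_eq_mul, mul_zero, add_zero]
    match_scalars
    · linear_combination (-r ^ m * P.dR i r) * hu
    · ring
    · ring
  -- The homomorphism keeps the form 1 + r η throughout, hence is the identity on the boundary. The
  -- starting point h = 1 uses the assumed form of θ' - θ.
  have main : ∀ m : ℕ, m ≤ κ →
      ∃ (η : 𝔄) (β : ι → 𝔄), ∀ i, P.cov θ' θ i (1 + r • η) = r ^ (m + 1) • β i := by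
    intro m
    induction m with
    | zero =>
      intro _
      refine step 0 0 χ c fun i ↦ ?_
      rw [smul_zero, add_zero, cov_one, hc, pow_zero, one_smul]
    | succ m ih =>
      intro hm
      obtain ⟨η, β, hβ⟩ := ih (by omega)
      obtain ⟨K, hK⟩ := P.exists_upperCurrent_mul_sub G (P.logVol g G) r κ m θ' θ _ hβ
      obtain ⟨u, hu, -⟩ := P.exists_const_mul_eq_one (t := ((m : ℝ) + 1) * (m - κ)) (by
        have h1 : (m : ℝ) + 1 ≤ κ := by exact_mod_cast hm
        have h2 : (m : ℝ) - κ ≠ 0 := by linarith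
        positivity)
      simp only [map_mul, map_sub, map_add, map_natCast, map_one] at hu
      obtain ⟨p, hp⟩ := Nat.exists_eq_add_of_le hm
      set Z : ι → 𝔄 := fun b ↦ kup' b * (1 + r • η) - (1 + r • η) * kup b with hZ
      -- Since m + 1 ≤ κ, both currents are divisible by r^(m+1), so the term of order r^m in the
      -- comparison identity must itself be divisible by r.
      have hV : ∀ b, P.leadingTerm G r β b = r • u • (r ^ p • Z b - K b) := by
        intro b
        have h1 := hK b
        rw [hJ, hJ', smul_mul_assoc, mul_smul_comm, ← smul_sub] at h1
        have h2 : r ^ m • (r • r ^ p • Z b) =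
            r ^ m • ((((m + 1 : ℕ) : R) * ((m : R) - κ)) • P.leadingTerm G r β b + r • K b) := by
          have h3 : r ^ κ • Z b = r ^ m • (r • r ^ p • Z b) := by
            rw [smul_smul, smul_smul]; congr 1; rw [hp]; ring
          rw [← h3, h1]; module
        have h4 := hrm m _ _ h2
        have h5 : (((m + 1 : ℕ) : R) * ((m : R) - κ)) • P.leadingTerm G r β b =
            r • (r ^ p • Z b - K b) := by
          rw [smul_sub, h4]; abel
        rw [smul_comm r u, ← h5, smul_smul]
        push_cast
        rw [hu, one_smul]
      -- lowering the index
      set νβ : 𝔄 := ∑ a, P.dR a r • ∑ c, G a c • β c with hνβ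
      have hlow : ∀ c, P.normSq G r • β c - P.dR c r • νβ =
          r • ∑ e, g c e • u • (r ^ p • Z e - K e) := by
        intro c
        have h1 : ∑ e, g c e • P.leadingTerm G r β e =
            P.normSq G r • β c - P.dR c r • νβ := by
          simp only [leadingTerm_eq, smul_sub, Finset.sum_sub_distrib]
          congr 1
          · simp only [smul_comm (g c _), ← Finset.smul_sum]
            rw [lower_raise h, normSq]
          · simp only [smul_smul, ← Finset.sum_smul]
            congr 1
            have h2 := lower_raise (𝔄 := R) h (fun e ↦ P.dR e r) c
            simpa only [smul_eq_mul] using h2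
        rw [← h1, Finset.smul_sum]
        exact Finset.sum_congr rfl fun e _ ↦ by rw [hV, smul_comm]
      -- Multiplying |n|² β - (n·β) n = O(r) by φ and using φ|n|² = 1 + rψ gives β = φ(n·β) n +
      -- O(r), the form which `step` absorbs.
      refine step (m + 1) η (φ • νβ)
        (fun c ↦ φ • ∑ e, g c e • u • (r ^ p • Z e - K e) - ψ • β c) fun i ↦ ?_
      rw [hβ]
      congr 1
      have h1 : φ • (P.normSq G r • β i - P.dR i r • νβ) =
          r • φ • ∑ e, g i e • u • (r ^ p • Z e - K e) := by rw [hlow, smul_comm]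
      rw [smul_sub r, ← h1, smul_sub φ, smul_smul φ, hφ]
      module
  obtain ⟨η, β, hβ⟩ := main κ le_rfl
  -- At m = κ the coefficient m - κ is zero: β no longer enters at order r^κ, and k' h - h k is
  -- divisible by r.
  obtain ⟨K, hK⟩ := P.exists_upperCurrent_mul_sub G (P.logVol g G) r κ κ θ' θ _ hβ
  have hup : ∀ b, kup' b - kup b = r • (K b - kup' b * η + η * kup b) := by
    intro b
    have h1 := hK b
    rw [hJ, hJ', smul_mul_assoc, mul_smul_comm, ← smul_sub, sub_self, mul_zero, zero_mul, zero_smul,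
      zero_add, pow_succ, mul_smul] at h1
    have h2 := hrm κ _ _ h1
    rw [mul_add, add_mul, mul_one, one_mul, mul_smul_comm, smul_mul_assoc] at h2
    rw [smul_add, smul_sub, ← h2]; abel
  refine ⟨∑ e, g b e • (K e - kup' e * η + η * kup e), ?_⟩
  rw [← lower_raise h k' b, ← lower_raise h k b, ← Finset.sum_sub_distrib, Finset.smul_sum]
  refine Finset.sum_congr rfl fun e _ ↦ ?_
  rw [← smul_sub, smul_comm r, ← hup]

/-- The normal component of the leading term of the current vanishes on the boundary. -/
lemma exists_sum_eq_smul_of_lowerCurrent {g G : Matrix ι ι R} (hg : g.IsSymm) (h : g * G = 1)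
    {r : R} (hr : ∀ x : 𝔄, r • x = 0 → x = 0) {κ m : ℕ} (hm : m ≤ κ) {θ k : ι → 𝔄}
    (hk : ∀ b, P.lowerCurrent g G r κ θ b = r ^ m • k b) :
    ∃ q : 𝔄, ∑ a, (∑ c, G a c * P.dR c r) • k a = r • q := by
  have hG := isSymm_inv hg h
  obtain ⟨q, hq⟩ := P.exists_normal_eq_smul (fun i j ↦ hG.apply j i) (P.dR_logVol h) hr hm θ
    (k := fun b ↦ ∑ e, G b e • k e) (fun b ↦ by
      rw [← P.sum_smul_lowerCurrent hg h]
      simp only [hk, Finset.smul_sum, smul_comm (r ^ m)])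
  refine ⟨q, ?_⟩
  rw [← hq]
  simp only [Finset.sum_smul, Finset.smul_sum, smul_smul]
  rw [Finset.sum_comm]
  exact Finset.sum_congr rfl fun a _ ↦ Finset.sum_congr rfl fun c _ ↦ by
    rw [hG.apply a c, mul_comm]

end PartialDerivatives
end DifferentialAlgebra
end ConformalYangMills

/-! ### Smooth functions on a subset as a model of the differential algebra. -/

namespace ConformalYangMills

section SmoothFunctions

variable {E : Type*} [NormedAddCommGroup E] [NormedSpace ℝ E]

/-- The algebra of smooth functions on a subset `O` of a normed space. -/
def smoothFunctions (O : Set E) (A : Type*) [NormedRing A] [NormedAlgebra ℝ A] :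
    Subalgebra ℝ (O → A) where
  carrier := {f | ∃ φ : E → A, ContDiffOn ℝ ∞ φ O ∧ ∀ x : O, f x = φ x}
  mul_mem' := by
    rintro f f' ⟨φ, hφ, h⟩ ⟨φ', hφ', h'⟩
    exact ⟨fun x ↦ φ x * φ' x, hφ.mul hφ', fun x ↦ by simp [h, h']⟩
  add_mem' := by
    rintro f f' ⟨φ, hφ, h⟩ ⟨φ', hφ', h'⟩
    exact ⟨fun x ↦ φ x + φ' x, hφ.add hφ', fun x ↦ by simp [h, h']⟩
  algebraMap_mem' c := ⟨fun _ ↦ algebraMap ℝ A c, contDiffOn_const, fun _ ↦ rfl⟩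

variable {O : Set E}

/-- The type of smooth functions on a subset `O` of a normed space. -/
abbrev SmoothFn (O : Set E) (A : Type*) [NormedRing A] [NormedAlgebra ℝ A] : Type _ :=
  smoothFunctions O A

namespace SmoothFn

section Basic

variable {A : Type*} [NormedRing A] [NormedAlgebra ℝ A]

/-- The smooth function on `O` given by a function which is smooth on `O`. -/
def mk (φ : E → A) (hφ : ContDiffOn ℝ ∞ φ O) : SmoothFn O A :=
  ⟨fun x ↦ φ x, φ, hφ, fun _ ↦ rfl⟩

@[simp] lemma mk_apply (φ : E → A) (hφ : ContDiffOn ℝ ∞ φ O) (x : O) : (mk φ hφ).1 x = φ x := rfl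

/-- The extension by zero. -/
noncomputable def extend (f : SmoothFn O A) : E → A := Function.extend Subtype.val f.1 0

lemma extend_apply (f : SmoothFn O A) (x : O) : f.extend x = f.1 x :=
  Subtype.val_injective.extend_apply _ _ _

lemma extend_of_mem (f : SmoothFn O A) {x : E} (hx : x ∈ O) : f.extend x = f.1 ⟨x, hx⟩ :=
  f.extend_apply ⟨x, hx⟩

lemma contDiffOn_extend (f : SmoothFn O A) : ContDiffOn ℝ ∞ f.extend O := by
  obtain ⟨φ, hφ, h⟩ := f.2
  exact hφ.congr fun x hx ↦ by rw [f.extend_of_mem hx, h]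

lemma ext {f f' : SmoothFn O A} (h : ∀ (x) (hx : x ∈ O), f.1 ⟨x, hx⟩ = f'.1 ⟨x, hx⟩) :
    f = f' :=
  Subtype.ext (funext fun x ↦ h x.1 x.2)

variable (hO : UniqueDiffOn ℝ O)

/-- The derivative in the direction `v`. -/
noncomputable def deriv (hO : UniqueDiffOn ℝ O) (v : E) (f : SmoothFn O A) :
    SmoothFn O A :=
  mk (fun x ↦ fderivWithin ℝ f.extend O x v)
    ((f.contDiffOn_extend.fderivWithin hO (m := ∞) (by simp)).clm_apply contDiffOn_const)

lemma deriv_apply (v : E) (f : SmoothFn O A) (x : O) :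
    (f.deriv hO v).1 x = fderivWithin ℝ f.extend O x v := rfl

lemma deriv_mk (v : E) (φ : E → A) (hφ : ContDiffOn ℝ ∞ φ O) (x : O) :
    ((mk φ hφ).deriv hO v).1 x = fderivWithin ℝ φ O x v := by
  rw [deriv_apply]
  congr 1
  exact fderivWithin_congr (fun y hy ↦ extend_of_mem _ hy) (extend_of_mem _ x.2)

lemma differentiableWithinAt_extend (f : SmoothFn O A) (x : O) :
    DifferentiableWithinAt ℝ f.extend O x :=
  (f.contDiffOn_extend x x.2).differentiableWithinAt (by simp)

lemma deriv_add (v : E) (f f' : SmoothFn O A) :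
    (f + f').deriv hO v = f.deriv hO v + f'.deriv hO v := by
  refine ext fun x hx ↦ ?_
  have h : f + f' = mk (fun x ↦ f.extend x + f'.extend x)
      (f.contDiffOn_extend.add f'.contDiffOn_extend) :=
    ext fun y hy ↦ by simp [extend_of_mem _ hy]
  rw [h, deriv_mk, fderivWithin_fun_add (hO x hx) (f.differentiableWithinAt_extend ⟨x, hx⟩)
    (f'.differentiableWithinAt_extend ⟨x, hx⟩)]
  rfl

lemma deriv_mul (v : E) (f f' : SmoothFn O A) :
    (f * f').deriv hO v = f.deriv hO v * f' + f * f'.deriv hO v := by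
  refine ext fun x hx ↦ ?_
  have h : f * f' = mk (fun x ↦ f.extend x * f'.extend x)
      (f.contDiffOn_extend.mul f'.contDiffOn_extend) :=
    ext fun y hy ↦ by simp [extend_of_mem _ hy]
  rw [h, deriv_mk, fderivWithin_fun_mul' (hO x hx) (f.differentiableWithinAt_extend ⟨x, hx⟩)
    (f'.differentiableWithinAt_extend ⟨x, hx⟩)]
  simp [extend_of_mem _ hx, deriv_apply, add_comm]

lemma deriv_const_smul (v : E) (c : ℝ) (f : SmoothFn O A) :
    (c • f).deriv hO v = c • f.deriv hO v := by
  refine ext fun x hx ↦ ?_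
  have h : c • f = mk (fun x ↦ c • f.extend x) (f.contDiffOn_extend.const_smul c) :=
    ext fun y hy ↦ by simp [extend_of_mem _ hy]
  rw [h, deriv_mk, fderivWithin_fun_const_smul (hO x hx) (f.differentiableWithinAt_extend ⟨x, hx⟩)]
  rfl

/-- On a set with boundary, symmetry of the second derivative is inherited from interior points,
which have to accumulate at every point. -/
lemma deriv_comm (hO' : O ⊆ closure (interior O)) (v w : E) (f : SmoothFn O A) :
    (f.deriv hO w).deriv hO v = (f.deriv hO v).deriv hO w := by
  refine ext fun x hx ↦ ?_
  have hs : IsSymmSndFDerivWithinAt ℝ f.extend O x :=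
    (f.contDiffOn_extend x hx).isSymmSndFDerivWithinAt
      (by simp only [minSmoothness_of_isRCLikeNormedField]; exact ENat.LEInfty.out) hO (hO' hx) hx
  have key : ∀ v w : E, ((f.deriv hO w).deriv hO v).1 ⟨x, hx⟩ =
      fderivWithin ℝ (fderivWithin ℝ f.extend O) O x v w := by
    intro v w
    rw [deriv.eq_1 hO w, deriv_mk, fderivWithin_clm_apply (hO x hx) _ (differentiableWithinAt_const _)]
    · simp
    · exact ((f.contDiffOn_extend.fderivWithin hO (m := ∞) (by simp)) x hx).differentiableWithinAt
        (by simp)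
  rw [key, key, hs.eq]

end Basic

section Module

variable {F : Type*} [NormedAddCommGroup F] [NormedSpace ℝ F]

noncomputable instance : Module (SmoothFn O ℝ) (SmoothFn O (F →L[ℝ] F)) where
  smul f X := ⟨fun x ↦ f.1 x • X.1 x, fun x ↦ f.extend x • X.extend x,
    f.contDiffOn_extend.smul X.contDiffOn_extend, fun x ↦ by
      change _ = f.extend x • X.extend x
      rw [extend_apply, extend_apply]⟩
  one_smul X := ext fun x hx ↦ one_smul ℝ (X.1 ⟨x, hx⟩)
  mul_smul f f' X := ext fun x hx ↦ mul_smul (f.1 ⟨x, hx⟩) (f'.1 ⟨x, hx⟩) (X.1 ⟨x, hx⟩)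
  smul_zero f := ext fun x hx ↦ smul_zero (f.1 ⟨x, hx⟩)
  smul_add f X Y := ext fun x hx ↦ smul_add (f.1 ⟨x, hx⟩) (X.1 ⟨x, hx⟩) (Y.1 ⟨x, hx⟩)
  add_smul f f' X := ext fun x hx ↦ add_smul (f.1 ⟨x, hx⟩) (f'.1 ⟨x, hx⟩) (X.1 ⟨x, hx⟩)
  zero_smul X := ext fun x hx ↦ zero_smul ℝ (X.1 ⟨x, hx⟩)

lemma smul_apply (f : SmoothFn O ℝ) (X : SmoothFn O (F →L[ℝ] F)) (x : O) :
    (f • X).1 x = f.1 x • X.1 x := rfl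

noncomputable instance : Algebra (SmoothFn O ℝ) (SmoothFn O (F →L[ℝ] F)) :=
  Algebra.ofModule (fun f X Y ↦ ext fun x hx ↦ smul_mul_assoc (f.1 ⟨x, hx⟩) (X.1 _) (Y.1 _))
    (fun f X Y ↦ ext fun x hx ↦ mul_smul_comm (f.1 ⟨x, hx⟩) (X.1 _) (Y.1 _))

lemma deriv_smul (hO : UniqueDiffOn ℝ O) (v : E) (f : SmoothFn O ℝ)
    (X : SmoothFn O (F →L[ℝ] F)) :
    (f • X).deriv hO v = f.deriv hO v • X + f • X.deriv hO v := by
  refine ext fun x hx ↦ ?_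
  have h : f • X = mk (fun x ↦ f.extend x • X.extend x)
      (f.contDiffOn_extend.smul X.contDiffOn_extend) :=
    ext fun y hy ↦ by simp [extend_of_mem _ hy, smul_apply]
  rw [h, deriv_mk, fderivWithin_fun_smul (hO x hx) (f.differentiableWithinAt_extend ⟨x, hx⟩)
    (X.differentiableWithinAt_extend ⟨x, hx⟩)]
  simp only [add_apply, _root_.smul_apply,
    ContinuousLinearMap.smulRight_apply, extend_of_mem _ hx]
  exact add_comm _ _

variable (F) in
/-- The partial derivatives along a family of vectors. -/
noncomputable def partialDerivatives {ι : Type*} (b : ι → E) (hO : UniqueDiffOn ℝ O)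
    (hO' : O ⊆ closure (interior O)) :
    PartialDerivatives ι (SmoothFn O ℝ) (SmoothFn O (F →L[ℝ] F)) where
  dR i := Derivation.mk' ⟨⟨deriv hO (b i), deriv_add hO _⟩, deriv_const_smul hO _⟩ fun f f' ↦ by
    change (f * f').deriv hO (b i) = f * f'.deriv hO (b i) + f' * f.deriv hO (b i)
    rw [deriv_mul]; ring
  dA i := AddMonoidHom.mk' (deriv hO (b i)) (deriv_add hO _)
  dA_mul i := deriv_mul hO _
  dA_smul i := deriv_smul hO _
  dR_comm i j := deriv_comm hO hO' _ _
  dA_comm i j := deriv_comm hO hO' _ _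

end Module

lemma exists_mul_eq_one (f : SmoothFn O ℝ) (hf : ∀ x, f.1 x ≠ 0) :
    ∃ f', f * f' = 1 :=
  ⟨mk (fun x ↦ (f.extend x)⁻¹) (f.contDiffOn_extend.inv fun x hx ↦ by
    rw [extend_of_mem _ hx]; exact hf _), ext fun x hx ↦ by
      have := hf ⟨x, hx⟩
      simp [extend_of_mem _ hx, this]⟩

end SmoothFn

end SmoothFunctions
end ConformalYangMills

/-! ### Smooth dependence of integrals on parameters in a convex set. -/

namespace ConformalYangMills

section ParametricIntegral

variable {E : Type} [NormedAddCommGroup E] [NormedSpace ℝ E]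

lemma intervalIntegrable_prodMk {C : Type*} [NormedAddCommGroup C] {O : Set E} {f : ℝ × E → C}
    (hf : ContinuousOn f (Icc 0 1 ×ˢ O)) {y : E} (hy : y ∈ O) :
    IntervalIntegrable (fun t ↦ f (t, y)) MeasureTheory.volume 0 1 := by
  refine ContinuousOn.intervalIntegrable ?_
  rw [uIcc_of_le zero_le_one]
  exact hf.comp (by fun_prop) fun t ht ↦ ⟨ht, hy⟩

/-- Differentiation under the integral sign on a convex set. -/
lemma hasFDerivWithinAt_integral_of_continuousOn {B : Type*} [NormedAddCommGroup B]
    [NormedSpace ℝ B] [CompleteSpace B] {O : Set E} (hO : Convex ℝ O)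
    {Φ : ℝ × E → B} {Ψ : ℝ × E → E →L[ℝ] B} (hΦ : ContinuousOn Φ (Icc 0 1 ×ˢ O))
    (hΨ : ContinuousOn Ψ (Icc 0 1 ×ˢ O))
    (hd : ∀ t ∈ Icc (0 : ℝ) 1, ∀ y ∈ O,
      HasFDerivWithinAt (fun y ↦ Φ (t, y)) (Ψ (t, y)) O y) {x : E} (hx : x ∈ O) :
    HasFDerivWithinAt (fun y ↦ ∫ t in (0 : ℝ)..1, Φ (t, y)) (∫ t in (0 : ℝ)..1, Ψ (t, x)) O x := by
  rw [hasFDerivWithinAt_iff_isLittleO, Asymptotics.isLittleO_iff]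
  intro ε hε
  -- Compactness of the interval makes the continuity of `Ψ` at x uniform in t.
  have hunif : ∀ᶠ z in 𝓝 x, ∀ t ∈ Icc (0 : ℝ) 1, t ∈ Icc (0 : ℝ) 1 → z ∈ O →
      ‖Ψ (t, z) - Ψ (t, x)‖ ≤ ε := by
    refine isCompact_Icc.eventually_forall_of_forall_eventually
      (P := fun z t ↦ t ∈ Icc (0 : ℝ) 1 → z ∈ O → ‖Ψ (t, z) - Ψ (t, x)‖ ≤ ε) ?_
    intro t ht
    have h1 := Metric.continuousOn_iff.1 hΨ (t, x) ⟨ht, hx⟩ (ε / 2) (by positivity)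
    obtain ⟨δ, hδ, h⟩ := h1
    refine Metric.eventually_nhds_iff.2 ⟨δ, hδ, fun {y} hy ht' hz ↦ ?_⟩
    obtain ⟨z, t'⟩ := y
    simp only [Prod.dist_eq, max_lt_iff] at hy
    have a := h (t', z) ⟨ht', hz⟩ (by simp [Prod.dist_eq, hy.1, hy.2])
    have b := h (t', x) ⟨ht', hx⟩ (by simp [Prod.dist_eq, hy.2])
    have := dist_triangle_right (Ψ (t', z)) (Ψ (t', x)) (Ψ (t, x))
    rw [← dist_eq_norm]
    linarith
  obtain ⟨δ, hδ, hball⟩ := Metric.eventually_nhds_iff_ball.1 hunif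
  filter_upwards [inter_mem_nhdsWithin O (Metric.ball_mem_nhds x hδ)] with z hz
  -- The mean value inequality on the convex set O ∩ ball, for each t, with a bound independent of
  -- t.
  have key : ∀ t ∈ uIoc (0 : ℝ) 1, ‖Φ (t, z) - Φ (t, x) - Ψ (t, x) (z - x)‖ ≤ ε * ‖z - x‖ := by
    intro t ht
    rw [uIoc_of_le zero_le_one] at ht
    have ht' : t ∈ Icc (0 : ℝ) 1 := Ioc_subset_Icc_self ht
    refine (hO.inter (convex_ball x δ)).norm_image_sub_le_of_norm_hasFDerivWithin_le'
      (f := fun y ↦ Φ (t, y)) (f' := fun y ↦ Ψ (t, y))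
      (fun y hy ↦ (hd t ht' y hy.1).mono inter_subset_left)
      (fun y hy ↦ hball y hy.2 t ht' ht' hy.1) ⟨hx, Metric.mem_ball_self hδ⟩ hz
  have h2 := intervalIntegral.norm_integral_le_of_norm_le_const key
  rw [sub_zero, abs_one, mul_one] at h2
  have hΨi := intervalIntegrable_prodMk hΨ hx
  rw [intervalIntegral.integral_sub ((intervalIntegrable_prodMk hΦ hz.1).sub
    (intervalIntegrable_prodMk hΦ hx)), intervalIntegral.integral_sub
    (intervalIntegrable_prodMk hΦ hz.1) (intervalIntegrable_prodMk hΦ hx),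
    ← ContinuousLinearMap.intervalIntegral_apply hΨi] at h2
  · exact h2
  · exact (intervalIntegrable_prodMk (f := fun p ↦ Ψ p (z - x))
      (hΨ.clm_apply continuousOn_const) hx)

/-- The integral of a smooth family of functions on a convex set is smooth. -/
lemma contDiffOn_integral {O : Set E} (hO : Convex ℝ O) (hu : UniqueDiffOn ℝ O) (n : ℕ) :
    ∀ {B : Type*} [NormedAddCommGroup B] [NormedSpace ℝ B] [CompleteSpace B]
    {Φ : ℝ × E → B}, ContDiffOn ℝ ∞ Φ (Icc 0 1 ×ˢ O) →
    ContDiffOn ℝ n (fun y ↦ ∫ t in (0 : ℝ)..1, Φ (t, y)) O := by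
  -- The target B is quantified inside the induction because the derivative of the integral takes
  -- values in E →L[ℝ] B. With E in the lowest universe this space stays in the universe of B.
  induction n with
  | zero =>
    intro B _ _ _ Φ hΦ
    simp only [Nat.cast_zero, contDiffOn_zero]
    intro x hx
    have hu' : UniqueDiffOn ℝ (Icc (0 : ℝ) 1 ×ˢ O) :=
      (uniqueDiffOn_Icc zero_lt_one).prod hu
    refine (hasFDerivWithinAt_integral_of_continuousOn hO hΦ.continuousOn
      (Ψ := fun p ↦ (fderivWithin ℝ Φ (Icc 0 1 ×ˢ O) p).comp (ContinuousLinearMap.inr ℝ ℝ E))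
      ?_ ?_ hx).continuousWithinAt
    · exact ((hΦ.fderivWithin hu' (m := ∞) (by simp)).clm_comp contDiffOn_const).continuousOn
    · intro t ht y hy
      have h1 := ((hΦ (t, y) ⟨ht, hy⟩).differentiableWithinAt (by simp)).hasFDerivWithinAt
      exact h1.comp (t := Icc 0 1 ×ˢ O) y (hasFDerivAt_prodMk_right t y).hasFDerivWithinAt fun z hz ↦ ⟨ht, hz⟩
  | succ n ih =>
    intro B _ _ _ Φ hΦ
    have hu' : UniqueDiffOn ℝ (Icc (0 : ℝ) 1 ×ˢ O) :=
      (uniqueDiffOn_Icc zero_lt_one).prod hu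
    have hΨ : ContDiffOn ℝ ∞ (fun p ↦ (fderivWithin ℝ Φ (Icc 0 1 ×ˢ O) p).comp
      (ContinuousLinearMap.inr ℝ ℝ E)) (Icc 0 1 ×ˢ O) :=
      (hΦ.fderivWithin hu' (m := ∞) (by simp)).clm_comp contDiffOn_const
    have hd : ∀ x ∈ O, HasFDerivWithinAt (fun y ↦ ∫ t in (0 : ℝ)..1, Φ (t, y)) _ O x :=
      fun x hx ↦ hasFDerivWithinAt_integral_of_continuousOn hO hΦ.continuousOn
        hΨ.continuousOn (fun t ht y hy ↦
          (((hΦ (t, y) ⟨ht, hy⟩).differentiableWithinAt (by simp)).hasFDerivWithinAt).comp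
            (t := Icc 0 1 ×ˢ O) y (hasFDerivAt_prodMk_right t y).hasFDerivWithinAt fun z hz ↦ ⟨ht, hz⟩) hx
    rw [Nat.cast_succ, contDiffOn_succ_iff_fderivWithin hu]
    refine ⟨fun x hx ↦ (hd x hx).differentiableWithinAt, by simp, ?_⟩
    exact (ih hΨ).congr fun x hx ↦ (hd x hx).fderivWithin (hu x hx)

end ParametricIntegral

/-! ### Hadamard's lemma on half balls, and cancellation of the defining function. -/

section Hadamard

variable {d : ℕ} [NeZero d]

/-- The intersection of a half space and a ball around a point. -/
def halfBall (p : EuclideanSpace ℝ (Fin d)) (ε : ℝ) : Set (EuclideanSpace ℝ (Fin d)) :=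
  range (𝓡∂ d) ∩ Metric.ball p ε

variable {p : EuclideanSpace ℝ (Fin d)} {ε : ℝ}

lemma mem_halfBall {y : EuclideanSpace ℝ (Fin d)} :
    y ∈ halfBall p ε ↔ 0 ≤ y 0 ∧ y ∈ Metric.ball p ε := by
  rw [halfBall, range_modelWithCornersEuclideanHalfSpace]; rfl

lemma convex_halfBall : Convex ℝ (halfBall p ε) :=
  ((𝓡∂ d).convex_range).inter (convex_ball p ε)

lemma uniqueDiffOn_halfBall : UniqueDiffOn ℝ (halfBall p ε) :=
  ((𝓡∂ d).uniqueDiffOn).inter Metric.isOpen_ball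

lemma halfBall_subset_closure_interior : halfBall p ε ⊆ closure (interior (halfBall p ε)) := by
  intro x hx
  have h := (𝓡∂ d).range_subset_closure_interior hx.1
  rw [halfBall, interior_inter, Metric.isOpen_ball.interior_eq]
  exact closure_mono (by rw [inter_comm]) (Metric.isOpen_ball.inter_closure ⟨hx.2, h⟩)

/-- Hadamard's lemma for a function vanishing on the flat part of the boundary of a half ball
whose centre is in the boundary. -/
lemma exists_eq_coord_smul {B : Type*} [NormedAddCommGroup B] [NormedSpace ℝ B] [CompleteSpace B]
    (hp : p 0 = 0) {f : EuclideanSpace ℝ (Fin d) → B} (hf : ContDiffOn ℝ ∞ f (halfBall p ε))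
    (h0 : ∀ y ∈ halfBall p ε, y 0 = 0 → f y = 0) :
    ∃ q : EuclideanSpace ℝ (Fin d) → B, ContDiffOn ℝ ∞ q (halfBall p ε) ∧
      ∀ y ∈ halfBall p ε, f y = y 0 • q y := by
  set O := halfBall p ε with hOdef
  set e : EuclideanSpace ℝ (Fin d) := EuclideanSpace.single 0 1 with he
  -- The segment from the projection of y to the flat boundary (t = 0) to y (t = 1); only the
  -- coordinate 0 varies.
  let γ : ℝ × EuclideanSpace ℝ (Fin d) → EuclideanSpace ℝ (Fin d) :=
    fun z ↦ z.2 - ((1 - z.1) * z.2 0) • e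
  have hγs : ContDiff ℝ ∞ γ := by fun_prop
  -- Since the centre lies on the flat boundary, the projection does not increase the distance to
  -- it, so that the projected point stays in the half ball.
  have hnorm : ∀ y ∈ O, y - y 0 • e ∈ O := by
    intro y hy
    rw [hOdef, mem_halfBall] at hy ⊢
    refine ⟨by simp [he], ?_⟩
    rw [Metric.mem_ball, EuclideanSpace.dist_eq] at hy ⊢
    refine lt_of_le_of_lt (Real.sqrt_le_sqrt (Finset.sum_le_sum fun i _ ↦ ?_)) hy.2
    by_cases hi : i = 0
    · subst hi
      simp [he, hp, sq_nonneg]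
    · simp [he, hi]
  have hγ : MapsTo γ (Icc 0 1 ×ˢ O) O := by
    rintro ⟨t, y⟩ ⟨ht, hy⟩
    have := convex_halfBall (p := p) (ε := ε) hy (hnorm y hy) ht.1 (sub_nonneg.2 ht.2) (by ring)
    convert this using 1
    simp only [γ]
    module
  have hdf : ContDiffOn ℝ ∞ (fun y ↦ fderivWithin ℝ f O y e) O :=
    (hf.fderivWithin uniqueDiffOn_halfBall (m := ∞) (by simp)).clm_apply contDiffOn_const
  have hΦ : ContDiffOn ℝ ∞ (fun z ↦ fderivWithin ℝ f O (γ z) e) (Icc 0 1 ×ˢ O) :=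
    hdf.comp hγs.contDiffOn hγ
  refine ⟨fun y ↦ ∫ t in (0 : ℝ)..1, fderivWithin ℝ f O (γ (t, y)) e, contDiffOn_infty.2 fun n ↦
    contDiffOn_integral convex_halfBall uniqueDiffOn_halfBall n hΦ, fun y hy ↦ ?_⟩
  have hline : ContinuousOn (fun t ↦ γ (t, y)) (Icc 0 1) := by fun_prop
  have hmaps : MapsTo (fun t ↦ γ (t, y)) (Icc 0 1) O := fun t ht ↦ hγ ⟨ht, hy⟩
  have hder : ∀ t ∈ Ioo (0 : ℝ) 1, HasDerivAt (fun t ↦ f (γ (t, y)))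
      (y 0 • fderivWithin ℝ f O (γ (t, y)) e) t := by
    intro t ht
    have ht' : t ∈ Icc (0 : ℝ) 1 := Ioo_subset_Icc_self ht
    have h1 := ((hf _ (hmaps ht')).differentiableWithinAt (by simp)).hasFDerivWithinAt
    have h2 : HasDerivWithinAt (fun t ↦ γ (t, y)) (y 0 • e) (Icc 0 1) t := by
      have : HasDerivAt (fun t : ℝ ↦ y - ((1 - t) * y 0) • e) (y 0 • e) t := by
        have := ((((hasDerivAt_id t).const_sub 1).mul_const (y 0)).smul_const e).const_sub y
        simpa using this
      exact this.hasDerivWithinAt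
    have h3 := h1.comp_hasDerivWithinAt t h2 hmaps
    simpa [Function.comp_def] using h3.hasDerivAt (Icc_mem_nhds ht.1 ht.2)
  have hftc := intervalIntegral.integral_eq_sub_of_hasDerivAt_of_le zero_le_one
    (hf.continuousOn.comp hline hmaps) hder
    (((intervalIntegrable_prodMk hΦ.continuousOn hy)).smul (y 0))
  have h00 : f (γ (0, y)) = 0 := by
    refine h0 _ (hmaps ⟨le_rfl, zero_le_one⟩) ?_
    simp [γ, he]
  rw [← intervalIntegral.integral_smul, hftc, Function.comp, Function.comp, h00]
  simp [γ]

/-- Hadamard's lemma for a function vanishing on the zero set of a boundary defining function. -/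
lemma exists_eq_smul_of_defining {B : Type*} [NormedAddCommGroup B] [NormedSpace ℝ B]
    [CompleteSpace B] (hp : p 0 = 0) {r : EuclideanSpace ℝ (Fin d) → ℝ}
    (hr : ContDiffOn ℝ ∞ r (halfBall p ε)) (hr0 : ∀ y ∈ halfBall p ε, r y = 0 ↔ y 0 = 0)
    (hdr : ∀ y ∈ halfBall p ε, y 0 = 0 → fderivWithin ℝ r (halfBall p ε) y ≠ 0)
    {f : EuclideanSpace ℝ (Fin d) → B} (hf : ContDiffOn ℝ ∞ f (halfBall p ε))
    (h0 : ∀ y ∈ halfBall p ε, y 0 = 0 → f y = 0) :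
    ∃ q : EuclideanSpace ℝ (Fin d) → B, ContDiffOn ℝ ∞ q (halfBall p ε) ∧
      ∀ y ∈ halfBall p ε, f y = r y • q y := by
  obtain ⟨q, hq, hfq⟩ := exists_eq_coord_smul hp hf h0
  obtain ⟨s, hs, hrs⟩ := exists_eq_coord_smul hp hr fun y hy ↦ (hr0 y hy).2
  -- In r = y_0 s the factor s is a unit: at boundary points dr = s dy_0 is nonzero, at other points
  -- r itself is nonzero. Division by y_0 thus becomes division by r.
  have hs0 : ∀ y ∈ halfBall p ε, s y ≠ 0 := by
    intro y hy hsy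
    by_cases hy0 : y 0 = 0
    · refine hdr y hy hy0 ?_
      have hu := uniqueDiffOn_halfBall y hy
      rw [fderivWithin_congr (fun z hz ↦ hrs z hz) (hrs y hy),
        fderivWithin_fun_smul (c := fun z : EuclideanSpace ℝ (Fin d) ↦ z 0) hu
          (EuclideanSpace.proj (𝕜 := ℝ) 0).differentiableAt.differentiableWithinAt ((hs y hy).differentiableWithinAt (by simp)),
        hsy, hy0]
      simp
    · exact hy0 ((hr0 y hy).1 (by rw [hrs y hy, hsy, smul_zero]))
  refine ⟨fun y ↦ (s y)⁻¹ • q y, (hs.inv hs0).smul hq, fun y hy ↦ ?_⟩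
  rw [hfq y hy, hrs y hy, smul_eq_mul, smul_smul, mul_assoc, mul_inv_cancel₀ (hs0 y hy), mul_one]

namespace SmoothFn

variable {F : Type*} [NormedAddCommGroup F] [NormedSpace ℝ F]

lemma exists_eq_smul [CompleteSpace F] (hp : p 0 = 0) {r : SmoothFn (halfBall p ε) ℝ}
    (hr0 : ∀ y, r.1 y = 0 ↔ y.1 0 = 0)
    (hdr : ∀ y ∈ halfBall p ε, y 0 = 0 → fderivWithin ℝ r.extend (halfBall p ε) y ≠ 0)
    {f : SmoothFn (halfBall p ε) (F →L[ℝ] F)} (h0 : ∀ y, y.1 0 = 0 → f.1 y = 0) :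
    ∃ q : SmoothFn (halfBall p ε) (F →L[ℝ] F), f = r • q := by
  obtain ⟨q, hq, hfq⟩ := exists_eq_smul_of_defining hp r.contDiffOn_extend
    (fun y hy ↦ by rw [extend_of_mem _ hy]; exact hr0 _) hdr f.contDiffOn_extend
    (fun y hy hy0 ↦ by rw [extend_of_mem _ hy]; exact h0 _ hy0)
  refine ⟨mk q hq, ext fun y hy ↦ ?_⟩
  have := hfq y hy
  rw [extend_of_mem _ hy, extend_of_mem _ hy] at this
  rw [this, smul_apply, mk_apply]

/-- The function r vanishes nowhere in the interior, which is dense in the half ball; the conclusion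
extends by continuity. This supplies the cancellation hypothesis of the algebraic lemmas. -/
lemma eq_zero_of_smul_eq_zero {r : SmoothFn (halfBall p ε) ℝ}
    (hr0 : ∀ y, r.1 y = 0 ↔ y.1 0 = 0) (f : SmoothFn (halfBall p ε) (F →L[ℝ] F))
    (h : r • f = 0) : f = 0 := by
  have h1 : ∀ y ∈ interior (halfBall p ε), f.extend y = 0 := by
    intro y hy
    have hy' := interior_subset hy
    have h2 : r.1 ⟨y, hy'⟩ • f.1 ⟨y, hy'⟩ = 0 := congrFun (congrArg Subtype.val h) ⟨y, hy'⟩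
    have h3 : 0 < y 0 := by
      have : y ∈ interior (range (𝓡∂ d)) := interior_mono inter_subset_left hy
      rwa [interior_range_modelWithCornersEuclideanHalfSpace] at this
    rw [extend_of_mem _ hy']
    exact (smul_eq_zero.1 h2).resolve_left fun h4 ↦ h3.ne' ((hr0 _).1 h4)
  refine ext fun y hy ↦ ?_
  rw [← extend_of_mem _ hy]
  have hc := (f.contDiffOn_extend.continuousOn y hy).mono (interior_subset (s := halfBall p ε))
  have h5 := hc.mem_closure_image (halfBall_subset_closure_interior hy)
  change f.extend y = 0
  refine mem_singleton_iff.1 ?_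
  rw [← closure_singleton (x := (0 : F →L[ℝ] F))]
  refine closure_mono ?_ h5
  rintro _ ⟨z, hz, rfl⟩
  exact h1 z hz

end SmoothFn

end Hadamard
end ConformalYangMills

/-! ### Charts, trivializations and local representatives of sections. -/

namespace ConformalYangMills

section LocalRepresentatives

variable {E : Type*} [NormedAddCommGroup E] [NormedSpace ℝ E] {H : Type*} [TopologicalSpace H]
  {I : ModelWithCorners ℝ E H} {M : Type*} [TopologicalSpace M] [ChartedSpace H M]
  {F : Type*} [NormedAddCommGroup F] [NormedSpace ℝ F]
  {V : M → Type*} [TopologicalSpace (TotalSpace F V)]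
  [∀ x, AddCommGroup (V x)] [∀ x, Module ℝ (V x)] [∀ x, TopologicalSpace (V x)]
  [FiberBundle F V] [VectorBundle ℝ F V]

variable (I F V) in
/-- A set in the model space, relatively open in the range of the model with corners, over which
the preferred chart at `x₀` and the preferred trivialization of `V` at `x₀` are defined. -/
structure IsChartDomain (x₀ : M) (O : Set E) : Prop where
  mem_target : ∀ y ∈ O, y ∈ (extChartAt I x₀).target
  mem_baseSet : ∀ y ∈ O, (extChartAt I x₀).symm y ∈ (trivializationAt F V x₀).baseSet
  mem_nhdsWithin : ∀ y ∈ O, O ∈ 𝓝[range I] y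

variable (I F) in
/-- The local representative of a section of a vector bundle in the preferred chart and the
preferred trivialization at `x₀`. -/
noncomputable def localRep (x₀ : M) (s : Π x : M, V x) (y : E) : F :=
  (trivializationAt F V x₀).continuousLinearMapAt ℝ ((extChartAt I x₀).symm y)
    (s ((extChartAt I x₀).symm y))

variable (I F V) in
/-- The inverse of the preferred trivialization at `x₀`, in the preferred chart at `x₀`. -/
noncomputable def fibreMap (x₀ : M) (y : E) : F →L[ℝ] V ((extChartAt I x₀).symm y) :=
  (trivializationAt F V x₀).symmL ℝ ((extChartAt I x₀).symm y)

variable (I) in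
/-- The coordinate frame of the tangent bundle in the preferred chart at `x₀`. -/
noncomputable abbrev frame [IsManifold I 1 M] (x₀ : M) (y : E) :
    E →L[ℝ] TangentSpace I ((extChartAt I x₀).symm y) :=
  fibreMap I E (fun x : M ↦ TangentSpace I x) x₀ y

namespace IsChartDomain

variable {x₀ : M} {O : Set E}

lemma subset_range (hO : IsChartDomain I F V x₀ O) : O ⊆ range I :=
  fun y hy ↦ extChartAt_target_subset_range x₀ (hO.mem_target y hy)

lemma symm_mem_source (hO : IsChartDomain I F V x₀ O) {y : E} (hy : y ∈ O) :
    (extChartAt I x₀).symm y ∈ (chartAt H x₀).source := by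
  rw [← extChartAt_source I]
  exact (extChartAt I x₀).map_target (hO.mem_target y hy)

lemma right_inv (hO : IsChartDomain I F V x₀ O) {y : E} (hy : y ∈ O) :
    extChartAt I x₀ ((extChartAt I x₀).symm y) = y :=
  (extChartAt I x₀).right_inv (hO.mem_target y hy)

lemma nhdsWithin_eq (hO : IsChartDomain I F V x₀ O) {y : E} (hy : y ∈ O) :
    𝓝[O] y = 𝓝[range I] y :=
  le_antisymm (nhdsWithin_mono y hO.subset_range)
    (nhdsWithin_le_of_mem (hO.mem_nhdsWithin y hy))

lemma eventuallyEq_range (hO : IsChartDomain I F V x₀ O) {y : E} (hy : y ∈ O) :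
    O =ᶠ[𝓝 y] range I :=
  nhdsWithin_eq_iff_eventuallyEq.1 (hO.nhdsWithin_eq hy)

lemma uniqueDiffOn (hO : IsChartDomain I F V x₀ O) : UniqueDiffOn ℝ O := fun y hy ↦
  (I.uniqueDiffOn y (hO.subset_range hy)).mono_nhds (hO.nhdsWithin_eq hy).ge

lemma fibreMap_apply (hO : IsChartDomain I F V x₀ O) {y : E} (hy : y ∈ O) (f : F) :
    (trivializationAt F V x₀).continuousLinearMapAt ℝ ((extChartAt I x₀).symm y)
      (fibreMap I F V x₀ y f) = f :=
  (trivializationAt F V x₀).continuousLinearMapAt_symmL (hO.mem_baseSet y hy) f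

lemma fibreMap_localRep (hO : IsChartDomain I F V x₀ O) {y : E} (hy : y ∈ O)
    (s : Π x : M, V x) : fibreMap I F V x₀ y (localRep I F x₀ s y) = s _ :=
  (trivializationAt F V x₀).symmL_continuousLinearMapAt (hO.mem_baseSet y hy) _

lemma fibreMap_injective (hO : IsChartDomain I F V x₀ O) {y : E} (hy : y ∈ O) :
    Function.Injective (fibreMap I F V x₀ y) :=
  Function.LeftInverse.injective (hO.fibreMap_apply hy)

lemma fibreMap_surjective (hO : IsChartDomain I F V x₀ O) {y : E} (hy : y ∈ O) :
    Function.Surjective (fibreMap I F V x₀ y) :=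
  fun v ↦ ⟨(trivializationAt F V x₀).continuousLinearMapAt ℝ _ v,
    (trivializationAt F V x₀).symmL_continuousLinearMapAt (hO.mem_baseSet y hy) _⟩

/-- Relative openness of O in the range of the model is used here: germs on the manifold, boundary
points included, correspond to germs within O. -/
lemma map_symm_nhdsWithin (hO : IsChartDomain I F V x₀ O) {y : E} (hy : y ∈ O) :
    Filter.map (extChartAt I x₀).symm (𝓝[O] y) = 𝓝 ((extChartAt I x₀).symm y) := by
  rw [hO.nhdsWithin_eq hy]
  conv_lhs => rw [← hO.right_inv hy]
  exact map_extChartAt_symm_nhdsWithin_range'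
    ((extChartAt I x₀).map_target (hO.mem_target y hy))

lemma eventually_iff (hO : IsChartDomain I F V x₀ O) {y : E} (hy : y ∈ O) {p : M → Prop} :
    (∀ᶠ x in 𝓝 ((extChartAt I x₀).symm y), p x) ↔
      ∀ᶠ z in 𝓝[O] y, p ((extChartAt I x₀).symm z) := by
  rw [← hO.map_symm_nhdsWithin hy, Filter.eventually_map]

variable [IsManifold I ∞ M]

/-- The preferred trivialization of the tangent bundle is defined over the whole chart source, so
every chart domain for `V` also serves for the tangent bundle. -/
lemma tangent (hO : IsChartDomain I F V x₀ O) :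
    IsChartDomain I E (fun x : M ↦ TangentSpace I x) x₀ O :=
  ⟨hO.mem_target, fun _ hy ↦ by
    rw [TangentBundle.trivializationAt_baseSet]; exact hO.symm_mem_source hy,
    hO.mem_nhdsWithin⟩

lemma mdifferentiableAt_iff {F' : Type*} [NormedAddCommGroup F'] [NormedSpace ℝ F']
    (hO : IsChartDomain I F V x₀ O) {y : E} (hy : y ∈ O) {f : M → F'} :
    MDifferentiableAt I 𝓘(ℝ, F') f ((extChartAt I x₀).symm y) ↔
      DifferentiableWithinAt ℝ (f ∘ (extChartAt I x₀).symm) O y := by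
  rw [mdifferentiableAt_iff_source_of_mem_source (hO.symm_mem_source hy), hO.right_inv hy,
    mdifferentiableWithinAt_iff_differentiableWithinAt]
  exact differentiableWithinAt_congr_nhds (hO.nhdsWithin_eq hy).symm

lemma contMDiffAt_iff {F' : Type*} [NormedAddCommGroup F'] [NormedSpace ℝ F']
    (hO : IsChartDomain I F V x₀ O) {y : E} (hy : y ∈ O) {f : M → F'} :
    ContMDiffAt I 𝓘(ℝ, F') ∞ f ((extChartAt I x₀).symm y) ↔
      ContDiffWithinAt ℝ ∞ (f ∘ (extChartAt I x₀).symm) O y := by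
  rw [contMDiffAt_iff_source_of_mem_source (hO.symm_mem_source hy), hO.right_inv hy,
    contMDiffWithinAt_iff_contDiffWithinAt]
  exact contDiffWithinAt_congr_set (hO.eventuallyEq_range hy).symm

variable [ContMDiffVectorBundle ∞ F V I]

lemma localRep_eq (hO : IsChartDomain I F V x₀ O) (s : Π x : M, V x) :
    ∀ y ∈ O, ((fun x ↦ (trivializationAt F V x₀ ⟨x, s x⟩).2) ∘ (extChartAt I x₀).symm) y =
      localRep I F x₀ s y := fun y hy ↦ by
  rw [localRep, Trivialization.continuousLinearMapAt_apply,
    Trivialization.coe_linearMapAt_of_mem _ (hO.mem_baseSet y hy)]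
  rfl

lemma mdifferentiableAt_section_iff (hO : IsChartDomain I F V x₀ O) {y : E} (hy : y ∈ O)
    {s : Π x : M, V x} :
    MDifferentiableAt I (I.prod 𝓘(ℝ, F)) (fun x ↦ TotalSpace.mk' F x (s x))
      ((extChartAt I x₀).symm y) ↔ DifferentiableWithinAt ℝ (localRep I F x₀ s) O y := by
  have : ContMDiffVectorBundle 1 F V I := ContMDiffVectorBundle.of_le (n := ∞) (by simp)
  rw [(trivializationAt F V x₀).mdifferentiableAt_section_iff I s (hO.mem_baseSet y hy),
    hO.mdifferentiableAt_iff hy]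
  exact ⟨fun h ↦ h.congr (fun z hz ↦ (hO.localRep_eq s z hz).symm) (hO.localRep_eq s y hy).symm,
    fun h ↦ h.congr (hO.localRep_eq s) (hO.localRep_eq s y hy)⟩

lemma contMDiffAt_section_iff (hO : IsChartDomain I F V x₀ O) {y : E} (hy : y ∈ O)
    {s : Π x : M, V x} :
    ContMDiffAt I (I.prod 𝓘(ℝ, F)) ∞ (fun x ↦ TotalSpace.mk' F x (s x))
      ((extChartAt I x₀).symm y) ↔ ContDiffWithinAt ℝ ∞ (localRep I F x₀ s) O y := by
  rw [(trivializationAt F V x₀).contMDiffAt_section_iff (hO.mem_baseSet y hy),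
    hO.contMDiffAt_iff hy]
  exact contDiffWithinAt_congr (hO.localRep_eq s) (hO.localRep_eq s y hy)

lemma frame_eq (hO : IsChartDomain I F V x₀ O) {y : E} (hy : y ∈ O) :
    frame I x₀ y = mfderivWithin 𝓘(ℝ, E) I (extChartAt I x₀).symm (range I) y := by
  rw [frame, fibreMap, TangentBundle.symmL_trivializationAt (hO.symm_mem_source hy),
    hO.right_inv hy]

/-- The derivative of a function along the coordinate frame. -/
lemma mfderiv_frame {F' : Type*} [NormedAddCommGroup F'] [NormedSpace ℝ F']
    (hO : IsChartDomain I F V x₀ O) {y : E} (hy : y ∈ O) {f : M → F'}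
    (hf : MDifferentiableAt I 𝓘(ℝ, F') f ((extChartAt I x₀).symm y)) (v : E) :
    mfderiv I 𝓘(ℝ, F') f ((extChartAt I x₀).symm y) (frame I x₀ y v) =
      fderivWithin ℝ (f ∘ (extChartAt I x₀).symm) O y v := by
  have h1 := mdifferentiableWithinAt_extChartAt_symm (I := I) (hO.mem_target y hy)
  have h2 : UniqueMDiffWithinAt 𝓘(ℝ, E) (range I) y :=
    (I.uniqueDiffOn y (hO.subset_range hy)).uniqueMDiffWithinAt
  have h3 := mfderiv_comp_mfderivWithin y hf h1 h2
  rw [mfderivWithin_eq_fderivWithin, ← fderivWithin_congr_set (hO.eventuallyEq_range hy)] at h3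
  rw [h3, hO.frame_eq hy]
  rfl

lemma mpullbackWithin_eq (hO : IsChartDomain I F V x₀ O) {y : E} (hy : y ∈ O)
    (X : Π x : M, TangentSpace I x) :
    VectorField.mpullbackWithin 𝓘(ℝ, E) I (extChartAt I x₀).symm X (range I) y =
      localRep I E x₀ X y := by
  rw [VectorField.mpullbackWithin_apply, ← hO.frame_eq hy]
  have h := hO.tangent.mem_baseSet y hy
  have : frame I x₀ y = (((trivializationAt E (TangentSpace I) x₀).continuousLinearEquivAt ℝ
      ((extChartAt I x₀).symm y) h).symm : E →L[ℝ] TangentSpace I ((extChartAt I x₀).symm y)) :=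
    ((trivializationAt E (TangentSpace I) x₀).symm_continuousLinearEquivAt_eq' (R := ℝ) h).symm
  rw [this]
  refine (congrArg (fun L : TangentSpace I ((extChartAt I x₀).symm y) →L[ℝ] E ↦ L (X _))
    (ContinuousLinearMap.inverse_equiv _)).trans ?_
  exact congrFun ((trivializationAt E (TangentSpace I) x₀).coe_continuousLinearEquivAt_eq
    (R := ℝ) h) _

/-- Naturality of the bracket under pullback by the inverse chart; pulling back a vector field gives
its local representative. -/
lemma mlieBracket_eq [CompleteSpace E] (hO : IsChartDomain I F V x₀ O) {y : E} (hy : y ∈ O)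
    {X Y : Π x : M, TangentSpace I x}
    (hX : DifferentiableWithinAt ℝ (localRep I E x₀ X) O y)
    (hY : DifferentiableWithinAt ℝ (localRep I E x₀ Y) O y) :
    VectorField.mlieBracket I X Y ((extChartAt I x₀).symm y) = frame I x₀ y
      (fderivWithin ℝ (localRep I E x₀ Y) O y (localRep I E x₀ X y) -
        fderivWithin ℝ (localRep I E x₀ X) O y (localRep I E x₀ Y y)) := by
  have hm : IsManifold I (minSmoothness ℝ 2) M := IsManifold.of_le (n := ∞) (by
    simp only [minSmoothness_of_isRCLikeNormedField]; exact ENat.LEInfty.out)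
  have hm' : IsManifold 𝓘(ℝ, E) (minSmoothness ℝ 2) E := inferInstance
  have h := VectorField.mpullbackWithin_mlieBracketWithin (I := 𝓘(ℝ, E)) (I' := I)
    (f := (extChartAt I x₀).symm) (V := X) (W := Y) (x₀ := y) (s := range I) (t := univ)
    (n := minSmoothness ℝ 2)
    (((hO.tangent.mdifferentiableAt_section_iff hy).2 hX).mdifferentiableWithinAt)
    (((hO.tangent.mdifferentiableAt_section_iff hy).2 hY).mdifferentiableWithinAt)
    I.uniqueDiffOn.uniqueMDiffOn
    (contMDiffWithinAt_extChartAt_symm_range x₀ (hO.mem_target y hy)) (hO.subset_range hy) le_rfl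
    (by simp) (I.range_subset_closure_interior (hO.subset_range hy))
  rw [hO.mpullbackWithin_eq hy, VectorField.mlieBracketWithin_univ,
    VectorField.mlieBracketWithin_eq_lieBracketWithin] at h
  have h2 : ∀ f g f' g' : E → E, EqOn f f' O → EqOn g g' O →
      VectorField.lieBracketWithin ℝ f g (range I) y =
        VectorField.lieBracketWithin ℝ f' g' O y := by
    intro f g f' g' hf hg
    rw [VectorField.lieBracketWithin_congr_set (hO.eventuallyEq_range hy).symm]
    exact VectorField.lieBracketWithin_congr hf (hf hy) hg (hg hy)
  have h3 := hO.tangent.fibreMap_localRep hy (VectorField.mlieBracket I X Y)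
  rw [← h3, h]
  exact congrArg _ (h2 _ _ _ _ (fun z hz ↦ hO.mpullbackWithin_eq hz X)
    fun z hz ↦ hO.mpullbackWithin_eq hz Y)

end IsChartDomain

end LocalRepresentatives
end ConformalYangMills

/-! ### Existence of chart domains. -/

namespace ConformalYangMills

section ChartDomains

variable {E : Type*} [NormedAddCommGroup E] [NormedSpace ℝ E] {H : Type*} [TopologicalSpace H]
  {I : ModelWithCorners ℝ E H} {M : Type*} [TopologicalSpace M] [ChartedSpace H M]
  {F : Type*} [NormedAddCommGroup F] [NormedSpace ℝ F]
  {V : M → Type*} [TopologicalSpace (TotalSpace F V)]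
  [∀ x, AddCommGroup (V x)] [∀ x, Module ℝ (V x)] [∀ x, TopologicalSpace (V x)]
  [FiberBundle F V] [VectorBundle ℝ F V]

namespace IsChartDomain

variable {x₀ : M} {O : Set E}

lemma inter (hO : IsChartDomain I F V x₀ O) {U : Set E} (hU : IsOpen U) :
    IsChartDomain I F V x₀ (O ∩ U) :=
  ⟨fun y hy ↦ hO.mem_target y hy.1, fun y hy ↦ hO.mem_baseSet y hy.1, fun y hy ↦
    Filter.inter_mem (hO.mem_nhdsWithin y hy.1) (mem_nhdsWithin_of_mem_nhds (hU.mem_nhds hy.2))⟩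

variable (I F V) in
lemma maximal (x₀ : M) : IsChartDomain I F V x₀ ((extChartAt I x₀).target ∩
    (extChartAt I x₀).symm ⁻¹' (trivializationAt F V x₀).baseSet) where
  mem_target y hy := hy.1
  mem_baseSet y hy := hy.2
  mem_nhdsWithin y hy := by
    refine Filter.inter_mem (extChartAt_target_mem_nhdsWithin_of_mem hy.1) ?_
    have := map_extChartAt_symm_nhdsWithin_range' (I := I) (x := x₀)
      ((extChartAt I x₀).map_target hy.1)
    rw [(extChartAt I x₀).right_inv hy.1] at this
    refine Filter.mem_map.1 ?_
    rw [this]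
    exact (trivializationAt F V x₀).open_baseSet.mem_nhds hy.2

variable (I F V) in
lemma mem_maximal (x₀ : M) : extChartAt I x₀ x₀ ∈ (extChartAt I x₀).target ∩
    (extChartAt I x₀).symm ⁻¹' (trivializationAt F V x₀).baseSet :=
  ⟨mem_extChartAt_target x₀, by
    rw [mem_preimage, extChartAt_to_inv]; exact FiberBundle.mem_baseSet_trivializationAt' x₀⟩

lemma isOpen_preimage (hO : IsChartDomain I F V x₀ O) :
    IsOpen {x | x ∈ (extChartAt I x₀).source ∧ extChartAt I x₀ x ∈ O} := by
  refine isOpen_iff_mem_nhds.2 fun x hx ↦ ?_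
  have h : x = (extChartAt I x₀).symm (extChartAt I x₀ x) := ((extChartAt I x₀).left_inv hx.1).symm
  rw [h]
  refine (hO.eventually_iff hx.2).2 ?_
  filter_upwards [self_mem_nhdsWithin] with z hz
  exact ⟨(extChartAt I x₀).map_target (hO.mem_target z hz), by rwa [hO.right_inv hz]⟩

lemma exists_symm_eq (_hO : IsChartDomain I F V x₀ O) {x : M}
    (hx : x ∈ {x | x ∈ (extChartAt I x₀).source ∧ extChartAt I x₀ x ∈ O}) :
    ∃ y ∈ O, x = (extChartAt I x₀).symm y :=
  ⟨_, hx.2, ((extChartAt I x₀).left_inv hx.1).symm⟩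

lemma symm_mem_preimage (hO : IsChartDomain I F V x₀ O) {y : E} (hy : y ∈ O) :
    (extChartAt I x₀).symm y ∈ {x | x ∈ (extChartAt I x₀).source ∧ extChartAt I x₀ x ∈ O} :=
  ⟨(extChartAt I x₀).map_target (hO.mem_target y hy), by rwa [hO.right_inv hy]⟩

lemma subset_closure_interior (hO : IsChartDomain I F V x₀ O) : O ⊆ closure (interior O) := by
  intro y hy
  rw [mem_closure_iff_nhds]
  intro t ht
  have h1 := hO.eventuallyEq_range hy
  obtain ⟨u, hu, huo, hyu⟩ := eventually_nhds_iff.1 (h1.and ht)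
  have h2 := I.range_subset_closure_interior (hO.subset_range hy)
  obtain ⟨z, hz, hz'⟩ := mem_closure_iff.1 h2 u huo hyu
  refine ⟨z, (hu z hz).2, mem_interior.2 ⟨u ∩ interior (range I), fun w hw ↦ ?_,
    huo.inter isOpen_interior, hz, hz'⟩⟩
  exact ((hu w hw.1).1 : (w ∈ O) = (w ∈ range I)).mpr
    (interior_subset (s := range I) hw.2)

end IsChartDomain

/-- Half balls are needed because Hadamard's lemma and the cancellation of r are proved on them. -/
lemma exists_isChartDomain_halfBall {d : ℕ} [NeZero d] {M : Type*} [TopologicalSpace M]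
    [ChartedSpace (EuclideanHalfSpace d) M]
    {V : M → Type*} [TopologicalSpace (TotalSpace F V)]
    [∀ x, AddCommGroup (V x)] [∀ x, Module ℝ (V x)] [∀ x, TopologicalSpace (V x)]
    [FiberBundle F V] [VectorBundle ℝ F V] (x₀ : M) :
    ∃ ε > 0, IsChartDomain (𝓡∂ d) F V x₀ (halfBall (extChartAt (𝓡∂ d) x₀ x₀) ε) := by
  have h := (IsChartDomain.maximal (𝓡∂ d) F V x₀).mem_nhdsWithin _
    (IsChartDomain.mem_maximal (𝓡∂ d) F V x₀)
  obtain ⟨ε, hε, h⟩ := Metric.mem_nhdsWithin_iff.1 h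
  refine ⟨ε, hε, ?_⟩
  have h2 := (IsChartDomain.maximal (𝓡∂ d) F V x₀).inter
    (Metric.isOpen_ball (x := extChartAt (𝓡∂ d) x₀ x₀) (ε := ε))
  convert h2 using 1
  refine Subset.antisymm (fun y hy ↦ ⟨h ⟨hy.2, hy.1⟩, hy.2⟩) fun y hy ↦
    ⟨extChartAt_target_subset_range x₀ hy.1.1, hy.2⟩

end ChartDomains

/-! ### Connection forms of covariant derivatives. -/

section ConnectionForms

variable {E : Type*} [NormedAddCommGroup E] [NormedSpace ℝ E] {H : Type*} [TopologicalSpace H]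
  {I : ModelWithCorners ℝ E H} {M : Type*} [TopologicalSpace M] [ChartedSpace H M]
  {F : Type*} [NormedAddCommGroup F] [NormedSpace ℝ F]
  {V : M → Type*} [TopologicalSpace (TotalSpace F V)]
  [∀ x, AddCommGroup (V x)] [∀ x, Module ℝ (V x)] [∀ x, TopologicalSpace (V x)]
  [FiberBundle F V] [VectorBundle ℝ F V]

lemma localRep_add (x₀ : M) (s s' : Π x : M, V x) :
    localRep I F x₀ (s + s') = localRep I F x₀ s + localRep I F x₀ s' :=
  funext fun _ ↦ map_add _ _ _

lemma localRep_smul (x₀ : M) (f : M → ℝ) (s : Π x : M, V x) (y : E) :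
    localRep I F x₀ (f • s) y = f ((extChartAt I x₀).symm y) • localRep I F x₀ s y :=
  map_smul _ _ _

variable [∀ x, IsTopologicalAddGroup (V x)] [∀ x, ContinuousSMul ℝ (V x)]

variable (F) in
/-- The covariant derivative which is trivial in the preferred trivialization at `x₀`. -/
noncomputable def flatDerivative (I : ModelWithCorners ℝ E H) (x₀ : M) (s : Π x : M, V x) (x : M) :
    TangentSpace I x →L[ℝ] V x :=
  ((trivializationAt F V x₀).symmL ℝ x).comp
    (mfderiv I 𝓘(ℝ, F) (fun z ↦ (trivializationAt F V x₀).continuousLinearMapAt ℝ z (s z)) x)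

section Hom

variable {F' : Type*} [NormedAddCommGroup F'] [NormedSpace ℝ F']
  {V' : M → Type*} [TopologicalSpace (TotalSpace F' V')]
  [∀ x, AddCommGroup (V' x)] [∀ x, Module ℝ (V' x)] [∀ x, TopologicalSpace (V' x)]
  [FiberBundle F' V'] [VectorBundle ℝ F' V']
  [∀ x, IsTopologicalAddGroup (V' x)] [∀ x, ContinuousSMul ℝ (V' x)]

lemma IsChartDomain.hom {x₀ : M} {O : Set E} (hO : IsChartDomain I F V x₀ O)
    (hO' : IsChartDomain I F' V' x₀ O) :
    IsChartDomain I (F →L[ℝ] F') (fun x ↦ V x →L[ℝ] V' x) x₀ O :=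
  ⟨hO.mem_target, fun y hy ↦ ⟨hO.mem_baseSet y hy, hO'.mem_baseSet y hy⟩, hO.mem_nhdsWithin⟩

lemma IsChartDomain.localRep_hom_apply {x₀ : M} {O : Set E} (hO : IsChartDomain I F V x₀ O)
    (hO' : IsChartDomain I F' V' x₀ O) {y : E} (hy : y ∈ O) (T : Π x, V x →L[ℝ] V' x) (f : F) :
    localRep I (F →L[ℝ] F') x₀ T y f =
      (trivializationAt F' V' x₀).continuousLinearMapAt ℝ _ (T _ (fibreMap I F V x₀ y f)) := by
  rw [localRep, Trivialization.continuousLinearMapAt_apply,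
    Trivialization.coe_linearMapAt_of_mem _ ((hO.hom hO').mem_baseSet y hy)]
  rfl

end Hom

variable [IsManifold I ∞ M] [ContMDiffVectorBundle ∞ F V I]

lemma IsChartDomain.flatDerivative_frame {x₀ : M} {O : Set E} (hO : IsChartDomain I F V x₀ O)
    {y : E} (hy : y ∈ O) {s : Π x, V x} (hs : DifferentiableWithinAt ℝ (localRep I F x₀ s) O y)
    (v : E) :
    flatDerivative F I x₀ s _ (frame I x₀ y v) =
      fibreMap I F V x₀ y (fderivWithin ℝ (localRep I F x₀ s) O y v) := by
  refine congrArg (fibreMap I F V x₀ y) ?_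
  exact hO.mfderiv_frame (f := fun z ↦ (trivializationAt F V x₀).continuousLinearMapAt ℝ z (s z))
    hy ((hO.mdifferentiableAt_iff hy).2 hs) v

lemma IsChartDomain.isCovariantDerivativeOn_flatDerivative {x₀ : M} {O : Set E}
    (hO : IsChartDomain I F V x₀ O) :
    IsCovariantDerivativeOn F (flatDerivative (V := V) F I x₀)
      {x | x ∈ (extChartAt I x₀).source ∧ extChartAt I x₀ x ∈ O} where
  add {s s' x} hs hs' hx := by
    obtain ⟨y, hy, rfl⟩ := hO.exists_symm_eq hx
    rw [hO.mdifferentiableAt_section_iff hy] at hs hs'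
    ext u
    obtain ⟨v, rfl⟩ := hO.tangent.fibreMap_surjective hy u
    rw [add_apply, hO.flatDerivative_frame hy hs, hO.flatDerivative_frame hy hs',
      hO.flatDerivative_frame hy (by rw [localRep_add]; exact hs.add hs'), localRep_add,
      fderivWithin_add (hO.uniqueDiffOn y hy) hs hs', add_apply, map_add]
  leibniz {s f x} hs hf hx := by
    obtain ⟨y, hy, rfl⟩ := hO.exists_symm_eq hx
    rw [hO.mdifferentiableAt_section_iff hy] at hs
    have hf' := (hO.mdifferentiableAt_iff hy).1 hf
    have h1 : localRep I F x₀ (f • s) =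
        fun z ↦ (f ∘ (extChartAt I x₀).symm) z • localRep I F x₀ s z :=
      funext fun z ↦ localRep_smul x₀ f s z
    ext u
    obtain ⟨v, rfl⟩ := hO.tangent.fibreMap_surjective hy u
    rw [hO.flatDerivative_frame hy (by rw [h1]; exact hf'.smul hs), h1,
      fderivWithin_fun_smul (hO.uniqueDiffOn y hy) hf' hs]
    change _ = f _ • flatDerivative F I x₀ s _ (frame I x₀ y v) +
      (d% f ((extChartAt I x₀).symm y)) (frame I x₀ y v) • s ((extChartAt I x₀).symm y)
    have h2 : (d% f ((extChartAt I x₀).symm y)) (frame I x₀ y v) =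
      fderivWithin ℝ (f ∘ (extChartAt I x₀).symm) O y v := hO.mfderiv_frame hy hf v
    rw [hO.flatDerivative_frame hy hs, h2, ← hO.fibreMap_localRep hy s,
      ← map_smul (fibreMap I F V x₀ y), ← map_smul (fibreMap I F V x₀ y), ← map_add]
    rfl

variable [FiniteDimensional ℝ F]

/-- The difference between a covariant derivative and the trivial one in the preferred
trivialization at `x₀`. -/
noncomputable def flatDifference (A : CovariantDerivative I F V) (x₀ : M) (x : M) :
    V x →L[ℝ] TangentSpace I x →L[ℝ] V x :=
  have : ContMDiffVectorBundle 1 F V I := ContMDiffVectorBundle.of_le (n := ∞) (by simp)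
  IsCovariantDerivativeOn.difference A.isCovariantDerivativeOn
    (IsChartDomain.maximal I F V x₀).isCovariantDerivativeOn_flatDerivative x

/-- The connection form of a covariant derivative in the preferred chart and the preferred
trivialization at `x₀`. -/
noncomputable def connectionForm (A : CovariantDerivative I F V) (x₀ : M) (y : E) :
    E →L[ℝ] F →L[ℝ] F :=
  (localRep I (F →L[ℝ] E →L[ℝ] F) (V := fun x ↦ V x →L[ℝ] TangentSpace I x →L[ℝ] V x) x₀
    (flatDifference A x₀) y).flip

namespace IsChartDomain

variable {x₀ : M} {O : Set E}

lemma subset_maximal (hO : IsChartDomain I F V x₀ O) : O ⊆ (extChartAt I x₀).target ∩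
    (extChartAt I x₀).symm ⁻¹' (trivializationAt F V x₀).baseSet :=
  fun y hy ↦ ⟨hO.mem_target y hy, hO.mem_baseSet y hy⟩

/-- The local formula for a covariant derivative. -/
lemma localRep_covariantDerivative (hO : IsChartDomain I F V x₀ O) (A : CovariantDerivative I F V)
    {y : E} (hy : y ∈ O) {s : Π x, V x}
    (hs : DifferentiableWithinAt ℝ (localRep I F x₀ s) O y) (v : E) :
    (trivializationAt F V x₀).continuousLinearMapAt ℝ _ (A s _ (frame I x₀ y v)) =
      fderivWithin ℝ (localRep I F x₀ s) O y v + connectionForm A x₀ y v (localRep I F x₀ s y) := by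
  have hb : ContMDiffVectorBundle 1 F V I := ContMDiffVectorBundle.of_le (n := ∞) (by simp)
  have h1 : flatDifference A x₀ _ (s ((extChartAt I x₀).symm y)) =
      A s _ - flatDerivative F I x₀ s _ :=
    IsCovariantDerivativeOn.difference_apply A.isCovariantDerivativeOn
      (IsChartDomain.maximal I F V x₀).isCovariantDerivativeOn_flatDerivative
      ((IsChartDomain.maximal I F V x₀).symm_mem_preimage (hO.subset_maximal hy))
      ((hO.mdifferentiableAt_section_iff hy).2 hs)
  have h2 : A s _ (frame I x₀ y v) = flatDerivative F I x₀ s _ (frame I x₀ y v) +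
      flatDifference A x₀ _ (s ((extChartAt I x₀).symm y)) (frame I x₀ y v) := by
    rw [h1, sub_apply, add_sub_cancel]
  rw [h2, map_add, hO.flatDerivative_frame hy hs, hO.fibreMap_apply hy, connectionForm,
    ContinuousLinearMap.flip_apply, hO.localRep_hom_apply (hO.tangent.hom hO) hy,
    hO.fibreMap_localRep hy]
  congr 1
  exact (hO.tangent.localRep_hom_apply hO hy
    (T := fun x ↦ flatDifference A x₀ x (s x)) v).symm

end IsChartDomain

end ConnectionForms
end ConformalYangMills

/-! ### Smoothness of connections and of endomorphism valued forms in charts. -/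

namespace ConformalYangMills

section SmoothConnections

variable {E : Type*} [NormedAddCommGroup E] [NormedSpace ℝ E] [FiniteDimensional ℝ E]
  {H : Type*} [TopologicalSpace H]
  {I : ModelWithCorners ℝ E H} {M : Type*} [TopologicalSpace M] [ChartedSpace H M]
  [IsManifold I ∞ M]
  {F : Type*} [NormedAddCommGroup F] [NormedSpace ℝ F] [FiniteDimensional ℝ F]
  {V : M → Type*} [TopologicalSpace (TotalSpace F V)]
  [∀ x, AddCommGroup (V x)] [∀ x, Module ℝ (V x)] [∀ x, TopologicalSpace (V x)]
  [FiberBundle F V] [VectorBundle ℝ F V]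
  [∀ x, IsTopologicalAddGroup (V x)] [∀ x, ContinuousSMul ℝ (V x)]
  [ContMDiffVectorBundle ∞ F V I]

namespace IsChartDomain

variable {x₀ : M} {O : Set E}

lemma localRep_symmL (hO : IsChartDomain I F V x₀ O) (f : F) :
    ∀ y ∈ O, localRep I F (V := V) x₀ (fun x ↦ (trivializationAt F V x₀).symmL ℝ x f) y = f :=
  fun _ hy ↦ hO.fibreMap_apply hy f

/-- A section which is constant in the preferred trivialization extends, from a neighbourhood of
a point, to a smooth section. -/
lemma exists_contMDiff_section [T2Space M] (hO : IsChartDomain I F V x₀ O) {y : E} (hy : y ∈ O)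
    (f : F) : ∃ s : Π x, V x, ContMDiff I (I.prod 𝓘(ℝ, F)) ∞ (fun x ↦ TotalSpace.mk' F x (s x)) ∧
      ∀ᶠ z in 𝓝[O] y, localRep I F x₀ s z = f := by
  set s₀ : Π x, V x := fun x ↦ (trivializationAt F V x₀).symmL ℝ x f with hs₀
  set U := {x | x ∈ (extChartAt I x₀).source ∧ extChartAt I x₀ x ∈ O} with hU
  have hUo : IsOpen U := hO.isOpen_preimage
  obtain ⟨ψ, -, hψ⟩ := (SmoothBumpFunction.nhds_basis_tsupport (I := I)
    ((extChartAt I x₀).symm y)).mem_iff.1 (hUo.mem_nhds (hO.symm_mem_preimage hy))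
  refine ⟨(ψ : M → ℝ) • s₀, ContMDiffOn.smul_section_of_tsupport ψ.contMDiff.contMDiffOn hUo hψ
    fun x hx ↦ ContMDiffAt.contMDiffWithinAt ?_, ?_⟩
  · obtain ⟨z, hz, rfl⟩ := hO.exists_symm_eq hx
    rw [hO.contMDiffAt_section_iff hz]
    exact contDiffWithinAt_const.congr (hO.localRep_symmL f) (hO.localRep_symmL f z hz)
  · have h1 := (hO.eventually_iff hy).1 ψ.eventuallyEq_one
    filter_upwards [h1, self_mem_nhdsWithin] with z hz hzO
    rw [localRep_smul, hz, hO.localRep_symmL f z hzO, Pi.one_apply, one_smul]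

lemma contDiffOn_localRep (hO : IsChartDomain I F V x₀ O) {s : Π x, V x}
    (hs : ContMDiff I (I.prod 𝓘(ℝ, F)) ∞ (fun x ↦ TotalSpace.mk' F x (s x))) :
    ContDiffOn ℝ ∞ (localRep I F x₀ s) O :=
  fun _ hy ↦ (hO.contMDiffAt_section_iff hy).1 (hs _)

lemma contMDiff_iff_forall {s : Π x, V x} :
    ContMDiff I (I.prod 𝓘(ℝ, F)) ∞ (fun x ↦ TotalSpace.mk' F x (s x)) ↔
      ∀ x₀, ∃ O, IsChartDomain I F V x₀ O ∧ extChartAt I x₀ x₀ ∈ O ∧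
        ContDiffOn ℝ ∞ (localRep I F x₀ s) O := by
  refine ⟨fun h x₀ ↦ ⟨_, IsChartDomain.maximal I F V x₀, IsChartDomain.mem_maximal I F V x₀,
    (IsChartDomain.maximal I F V x₀).contDiffOn_localRep h⟩, fun h x₀ ↦ ?_⟩
  obtain ⟨O, hO, hx, h⟩ := h x₀
  have := (hO.contMDiffAt_section_iff hx).2 (h _ hx)
  rwa [extChartAt_to_inv] at this

/-- The local formula for a covariant derivative, as an identity of local representatives. -/
lemma localRep_covariantDerivative_apply (hO : IsChartDomain I F V x₀ O)
    (A : CovariantDerivative I F V) {y : E} (hy : y ∈ O) {s : Π x, V x}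
    (hs : DifferentiableWithinAt ℝ (localRep I F x₀ s) O y) (v : E) :
    localRep I (E →L[ℝ] F) (V := fun x ↦ TangentSpace I x →L[ℝ] V x) x₀ (A s) y v =
      fderivWithin ℝ (localRep I F x₀ s) O y v + connectionForm A x₀ y v (localRep I F x₀ s y) := by
  rw [← hO.localRep_covariantDerivative A hy hs]
  exact hO.tangent.localRep_hom_apply hO hy (A s) v

/-- The connection form of a smooth covariant derivative is smooth. -/
lemma contDiffOn_connectionForm [T2Space M] (hO : IsChartDomain I F V x₀ O)
    {A : CovariantDerivative I F V} (hA : A.ContMDiffCovariantDerivative ∞) :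
    ContDiffOn ℝ ∞ (connectionForm A x₀) O := by
  refine contDiffOn_clm_apply.2 fun v ↦ contDiffOn_clm_apply.2 fun f y hy ↦ ?_
  -- The connection form at the constant f is the covariant derivative of a section with constant
  -- representative f. Smoothness of `A` is tested on a global section, hence the cut-off.
  obtain ⟨s, hs, hsf⟩ := hO.exists_contMDiff_section hy f
  have h1 := contMDiffOn_univ.1 (hA.contMDiff.contMDiff (σ := s) (contMDiffOn_univ.2 (by simpa)))
  have h2 := (hO.tangent.hom hO).contDiffOn_localRep
    (V := fun x ↦ TangentSpace I x →L[ℝ] V x) h1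
  have h3 := (h2.clm_apply (contDiffOn_const (c := v))) y hy
  refine h3.congr_of_eventuallyEq_of_mem ?_ hy
  filter_upwards [eventually_eventually_nhdsWithin.2 hsf, self_mem_nhdsWithin] with z hz hzO
  have h4 : localRep I F x₀ s =ᶠ[𝓝[O] z] fun _ ↦ f := hz
  rw [hO.localRep_covariantDerivative_apply A hzO
    ((hO.contDiffOn_localRep hs z hzO).differentiableWithinAt (by simp)),
    h4.fderivWithin_eq_of_mem hzO, h4.eq_of_nhdsWithin hzO]
  simp

end IsChartDomain

/-- A covariant derivative with smooth connection forms is smooth. -/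
lemma contMDiffCovariantDerivative_of_connectionForm {A : CovariantDerivative I F V}
    (h : ∀ x₀, ∃ O, IsChartDomain I F V x₀ O ∧ extChartAt I x₀ x₀ ∈ O ∧
      ContDiffOn ℝ ∞ (connectionForm A x₀) O) :
    A.ContMDiffCovariantDerivative ∞ := by
  refine ⟨⟨fun {s} hs ↦ contMDiffOn_univ.2 ?_⟩⟩
  have hs' : ContMDiff I (I.prod 𝓘(ℝ, F)) ∞ (fun x ↦ TotalSpace.mk' F x (s x)) := by
    simpa using contMDiffOn_univ.1 hs
  refine (IsChartDomain.contMDiff_iff_forall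
    (V := fun x ↦ TangentSpace I x →L[ℝ] V x)).2 fun x₀ ↦ ?_
  obtain ⟨O, hO, hx, hA⟩ := h x₀
  refine ⟨O, hO.tangent.hom hO, hx, contDiffOn_clm_apply.2 fun v ↦ ?_⟩
  have h1 := hO.contDiffOn_localRep hs'
  refine ((((h1.fderivWithin hO.uniqueDiffOn (m := ∞) (by simp)).clm_apply
    (contDiffOn_const (c := v))).add ((hA.clm_apply (contDiffOn_const (c := v))).clm_apply h1))).congr
    fun y hy ↦ hO.localRep_covariantDerivative_apply A hy
      ((h1 y hy).differentiableWithinAt (by simp)) v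

set_option synthInstance.maxHeartbeats 200000 in
variable (I F) in
/-- The local representative of a one-form with values in the endomorphisms of `V`. -/
noncomputable def formRep (x₀ : M) (k : Π x : M, TangentSpace I x →L[ℝ] V x →L[ℝ] V x) (y : E) :
    E →L[ℝ] F →L[ℝ] F :=
  localRep I (E →L[ℝ] F →L[ℝ] F) (V := fun x ↦ TangentSpace I x →L[ℝ] V x →L[ℝ] V x) x₀ k y

variable {x₀ : M} {O : Set E}

set_option synthInstance.maxHeartbeats 200000 in
lemma IsChartDomain.formRep_apply (hO : IsChartDomain I F V x₀ O) {y : E} (hy : y ∈ O)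
    (k : Π x : M, TangentSpace I x →L[ℝ] V x →L[ℝ] V x) (v : E) (f : F) :
    formRep I F x₀ k y v f = (trivializationAt F V x₀).continuousLinearMapAt ℝ _
      (k _ (frame I x₀ y v) (fibreMap I F V x₀ y f)) := by
  rw [formRep, hO.tangent.localRep_hom_apply (hO.hom hO) hy]
  exact hO.localRep_hom_apply hO hy (T := fun x ↦ k x ((trivializationAt E
    (TangentSpace I) x₀).symmL ℝ x v)) f

lemma IsChartDomain.fibreMap_formRep (hO : IsChartDomain I F V x₀ O) {y : E} (hy : y ∈ O)
    (k : Π x : M, TangentSpace I x →L[ℝ] V x →L[ℝ] V x) (v : E) (f : F) :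
    fibreMap I F V x₀ y (formRep I F x₀ k y v f) =
      k _ (frame I x₀ y v) (fibreMap I F V x₀ y f) := by
  rw [hO.formRep_apply hy]
  exact (trivializationAt F V x₀).symmL_continuousLinearMapAt (hO.mem_baseSet y hy) _

set_option synthInstance.maxHeartbeats 200000 in
lemma IsChartDomain.contDiffOn_formRep (hO : IsChartDomain I F V x₀ O)
    {k : Π x : M, TangentSpace I x →L[ℝ] V x →L[ℝ] V x}
    (hk : ContMDiff I (I.prod 𝓘(ℝ, E →L[ℝ] F →L[ℝ] F)) ∞
      (fun x ↦ TotalSpace.mk' (E →L[ℝ] F →L[ℝ] F) x (k x))) :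
    ContDiffOn ℝ ∞ (formRep I F x₀ k) O :=
  (hO.tangent.hom (hO.hom hO)).contDiffOn_localRep
    (V := fun x ↦ TangentSpace I x →L[ℝ] V x →L[ℝ] V x) hk

set_option synthInstance.maxHeartbeats 200000 in
lemma contMDiff_of_contDiffOn_formRep
    {k : Π x : M, TangentSpace I x →L[ℝ] V x →L[ℝ] V x}
    (h : ∀ x₀, ∃ O, IsChartDomain I F V x₀ O ∧ extChartAt I x₀ x₀ ∈ O ∧
        ContDiffOn ℝ ∞ (formRep I F x₀ k) O) :
    ContMDiff I (I.prod 𝓘(ℝ, E →L[ℝ] F →L[ℝ] F)) ∞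
      (fun x ↦ TotalSpace.mk' (E →L[ℝ] F →L[ℝ] F) x (k x)) := by
  refine (IsChartDomain.contMDiff_iff_forall
    (V := fun x ↦ TangentSpace I x →L[ℝ] V x →L[ℝ] V x)).2 fun x₀ ↦ ?_
  obtain ⟨O, hO, hx, h⟩ := h x₀
  exact ⟨O, hO.tangent.hom (hO.hom hO), hx, h⟩

/-- Two covariant derivatives which differ by an endomorphism valued one-form. -/
lemma IsChartDomain.connectionForm_eq_add (hO : IsChartDomain I F V x₀ O)
    {A A' : CovariantDerivative I F V} {k : Π x : M, TangentSpace I x →L[ℝ] V x →L[ℝ] V x}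
    (h : ∀ (s : Π x, V x) x,
      MDifferentiableAt I (I.prod 𝓘(ℝ, F)) (fun x ↦ TotalSpace.mk' F x (s x)) x →
      ∀ u, A' s x u = A s x u + k x u (s x)) {y : E} (hy : y ∈ O) :
    connectionForm A' x₀ y = connectionForm A x₀ y + formRep I F x₀ k y := by
  ext v f
  set s : Π x, V x := fun x ↦ (trivializationAt F V x₀).symmL ℝ x f
  have hs : DifferentiableWithinAt ℝ (localRep I F x₀ s) O y :=
    (differentiableWithinAt_const f).congr (hO.localRep_symmL f) (hO.localRep_symmL f y hy)
  have h1 := h s _ ((hO.mdifferentiableAt_section_iff hy).2 hs) (frame I x₀ y v)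
  have h2 := hO.localRep_covariantDerivative A hy hs v
  have h3 := hO.localRep_covariantDerivative A' hy hs v
  rw [h1, map_add, h2, hO.localRep_symmL f y hy, add_assoc, add_right_inj] at h3
  rw [add_apply, add_apply, hO.formRep_apply hy]
  exact h3.symm

end SmoothConnections
end ConformalYangMills

/-! ### Gram matrices and contractions independent of the basis. -/

namespace ConformalYangMills

section LinearAlgebra

variable {n : Type*} [Fintype n] [DecidableEq n] {W : Type*} [AddCommGroup W] [Module ℝ W]

/-- The inverse of the Gram matrix of a bilinear form. -/
noncomputable def inverseGram (B : W →ₗ[ℝ] W →ₗ[ℝ] ℝ) (b : n → W) : Matrix n n ℝ :=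
  (Matrix.of fun i j ↦ B (b i) (b j))⁻¹

/-- A vector in the kernel of the Gram matrix would be the coordinate vector of a null vector for
the form. -/
lemma isUnit_det_gram {B : W →ₗ[ℝ] W →ₗ[ℝ] ℝ} (hB : ∀ w ≠ 0, 0 < B w w)
    (b : Module.Basis n ℝ W) : IsUnit (Matrix.of fun i j ↦ B (b i) (b j)).det := by
  rw [isUnit_iff_ne_zero]
  intro h
  obtain ⟨a, ha, h⟩ := Matrix.exists_mulVec_eq_zero_iff.2 h
  have h1 : B (∑ i, a i • b i) (∑ i, a i • b i) = a ⬝ᵥ ((Matrix.of fun i j ↦ B (b i) (b j)).mulVec a) := by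
    simp only [map_sum, map_smul, LinearMap.sum_apply, LinearMap.smul_apply, dotProduct,
      Matrix.mulVec, Matrix.of_apply, smul_eq_mul, Finset.mul_sum]
    rw [Finset.sum_comm]
    exact Finset.sum_congr rfl fun i _ ↦ Finset.sum_congr rfl fun j _ ↦ by ring
  rw [h, dotProduct_zero] at h1
  refine (hB _ fun h0 ↦ ha ?_).ne' h1
  funext i
  simpa using (Fintype.linearIndependent_iff.1 b.linearIndependent a h0 i)

variable {B : W →ₗ[ℝ] W →ₗ[ℝ] ℝ}

lemma sum_inverseGram_smul_basis (hB : ∀ w ≠ 0, 0 < B w w) (b : Module.Basis n ℝ W) (w : W) :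
    ∑ i, ∑ j, (inverseGram B b i j * B (b j) w) • b i = w := by
  have h1 := Matrix.nonsing_inv_mul _ (isUnit_det_gram hB b)
  conv_rhs => rw [← b.sum_repr w]
  refine Finset.sum_congr rfl fun i _ ↦ ?_
  rw [← Finset.sum_smul]
  congr 1
  have h2 : ∀ j, B (b j) w = ∑ k, b.repr w k * B (b j) (b k) := fun j ↦ by
    have h := congrArg (B (b j)) (b.sum_repr w)
    rw [← h]
    simp only [map_sum, map_smul, smul_eq_mul]
  simp only [h2, Finset.mul_sum]
  rw [Finset.sum_comm]
  have h3 : ∀ k, ∑ j, inverseGram B b i j * B (b j) (b k) = (1 : Matrix n n ℝ) i k :=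
    fun k ↦ by rw [← h1, Matrix.mul_apply]; rfl
  calc _ = ∑ k, b.repr w k * ∑ j, inverseGram B b i j * B (b j) (b k) := by
        refine Finset.sum_congr rfl fun k _ ↦ ?_
        rw [Finset.mul_sum]
        exact Finset.sum_congr rfl fun j _ ↦ by ring
    _ = _ := by simp [h3, Matrix.one_apply]

lemma inverseGram_symm (hs : ∀ v w, B v w = B w v) (b : n → W) (i j : n) :
    inverseGram B b i j = inverseGram B b j i := by
  have : (inverseGram B b).transpose = inverseGram B b := by
    rw [inverseGram, Matrix.transpose_nonsing_inv]
    congr 1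
    ext i j
    exact hs _ _
  exact congrFun (congrFun this j) i

lemma sum_inverseGram_mul (hB : ∀ w ≠ 0, 0 < B w w) (hs : ∀ v w, B v w = B w v)
    (b : Module.Basis n ℝ W) (α : W →ₗ[ℝ] ℝ) (w : W) :
    ∑ i, ∑ j, inverseGram B b i j * α (b j) * B (b i) w = α w := by
  conv_rhs => rw [← sum_inverseGram_smul_basis hB b w]
  simp only [map_sum, map_smul, smul_eq_mul]
  rw [Finset.sum_comm]
  refine Finset.sum_congr rfl fun i _ ↦ Finset.sum_congr rfl fun j _ ↦ ?_
  rw [inverseGram_symm hs b j i]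
  ring

/-- The contraction of a bilinear map with the inverse of a scalar product does not depend on the
basis. -/
lemma sum_inverseGram_smul_eq {G : Type*} [AddCommGroup G] [Module ℝ G]
    (hB : ∀ w ≠ 0, 0 < B w w) (hs : ∀ v w, B v w = B w v)
    (b c : Module.Basis n ℝ W) (T : W →ₗ[ℝ] W →ₗ[ℝ] G) :
    ∑ i, ∑ j, inverseGram B b i j • T (b i) (b j) =
      ∑ i, ∑ j, inverseGram B c i j • T (c i) (c j) := by
  calc ∑ i, ∑ j, inverseGram B b i j • T (b i) (b j)
      = ∑ i, ∑ j, ∑ k, ∑ l, (inverseGram B b i j * (inverseGram B c k l * B (c l) (b i))) •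
          T (c k) (b j) := by
        refine Finset.sum_congr rfl fun i _ ↦ Finset.sum_congr rfl fun j _ ↦ ?_
        conv_lhs => rw [← sum_inverseGram_smul_basis hB c (b i)]
        simp only [map_sum, map_smul, LinearMap.sum_apply, LinearMap.smul_apply, Finset.smul_sum,
          smul_smul]
    _ = ∑ k, ∑ l, ∑ j, ∑ i, (inverseGram B b i j * (inverseGram B c k l * B (c l) (b i))) •
          T (c k) (b j) := by
        rw [Finset.sum_comm]
        exact (Finset.sum_congr rfl fun j _ ↦ Finset.sum_comm).trans (Finset.sum_comm.trans
          (Finset.sum_congr rfl fun k _ ↦ (Finset.sum_congr rfl fun j _ ↦ Finset.sum_comm).trans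
            Finset.sum_comm))
    _ = _ := by
        refine Finset.sum_congr rfl fun k _ ↦ Finset.sum_congr rfl fun l _ ↦ ?_
        conv_rhs => rw [← sum_inverseGram_smul_basis hB b (c l)]
        simp only [map_sum, map_smul, Finset.smul_sum, smul_smul]
        refine Finset.sum_congr rfl fun j _ ↦ Finset.sum_congr rfl fun i _ ↦ ?_
        rw [inverseGram_symm hs b i j, hs (c l) (b i)]
        congr 1
        ring

end LinearAlgebra
end ConformalYangMills

/-! ### The metric, its inverse and the gradient in a chart. -/

namespace ConformalYangMills

section MetricRep

variable {d : ℕ} [NeZero d] {M : Type*} [TopologicalSpace M]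
  [ChartedSpace (EuclideanHalfSpace d) M] [IsManifold (𝓡∂ d) ∞ M]

/-- The scalar product on a tangent space, as a bilinear map. -/
noncomputable def innerMap (g : Metric d M) (x : M) :
    TangentSpace (𝓡∂ d) x →ₗ[ℝ] TangentSpace (𝓡∂ d) x →ₗ[ℝ] ℝ :=
  (ContinuousLinearMap.coeLM ℝ).comp (g.inner x).toLinearMap

lemma innerMap_apply (g : Metric d M) (x : M) (v w : TangentSpace (𝓡∂ d) x) :
    innerMap g x v w = g.inner x v w := rfl

lemma innerMap_pos (g : Metric d M) (x : M) : ∀ w ≠ 0, 0 < innerMap g x w w :=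
  fun w hw ↦ g.pos x w hw

lemma innerMap_symm (g : Metric d M) (x : M) : ∀ v w, innerMap g x v w = innerMap g x w v :=
  fun v w ↦ g.symm x v w

/-- The coordinate basis at `x`. -/
noncomputable def tangentBasisBasis (x : M) : Module.Basis (Fin d) ℝ (TangentSpace (𝓡∂ d) x) :=
  (EuclideanSpace.basisFun (Fin d) ℝ).toBasis

lemma coe_tangentBasisBasis (x : M) :
    ⇑(tangentBasisBasis (d := d) x) = tangentBasis (d := d) x := by
  funext i
  change (EuclideanSpace.basisFun (Fin d) ℝ).toBasis i = _
  rw [OrthonormalBasis.coe_toBasis, EuclideanSpace.basisFun_apply]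
  rfl

lemma inverseMetric_eq (g : Metric d M) (x : M) :
    inverseMetric g x = inverseGram (innerMap g x) (tangentBasisBasis x) := by
  rw [coe_tangentBasisBasis]
  rfl

set_option synthInstance.maxHeartbeats 200000 in
/-- The local representative of a metric in the preferred chart at `x₀`. -/
noncomputable def metricRep (g : Metric d M) (x₀ : M) (y : EuclideanSpace ℝ (Fin d)) :
    EuclideanSpace ℝ (Fin d) →L[ℝ] EuclideanSpace ℝ (Fin d) →L[ℝ] ℝ :=
  localRep (𝓡∂ d) (EuclideanSpace ℝ (Fin d) →L[ℝ] EuclideanSpace ℝ (Fin d) →L[ℝ] ℝ)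
    (V := fun x : M ↦ TangentSpace (𝓡∂ d) x →L[ℝ] TangentSpace (𝓡∂ d) x →L[ℝ] ℝ) x₀ g.inner y

variable {x₀ : M} {O : Set (EuclideanSpace ℝ (Fin d))}

lemma isChartDomain_trivial (hO : IsChartDomain (𝓡∂ d) (EuclideanSpace ℝ (Fin d))
    (fun x : M ↦ TangentSpace (𝓡∂ d) x) x₀ O) : IsChartDomain (𝓡∂ d) ℝ (fun _ : M ↦ ℝ) x₀ O :=
  ⟨hO.mem_target, fun _ _ ↦ trivial, hO.mem_nhdsWithin⟩

set_option synthInstance.maxHeartbeats 200000 in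
lemma metricRep_apply (hO : IsChartDomain (𝓡∂ d) (EuclideanSpace ℝ (Fin d))
    (fun x : M ↦ TangentSpace (𝓡∂ d) x) x₀ O) (g : Metric d M) {y : EuclideanSpace ℝ (Fin d)}
    (hy : y ∈ O) (v w : EuclideanSpace ℝ (Fin d)) :
    metricRep g x₀ y v w = g.inner _ (frame (𝓡∂ d) x₀ y v) (frame (𝓡∂ d) x₀ y w) := by
  rw [metricRep, hO.localRep_hom_apply (hO.hom (isChartDomain_trivial hO)) hy]
  refine (hO.localRep_hom_apply (isChartDomain_trivial hO) hy (T := fun x ↦ g.inner x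
    ((trivializationAt _ (TangentSpace (𝓡∂ d)) x₀).symmL ℝ x v)) w).trans ?_
  rw [Trivialization.continuousLinearMapAt_apply,
    Trivialization.coe_linearMapAt_of_mem _ ((isChartDomain_trivial hO).mem_baseSet y hy)]
  rfl

set_option synthInstance.maxHeartbeats 200000 in
lemma contDiffOn_metricRep (hO : IsChartDomain (𝓡∂ d) (EuclideanSpace ℝ (Fin d))
    (fun x : M ↦ TangentSpace (𝓡∂ d) x) x₀ O) (g : Metric d M) :
    ContDiffOn ℝ ∞ (metricRep g x₀) O :=
  (hO.hom (hO.hom (isChartDomain_trivial hO))).contDiffOn_localRep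
    (V := fun x : M ↦ TangentSpace (𝓡∂ d) x →L[ℝ] TangentSpace (𝓡∂ d) x →L[ℝ] ℝ) g.contMDiff

/-- The basis of the tangent space given by the coordinate frame. -/
noncomputable def frameBasis (hO : IsChartDomain (𝓡∂ d) (EuclideanSpace ℝ (Fin d))
    (fun x : M ↦ TangentSpace (𝓡∂ d) x) x₀ O) {y : EuclideanSpace ℝ (Fin d)} (hy : y ∈ O) :
    Module.Basis (Fin d) ℝ (TangentSpace (𝓡∂ d) ((extChartAt (𝓡∂ d) x₀).symm y)) :=
  (EuclideanSpace.basisFun (Fin d) ℝ).toBasis.map (LinearEquiv.ofBijective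
    (frame (𝓡∂ d) x₀ y).toLinearMap ⟨hO.fibreMap_injective hy, hO.fibreMap_surjective hy⟩)

lemma frameBasis_apply (hO : IsChartDomain (𝓡∂ d) (EuclideanSpace ℝ (Fin d))
    (fun x : M ↦ TangentSpace (𝓡∂ d) x) x₀ O) {y : EuclideanSpace ℝ (Fin d)} (hy : y ∈ O)
    (i : Fin d) : frameBasis hO hy i = frame (𝓡∂ d) x₀ y (EuclideanSpace.single i 1) := by
  rw [frameBasis, Module.Basis.map_apply, OrthonormalBasis.coe_toBasis,
    EuclideanSpace.basisFun_apply]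
  rfl

/-- The inverse of the Gram matrix of the coordinate frame. -/
noncomputable def inverseMetricRep (g : Metric d M) (x₀ : M) (y : EuclideanSpace ℝ (Fin d)) :
    Matrix (Fin d) (Fin d) ℝ :=
  (Matrix.of fun i j ↦ metricRep g x₀ y (EuclideanSpace.single i 1) (EuclideanSpace.single j 1))⁻¹

lemma inverseMetricRep_eq (hO : IsChartDomain (𝓡∂ d) (EuclideanSpace ℝ (Fin d))
    (fun x : M ↦ TangentSpace (𝓡∂ d) x) x₀ O) (g : Metric d M) {y : EuclideanSpace ℝ (Fin d)}
    (hy : y ∈ O) : inverseMetricRep g x₀ y = inverseGram (innerMap g _) (frameBasis hO hy) := by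
  rw [inverseMetricRep, inverseGram]
  congr 2
  ext i j
  simp only [frameBasis_apply, metricRep_apply hO g hy]
  rfl

lemma isUnit_det_metricRep (hO : IsChartDomain (𝓡∂ d) (EuclideanSpace ℝ (Fin d))
    (fun x : M ↦ TangentSpace (𝓡∂ d) x) x₀ O) (g : Metric d M) {y : EuclideanSpace ℝ (Fin d)}
    (hy : y ∈ O) : IsUnit (Matrix.of fun i j ↦
      metricRep g x₀ y (EuclideanSpace.single i 1) (EuclideanSpace.single j 1)).det := by
  have h := isUnit_det_gram (innerMap_pos g _) (frameBasis hO hy)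
  simp only [frameBasis_apply, innerMap_apply, ← metricRep_apply hO g hy] at h
  exact h

/-- The contraction with the inverse metric in the coordinate frame. -/
lemma sum_inverseMetric_smul (hO : IsChartDomain (𝓡∂ d) (EuclideanSpace ℝ (Fin d))
    (fun x : M ↦ TangentSpace (𝓡∂ d) x) x₀ O) (g : Metric d M) {y : EuclideanSpace ℝ (Fin d)}
    (hy : y ∈ O) {G : Type*} [AddCommGroup G] [Module ℝ G]
    (T : TangentSpace (𝓡∂ d) ((extChartAt (𝓡∂ d) x₀).symm y) →ₗ[ℝ]
      TangentSpace (𝓡∂ d) ((extChartAt (𝓡∂ d) x₀).symm y) →ₗ[ℝ] G) :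
    ∑ i, ∑ j, inverseMetric g ((extChartAt (𝓡∂ d) x₀).symm y) i j • T (tangentBasis _ i) (tangentBasis _ j) =
      ∑ i, ∑ j, inverseMetricRep g x₀ y i j •
        T (frame (𝓡∂ d) x₀ y (EuclideanSpace.single i 1))
          (frame (𝓡∂ d) x₀ y (EuclideanSpace.single j 1)) := by
  rw [inverseMetric_eq, inverseMetricRep_eq hO g hy,
    ← coe_tangentBasisBasis,
    sum_inverseGram_smul_eq (innerMap_pos g _) (innerMap_symm g _) _ (frameBasis hO hy) T]
  simp only [frameBasis_apply]

lemma sum_inverseMetric_inner_smul (g : Metric d M) (x : M) (w : TangentSpace (𝓡∂ d) x) :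
    ∑ i, ∑ j, (inverseMetric g x i j * g.inner x w (tangentBasis x j)) • tangentBasis x i = w := by
  have := sum_inverseGram_smul_basis (innerMap_pos g x) (tangentBasisBasis x) w
  rw [inverseMetric_eq, ← coe_tangentBasisBasis]
  conv_rhs => rw [← this]
  refine Finset.sum_congr rfl fun i _ ↦ Finset.sum_congr rfl fun j _ ↦ ?_
  rw [← innerMap_apply, innerMap_symm]

/-- The gradient represents the differential. -/
lemma inner_gradient (g : Metric d M) (f : M → ℝ) (x : M) (w : TangentSpace (𝓡∂ d) x) :
    g.inner x (gradient g f x) w = dirDeriv f x w := by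
  have h := sum_inverseGram_mul (innerMap_pos g x) (innerMap_symm g x) (tangentBasisBasis x)
    ((mfderiv (𝓡∂ d) 𝓘(ℝ, ℝ) f x).toLinearMap : TangentSpace (𝓡∂ d) x →ₗ[ℝ] ℝ) w
  rw [← inverseMetric_eq, coe_tangentBasisBasis] at h
  refine Eq.trans ?_ h
  rw [← innerMap_apply, gradient]
  simp only [map_sum, map_smul, LinearMap.sum_apply, LinearMap.smul_apply, smul_eq_mul]
  rfl

end MetricRep
end ConformalYangMills

/-! ### The curvature of a connection form as a commutator. -/

namespace ConformalYangMills

section CurvatureRep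

set_option synthInstance.maxHeartbeats 200000
set_option maxSynthPendingDepth 5

variable {E : Type*} [NormedAddCommGroup E] [NormedSpace ℝ E]
  {F : Type*} [NormedAddCommGroup F] [NormedSpace ℝ F] {O : Set E}

/-- The curvature of the connection form `Ω` on the set `O`. -/
noncomputable def curvatureRep (O : Set E) (Ω : E → E →L[ℝ] F →L[ℝ] F) (y : E) :
    E →L[ℝ] E →L[ℝ] F →L[ℝ] F :=
  fderivWithin ℝ Ω O y - (fderivWithin ℝ Ω O y).flip
    + (((ContinuousLinearMap.mul ℝ (F →L[ℝ] F)).comp (Ω y)).flip.comp (Ω y)).flip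
    - ((ContinuousLinearMap.mul ℝ (F →L[ℝ] F)).comp (Ω y)).flip.comp (Ω y)

lemma curvatureRep_apply (Ω : E → E →L[ℝ] F →L[ℝ] F) (y v w : E) :
    curvatureRep O Ω y v w = fderivWithin ℝ Ω O y v w - fderivWithin ℝ Ω O y w v
      + Ω y v * Ω y w - Ω y w * Ω y v := rfl

lemma mul_apply_apply (A B : F →L[ℝ] F) (f : F) : (A * B) f = A (B f) := rfl

lemma contDiffOn_curvatureRep [FiniteDimensional ℝ E] (hO : UniqueDiffOn ℝ O)
    {Ω : E → E →L[ℝ] F →L[ℝ] F} (hΩ : ContDiffOn ℝ ∞ Ω O) :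
    ContDiffOn ℝ ∞ (curvatureRep O Ω) O := by
  have h1 : ContDiffOn ℝ ∞ (fderivWithin ℝ Ω O) O := hΩ.fderivWithin hO (m := ∞) (by simp)
  have h2 (v : E) : ContDiffOn ℝ ∞ (fun y ↦ Ω y v) O := hΩ.clm_apply contDiffOn_const
  have h3 (v w : E) : ContDiffOn ℝ ∞ (fun y ↦ fderivWithin ℝ Ω O y v w) O :=
    (h1.clm_apply contDiffOn_const).clm_apply contDiffOn_const
  refine contDiffOn_clm_apply.2 fun v ↦ contDiffOn_clm_apply.2 fun w ↦ ?_
  exact (((h3 v w).sub (h3 w v)).add ((h2 v).clm_comp (h2 w))).sub ((h2 w).clm_comp (h2 v))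

lemma differentiableWithinAt_of_contDiffWithinAt {G : Type*} [NormedAddCommGroup G]
    [NormedSpace ℝ G] {f : E → G} {y : E} (hf : ContDiffWithinAt ℝ ∞ f O y) :
    DifferentiableWithinAt ℝ f O y := hf.differentiableWithinAt (by simp)

lemma eventually_differentiableWithinAt {G : Type*} [NormedAddCommGroup G]
    [NormedSpace ℝ G] {f : E → G} {y : E} (hy : y ∈ O) (hf : ContDiffWithinAt ℝ ∞ f O y) :
    ∀ᶠ z in 𝓝[O] y, DifferentiableWithinAt ℝ f O z := by
  have h := (hf.of_le (m := 1) (by simp)).eventually (by simp)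
  rw [insert_eq_of_mem hy] at h
  exact h.mono fun z hz ↦ hz.differentiableWithinAt (by simp)

variable {Ω : E → E →L[ℝ] F →L[ℝ] F} {s : E → F} {X Y : E → E} {y : E}

lemma differentiableWithinAt_fderivWithin {G : Type*} [NormedAddCommGroup G]
    [NormedSpace ℝ G] {f : E → G} (hO : UniqueDiffOn ℝ O) (hy : y ∈ O)
    (hf : ContDiffWithinAt ℝ ∞ f O y) : DifferentiableWithinAt ℝ (fderivWithin ℝ f O) O y :=
  (hf.fderivWithin_right hO (m := ∞) (by simp) hy).differentiableWithinAt (by simp)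

lemma differentiableWithinAt_covariant (hO : UniqueDiffOn ℝ O) (hy : y ∈ O)
    (hΩ : ContDiffWithinAt ℝ ∞ Ω O y) (hs : ContDiffWithinAt ℝ ∞ s O y)
    (hX : ContDiffWithinAt ℝ ∞ X O y) :
    DifferentiableWithinAt ℝ (fun z ↦ fderivWithin ℝ s O z (X z) + Ω z (X z) (s z)) O y :=
  (((differentiableWithinAt_fderivWithin hO hy hs).clm_apply
    (differentiableWithinAt_of_contDiffWithinAt hX)).add
    (((differentiableWithinAt_of_contDiffWithinAt hΩ).clm_apply
    (differentiableWithinAt_of_contDiffWithinAt hX)).clm_apply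
      (differentiableWithinAt_of_contDiffWithinAt hs)))

lemma fderivWithin_covariant (hO : UniqueDiffOn ℝ O) (hy : y ∈ O)
    (hΩ : ContDiffWithinAt ℝ ∞ Ω O y) (hs : ContDiffWithinAt ℝ ∞ s O y)
    (hX : ContDiffWithinAt ℝ ∞ X O y) (u : E) :
    fderivWithin ℝ (fun z ↦ fderivWithin ℝ s O z (X z) + Ω z (X z) (s z)) O y u =
      fderivWithin ℝ (fderivWithin ℝ s O) O y u (X y) +
        fderivWithin ℝ s O y (fderivWithin ℝ X O y u) +
        (fderivWithin ℝ Ω O y u (X y) (s y) + Ω y (fderivWithin ℝ X O y u) (s y) +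
          Ω y (X y) (fderivWithin ℝ s O y u)) := by
  have h1 := differentiableWithinAt_fderivWithin hO hy hs
  have h2 := differentiableWithinAt_of_contDiffWithinAt hX
  have h3 := differentiableWithinAt_of_contDiffWithinAt hΩ
  have h4 := differentiableWithinAt_of_contDiffWithinAt hs
  have hu := hO y hy
  rw [fderivWithin_fun_add hu (h1.clm_apply h2) ((h3.clm_apply h2).clm_apply h4),
    fderivWithin_clm_apply hu h1 h2, fderivWithin_clm_apply hu (h3.clm_apply h2) h4,
    fderivWithin_clm_apply hu h3 h2]
  simp only [add_apply, ContinuousLinearMap.comp_apply, ContinuousLinearMap.flip_apply]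
  abel

/-- The commutator of covariant derivatives in a local frame. -/
lemma covariant_commutator (hO : UniqueDiffOn ℝ O) (hO' : O ⊆ closure (interior O)) (hy : y ∈ O)
    (hΩ : ContDiffWithinAt ℝ ∞ Ω O y) (hs : ContDiffWithinAt ℝ ∞ s O y)
    (hX : ContDiffWithinAt ℝ ∞ X O y) (hY : ContDiffWithinAt ℝ ∞ Y O y) :
    (fderivWithin ℝ (fun z ↦ fderivWithin ℝ s O z (Y z) + Ω z (Y z) (s z)) O y (X y) +
        Ω y (X y) (fderivWithin ℝ s O y (Y y) + Ω y (Y y) (s y)))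
      - (fderivWithin ℝ (fun z ↦ fderivWithin ℝ s O z (X z) + Ω z (X z) (s z)) O y (Y y) +
        Ω y (Y y) (fderivWithin ℝ s O y (X y) + Ω y (X y) (s y)))
      - (fderivWithin ℝ s O y (fderivWithin ℝ Y O y (X y) - fderivWithin ℝ X O y (Y y)) +
        Ω y (fderivWithin ℝ Y O y (X y) - fderivWithin ℝ X O y (Y y)) (s y)) =
      curvatureRep O Ω y (X y) (Y y) (s y) := by
  -- Second derivatives of s cancel by symmetry, and derivatives of X and Y cancel against the
  -- bracket term; no derivative of s, X or Y remains.
  have hsym : IsSymmSndFDerivWithinAt ℝ s O y := hs.isSymmSndFDerivWithinAt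
    (by simp only [minSmoothness_of_isRCLikeNormedField]; exact ENat.LEInfty.out) hO (hO' hy) hy
  rw [fderivWithin_covariant hO hy hΩ hs hX, fderivWithin_covariant hO hy hΩ hs hY,
    curvatureRep_apply, hsym.eq (X y) (Y y)]
  simp only [map_add, map_sub, add_apply, sub_apply, mul_apply_apply]
  abel

end CurvatureRep

end ConformalYangMills

/-! ### The invariant curvature agrees with the curvature of the connection form. -/

namespace ConformalYangMills

section CurvatureLocal

variable {E : Type*} [NormedAddCommGroup E] [NormedSpace ℝ E] [FiniteDimensional ℝ E]
  {H : Type*} [TopologicalSpace H]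
  {I : ModelWithCorners ℝ E H} {M : Type*} [TopologicalSpace M] [ChartedSpace H M]
  [IsManifold I ∞ M]
  {F : Type*} [NormedAddCommGroup F] [NormedSpace ℝ F] [FiniteDimensional ℝ F]
  {V : M → Type*} [TopologicalSpace (TotalSpace F V)]
  [∀ x, AddCommGroup (V x)] [∀ x, Module ℝ (V x)] [∀ x, TopologicalSpace (V x)]
  [FiberBundle F V] [VectorBundle ℝ F V]
  [∀ x, IsTopologicalAddGroup (V x)] [∀ x, ContinuousSMul ℝ (V x)]
  [ContMDiffVectorBundle ∞ F V I]

namespace IsChartDomain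

variable {x₀ : M} {O : Set E} {y : E}

lemma contDiffWithinAt_localRep_extend (hO : IsChartDomain I F V x₀ O) (hy : y ∈ O)
    (s : V ((extChartAt I x₀).symm y)) :
    ContDiffWithinAt ℝ ∞ (localRep I F x₀ (FiberBundle.extend F s)) O y :=
  (hO.contMDiffAt_section_iff hy).1 (FiberBundle.contMDiffAt_extend I F s)

lemma localRep_extend_self (hO : IsChartDomain I F V x₀ O) (hy : y ∈ O) (f : F) :
    localRep I F x₀ (FiberBundle.extend F (fibreMap I F V x₀ y f)) y = f := by
  rw [localRep, FiberBundle.extend_apply_self, hO.fibreMap_apply hy]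

/-- The local representative of the covariant derivative of a section along a vector field. -/
lemma localRep_covariantDerivative_field (hO : IsChartDomain I F V x₀ O)
    (A : CovariantDerivative I F V) (hy : y ∈ O) {s : Π x, V x} (X : Π x : M, TangentSpace I x)
    (hs : DifferentiableWithinAt ℝ (localRep I F x₀ s) O y) :
    localRep I F x₀ (fun x ↦ A s x (X x)) y =
      fderivWithin ℝ (localRep I F x₀ s) O y (localRep I E x₀ X y) +
        connectionForm A x₀ y (localRep I E x₀ X y) (localRep I F x₀ s y) := by
  rw [← hO.localRep_covariantDerivative A hy hs, hO.tangent.fibreMap_localRep hy]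
  rfl

/-- The covariant derivative of a section whose local representative is known near a point. -/
lemma localRep_covariantDerivative_of_eventuallyEq (hO : IsChartDomain I F V x₀ O)
    (A : CovariantDerivative I F V) (hy : y ∈ O) {s : Π x, V x} (X : Π x : M, TangentSpace I x)
    {f : E → F} (h : localRep I F x₀ s =ᶠ[𝓝[O] y] f) (hf : DifferentiableWithinAt ℝ f O y) :
    localRep I F x₀ (fun x ↦ A s x (X x)) y =
      fderivWithin ℝ f O y (localRep I E x₀ X y) +
        connectionForm A x₀ y (localRep I E x₀ X y) (f y) := by
  rw [hO.localRep_covariantDerivative_field A hy X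
    (hf.congr_of_eventuallyEq_of_mem h hy), h.fderivWithin_eq_of_mem hy, h.eq_of_nhdsWithin hy]

/-- The commutator of covariant derivatives along vector fields. -/
lemma localRep_commutator [T2Space M] (hO : IsChartDomain I F V x₀ O)
    {A : CovariantDerivative I F V} (hA : A.ContMDiffCovariantDerivative ∞) (hy : y ∈ O)
    {s : Π x, V x} {X Y : Π x : M, TangentSpace I x}
    (hs : ContDiffWithinAt ℝ ∞ (localRep I F x₀ s) O y)
    (hX : ContDiffWithinAt ℝ ∞ (localRep I E x₀ X) O y)
    (hY : ContDiffWithinAt ℝ ∞ (localRep I E x₀ Y) O y) :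
    localRep I F x₀ (fun x ↦ A (fun z ↦ A s z (Y z)) x (X x) - A (fun z ↦ A s z (X z)) x (Y x) -
      A s x (VectorField.mlieBracket I X Y x)) y =
      curvatureRep O (connectionForm A x₀) y (localRep I E x₀ X y) (localRep I E x₀ Y y)
        (localRep I F x₀ s y) := by
  have : CompleteSpace E := FiniteDimensional.complete ℝ E
  have hΩ := hO.contDiffOn_connectionForm hA y hy
  have hs' := eventually_differentiableWithinAt hy hs
  have key (Z : Π x : M, TangentSpace I x) :
      localRep I F x₀ (fun z ↦ A s z (Z z)) =ᶠ[𝓝[O] y] fun z ↦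
        fderivWithin ℝ (localRep I F x₀ s) O z (localRep I E x₀ Z z) +
        connectionForm A x₀ z (localRep I E x₀ Z z) (localRep I F x₀ s z) := by
    filter_upwards [hs', self_mem_nhdsWithin] with z hz hzO
    exact hO.localRep_covariantDerivative_field A hzO Z hz
  rw [← covariant_commutator hO.uniqueDiffOn hO.subset_closure_interior hy hΩ hs hX hY,
    ← hO.localRep_covariantDerivative_of_eventuallyEq A hy X (key Y)
      (differentiableWithinAt_covariant hO.uniqueDiffOn hy hΩ hs hY),
    ← hO.localRep_covariantDerivative_of_eventuallyEq A hy Y (key X)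
      (differentiableWithinAt_covariant hO.uniqueDiffOn hy hΩ hs hX),
    ← hO.localRep_covariantDerivative A hy (differentiableWithinAt_of_contDiffWithinAt hs),
    ← hO.mlieBracket_eq hy (differentiableWithinAt_of_contDiffWithinAt hX)
      (differentiableWithinAt_of_contDiffWithinAt hY)]
  simp only [localRep, map_sub]

end IsChartDomain

end CurvatureLocal

section Curvature

variable {d : ℕ} [NeZero d] {M : Type*} [TopologicalSpace M] [T2Space M]
  [ChartedSpace (EuclideanHalfSpace d) M] [IsManifold (𝓡∂ d) ∞ M]
  {F : Type*} [NormedAddCommGroup F] [NormedSpace ℝ F] [FiniteDimensional ℝ F]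
  {V : M → Type*} [TopologicalSpace (TotalSpace F V)]
  [∀ x, AddCommGroup (V x)] [∀ x, Module ℝ (V x)] [∀ x, TopologicalSpace (V x)]
  [∀ x, IsTopologicalAddGroup (V x)] [∀ x, ContinuousSMul ℝ (V x)]
  [FiberBundle F V] [VectorBundle ℝ F V] [ContMDiffVectorBundle ∞ F V (𝓡∂ d)]
  {x₀ : M} {O : Set (EuclideanSpace ℝ (Fin d))} {y : EuclideanSpace ℝ (Fin d)}

/-- The curvature in the coordinate frame. -/
lemma curvature_frame (hO : IsChartDomain (𝓡∂ d) F V x₀ O)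
    {A : CovariantDerivative (𝓡∂ d) F V} (hA : A.ContMDiffCovariantDerivative ∞) (hy : y ∈ O)
    (v w : EuclideanSpace ℝ (Fin d)) (f : F) :
    curvature A _ (frame (𝓡∂ d) x₀ y v) (frame (𝓡∂ d) x₀ y w) (fibreMap (𝓡∂ d) F V x₀ y f) =
      fibreMap (𝓡∂ d) F V x₀ y (curvatureRep O (connectionForm A x₀) y v w f) := by
  have h := hO.localRep_commutator hA hy
    (hO.contDiffWithinAt_localRep_extend hy (fibreMap (𝓡∂ d) F V x₀ y f))
    (hO.tangent.contDiffWithinAt_localRep_extend hy (frame (𝓡∂ d) x₀ y v))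
    (hO.tangent.contDiffWithinAt_localRep_extend hy (frame (𝓡∂ d) x₀ y w))
  rw [hO.localRep_extend_self hy, hO.tangent.localRep_extend_self hy,
    hO.tangent.localRep_extend_self hy] at h
  rw [← h, hO.fibreMap_localRep hy, curvature]
  simp only [FiberBundle.extend_apply_self]

/-- Tensoriality: `curvature` sees only the values at each point, so no regularity of the fields is
required. This allows it to be differentiated along extended vectors. -/
lemma localRep_curvature (hO : IsChartDomain (𝓡∂ d) F V x₀ O)
    {A : CovariantDerivative (𝓡∂ d) F V} (hA : A.ContMDiffCovariantDerivative ∞) (hy : y ∈ O)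
    (v w : Π x : M, TangentSpace (𝓡∂ d) x) (s : Π x, V x) :
    localRep (𝓡∂ d) F x₀ (fun x ↦ curvature A x (v x) (w x) (s x)) y =
      curvatureRep O (connectionForm A x₀) y (localRep (𝓡∂ d) _ x₀ v y)
        (localRep (𝓡∂ d) _ x₀ w y) (localRep (𝓡∂ d) F x₀ s y) := by
  have h := curvature_frame hO hA hy (localRep (𝓡∂ d) _ x₀ v y)
        (localRep (𝓡∂ d) _ x₀ w y) (localRep (𝓡∂ d) F x₀ s y)
  rw [hO.fibreMap_localRep hy, hO.tangent.fibreMap_localRep hy,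
    hO.tangent.fibreMap_localRep hy] at h
  refine (congrArg _ h).trans ?_
  exact hO.fibreMap_apply hy _

end Curvature
end ConformalYangMills

/-! ### The Levi-Civita connection in a chart, from the Koszul formula. -/

namespace ConformalYangMills

section LeviCivita

variable {d : ℕ} [NeZero d] {M : Type*} [TopologicalSpace M]
  [ChartedSpace (EuclideanHalfSpace d) M] [IsManifold (𝓡∂ d) ∞ M]
  {x₀ : M} {O : Set (EuclideanSpace ℝ (Fin d))} {y : EuclideanSpace ℝ (Fin d)}

/-- The combination of derivatives of the metric which defines the Christoffel symbols. -/
noncomputable def lowerChristoffel (g : Metric d M) (x₀ : M) (O : Set (EuclideanSpace ℝ (Fin d)))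
    (y u w : EuclideanSpace ℝ (Fin d)) : EuclideanSpace ℝ (Fin d) →ₗ[ℝ] ℝ :=
  (1 / 2 : ℝ) • ((fderivWithin ℝ (metricRep g x₀) O y u w).toLinearMap +
    (fderivWithin ℝ (metricRep g x₀) O y w u).toLinearMap -
    (((fderivWithin ℝ (metricRep g x₀) O y).flip u).flip w).toLinearMap)

lemma lowerChristoffel_apply (g : Metric d M) (u w c : EuclideanSpace ℝ (Fin d)) :
    lowerChristoffel g x₀ O y u w c = (1 / 2) * (fderivWithin ℝ (metricRep g x₀) O y u w c +
      fderivWithin ℝ (metricRep g x₀) O y w u c - fderivWithin ℝ (metricRep g x₀) O y c u w) := rfl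

/-- The Christoffel symbols in the preferred chart at `x₀`. -/
noncomputable def christoffelRep (g : Metric d M) (x₀ : M) (O : Set (EuclideanSpace ℝ (Fin d)))
    (y u w : EuclideanSpace ℝ (Fin d)) : EuclideanSpace ℝ (Fin d) :=
  ∑ i, ∑ j, (inverseMetricRep g x₀ y i j *
    lowerChristoffel g x₀ O y u w (EuclideanSpace.single j 1)) • EuclideanSpace.single i 1

lemma metricRep_christoffelRep (hO : IsChartDomain (𝓡∂ d) (EuclideanSpace ℝ (Fin d))
    (fun x : M ↦ TangentSpace (𝓡∂ d) x) x₀ O) (g : Metric d M) (hy : y ∈ O)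
    (u w c : EuclideanSpace ℝ (Fin d)) :
    metricRep g x₀ y (christoffelRep g x₀ O y u w) c = lowerChristoffel g x₀ O y u w c := by
  set B : EuclideanSpace ℝ (Fin d) →ₗ[ℝ] EuclideanSpace ℝ (Fin d) →ₗ[ℝ] ℝ :=
    (ContinuousLinearMap.coeLM ℝ).comp (metricRep g x₀ y).toLinearMap with hBdef
  have hBa : ∀ v w, B v w = metricRep g x₀ y v w := fun _ _ ↦ rfl
  have hB : ∀ w ≠ 0, 0 < B w w := fun w hw ↦ by
    rw [hBa, metricRep_apply hO g hy]
    exact g.pos _ _ fun h ↦ hw (hO.fibreMap_injective hy (h.trans (map_zero _).symm))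
  have hs : ∀ v w, B v w = B w v := fun v w ↦ by
    rw [hBa, hBa, metricRep_apply hO g hy, metricRep_apply hO g hy]
    exact g.symm _ _ _
  have h := sum_inverseGram_mul hB hs (EuclideanSpace.basisFun (Fin d) ℝ).toBasis
    (lowerChristoffel g x₀ O y u w) c
  rw [← h, christoffelRep]
  simp only [map_sum, map_smul, sum_apply, smul_apply, smul_eq_mul,
    OrthonormalBasis.coe_toBasis, EuclideanSpace.basisFun_apply]
  have hG : inverseGram B (EuclideanSpace.basisFun (Fin d) ℝ) = inverseMetricRep g x₀ y := by
    rw [inverseGram, inverseMetricRep]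
    simp only [EuclideanSpace.basisFun_apply, hBa]
  rw [hG]
  rfl

/-- The derivative of a scalar product of vector fields along the coordinate frame. -/
lemma dirDeriv_inner_frame (hO : IsChartDomain (𝓡∂ d) (EuclideanSpace ℝ (Fin d))
    (fun x : M ↦ TangentSpace (𝓡∂ d) x) x₀ O) (g : Metric d M) (hy : y ∈ O)
    {X Y : Π x : M, TangentSpace (𝓡∂ d) x}
    (hX : DifferentiableWithinAt ℝ (localRep (𝓡∂ d) (EuclideanSpace ℝ (Fin d)) x₀ X) O y)
    (hY : DifferentiableWithinAt ℝ (localRep (𝓡∂ d) (EuclideanSpace ℝ (Fin d)) x₀ Y) O y)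
    (Z : Π x : M, TangentSpace (𝓡∂ d) x) :
    dirDeriv (fun x ↦ g.inner x (X x) (Y x)) ((extChartAt (𝓡∂ d) x₀).symm y) (Z _) =
      fderivWithin ℝ (metricRep g x₀) O y (localRep (𝓡∂ d) (EuclideanSpace ℝ (Fin d)) x₀ Z y)
        (localRep (𝓡∂ d) (EuclideanSpace ℝ (Fin d)) x₀ X y) (localRep (𝓡∂ d) (EuclideanSpace ℝ (Fin d)) x₀ Y y) +
      metricRep g x₀ y (fderivWithin ℝ (localRep (𝓡∂ d) (EuclideanSpace ℝ (Fin d)) x₀ X) O y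
        (localRep (𝓡∂ d) (EuclideanSpace ℝ (Fin d)) x₀ Z y)) (localRep (𝓡∂ d) (EuclideanSpace ℝ (Fin d)) x₀ Y y) +
      metricRep g x₀ y (localRep (𝓡∂ d) (EuclideanSpace ℝ (Fin d)) x₀ X y)
        (fderivWithin ℝ (localRep (𝓡∂ d) (EuclideanSpace ℝ (Fin d)) x₀ Y) O y (localRep (𝓡∂ d) (EuclideanSpace ℝ (Fin d)) x₀ Z y)) := by
  have hm : DifferentiableWithinAt ℝ (metricRep g x₀) O y :=
    (contDiffOn_metricRep hO g y hy).differentiableWithinAt (by simp)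
  have h1 : ∀ z ∈ O, ((fun x ↦ g.inner x (X x) (Y x)) ∘ (extChartAt (𝓡∂ d) x₀).symm) z =
      metricRep g x₀ z (localRep (𝓡∂ d) (EuclideanSpace ℝ (Fin d)) x₀ X z) (localRep (𝓡∂ d) (EuclideanSpace ℝ (Fin d)) x₀ Y z) := fun z hz ↦ by
    rw [metricRep_apply hO g hz, hO.fibreMap_localRep hz, hO.fibreMap_localRep hz]
    rfl
  have h2 := (hm.clm_apply hX).clm_apply hY
  have h3 : DifferentiableWithinAt ℝ
      ((fun x ↦ g.inner x (X x) (Y x)) ∘ (extChartAt (𝓡∂ d) x₀).symm) O y :=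
    h2.congr h1 (h1 y hy)
  rw [← hO.fibreMap_localRep hy Z, dirDeriv]
  refine (hO.mfderiv_frame hy ((hO.mdifferentiableAt_iff hy).2 h3) _).trans ?_
  rw [fderivWithin_congr h1 (h1 y hy), fderivWithin_clm_apply (hO.uniqueDiffOn y hy)
    (hm.clm_apply hX) hY, fderivWithin_clm_apply (hO.uniqueDiffOn y hy) hm hX]
  simp only [add_apply, ContinuousLinearMap.comp_apply, ContinuousLinearMap.flip_apply]
  exact (fun a b c ↦ by ring : ∀ a b c : ℝ, a + (b + c) = c + b + a) _ _ _

lemma inner_eq_metricRep (hO : IsChartDomain (𝓡∂ d) (EuclideanSpace ℝ (Fin d))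
    (fun x : M ↦ TangentSpace (𝓡∂ d) x) x₀ O) (g : Metric d M) (hy : y ∈ O)
    (a : EuclideanSpace ℝ (Fin d)) (Z : Π x : M, TangentSpace (𝓡∂ d) x) :
    g.inner ((extChartAt (𝓡∂ d) x₀).symm y) (frame (𝓡∂ d) x₀ y a) (Z _) =
      metricRep g x₀ y a (localRep (𝓡∂ d) (EuclideanSpace ℝ (Fin d)) x₀ Z y) := by
  rw [metricRep_apply hO g hy, hO.fibreMap_localRep hy]

/-- The Koszul formula in a chart. -/
lemma koszul_eq (hO : IsChartDomain (𝓡∂ d) (EuclideanSpace ℝ (Fin d))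
    (fun x : M ↦ TangentSpace (𝓡∂ d) x) x₀ O) (g : Metric d M) (hy : y ∈ O)
    {X Y Z : Π x : M, TangentSpace (𝓡∂ d) x}
    (hX : DifferentiableWithinAt ℝ (localRep (𝓡∂ d) (EuclideanSpace ℝ (Fin d)) x₀ X) O y)
    (hY : DifferentiableWithinAt ℝ (localRep (𝓡∂ d) (EuclideanSpace ℝ (Fin d)) x₀ Y) O y)
    (hZ : DifferentiableWithinAt ℝ (localRep (𝓡∂ d) (EuclideanSpace ℝ (Fin d)) x₀ Z) O y) :
    koszul g X Y Z ((extChartAt (𝓡∂ d) x₀).symm y) =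
      metricRep g x₀ y (fderivWithin ℝ (localRep (𝓡∂ d) (EuclideanSpace ℝ (Fin d)) x₀ Y) O y (localRep (𝓡∂ d) (EuclideanSpace ℝ (Fin d)) x₀ X y) +
        christoffelRep g x₀ O y (localRep (𝓡∂ d) (EuclideanSpace ℝ (Fin d)) x₀ X y) (localRep (𝓡∂ d) (EuclideanSpace ℝ (Fin d)) x₀ Y y))
        (localRep (𝓡∂ d) (EuclideanSpace ℝ (Fin d)) x₀ Z y) := by
  have hs : ∀ v w, metricRep g x₀ y v w = metricRep g x₀ y w v := fun v w ↦ by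
    rw [metricRep_apply hO g hy, metricRep_apply hO g hy]
    exact g.symm _ _ _
  -- The derivative of a symmetric form is symmetric. With this the derivatives of X and Z cancel
  -- between the product rule and the brackets, and those of Y add up.
  have hsd : ∀ u v w, fderivWithin ℝ (metricRep g x₀) O y u v w =
      fderivWithin ℝ (metricRep g x₀) O y u w v := fun u v w ↦ by
    have hm : DifferentiableWithinAt ℝ (metricRep g x₀) O y :=
      (contDiffOn_metricRep hO g y hy).differentiableWithinAt (by simp)
    have key : ∀ v w, fderivWithin ℝ (metricRep g x₀) O y u v w =
        fderivWithin ℝ (fun z ↦ metricRep g x₀ z v w) O y u := fun v w ↦ by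
      rw [fderivWithin_clm_apply (hO.uniqueDiffOn y hy)
        (hm.clm_apply (differentiableWithinAt_const v)) (differentiableWithinAt_const w),
        fderivWithin_clm_apply (hO.uniqueDiffOn y hy) hm (differentiableWithinAt_const v)]
      simp
    rw [key, key]
    congr 1
    refine fderivWithin_congr (fun z hz ↦ ?_) (hs v w)
    rw [metricRep_apply hO g hz, metricRep_apply hO g hz]
    exact g.symm _ _ _
  rw [koszul, dirDeriv_inner_frame hO g hy hY hZ, dirDeriv_inner_frame hO g hy hX hZ,
    dirDeriv_inner_frame hO g hy hX hY, hO.mlieBracket_eq hy hX hY, hO.mlieBracket_eq hy hX hZ,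
    hO.mlieBracket_eq hy hY hZ, inner_eq_metricRep hO g hy, inner_eq_metricRep hO g hy,
    inner_eq_metricRep hO g hy, map_add, add_apply, metricRep_christoffelRep hO g hy,
    lowerChristoffel_apply]
  simp only [map_sub, sub_apply]
  generalize localRep (𝓡∂ d) (EuclideanSpace ℝ (Fin d)) x₀ X = a, localRep (𝓡∂ d) (EuclideanSpace ℝ (Fin d)) x₀ Y = b,
    localRep (𝓡∂ d) (EuclideanSpace ℝ (Fin d)) x₀ Z = c at *
  rw [hs (b y) (fderivWithin ℝ c O y (a y)), hs (a y) (fderivWithin ℝ c O y (b y)),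
    hs (a y) (fderivWithin ℝ b O y (c y))]
  ring

/-- The Levi-Civita covariant derivative in the coordinate frame. -/
lemma leviCivita_frame (hO : IsChartDomain (𝓡∂ d) (EuclideanSpace ℝ (Fin d))
    (fun x : M ↦ TangentSpace (𝓡∂ d) x) x₀ O) (g : Metric d M) (hy : y ∈ O)
    (u w : EuclideanSpace ℝ (Fin d)) {Y : Π x : M, TangentSpace (𝓡∂ d) x}
    (hY : DifferentiableWithinAt ℝ (localRep (𝓡∂ d) (EuclideanSpace ℝ (Fin d)) x₀ Y) O y) 
    (hw : localRep (𝓡∂ d) (EuclideanSpace ℝ (Fin d)) x₀ Y y = w) :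
    leviCivita g Y _ (frame (𝓡∂ d) x₀ y u) = frame (𝓡∂ d) x₀ y
      (fderivWithin ℝ (localRep (𝓡∂ d) (EuclideanSpace ℝ (Fin d)) x₀ Y) O y u + christoffelRep g x₀ O y u w) := by
  subst hw
  rw [leviCivita]
  have h (j : Fin d) : koszul g (extendVector (frame (𝓡∂ d) x₀ y u)) Y
      (extendVector (tangentBasis ((extChartAt (𝓡∂ d) x₀).symm y) j)) ((extChartAt (𝓡∂ d) x₀).symm y) =
      g.inner _ (frame (𝓡∂ d) x₀ y (fderivWithin ℝ (localRep (𝓡∂ d) (EuclideanSpace ℝ (Fin d)) x₀ Y) O y u +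
        christoffelRep g x₀ O y u (localRep (𝓡∂ d) (EuclideanSpace ℝ (Fin d)) x₀ Y y))) (tangentBasis _ j) := by
    rw [koszul_eq hO g hy (differentiableWithinAt_of_contDiffWithinAt
      (hO.contDiffWithinAt_localRep_extend hy _)) hY (differentiableWithinAt_of_contDiffWithinAt
      (hO.contDiffWithinAt_localRep_extend hy _)), hO.localRep_extend_self hy,
      metricRep_apply hO g hy, hO.fibreMap_localRep hy]
    congr 1
    exact FiberBundle.extend_apply_self _ _
  simp only [h]
  exact sum_inverseMetric_inner_smul g _ _

end LeviCivita
end ConformalYangMills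

/-! ### The covariant derivative of the curvature in a chart. -/

namespace ConformalYangMills

section CovDerivCurvature

set_option synthInstance.maxHeartbeats 200000
set_option maxSynthPendingDepth 5

variable {d : ℕ} [NeZero d] {M : Type*} [TopologicalSpace M] [T2Space M]
  [ChartedSpace (EuclideanHalfSpace d) M] [IsManifold (𝓡∂ d) ∞ M]
  {F : Type*} [NormedAddCommGroup F] [NormedSpace ℝ F] [FiniteDimensional ℝ F]
  {V : M → Type*} [TopologicalSpace (TotalSpace F V)]
  [∀ x, AddCommGroup (V x)] [∀ x, Module ℝ (V x)] [∀ x, TopologicalSpace (V x)]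
  [∀ x, IsTopologicalAddGroup (V x)] [∀ x, ContinuousSMul ℝ (V x)]
  [FiberBundle F V] [VectorBundle ℝ F V] [ContMDiffVectorBundle ∞ F V (𝓡∂ d)]
  {x₀ : M} {O : Set (EuclideanSpace ℝ (Fin d))} {y : EuclideanSpace ℝ (Fin d)}

/-- The covariant derivative of the curvature in the preferred chart and trivialization at `x₀`. -/
noncomputable def covDerivCurvatureRep (g : Metric d M) (A : CovariantDerivative (𝓡∂ d) F V)
    (x₀ : M) (O : Set (EuclideanSpace ℝ (Fin d))) (y u v w : EuclideanSpace ℝ (Fin d)) :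
    F →L[ℝ] F :=
  fderivWithin ℝ (curvatureRep O (connectionForm A x₀)) O y u v w +
    connectionForm A x₀ y u * curvatureRep O (connectionForm A x₀) y v w -
    curvatureRep O (connectionForm A x₀) y v w * connectionForm A x₀ y u -
    curvatureRep O (connectionForm A x₀) y (christoffelRep g x₀ O y u v) w -
    curvatureRep O (connectionForm A x₀) y v (christoffelRep g x₀ O y u w)

/-- By the Leibniz rule the derivatives of the three chosen extensions cancel against the correction
terms, leaving only connection forms and Christoffel symbols. -/
lemma covDerivCurvature_frame (hO : IsChartDomain (𝓡∂ d) F V x₀ O) (g : Metric d M)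
    {A : CovariantDerivative (𝓡∂ d) F V} (hA : A.ContMDiffCovariantDerivative ∞) (hy : y ∈ O)
    (u v w : EuclideanSpace ℝ (Fin d)) (f : F) :
    covDerivCurvature g A _ (frame (𝓡∂ d) x₀ y u) (frame (𝓡∂ d) x₀ y v) (frame (𝓡∂ d) x₀ y w)
        (fibreMap (𝓡∂ d) F V x₀ y f) =
      fibreMap (𝓡∂ d) F V x₀ y (covDerivCurvatureRep g A x₀ O y u v w f) := by
  set K := curvatureRep O (connectionForm A x₀) with hK
  have hKd : DifferentiableWithinAt ℝ K O y := differentiableWithinAt_of_contDiffWithinAt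
    (contDiffOn_curvatureRep hO.uniqueDiffOn (hO.contDiffOn_connectionForm hA) y hy)
  have hu := hO.uniqueDiffOn y hy
  set v' := extendVector (frame (𝓡∂ d) x₀ y v) with hv'
  set w' := extendVector (frame (𝓡∂ d) x₀ y w) with hw'
  set s' := FiberBundle.extend F (fibreMap (𝓡∂ d) F V x₀ y f) with hs'
  have hv1 : localRep (𝓡∂ d) (EuclideanSpace ℝ (Fin d)) x₀ v' y = v :=
    hO.tangent.localRep_extend_self hy v
  have hw1 : localRep (𝓡∂ d) (EuclideanSpace ℝ (Fin d)) x₀ w' y = w :=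
    hO.tangent.localRep_extend_self hy w
  have hs1 : localRep (𝓡∂ d) F x₀ s' y = f := hO.localRep_extend_self hy f
  have hv2 : DifferentiableWithinAt ℝ (localRep (𝓡∂ d) (EuclideanSpace ℝ (Fin d)) x₀ v') O y :=
    differentiableWithinAt_of_contDiffWithinAt (hO.tangent.contDiffWithinAt_localRep_extend hy _)
  have hw2 : DifferentiableWithinAt ℝ (localRep (𝓡∂ d) (EuclideanSpace ℝ (Fin d)) x₀ w') O y :=
    differentiableWithinAt_of_contDiffWithinAt (hO.tangent.contDiffWithinAt_localRep_extend hy _)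
  have hs2 : DifferentiableWithinAt ℝ (localRep (𝓡∂ d) F x₀ s') O y :=
    differentiableWithinAt_of_contDiffWithinAt (hO.contDiffWithinAt_localRep_extend hy _)
  have h1 : localRep (𝓡∂ d) F x₀ (fun x ↦ curvature A x (v' x) (w' x) (s' x)) =ᶠ[𝓝[O] y]
      fun z ↦ K z (localRep (𝓡∂ d) (EuclideanSpace ℝ (Fin d)) x₀ v' z)
        (localRep (𝓡∂ d) (EuclideanSpace ℝ (Fin d)) x₀ w' z) (localRep (𝓡∂ d) F x₀ s' z) :=
    Filter.eventually_of_mem self_mem_nhdsWithin fun z hz ↦ localRep_curvature hO hA hz v' w' s'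
  have h2 := ((hKd.clm_apply hv2).clm_apply hw2).clm_apply hs2
  have h3 := hO.localRep_covariantDerivative A hy (h2.congr_of_eventuallyEq_of_mem h1 hy) u
  rw [h1.fderivWithin_eq_of_mem hy, h1.eq_of_nhdsWithin hy,
    fderivWithin_clm_apply hu ((hKd.clm_apply hv2).clm_apply hw2) hs2,
    fderivWithin_clm_apply hu (hKd.clm_apply hv2) hw2, fderivWithin_clm_apply hu hKd hv2] at h3
  have h4 := hO.localRep_covariantDerivative A hy hs2 u
  have h6 (t : V ((extChartAt (𝓡∂ d) x₀).symm y)) : fibreMap (𝓡∂ d) F V x₀ y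
      ((trivializationAt F V x₀).continuousLinearMapAt ℝ _ t) = t :=
    (trivializationAt F V x₀).symmL_continuousLinearMapAt (hO.mem_baseSet y hy) t
  have h3' := congrArg (fibreMap (𝓡∂ d) F V x₀ y) h3
  have h4' := congrArg (fibreMap (𝓡∂ d) F V x₀ y) h4
  rw [h6] at h3' h4'
  rw [covDerivCurvature, h3', h4', leviCivita_frame hO.tangent g hy u v hv2 hv1,
    leviCivita_frame hO.tangent g hy u w hw2 hw1, curvature_frame hO hA hy,
    curvature_frame hO hA hy, curvature_frame hO hA hy, ← map_sub, ← map_sub, ← map_sub,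
    covDerivCurvatureRep, ← hK]
  refine congrArg _ ?_
  simp only [add_apply, sub_apply, ContinuousLinearMap.comp_apply,
    ContinuousLinearMap.flip_apply, map_add, hv1, hw1, hs1, mul_apply_apply]
  abel

end CovDerivCurvature
end ConformalYangMills

/-! ### Metric coefficients and Christoffel symbols as elements of the ring of functions. -/

namespace ConformalYangMills

section RingOfFunctions

variable {d : ℕ} [NeZero d] {M : Type*} [TopologicalSpace M]
  [ChartedSpace (EuclideanHalfSpace d) M] [IsManifold (𝓡∂ d) ∞ M]
  {x₀ : M} {O : Set (EuclideanSpace ℝ (Fin d))} {y : EuclideanSpace ℝ (Fin d)}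

/-- The partial derivatives on a chart domain. -/
noncomputable abbrev coordDerivatives (F : Type*) [NormedAddCommGroup F] [NormedSpace ℝ F]
    (hO : IsChartDomain (𝓡∂ d) (EuclideanSpace ℝ (Fin d))
    (fun x : M ↦ TangentSpace (𝓡∂ d) x) x₀ O) :
    PartialDerivatives (Fin d) (SmoothFn O ℝ) (SmoothFn O (F →L[ℝ] F)) :=
  SmoothFn.partialDerivatives F (fun i ↦ EuclideanSpace.single i (1 : ℝ)) hO.uniqueDiffOn
    hO.subset_closure_interior

/-- The components of the metric as smooth functions. -/
noncomputable def metricMatrix (hO : IsChartDomain (𝓡∂ d) (EuclideanSpace ℝ (Fin d))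
    (fun x : M ↦ TangentSpace (𝓡∂ d) x) x₀ O) (g : Metric d M) :
    Matrix (Fin d) (Fin d) (SmoothFn O ℝ) :=
  Matrix.of fun i j ↦ SmoothFn.mk (fun y ↦ metricRep g x₀ y (EuclideanSpace.single i 1)
    (EuclideanSpace.single j 1))
    (((contDiffOn_metricRep hO g).clm_apply contDiffOn_const).clm_apply contDiffOn_const)

namespace SmoothFn

/-- The evaluation at a point. -/
def eval (x : O) : SmoothFn O ℝ →+* ℝ where
  toFun f := f.1 x
  map_one' := rfl
  map_mul' _ _ := rfl
  map_zero' := rfl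
  map_add' _ _ := rfl

lemma eval_apply (x : O) (f : SmoothFn O ℝ) : eval x f = f.1 x := rfl

/-- The evaluation at a point of an endomorphism valued function. -/
def evalEnd {F : Type*} [NormedAddCommGroup F] [NormedSpace ℝ F] (x : O) :
    SmoothFn O (F →L[ℝ] F) →+* (F →L[ℝ] F) where
  toFun f := f.1 x
  map_one' := rfl
  map_mul' _ _ := rfl
  map_zero' := rfl
  map_add' _ _ := rfl

lemma evalEnd_apply {F : Type*} [NormedAddCommGroup F] [NormedSpace ℝ F] (x : O)
    (f : SmoothFn O (F →L[ℝ] F)) : evalEnd x f = f.1 x := rfl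

lemma evalEnd_smul {F : Type*} [NormedAddCommGroup F] [NormedSpace ℝ F] (x : O)
    (r : SmoothFn O ℝ) (f : SmoothFn O (F →L[ℝ] F)) : evalEnd x (r • f) = eval x r • evalEnd x f :=
  rfl

end SmoothFn

lemma mapMatrix_metricMatrix (hO : IsChartDomain (𝓡∂ d) (EuclideanSpace ℝ (Fin d))
    (fun x : M ↦ TangentSpace (𝓡∂ d) x) x₀ O) (g : Metric d M) (x : O) :
    (SmoothFn.eval x).mapMatrix (metricMatrix hO g) = Matrix.of fun i j ↦
      metricRep g x₀ x (EuclideanSpace.single i 1) (EuclideanSpace.single j 1) := rfl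

lemma isUnit_det_metricMatrix (hO : IsChartDomain (𝓡∂ d) (EuclideanSpace ℝ (Fin d))
    (fun x : M ↦ TangentSpace (𝓡∂ d) x) x₀ O) (g : Metric d M) :
    IsUnit (metricMatrix hO g).det := by
  obtain ⟨f, hf⟩ := SmoothFn.exists_mul_eq_one (metricMatrix hO g).det fun x ↦ by
    rw [← SmoothFn.eval_apply, RingHom.map_det, mapMatrix_metricMatrix]
    exact (isUnit_det_metricRep hO g x.2).ne_zero
  exact IsUnit.of_mul_eq_one f hf

lemma metricMatrix_mul_inv (hO : IsChartDomain (𝓡∂ d) (EuclideanSpace ℝ (Fin d))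
    (fun x : M ↦ TangentSpace (𝓡∂ d) x) x₀ O) (g : Metric d M) :
    metricMatrix hO g * (metricMatrix hO g)⁻¹ = 1 :=
  Matrix.mul_nonsing_inv _ (isUnit_det_metricMatrix hO g)

/-- Evaluation at a point is a ring homomorphism, so it commutes with inverting the matrix.
Smoothness of the inverse metric is thereby automatic. -/
lemma metricMatrix_inv_apply (hO : IsChartDomain (𝓡∂ d) (EuclideanSpace ℝ (Fin d))
    (fun x : M ↦ TangentSpace (𝓡∂ d) x) x₀ O) (g : Metric d M) (x : O) (i j : Fin d) :
    ((metricMatrix hO g)⁻¹ i j).1 x = inverseMetricRep g x₀ x i j := by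
  have h : (SmoothFn.eval x).mapMatrix (metricMatrix hO g)⁻¹ = inverseMetricRep g x₀ x := by
    rw [inverseMetricRep, ← mapMatrix_metricMatrix hO g x]
    refine (Matrix.inv_eq_right_inv ?_).symm
    rw [← map_mul, metricMatrix_mul_inv, map_one]
  rw [← h]
  rfl

lemma isSymm_metricMatrix (hO : IsChartDomain (𝓡∂ d) (EuclideanSpace ℝ (Fin d))
    (fun x : M ↦ TangentSpace (𝓡∂ d) x) x₀ O) (g : Metric d M) :
    (metricMatrix hO g).IsSymm := by
  ext i j : 1
  refine SmoothFn.ext fun x hx ↦ ?_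
  change metricRep g x₀ x _ _ = metricRep g x₀ x _ _
  rw [metricRep_apply hO g hx, metricRep_apply hO g hx]
  exact g.symm _ _ _

variable {F : Type*} [NormedAddCommGroup F] [NormedSpace ℝ F]

lemma coordDerivatives_dR_mk (hO : IsChartDomain (𝓡∂ d) (EuclideanSpace ℝ (Fin d))
    (fun x : M ↦ TangentSpace (𝓡∂ d) x) x₀ O) (i : Fin d) (φ : EuclideanSpace ℝ (Fin d) → ℝ)
    (hφ : ContDiffOn ℝ ∞ φ O) (x : O) :
    ((coordDerivatives F hO).dR i (SmoothFn.mk φ hφ)).1 x =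
      fderivWithin ℝ φ O x (EuclideanSpace.single i 1) :=
  SmoothFn.deriv_mk hO.uniqueDiffOn _ φ hφ x

lemma coordDerivatives_dA_mk (hO : IsChartDomain (𝓡∂ d) (EuclideanSpace ℝ (Fin d))
    (fun x : M ↦ TangentSpace (𝓡∂ d) x) x₀ O) (i : Fin d)
    (φ : EuclideanSpace ℝ (Fin d) → F →L[ℝ] F) (hφ : ContDiffOn ℝ ∞ φ O) (x : O) :
    ((coordDerivatives F hO).dA i (SmoothFn.mk φ hφ)).1 x =
      fderivWithin ℝ φ O x (EuclideanSpace.single i 1) :=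
  SmoothFn.deriv_mk hO.uniqueDiffOn _ φ hφ x

lemma fderivWithin_clm_const {E G G' : Type*} [NormedAddCommGroup E] [NormedSpace ℝ E]
    [NormedAddCommGroup G] [NormedSpace ℝ G] [NormedAddCommGroup G'] [NormedSpace ℝ G']
    {O : Set E} {y : E} (hO : UniqueDiffWithinAt ℝ O y) {T : E → G →L[ℝ] G'}
    (hT : DifferentiableWithinAt ℝ T O y) (v : E) (w : G) :
    fderivWithin ℝ (fun z ↦ T z w) O y v = fderivWithin ℝ T O y v w := by
  rw [fderivWithin_clm_apply hO hT (differentiableWithinAt_const w)]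
  simp

lemma fderivWithin_metricRep (hO : IsChartDomain (𝓡∂ d) (EuclideanSpace ℝ (Fin d))
    (fun x : M ↦ TangentSpace (𝓡∂ d) x) x₀ O) (g : Metric d M) (hy : y ∈ O)
    (u v w : EuclideanSpace ℝ (Fin d)) :
    fderivWithin ℝ (fun z ↦ metricRep g x₀ z v w) O y u =
      fderivWithin ℝ (metricRep g x₀) O y u v w := by
  have hm : DifferentiableWithinAt ℝ (metricRep g x₀) O y :=
    (contDiffOn_metricRep hO g y hy).differentiableWithinAt (by simp)
  rw [fderivWithin_clm_const (hO.uniqueDiffOn y hy)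
    (hm.clm_apply (differentiableWithinAt_const v)),
    fderivWithin_clm_const (hO.uniqueDiffOn y hy) hm]

lemma christoffelRep_single (hO : IsChartDomain (𝓡∂ d) (EuclideanSpace ℝ (Fin d))
    (fun x : M ↦ TangentSpace (𝓡∂ d) x) x₀ O) (g : Metric d M) (x : O) (i j : Fin d) :
    christoffelRep g x₀ O x (EuclideanSpace.single i 1) (EuclideanSpace.single j 1) =
      ∑ k, ((coordDerivatives F hO).christoffel (metricMatrix hO g) (metricMatrix hO g)⁻¹ i j k).1 x •
        EuclideanSpace.single k (1 : ℝ) := by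
  rw [christoffelRep]
  refine Finset.sum_congr rfl fun k _ ↦ ?_
  rw [← Finset.sum_smul]
  congr 1
  rw [PartialDerivatives.christoffel, ← SmoothFn.eval_apply, map_mul, map_sum, Finset.mul_sum]
  refine Finset.sum_congr rfl fun l _ ↦ ?_
  simp only [map_mul, map_add, map_sub, SmoothFn.eval_apply, metricMatrix_inv_apply]
  have key (a b c : Fin d) : ((coordDerivatives F hO).dR a (metricMatrix hO g b c)).1 x =
      fderivWithin ℝ (metricRep g x₀) O x (EuclideanSpace.single a 1) (EuclideanSpace.single b 1)
        (EuclideanSpace.single c 1) :=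
    (coordDerivatives_dR_mk hO a _ (((contDiffOn_metricRep hO g).clm_apply
      contDiffOn_const).clm_apply contDiffOn_const) x).trans (fderivWithin_metricRep hO g x.2 _ _ _)
  rw [key, key, key, lowerChristoffel_apply]
  have hh : (PartialDerivatives.half (SmoothFn O ℝ)).1 x = 1 / 2 := rfl
  rw [hh]
  ring

end RingOfFunctions

/-! ### Components of curvature and of its covariant derivative as algebra elements. -/

section Current

set_option synthInstance.maxHeartbeats 200000
set_option maxSynthPendingDepth 5

variable {d : ℕ} [NeZero d] {M : Type*} [TopologicalSpace M] [T2Space M]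
  [ChartedSpace (EuclideanHalfSpace d) M] [IsManifold (𝓡∂ d) ∞ M]
  {F : Type*} [NormedAddCommGroup F] [NormedSpace ℝ F] [FiniteDimensional ℝ F]
  {V : M → Type*} [TopologicalSpace (TotalSpace F V)]
  [∀ x, AddCommGroup (V x)] [∀ x, Module ℝ (V x)] [∀ x, TopologicalSpace (V x)]
  [∀ x, IsTopologicalAddGroup (V x)] [∀ x, ContinuousSMul ℝ (V x)]
  [FiberBundle F V] [VectorBundle ℝ F V] [ContMDiffVectorBundle ∞ F V (𝓡∂ d)]
  {x₀ : M} {O : Set (EuclideanSpace ℝ (Fin d))} {y : EuclideanSpace ℝ (Fin d)}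

/-- The components of an endomorphism valued one-form as smooth functions. -/
noncomputable def components {Ω : EuclideanSpace ℝ (Fin d) → EuclideanSpace ℝ (Fin d) →L[ℝ] F →L[ℝ] F}
    (hΩ : ContDiffOn ℝ ∞ Ω O) (i : Fin d) : SmoothFn O (F →L[ℝ] F) :=
  SmoothFn.mk (fun y ↦ Ω y (EuclideanSpace.single i 1)) (hΩ.clm_apply contDiffOn_const)

lemma contDiffOn_curvatureRep_apply (hO : IsChartDomain (𝓡∂ d) F V x₀ O)
    {Ω : EuclideanSpace ℝ (Fin d) → EuclideanSpace ℝ (Fin d) →L[ℝ] F →L[ℝ] F}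
    (hΩ : ContDiffOn ℝ ∞ Ω O) (v w : EuclideanSpace ℝ (Fin d)) :
    ContDiffOn ℝ ∞ (fun y ↦ curvatureRep O Ω y v w) O :=
  ((contDiffOn_curvatureRep hO.uniqueDiffOn hΩ).clm_apply contDiffOn_const).clm_apply
    contDiffOn_const

lemma curv_components (hO : IsChartDomain (𝓡∂ d) F V x₀ O)
    {Ω : EuclideanSpace ℝ (Fin d) → EuclideanSpace ℝ (Fin d) →L[ℝ] F →L[ℝ] F}
    (hΩ : ContDiffOn ℝ ∞ Ω O) (i j : Fin d) :
    (coordDerivatives F hO.tangent).curv (components hΩ) i j =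
      SmoothFn.mk (fun y ↦ curvatureRep O Ω y (EuclideanSpace.single i 1)
        (EuclideanSpace.single j 1)) (contDiffOn_curvatureRep_apply hO hΩ _ _) := by
  refine SmoothFn.ext fun x hx ↦ ?_
  have key (a b : Fin d) : ((coordDerivatives F hO.tangent).dA a (components hΩ b)).1 ⟨x, hx⟩ =
      fderivWithin ℝ Ω O x (EuclideanSpace.single a 1) (EuclideanSpace.single b 1) :=
    (coordDerivatives_dA_mk hO.tangent a _ _ ⟨x, hx⟩).trans
      (fderivWithin_clm_const (hO.uniqueDiffOn x hx)
        ((hΩ x hx).differentiableWithinAt (by simp)) _ _)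
  rw [SmoothFn.mk_apply, curvatureRep_apply, ← key, ← key]
  rfl

lemma covCurv_components (hO : IsChartDomain (𝓡∂ d) F V x₀ O) (g : Metric d M)
    {A : CovariantDerivative (𝓡∂ d) F V} (hΩ : ContDiffOn ℝ ∞ (connectionForm A x₀) O)
    (i j b : Fin d) (x : O) :
    ((coordDerivatives F hO.tangent).covCurv (metricMatrix hO.tangent g)
        (metricMatrix hO.tangent g)⁻¹ (components hΩ) i j b).1 x =
      covDerivCurvatureRep g A x₀ O x (EuclideanSpace.single i 1) (EuclideanSpace.single j 1)
        (EuclideanSpace.single b 1) := by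
  have hK : DifferentiableWithinAt ℝ (curvatureRep O (connectionForm A x₀)) O x :=
    (contDiffOn_curvatureRep hO.uniqueDiffOn hΩ x x.2).differentiableWithinAt (by simp)
  have key : ((coordDerivatives F hO.tangent).dA i
      ((coordDerivatives F hO.tangent).curv (components hΩ) j b)).1 x =
      fderivWithin ℝ (curvatureRep O (connectionForm A x₀)) O x (EuclideanSpace.single i 1)
        (EuclideanSpace.single j 1) (EuclideanSpace.single b 1) := by
    rw [curv_components hO hΩ]
    refine (coordDerivatives_dA_mk hO.tangent i _ _ x).trans ?_
    rw [fderivWithin_clm_const (hO.uniqueDiffOn x x.2)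
      (hK.clm_apply (differentiableWithinAt_const _)),
      fderivWithin_clm_const (hO.uniqueDiffOn x x.2) hK]
  rw [PartialDerivatives.covCurv, PartialDerivatives.cov, ← SmoothFn.evalEnd_apply,
    covDerivCurvatureRep, christoffelRep_single (F := F) hO.tangent g x,
    christoffelRep_single (F := F) hO.tangent g x, ← key]
  simp only [map_sub, map_add, map_sum, map_mul, SmoothFn.evalEnd_smul, map_smul, sum_apply,
    smul_apply]
  simp only [curv_components hO hΩ, SmoothFn.evalEnd_apply, SmoothFn.eval_apply,
    SmoothFn.mk_apply]
  rfl

end Current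
end ConformalYangMills

/-! ### The current in the coordinate frame. -/

namespace ConformalYangMills

section CurrentRep

set_option synthInstance.maxHeartbeats 200000
set_option maxSynthPendingDepth 5

variable {d : ℕ} [NeZero d] {M : Type*} [TopologicalSpace M]
  [ChartedSpace (EuclideanHalfSpace d) M] [IsManifold (𝓡∂ d) ∞ M]
  {F : Type*} [NormedAddCommGroup F] [NormedSpace ℝ F] [FiniteDimensional ℝ F]
  {V : M → Type*} [TopologicalSpace (TotalSpace F V)]
  [∀ x, AddCommGroup (V x)] [∀ x, Module ℝ (V x)] [∀ x, TopologicalSpace (V x)]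
  [∀ x, IsTopologicalAddGroup (V x)] [∀ x, ContinuousSMul ℝ (V x)]
  [FiberBundle F V] [VectorBundle ℝ F V] [ContMDiffVectorBundle ∞ F V (𝓡∂ d)]
  {x₀ : M} {O : Set (EuclideanSpace ℝ (Fin d))} {y : EuclideanSpace ℝ (Fin d)}

lemma christoffelRep_add_left (g : Metric d M) (u u' w : EuclideanSpace ℝ (Fin d)) :
    christoffelRep g x₀ O y (u + u') w =
      christoffelRep g x₀ O y u w + christoffelRep g x₀ O y u' w := by
  simp only [christoffelRep, lowerChristoffel_apply, map_add, add_apply,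
    ← Finset.sum_add_distrib, ← add_smul]
  refine Finset.sum_congr rfl fun i _ ↦ Finset.sum_congr rfl fun j _ ↦ ?_
  congr 1
  ring

lemma christoffelRep_smul_left (g : Metric d M) (c : ℝ) (u w : EuclideanSpace ℝ (Fin d)) :
    christoffelRep g x₀ O y (c • u) w = c • christoffelRep g x₀ O y u w := by
  simp only [christoffelRep, lowerChristoffel_apply, map_smul, smul_apply, Finset.smul_sum,
    smul_eq_mul, smul_smul]
  refine Finset.sum_congr rfl fun i _ ↦ Finset.sum_congr rfl fun j _ ↦ ?_
  congr 1
  ring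

lemma christoffelRep_add_right (g : Metric d M) (u w w' : EuclideanSpace ℝ (Fin d)) :
    christoffelRep g x₀ O y u (w + w') =
      christoffelRep g x₀ O y u w + christoffelRep g x₀ O y u w' := by
  simp only [christoffelRep, lowerChristoffel_apply, map_add, add_apply,
    ← Finset.sum_add_distrib, ← add_smul]
  refine Finset.sum_congr rfl fun i _ ↦ Finset.sum_congr rfl fun j _ ↦ ?_
  congr 1
  ring

lemma christoffelRep_smul_right (g : Metric d M) (c : ℝ) (u w : EuclideanSpace ℝ (Fin d)) :
    christoffelRep g x₀ O y u (c • w) = c • christoffelRep g x₀ O y u w := by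
  simp only [christoffelRep, lowerChristoffel_apply, map_smul, smul_apply, Finset.smul_sum,
    smul_eq_mul, smul_smul]
  refine Finset.sum_congr rfl fun i _ ↦ Finset.sum_congr rfl fun j _ ↦ ?_
  congr 1
  ring

/-- The covariant derivative of the curvature is linear in the first two arguments. -/
noncomputable def covDerivCurvatureMap (g : Metric d M) (A : CovariantDerivative (𝓡∂ d) F V)
    (x₀ : M) (O : Set (EuclideanSpace ℝ (Fin d))) (y w : EuclideanSpace ℝ (Fin d)) :
    EuclideanSpace ℝ (Fin d) →ₗ[ℝ] EuclideanSpace ℝ (Fin d) →ₗ[ℝ] F →L[ℝ] F :=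
  LinearMap.mk₂ ℝ (fun u v ↦ covDerivCurvatureRep g A x₀ O y u v w)
    (fun u u' v ↦ by
      simp only [covDerivCurvatureRep, map_add, add_apply, christoffelRep_add_left, add_mul,
        mul_add]
      abel)
    (fun c u v ↦ by
      simp only [covDerivCurvatureRep, map_smul, smul_apply, christoffelRep_smul_left,
        smul_mul_assoc, mul_smul_comm, smul_add, smul_sub])
    (fun u v v' ↦ by
      simp only [covDerivCurvatureRep, map_add, add_apply, christoffelRep_add_right, add_mul,
        mul_add]
      abel)
    (fun c u v ↦ by
      simp only [covDerivCurvatureRep, map_smul, smul_apply, christoffelRep_smul_right,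
        smul_mul_assoc, mul_smul_comm, smul_add, smul_sub])

/-- The definition contracts in the basis of the preferred chart at the point itself, the
computation uses the frame of the chart at `x₀`; independence of the basis bridges the two. -/
lemma gradient_eq (hO : IsChartDomain (𝓡∂ d) (EuclideanSpace ℝ (Fin d))
    (fun x : M ↦ TangentSpace (𝓡∂ d) x) x₀ O) (g : Metric d M) (hy : y ∈ O) {r : M → ℝ}
    (hr : MDifferentiableAt (𝓡∂ d) 𝓘(ℝ, ℝ) r ((extChartAt (𝓡∂ d) x₀).symm y)) :
    gradient g r ((extChartAt (𝓡∂ d) x₀).symm y) = frame (𝓡∂ d) x₀ y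
      (∑ i, ∑ j, (inverseMetricRep g x₀ y i j *
        fderivWithin ℝ (r ∘ (extChartAt (𝓡∂ d) x₀).symm) O y (EuclideanSpace.single j 1)) •
          EuclideanSpace.single i (1 : ℝ)) := by
  set x := (extChartAt (𝓡∂ d) x₀).symm y
  have h := sum_inverseMetric_smul hO g hy (G := TangentSpace (𝓡∂ d) x)
    (((LinearMap.lsmul ℝ (TangentSpace (𝓡∂ d) x)).comp
      ((mfderiv (𝓡∂ d) 𝓘(ℝ, ℝ) r x).toLinearMap : TangentSpace (𝓡∂ d) x →ₗ[ℝ] ℝ)).flip)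
  have h1 (j : Fin d) : mfderiv (𝓡∂ d) 𝓘(ℝ, ℝ) r x (frame (𝓡∂ d) x₀ y (EuclideanSpace.single j 1)) =
      fderivWithin ℝ (r ∘ (extChartAt (𝓡∂ d) x₀).symm) O y (EuclideanSpace.single j 1) :=
    hO.mfderiv_frame hy hr _
  simp only [map_sum, map_smul]
  refine ((Finset.sum_congr rfl fun i _ ↦ Finset.sum_congr rfl fun j _ ↦ ?_).trans h).trans
    (Finset.sum_congr rfl fun i _ ↦ Finset.sum_congr rfl fun j _ ↦ ?_)
  · exact mul_smul _ _ _
  · exact (mul_smul _ _ _).symm.trans (congrArg (fun t : ℝ ↦ (inverseMetricRep g x₀ y i j * t) •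
      frame (𝓡∂ d) x₀ y (EuclideanSpace.single i 1)) (h1 j))

variable [T2Space M]

/-- Again independence of the basis. It applies because the local formula exhibits the covariant
derivative of the curvature as bilinear in its first two arguments. -/
lemma divCurvature_frame (hO : IsChartDomain (𝓡∂ d) F V x₀ O) (g : Metric d M)
    {A : CovariantDerivative (𝓡∂ d) F V} (hA : A.ContMDiffCovariantDerivative ∞) (hy : y ∈ O)
    (w : EuclideanSpace ℝ (Fin d)) (f : F) :
    divCurvature g A _ (frame (𝓡∂ d) x₀ y w) (fibreMap (𝓡∂ d) F V x₀ y f) =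
      fibreMap (𝓡∂ d) F V x₀ y (∑ i, ∑ j, inverseMetricRep g x₀ y i j •
        covDerivCurvatureRep g A x₀ O y (EuclideanSpace.single i 1)
          (EuclideanSpace.single j 1) w f) := by
  set x := (extChartAt (𝓡∂ d) x₀).symm y
  have hs := hO.tangent.fibreMap_surjective hy
  set c : TangentSpace (𝓡∂ d) x →ₗ[ℝ] EuclideanSpace ℝ (Fin d) :=
    ((trivializationAt (EuclideanSpace ℝ (Fin d)) (TangentSpace (𝓡∂ d)) x₀).continuousLinearMapAt
      ℝ x).toLinearMap with hc
  have hcf (v : EuclideanSpace ℝ (Fin d)) : c (frame (𝓡∂ d) x₀ y v) = v :=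
    hO.tangent.fibreMap_apply hy v
  set e : (F →L[ℝ] F) →ₗ[ℝ] V x := (fibreMap (𝓡∂ d) F V x₀ y).toLinearMap.comp
    (ContinuousLinearMap.apply ℝ F f).toLinearMap with he
  have h := sum_inverseMetric_smul hO.tangent g hy (((covDerivCurvatureMap g A x₀ O y w).compl₁₂
    c c).compr₂ e)
  have h1 (u v : TangentSpace (𝓡∂ d) x) : ((covDerivCurvatureMap g A x₀ O y w).compl₁₂ c c).compr₂ e
      u v = covDerivCurvature g A x u v (frame (𝓡∂ d) x₀ y w) (fibreMap (𝓡∂ d) F V x₀ y f) := by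
    obtain ⟨u, rfl⟩ := hs u
    obtain ⟨v, rfl⟩ := hs v
    rw [covDerivCurvature_frame hO g hA hy]
    change fibreMap (𝓡∂ d) F V x₀ y (covDerivCurvatureRep g A x₀ O y (c _) (c _) w f) = _
    rw [hcf, hcf]
  simp only [h1] at h
  rw [divCurvature]
  refine h.trans ?_
  simp only [map_sum, map_smul]
  exact Finset.sum_congr rfl fun i _ ↦ Finset.sum_congr rfl fun j _ ↦
    congrArg _ (covDerivCurvature_frame hO g hA hy _ _ w f)

variable {κ : ℕ}

/-- The current in the coordinate frame. -/
lemma current_frame (hO : IsChartDomain (𝓡∂ d) F V x₀ O) (g : Metric d M)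
    {A : CovariantDerivative (𝓡∂ d) F V} (hA : A.ContMDiffCovariantDerivative ∞)
    (hΩ : ContDiffOn ℝ ∞ (connectionForm A x₀) O) {r : M → ℝ}
    (hr : ContMDiff (𝓡∂ d) 𝓘(ℝ, ℝ) ∞ r)
    (hr' : ContDiffOn ℝ ∞ (r ∘ (extChartAt (𝓡∂ d) x₀).symm) O) (hκ : κ + 4 = d) (x : O)
    (b : Fin d) (f : F) :
    current g r A _ (frame (𝓡∂ d) x₀ x (EuclideanSpace.single b 1))
        (fibreMap (𝓡∂ d) F V x₀ x f) = fibreMap (𝓡∂ d) F V x₀ x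
      (((coordDerivatives F hO.tangent).lowerCurrent (metricMatrix hO.tangent g)
        (metricMatrix hO.tangent g)⁻¹ (SmoothFn.mk _ hr') κ (components hΩ) b).1 x f) := by
  have hr1 : MDifferentiableAt (𝓡∂ d) 𝓘(ℝ, ℝ) r ((extChartAt (𝓡∂ d) x₀).symm x) :=
    (hr _).mdifferentiableAt (by simp)
  have hκ' : (d : ℝ) - 4 = κ := by rw [← hκ]; push_cast; ring
  have h1 : ((κ : SmoothFn O ℝ)).1 x = κ := by
    rw [← SmoothFn.eval_apply, map_natCast]
  have h2 (c : Fin d) : ((coordDerivatives F hO.tangent).dR c (SmoothFn.mk _ hr')).1 x =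
      fderivWithin ℝ (r ∘ (extChartAt (𝓡∂ d) x₀).symm) O x (EuclideanSpace.single c 1) :=
    coordDerivatives_dR_mk hO.tangent c _ hr' x
  rw [current, divCurvature_frame hO g hA x.2, gradient_eq hO.tangent g x.2 hr1,
    curvature_frame hO hA x.2, PartialDerivatives.lowerCurrent, ← SmoothFn.evalEnd_apply, hκ']
  simp only [map_sub, SmoothFn.evalEnd_smul, map_sum, map_mul]
  simp only [SmoothFn.eval_apply, h1, h2, SmoothFn.evalEnd_apply, covCurv_components hO g hΩ,
    curv_components hO hΩ, SmoothFn.mk_apply,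
    metricMatrix_inv_apply, sub_apply, smul_apply, sum_apply, map_sub, map_sum, map_smul,
    Finset.sum_smul]
  rfl

end CurrentRep
end ConformalYangMills

/-! ### Gluing of local endomorphism valued forms. -/

namespace ConformalYangMills

section Gluing

variable {E : Type*} [NormedAddCommGroup E] [NormedSpace ℝ E] [FiniteDimensional ℝ E]
  {H : Type*} [TopologicalSpace H]
  {I : ModelWithCorners ℝ E H} {M : Type*} [TopologicalSpace M] [ChartedSpace H M]
  [IsManifold I ∞ M]
  {F : Type*} [NormedAddCommGroup F] [NormedSpace ℝ F] [FiniteDimensional ℝ F]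
  {V : M → Type*} [TopologicalSpace (TotalSpace F V)]
  [∀ x, AddCommGroup (V x)] [∀ x, Module ℝ (V x)] [∀ x, TopologicalSpace (V x)]
  [FiberBundle F V] [VectorBundle ℝ F V]
  [∀ x, IsTopologicalAddGroup (V x)] [∀ x, ContinuousSMul ℝ (V x)]
  [ContMDiffVectorBundle ∞ F V I] {x₀ : M} {O : Set E} {y : E}

lemma IsChartDomain.contDiffOn_comp {G : Type*} [NormedAddCommGroup G] [NormedSpace ℝ G]
    (hO : IsChartDomain I F V x₀ O) {f : M → G} (hf : ContMDiff I 𝓘(ℝ, G) ∞ f) :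
    ContDiffOn ℝ ∞ (f ∘ (extChartAt I x₀).symm) O :=
  fun _ hy ↦ (hO.contMDiffAt_iff hy).1 (hf _)

set_option synthInstance.maxHeartbeats 200000 in
variable (V) in
/-- The endomorphism valued one-form with a given local representative. -/
noncomputable def formOfRep (I : ModelWithCorners ℝ E H) [IsManifold I ∞ M] (x₀ : M)
    (Θ : E → E →L[ℝ] F →L[ℝ] F) (x : M) :
    TangentSpace I x →L[ℝ] V x →L[ℝ] V x :=
  (trivializationAt (E →L[ℝ] F →L[ℝ] F)
    (fun x ↦ TangentSpace I x →L[ℝ] V x →L[ℝ] V x) x₀).symmL ℝ x (Θ (extChartAt I x₀ x))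

set_option synthInstance.maxHeartbeats 200000 in
lemma IsChartDomain.formRep_formOfRep (hO : IsChartDomain I F V x₀ O)
    (Θ : E → E →L[ℝ] F →L[ℝ] F) (hy : y ∈ O) : formRep I F x₀ (formOfRep V I x₀ Θ) y = Θ y := by
  have h1 : formOfRep V I x₀ Θ ((extChartAt I x₀).symm y) = fibreMap I (E →L[ℝ] F →L[ℝ] F)
      (fun x ↦ TangentSpace I x →L[ℝ] V x →L[ℝ] V x) x₀ y (Θ y) := by
    rw [formOfRep, hO.right_inv hy, fibreMap]
  rw [formRep, localRep, h1]
  exact IsChartDomain.fibreMap_apply (F := E →L[ℝ] F →L[ℝ] F)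
    (V := fun x ↦ TangentSpace I x →L[ℝ] V x →L[ℝ] V x) (hO.tangent.hom (hO.hom hO)) hy (Θ y)

set_option synthInstance.maxHeartbeats 200000 in
/-- A local solution of a fibrewise linear equation for an endomorphism valued one-form near every
point yields a global solution. -/
lemma exists_form_of_local [T2Space M] [SigmaCompactSpace M] (ρ : M → ℝ)
    (j : Π x : M, TangentSpace I x → V x → V x)
    (h : ∀ x₀ : M, ∃ O, IsChartDomain I F V x₀ O ∧ extChartAt I x₀ x₀ ∈ O ∧
      ∃ Θ : E → E →L[ℝ] F →L[ℝ] F, ContDiffOn ℝ ∞ Θ O ∧ ∀ y ∈ O, ∀ v f,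
        j _ (frame I x₀ y v) (fibreMap I F V x₀ y f) =
          ρ ((extChartAt I x₀).symm y) • fibreMap I F V x₀ y (Θ y v f)) :
    ∃ k : Π x : M, TangentSpace I x →L[ℝ] V x →L[ℝ] V x,
      ContMDiff I (I.prod 𝓘(ℝ, E →L[ℝ] F →L[ℝ] F)) ∞
        (fun x ↦ TotalSpace.mk' (E →L[ℝ] F →L[ℝ] F) x (k x)) ∧
      ∀ x v s, j x v s = ρ x • k x v s := by
  -- At each point the solutions T of j = ρ T form a convex set, so local smooth solutions can be
  -- averaged with a partition of unity, also where ρ = 0 and T is not determined.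
  obtain ⟨k, hk⟩ := exists_contMDiffSection_forall_mem_convex_of_local (n := ⊤) I
    (F_fiber := E →L[ℝ] F →L[ℝ] F)
    (fun x : M ↦ TangentSpace I x →L[ℝ] V x →L[ℝ] V x)
    (fun x ↦ {T | ∀ v s, j x v s = ρ x • T v s})
    (fun x T hT T' hT' a b _ _ hab v s ↦ by
      rw [add_apply, add_apply, smul_apply, smul_apply, smul_apply, smul_apply, smul_add,
        smul_comm (ρ x) a, smul_comm (ρ x) b, ← hT v s, ← hT' v s, ← add_smul, hab, one_smul])
    (fun x₀ ↦ by
      obtain ⟨O, hO, hx, Θ, hΘ, hj⟩ := h x₀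
      refine ⟨_, hO.isOpen_preimage.mem_nhds ⟨mem_extChartAt_source x₀, hx⟩,
        formOfRep V I x₀ Θ, ?_, ?_⟩
      · intro x hx
        obtain ⟨y, hy, rfl⟩ := hO.exists_symm_eq hx
        refine ContMDiffAt.contMDiffWithinAt ?_
        refine ((hO.tangent.hom (hO.hom hO)).contMDiffAt_section_iff hy).2 ?_
        exact (hΘ y hy).congr (fun z hz ↦ hO.formRep_formOfRep Θ hz) (hO.formRep_formOfRep Θ hy)
      · intro x hx v s
        obtain ⟨y, hy, rfl⟩ := hO.exists_symm_eq hx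
        obtain ⟨v, rfl⟩ := hO.tangent.fibreMap_surjective hy v
        obtain ⟨f, rfl⟩ := hO.fibreMap_surjective hy s
        rw [hj y hy v f, ← hO.formRep_formOfRep Θ hy, hO.fibreMap_formRep hy])
  exact ⟨k, k.contMDiff, hk⟩

end Gluing
end ConformalYangMills

/-! ### Dictionary between divisibility of the current on the manifold and in charts. -/

namespace ConformalYangMills

section CurrentForms

variable {d : ℕ} [NeZero d] {M : Type*} [TopologicalSpace M] [T2Space M]
  [ChartedSpace (EuclideanHalfSpace d) M] [IsManifold (𝓡∂ d) ∞ M]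
  {F : Type*} [NormedAddCommGroup F] [NormedSpace ℝ F] [FiniteDimensional ℝ F]
  {V : M → Type*} [TopologicalSpace (TotalSpace F V)]
  [∀ x, AddCommGroup (V x)] [∀ x, Module ℝ (V x)] [∀ x, TopologicalSpace (V x)]
  [∀ x, IsTopologicalAddGroup (V x)] [∀ x, ContinuousSMul ℝ (V x)]
  [FiberBundle F V] [VectorBundle ℝ F V] [ContMDiffVectorBundle ∞ F V (𝓡∂ d)]
  {x₀ : M} {O : Set (EuclideanSpace ℝ (Fin d))} {y : EuclideanSpace ℝ (Fin d)} {κ : ℕ}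

lemma covDerivCurvatureRep_add_right (g : Metric d M) (A : CovariantDerivative (𝓡∂ d) F V)
    (u v w w' : EuclideanSpace ℝ (Fin d)) : covDerivCurvatureRep g A x₀ O y u v (w + w') =
      covDerivCurvatureRep g A x₀ O y u v w + covDerivCurvatureRep g A x₀ O y u v w' := by
  simp only [covDerivCurvatureRep, map_add, christoffelRep_add_right, add_mul, mul_add]
  abel

lemma covDerivCurvatureRep_smul_right (g : Metric d M) (A : CovariantDerivative (𝓡∂ d) F V)
    (c : ℝ) (u v w : EuclideanSpace ℝ (Fin d)) : covDerivCurvatureRep g A x₀ O y u v (c • w) =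
      c • covDerivCurvatureRep g A x₀ O y u v w := by
  simp only [covDerivCurvatureRep, map_smul, christoffelRep_smul_right,
    smul_mul_assoc, mul_smul_comm, smul_add, smul_sub]

/-- The current depends linearly on the tangent vector. -/
lemma exists_linearMap_current_frame (hO : IsChartDomain (𝓡∂ d) F V x₀ O) (g : Metric d M)
    {A : CovariantDerivative (𝓡∂ d) F V} (hA : A.ContMDiffCovariantDerivative ∞) {r : M → ℝ}
    (hr : ContMDiff (𝓡∂ d) 𝓘(ℝ, ℝ) ∞ r) (hy : y ∈ O) (f : F) :
    ∃ L : EuclideanSpace ℝ (Fin d) →ₗ[ℝ] F, ∀ v,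
      current g r A _ (frame (𝓡∂ d) x₀ y v) (fibreMap (𝓡∂ d) F V x₀ y f) =
        fibreMap (𝓡∂ d) F V x₀ y (L v) := by
  have hr1 : MDifferentiableAt (𝓡∂ d) 𝓘(ℝ, ℝ) r ((extChartAt (𝓡∂ d) x₀).symm y) :=
    (hr _).mdifferentiableAt (by simp)
  refine ⟨{ toFun := fun v ↦ r ((extChartAt (𝓡∂ d) x₀).symm y) • (∑ i, ∑ j, inverseMetricRep g x₀ y i j •
        covDerivCurvatureRep g A x₀ O y (EuclideanSpace.single i 1)
          (EuclideanSpace.single j 1) v f) - ((d : ℝ) - 4) •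
          curvatureRep O (connectionForm A x₀) y (∑ i, ∑ j, (inverseMetricRep g x₀ y i j *
        fderivWithin ℝ (r ∘ (extChartAt (𝓡∂ d) x₀).symm) O y (EuclideanSpace.single j 1)) •
          EuclideanSpace.single i (1 : ℝ)) v f
            map_add' := fun v v' ↦ ?_
            map_smul' := fun c v ↦ ?_ }, fun v ↦ ?_⟩
  · simp only [covDerivCurvatureRep_add_right, map_add, add_apply, smul_add,
      Finset.sum_add_distrib]
    abel
  · simp only [covDerivCurvatureRep_smul_right, map_smul, smul_apply, RingHom.id_apply, smul_sub,
      Finset.smul_sum, smul_comm c]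
  · rw [current, divCurvature_frame hO g hA hy, gradient_eq hO.tangent g hy hr1,
      curvature_frame hO hA hy, ← map_smul, ← map_smul, ← map_sub]
    rfl

lemma sum_single (v : EuclideanSpace ℝ (Fin d)) :
    ∑ i, v i • EuclideanSpace.single i (1 : ℝ) = v := by
  have h := (EuclideanSpace.basisFun (Fin d) ℝ).sum_repr v
  simpa only [EuclideanSpace.basisFun_repr, EuclideanSpace.basisFun_apply] using h

/-- The endomorphism valued one-form with given components. -/
noncomputable def ofComponents (k : Fin d → SmoothFn O (F →L[ℝ] F)) (y : EuclideanSpace ℝ (Fin d)) :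
    EuclideanSpace ℝ (Fin d) →L[ℝ] F →L[ℝ] F :=
  ∑ i, (EuclideanSpace.proj i : EuclideanSpace ℝ (Fin d) →L[ℝ] ℝ).smulRight ((k i).extend y)

lemma ofComponents_apply (k : Fin d → SmoothFn O (F →L[ℝ] F)) (x : O)
    (v : EuclideanSpace ℝ (Fin d)) : ofComponents k x v = ∑ i, v i • (k i).1 x := by
  simp [ofComponents, SmoothFn.extend_apply]

lemma contDiffOn_ofComponents (k : Fin d → SmoothFn O (F →L[ℝ] F)) :
    ContDiffOn ℝ ∞ (ofComponents k) O := by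
  refine contDiffOn_clm_apply.2 fun v ↦ ?_
  simp only [ofComponents, sum_apply, ContinuousLinearMap.smulRight_apply]
  exact ContDiffOn.sum fun i _ ↦ (k i).contDiffOn_extend.const_smul _

/-- A function on `M` restricted to a chart domain. -/
noncomputable def coordFn (hO : IsChartDomain (𝓡∂ d) F V x₀ O) {r : M → ℝ}
    (hr : ContMDiff (𝓡∂ d) 𝓘(ℝ, ℝ) ∞ r) : SmoothFn O ℝ :=
  SmoothFn.mk _ (hO.contDiffOn_comp hr)

/-- The components of the current of a connection on a chart domain. -/
noncomputable abbrev coordCurrent (hO : IsChartDomain (𝓡∂ d) F V x₀ O) (g : Metric d M) (κ : ℕ)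
    {r : M → ℝ} (hr : ContMDiff (𝓡∂ d) 𝓘(ℝ, ℝ) ∞ r) {A : CovariantDerivative (𝓡∂ d) F V}
    (hA : A.ContMDiffCovariantDerivative ∞) (b : Fin d) : SmoothFn O (F →L[ℝ] F) :=
  (coordDerivatives F hO.tangent).lowerCurrent (metricMatrix hO.tangent g)
    (metricMatrix hO.tangent g)⁻¹ (coordFn hO hr) κ
    (components (hO.contDiffOn_connectionForm hA)) b

lemma SmoothFn.pow_smul_apply (r : SmoothFn O ℝ) (m : ℕ) (X : SmoothFn O (F →L[ℝ] F)) (x : O) :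
    (r ^ m • X).1 x = (r.1 x) ^ m • X.1 x := rfl

lemma coordCurrent_eq (hO : IsChartDomain (𝓡∂ d) F V x₀ O) (g : Metric d M) {r : M → ℝ}
    (hr : ContMDiff (𝓡∂ d) 𝓘(ℝ, ℝ) ∞ r) {A : CovariantDerivative (𝓡∂ d) F V}
    (hA : A.ContMDiffCovariantDerivative ∞) (hκ : κ + 4 = d) {m : ℕ}
    {k : Π x : M, TangentSpace (𝓡∂ d) x →L[ℝ] V x →L[ℝ] V x}
    (hk : ContDiffOn ℝ ∞ (formRep (𝓡∂ d) F x₀ k) O)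
    (h : ∀ x v s, current g r A x v s = r x ^ m • k x v s) (b : Fin d) :
    coordCurrent hO g κ hr hA b = coordFn hO hr ^ m • components hk b := by
  refine SmoothFn.ext fun x hx ↦ ContinuousLinearMap.ext fun f ↦ hO.fibreMap_injective hx ?_
  refine (current_frame hO g hA (hO.contDiffOn_connectionForm hA) hr (hO.contDiffOn_comp hr) hκ
    ⟨x, hx⟩ b f).symm.trans ?_
  rw [h, SmoothFn.pow_smul_apply, smul_apply, map_smul]
  exact congrArg _ (hO.fibreMap_formRep hx k _ f).symm

/-- Linearity in the tangent vector reduces the identity to basis vectors, where it is the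
hypothesis on components. -/
lemma current_frame_eq_ofComponents (hO : IsChartDomain (𝓡∂ d) F V x₀ O) (g : Metric d M)
    {r : M → ℝ} (hr : ContMDiff (𝓡∂ d) 𝓘(ℝ, ℝ) ∞ r) {A : CovariantDerivative (𝓡∂ d) F V}
    (hA : A.ContMDiffCovariantDerivative ∞) (hκ : κ + 4 = d) {m : ℕ}
    {k : Fin d → SmoothFn O (F →L[ℝ] F)}
    (h : ∀ b, coordCurrent hO g κ hr hA b = coordFn hO hr ^ m • k b) (hy : y ∈ O)
    (v : EuclideanSpace ℝ (Fin d)) (f : F) :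
    current g r A _ (frame (𝓡∂ d) x₀ y v) (fibreMap (𝓡∂ d) F V x₀ y f) =
      r ((extChartAt (𝓡∂ d) x₀).symm y) ^ m • fibreMap (𝓡∂ d) F V x₀ y (ofComponents k y v f) := by
  obtain ⟨L, hL⟩ := exists_linearMap_current_frame hO g hA hr hy f
  have h1 (b : Fin d) : L (EuclideanSpace.single b 1) =
      r ((extChartAt (𝓡∂ d) x₀).symm y) ^ m • (k b).1 ⟨y, hy⟩ f := by
    refine hO.fibreMap_injective hy ((hL _).symm.trans ((current_frame hO g hA
      (hO.contDiffOn_connectionForm hA) hr (hO.contDiffOn_comp hr) hκ ⟨y, hy⟩ b f).trans ?_))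
    exact congrArg (fun z : SmoothFn O (F →L[ℝ] F) ↦ fibreMap (𝓡∂ d) F V x₀ y (z.1 ⟨y, hy⟩ f)) (h b)
  rw [hL, ← map_smul]
  refine congrArg _ ?_
  conv_lhs => rw [← sum_single v]
  rw [ofComponents_apply k ⟨y, hy⟩]
  simp only [map_sum, map_smul, h1, sum_apply, smul_apply, Finset.smul_sum]
  exact Finset.sum_congr rfl fun i _ ↦ smul_comm _ _ _

variable [SigmaCompactSpace M]

/-- If the current is locally divisible by a power of `r`, it is globally divisible. -/
lemma exists_current_eq_of_local (g : Metric d M)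
    {r : M → ℝ} (hr : ContMDiff (𝓡∂ d) 𝓘(ℝ, ℝ) ∞ r) {A : CovariantDerivative (𝓡∂ d) F V}
    (hA : A.ContMDiffCovariantDerivative ∞) (hκ : κ + 4 = d) {m : ℕ}
    (h : ∀ x₀ : M, ∃ (O : _) (hO : IsChartDomain (𝓡∂ d) F V x₀ O), extChartAt (𝓡∂ d) x₀ x₀ ∈ O ∧
      ∃ k : Fin d → SmoothFn O (F →L[ℝ] F),
        ∀ b, coordCurrent hO g κ hr hA b = coordFn hO hr ^ m • k b) :
    ∃ k : Π x : M, TangentSpace (𝓡∂ d) x →L[ℝ] V x →L[ℝ] V x,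
      ContMDiff (𝓡∂ d) ((𝓡∂ d).prod 𝓘(ℝ, EuclideanSpace ℝ (Fin d) →L[ℝ] F →L[ℝ] F)) ∞
        (fun x ↦ TotalSpace.mk' (EuclideanSpace ℝ (Fin d) →L[ℝ] F →L[ℝ] F) x (k x)) ∧
      ∀ x v s, current g r A x v s = r x ^ m • k x v s := by
  refine exists_form_of_local (fun x ↦ r x ^ m) _ fun x₀ ↦ ?_
  obtain ⟨O, hO, hx, k, hk⟩ := h x₀
  exact ⟨O, hO, hx, ofComponents k, contDiffOn_ofComponents k, fun y hy v f ↦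
    current_frame_eq_ofComponents hO g hr hA hκ hk hy v f⟩

end CurrentForms
end ConformalYangMills

/-! ### Boundary points in charts. -/

namespace ConformalYangMills

section Boundary

variable {d : ℕ} [NeZero d] {M : Type*} [TopologicalSpace M]
  [ChartedSpace (EuclideanHalfSpace d) M] [IsManifold (𝓡∂ d) ∞ M]
  {F : Type*} [NormedAddCommGroup F] [NormedSpace ℝ F]
  {V : M → Type*} [TopologicalSpace (TotalSpace F V)]
  [∀ x, AddCommGroup (V x)] [∀ x, Module ℝ (V x)] [∀ x, TopologicalSpace (V x)]
  [FiberBundle F V] [VectorBundle ℝ F V]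
  {x₀ : M} {O : Set (EuclideanSpace ℝ (Fin d))} {y : EuclideanSpace ℝ (Fin d)}

/-- Whether a point is interior can be decided in any chart around it, not only in the preferred one
at the point. -/
lemma IsChartDomain.symm_mem_boundary_iff (hO : IsChartDomain (𝓡∂ d) F V x₀ O) (hy : y ∈ O) :
    (extChartAt (𝓡∂ d) x₀).symm y ∈ (𝓡∂ d).boundary M ↔ y 0 = 0 := by
  have h1 : (𝓡∂ d).IsInteriorPoint ((extChartAt (𝓡∂ d) x₀).symm y) ↔
      y ∈ interior (extChartAt (𝓡∂ d) x₀).target := by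
    have := (𝓡∂ d).isInteriorPoint_iff_of_mem_atlas (n := ∞) (by simp)
      (chart_mem_atlas (EuclideanHalfSpace d) x₀) (hO.symm_mem_source hy)
    change _ ↔ extChartAt (𝓡∂ d) x₀ ((extChartAt (𝓡∂ d) x₀).symm y) ∈ _ at this
    rwa [hO.right_inv hy] at this
  have h2 : y ∈ interior (extChartAt (𝓡∂ d) x₀).target ↔ y ∈ interior (range (𝓡∂ d)) := by
    refine ⟨fun h ↦ interior_mono (extChartAt_target_subset_range x₀) h, fun h ↦ ?_⟩
    rw [mem_interior_iff_mem_nhds] at h ⊢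
    exact nhdsWithin_le_of_mem (mem_nhdsWithin_of_mem_nhds h)
      (extChartAt_target_mem_nhdsWithin_of_mem (hO.mem_target y hy)) |> fun h' ↦ by
        rwa [nhdsWithin_eq_nhds.2 h] at h'
  have h3 : 0 ≤ y 0 := by
    have := hO.subset_range hy
    rwa [range_modelWithCornersEuclideanHalfSpace] at this
  rw [← not_iff_not, ← mem_compl_iff, ModelWithCorners.compl_boundary]
  refine h1.trans (h2.trans ?_)
  rw [interior_range_modelWithCornersEuclideanHalfSpace]
  exact ⟨fun h ↦ ne_of_gt h, fun h ↦ lt_of_le_of_ne h3 (Ne.symm h)⟩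

end Boundary

/-! ### A smooth substitute for the inverse of |dr|². -/

section NormSq

variable {d : ℕ} [NeZero d] {M : Type*} [TopologicalSpace M]
  [ChartedSpace (EuclideanHalfSpace d) M] [IsManifold (𝓡∂ d) ∞ M]
  {F : Type*} [NormedAddCommGroup F] [NormedSpace ℝ F] [FiniteDimensional ℝ F]
  {V : M → Type*} [TopologicalSpace (TotalSpace F V)]
  [∀ x, AddCommGroup (V x)] [∀ x, Module ℝ (V x)] [∀ x, TopologicalSpace (V x)]
  [∀ x, IsTopologicalAddGroup (V x)] [∀ x, ContinuousSMul ℝ (V x)]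
  [FiberBundle F V] [VectorBundle ℝ F V] [ContMDiffVectorBundle ∞ F V (𝓡∂ d)]
  {x₀ : M} {O : Set (EuclideanSpace ℝ (Fin d))} {y : EuclideanSpace ℝ (Fin d)}

/-- The squared norm of the differential of a function. -/
noncomputable def gradientNormSq (g : Metric d M) (r : M → ℝ) (x : M) : ℝ :=
  dirDeriv r x (gradient g r x)

lemma gradientNormSq_pos (g : Metric d M) {r : M → ℝ} {x : M}
    (h : mfderiv (𝓡∂ d) 𝓘(ℝ, ℝ) r x ≠ 0) : 0 < gradientNormSq g r x := by
  rw [gradientNormSq, ← inner_gradient g]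
  refine g.pos x _ fun h0 ↦ h (ContinuousLinearMap.ext fun w ↦ ?_)
  have := inner_gradient g r x w
  rw [h0, map_zero] at this
  exact this.symm

lemma normSq_coordFn (hO : IsChartDomain (𝓡∂ d) F V x₀ O) (g : Metric d M) {r : M → ℝ}
    (hr : ContMDiff (𝓡∂ d) 𝓘(ℝ, ℝ) ∞ r) (x : O) :
    ((coordDerivatives F hO.tangent).normSq (metricMatrix hO.tangent g)⁻¹ (coordFn hO hr)).1 x =
      gradientNormSq g r ((extChartAt (𝓡∂ d) x₀).symm x) := by
  have hr1 : MDifferentiableAt (𝓡∂ d) 𝓘(ℝ, ℝ) r ((extChartAt (𝓡∂ d) x₀).symm x) :=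
    (hr _).mdifferentiableAt (by simp)
  have h2 (c : Fin d) : ((coordDerivatives F hO.tangent).dR c (coordFn hO hr)).1 x =
      fderivWithin ℝ (r ∘ (extChartAt (𝓡∂ d) x₀).symm) O x (EuclideanSpace.single c 1) :=
    coordDerivatives_dR_mk hO.tangent c _ _ x
  rw [gradientNormSq, gradient_eq hO.tangent g x.2 hr1]
  refine Eq.trans ?_ (hO.mfderiv_frame x.2 hr1 _).symm
  rw [PartialDerivatives.normSq, ← SmoothFn.eval_apply]
  simp only [map_sum, map_mul, map_smul, SmoothFn.eval_apply, h2, metricMatrix_inv_apply,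
    Finset.mul_sum, smul_eq_mul]
  exact Finset.sum_congr rfl fun i _ ↦ Finset.sum_congr rfl fun j _ ↦ by ring

lemma contMDiff_gradientNormSq (g : Metric d M) {r : M → ℝ}
    (hr : ContMDiff (𝓡∂ d) 𝓘(ℝ, ℝ) ∞ r) :
    ContMDiff (𝓡∂ d) 𝓘(ℝ, ℝ) ∞ (gradientNormSq g r) := fun x₀ ↦ by
  have hO := IsChartDomain.maximal (𝓡∂ d) (EuclideanSpace ℝ (Fin d))
    (fun x : M ↦ TangentSpace (𝓡∂ d) x) x₀
  have hx := IsChartDomain.mem_maximal (𝓡∂ d) (EuclideanSpace ℝ (Fin d))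
    (fun x : M ↦ TangentSpace (𝓡∂ d) x) x₀
  rw [← extChartAt_to_inv (I := 𝓡∂ d) x₀]
  refine (hO.contMDiffAt_iff hx).2 ?_
  refine (((coordDerivatives (EuclideanSpace ℝ (Fin d)) hO.tangent).normSq
    (metricMatrix hO.tangent g)⁻¹ (coordFn hO hr)).contDiffOn_extend _ hx).congr_of_mem
    (fun z hz ↦ ?_) hx
  rw [SmoothFn.extend_of_mem _ hz, normSq_coordFn hO g hr ⟨z, hz⟩]
  rfl

/-- A smooth function which is inverse to the squared norm of `dr` along the zero set of `r`. -/
noncomputable def inverseNormSq (g : Metric d M) (r : M → ℝ) (x : M) : ℝ :=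
  gradientNormSq g r x / (gradientNormSq g r x ^ 2 + r x ^ 2)

/-- The differential dr may vanish away from the boundary, but r does not vanish there; so this
denominator is safe everywhere, unlike |dr|² alone. -/
lemma sq_add_sq_ne_zero (g : Metric d M) {r : M → ℝ}
    (hdr : ∀ x, r x = 0 → mfderiv (𝓡∂ d) 𝓘(ℝ, ℝ) r x ≠ 0) (x : M) :
    gradientNormSq g r x ^ 2 + r x ^ 2 ≠ 0 := by
  by_cases h : r x = 0
  · have := gradientNormSq_pos g (hdr x h)
    positivity
  · positivity

lemma contMDiff_inverseNormSq (g : Metric d M) {r : M → ℝ}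
    (hr : ContMDiff (𝓡∂ d) 𝓘(ℝ, ℝ) ∞ r)
    (hdr : ∀ x, r x = 0 → mfderiv (𝓡∂ d) 𝓘(ℝ, ℝ) r x ≠ 0) :
    ContMDiff (𝓡∂ d) 𝓘(ℝ, ℝ) ∞ (inverseNormSq g r) := by
  have h := contMDiff_gradientNormSq g hr
  exact h.div₀ ((h.pow 2).add (hr.pow 2)) (sq_add_sq_ne_zero g hdr)

lemma exists_inverseNormSq_mul (hO : IsChartDomain (𝓡∂ d) F V x₀ O) (g : Metric d M) {r : M → ℝ}
    (hr : ContMDiff (𝓡∂ d) 𝓘(ℝ, ℝ) ∞ r)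
    (hdr : ∀ x, r x = 0 → mfderiv (𝓡∂ d) 𝓘(ℝ, ℝ) r x ≠ 0) :
    ∃ ψ, coordFn hO (contMDiff_inverseNormSq g hr hdr) *
      (coordDerivatives F hO.tangent).normSq (metricMatrix hO.tangent g)⁻¹ (coordFn hO hr) =
      1 + coordFn hO hr * ψ := by
  have h := contMDiff_gradientNormSq g hr
  -- With N = |dr|², N²/(N² + r²) = 1 - r · r/(N² + r²).
  refine ⟨coordFn hO (r := fun x ↦ -r x / (gradientNormSq g r x ^ 2 + r x ^ 2))
    (hr.neg.div₀ ((h.pow 2).add (hr.pow 2)) (sq_add_sq_ne_zero g hdr)),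
    SmoothFn.ext fun x hx ↦ ?_⟩
  rw [← SmoothFn.eval_apply, ← SmoothFn.eval_apply, map_mul, map_add, map_mul, map_one]
  simp only [SmoothFn.eval_apply, normSq_coordFn hO g hr]
  set p := (extChartAt (𝓡∂ d) x₀).symm x
  have h1 := sq_add_sq_ne_zero g hdr p
  change gradientNormSq g r p / (gradientNormSq g r p ^ 2 + r p ^ 2) * gradientNormSq g r p =
    1 + r p * (-r p / (gradientNormSq g r p ^ 2 + r p ^ 2))
  field_simp
  ring

end NormSq
end ConformalYangMills

/-! ### Changing a connection by a form, and the induction on the order of vanishing. -/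

namespace ConformalYangMills

section AddForm

variable {E : Type*} [NormedAddCommGroup E] [NormedSpace ℝ E]
  {H : Type*} [TopologicalSpace H]
  {I : ModelWithCorners ℝ E H} {M : Type*} [TopologicalSpace M] [ChartedSpace H M]
  {F : Type*} [NormedAddCommGroup F] [NormedSpace ℝ F]
  {V : M → Type*} [TopologicalSpace (TotalSpace F V)]
  [∀ x, AddCommGroup (V x)] [∀ x, Module ℝ (V x)] [∀ x, TopologicalSpace (V x)]
  [∀ x, IsTopologicalAddGroup (V x)] [∀ x, ContinuousSMul ℝ (V x)]
  [FiberBundle F V]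

/-- The value of an endomorphism valued form at an element of the fibre. -/
noncomputable def evalForm {x : M} (T : TangentSpace I x →L[ℝ] V x →L[ℝ] V x) (s : V x) :
    TangentSpace I x →L[ℝ] V x where
  toFun u := T u s
  map_add' u u' := by rw [map_add, add_apply]
  map_smul' c u := by rw [map_smul, smul_apply, RingHom.id_apply]
  cont := (continuous_eval_const s).comp T.continuous

lemma evalForm_add {x : M} (T : TangentSpace I x →L[ℝ] V x →L[ℝ] V x) (s s' : V x) :
    evalForm T (s + s') = evalForm T s + evalForm T s' :=
  ContinuousLinearMap.ext fun u ↦ map_add (T u) s s'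

lemma evalForm_smul {x : M} (T : TangentSpace I x →L[ℝ] V x →L[ℝ] V x) (c : ℝ) (s : V x) :
    evalForm T (c • s) = c • evalForm T s :=
  ContinuousLinearMap.ext fun u ↦ map_smul (T u) c s

/-- The sum of a covariant derivative and an endomorphism valued one-form. -/
noncomputable def addForm (A : CovariantDerivative I F V) (k : Π x : M, TangentSpace I x →L[ℝ] V x →L[ℝ] V x) :
    CovariantDerivative I F V where
  toFun s x := A s x + evalForm (k x) (s x)
  isCovariantDerivativeOnUniv :=
    { add := fun {s s' x} hs hs' _ ↦ by
        rw [A.isCovariantDerivativeOnUniv.add hs hs', Pi.add_apply, evalForm_add]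
        abel
      leibniz := fun {s f x} hs hf _ ↦ by
        rw [A.isCovariantDerivativeOnUniv.leibniz hs hf, Pi.smul_apply', evalForm_smul, smul_add]
        abel }

lemma addForm_apply (A : CovariantDerivative I F V)
    (k : Π x : M, TangentSpace I x →L[ℝ] V x →L[ℝ] V x) (s : Π x, V x) (x : M)
    (u : TangentSpace I x) : addForm A k s x u = A s x u + k x u (s x) := rfl

end AddForm

section Step

variable {d : ℕ} [NeZero d] {M : Type*} [TopologicalSpace M] [T2Space M]
  [ChartedSpace (EuclideanHalfSpace d) M] [IsManifold (𝓡∂ d) ∞ M]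
  {F : Type*} [NormedAddCommGroup F] [NormedSpace ℝ F] [FiniteDimensional ℝ F]
  {V : M → Type*} [TopologicalSpace (TotalSpace F V)]
  [∀ x, AddCommGroup (V x)] [∀ x, Module ℝ (V x)] [∀ x, TopologicalSpace (V x)]
  [∀ x, IsTopologicalAddGroup (V x)] [∀ x, ContinuousSMul ℝ (V x)]
  [FiberBundle F V] [VectorBundle ℝ F V] [ContMDiffVectorBundle ∞ F V (𝓡∂ d)]
  {κ : ℕ}

set_option synthInstance.maxHeartbeats 200000 in
lemma formRep_smul (x₀ : M) (f : M → ℝ) (k : Π x : M, TangentSpace (𝓡∂ d) x →L[ℝ] V x →L[ℝ] V x)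
    (y : EuclideanSpace ℝ (Fin d)) : formRep (𝓡∂ d) F x₀ (fun x ↦ f x • k x) y =
      f ((extChartAt (𝓡∂ d) x₀).symm y) • formRep (𝓡∂ d) F x₀ k y :=
  localRep_smul (F := EuclideanSpace ℝ (Fin d) →L[ℝ] F →L[ℝ] F)
    (V := fun x ↦ TangentSpace (𝓡∂ d) x →L[ℝ] V x →L[ℝ] V x) x₀ f k y

set_option synthInstance.maxHeartbeats 200000 in
set_option maxSynthPendingDepth 5 in
lemma contDiffOn_formRep_smul {x₀ : M} {O : Set (EuclideanSpace ℝ (Fin d))}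
    (hO : IsChartDomain (𝓡∂ d) F V x₀ O) {f : M → ℝ} (hf : ContMDiff (𝓡∂ d) 𝓘(ℝ, ℝ) ∞ f)
    {k : Π x : M, TangentSpace (𝓡∂ d) x →L[ℝ] V x →L[ℝ] V x}
    (hk : ContDiffOn ℝ ∞ (formRep (𝓡∂ d) F x₀ k) O) :
    ContDiffOn ℝ ∞ (formRep (𝓡∂ d) F x₀ (fun x ↦ f x • k x)) O := by
  have h := (hO.contDiffOn_comp hf).smul hk
  exact h.congr fun y _ ↦ formRep_smul x₀ f k y

lemma contMDiffCovariantDerivative_addForm {A : CovariantDerivative (𝓡∂ d) F V}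
    (hA : A.ContMDiffCovariantDerivative ∞)
    {k : Π x : M, TangentSpace (𝓡∂ d) x →L[ℝ] V x →L[ℝ] V x}
    (hk : ∀ x₀ O, IsChartDomain (𝓡∂ d) F V x₀ O → ContDiffOn ℝ ∞ (formRep (𝓡∂ d) F x₀ k) O) :
    (addForm A k).ContMDiffCovariantDerivative ∞ := by
  refine contMDiffCovariantDerivative_of_connectionForm fun x₀ ↦
    ⟨_, IsChartDomain.maximal (𝓡∂ d) F V x₀, IsChartDomain.mem_maximal (𝓡∂ d) F V x₀, ?_⟩
  have hO := IsChartDomain.maximal (𝓡∂ d) F V x₀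
  exact ((hO.contDiffOn_connectionForm hA).add (hk _ _ hO)).congr fun y hy ↦
    hO.connectionForm_eq_add (fun s x _ u ↦ addForm_apply A k s x u) hy

variable [SigmaCompactSpace M]

/-- Start of the induction. The exponent is 0, so the content is that the current is given by a
smooth endomorphism valued form. -/
lemma exists_current_eq (g : Metric d M)
    {r : M → ℝ} (hr : ContMDiff (𝓡∂ d) 𝓘(ℝ, ℝ) ∞ r) {A : CovariantDerivative (𝓡∂ d) F V}
    (hA : A.ContMDiffCovariantDerivative ∞) (hκ : κ + 4 = d) :
    ∃ k : Π x : M, TangentSpace (𝓡∂ d) x →L[ℝ] V x →L[ℝ] V x,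
      ContMDiff (𝓡∂ d) ((𝓡∂ d).prod 𝓘(ℝ, EuclideanSpace ℝ (Fin d) →L[ℝ] F →L[ℝ] F)) ∞
        (fun x ↦ TotalSpace.mk' (EuclideanSpace ℝ (Fin d) →L[ℝ] F →L[ℝ] F) x (k x)) ∧
      ∀ x v s, current g r A x v s = r x ^ 0 • k x v s :=
  exists_current_eq_of_local g hr hA hκ fun x₀ ↦
    ⟨_, IsChartDomain.maximal (𝓡∂ d) F V x₀, IsChartDomain.mem_maximal (𝓡∂ d) F V x₀, _,
      fun b ↦ by rw [pow_zero, one_smul]⟩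

/-- A connection whose current is divisible by `r ^ m` can be modified away from the zero set of `r`
such that its current is divisible by `r ^ (m + 1)`. -/
lemma exists_current_eq_pow_succ (g : Metric d M)
    {r : M → ℝ} (hr : ContMDiff (𝓡∂ d) 𝓘(ℝ, ℝ) ∞ r)
    (hr0 : ∀ x, r x = 0 ↔ x ∈ (𝓡∂ d).boundary M)
    (hdr : ∀ x, r x = 0 → mfderiv (𝓡∂ d) 𝓘(ℝ, ℝ) r x ≠ 0) {A : CovariantDerivative (𝓡∂ d) F V}
    (hA : A.ContMDiffCovariantDerivative ∞) (hκ : κ + 4 = d) {m : ℕ} (hm : m < κ)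
    {k : Π x : M, TangentSpace (𝓡∂ d) x →L[ℝ] V x →L[ℝ] V x}
    (hk : ContMDiff (𝓡∂ d) ((𝓡∂ d).prod 𝓘(ℝ, EuclideanSpace ℝ (Fin d) →L[ℝ] F →L[ℝ] F)) ∞
        (fun x ↦ TotalSpace.mk' (EuclideanSpace ℝ (Fin d) →L[ℝ] F →L[ℝ] F) x (k x)))
    (hj : ∀ x v s, current g r A x v s = r x ^ m • k x v s) :
    ∃ (A' : CovariantDerivative (𝓡∂ d) F V)
      (k' : Π x : M, TangentSpace (𝓡∂ d) x →L[ℝ] V x →L[ℝ] V x),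
      A'.ContMDiffCovariantDerivative ∞ ∧ (∀ s x, r x = 0 → A' s x = A s x) ∧
      ContMDiff (𝓡∂ d) ((𝓡∂ d).prod 𝓘(ℝ, EuclideanSpace ℝ (Fin d) →L[ℝ] F →L[ℝ] F)) ∞
        (fun x ↦ TotalSpace.mk' (EuclideanSpace ℝ (Fin d) →L[ℝ] F →L[ℝ] F) x (k' x)) ∧
      ∀ x v s, current g r A' x v s = r x ^ (m + 1) • k' x v s := by
  set φ := inverseNormSq g r with hφdef
  have hφ : ContMDiff (𝓡∂ d) 𝓘(ℝ, ℝ) ∞ φ := contMDiff_inverseNormSq g hr hdr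
  -- The factor prescribed by the algebraic step, as a global function, so that the corrected
  -- connection is defined globally. It vanishes with r, which preserves the boundary condition.
  set f : M → ℝ := fun x ↦ r x ^ (m + 1) * (-1 / (((m : ℝ) + 1) * (m - κ)) * φ x) with hfdef
  have hf : ContMDiff (𝓡∂ d) 𝓘(ℝ, ℝ) ∞ f := (hr.pow (m + 1)).mul (contMDiff_const.mul hφ)
  have hA' : (addForm A fun x ↦ f x • k x).ContMDiffCovariantDerivative ∞ :=
    contMDiffCovariantDerivative_addForm hA fun x₀ O hO ↦
      contDiffOn_formRep_smul hO hf (hO.contDiffOn_formRep hk)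
  obtain ⟨k', hk', hj'⟩ := exists_current_eq_of_local (m := m + 1) g hr hA' hκ fun x₀ ↦ by
    obtain ⟨ε, hε, hO⟩ := exists_isChartDomain_halfBall (d := d) (F := F) (V := V) x₀
    refine ⟨_, hO, ?_, ?_⟩
    · rw [mem_halfBall]
      refine ⟨?_, Metric.mem_ball_self hε⟩
      have := extChartAt_target_subset_range (I := 𝓡∂ d) x₀ (mem_extChartAt_target (I := 𝓡∂ d) x₀)
      rwa [range_modelWithCornersEuclideanHalfSpace] at this
    obtain ⟨ψ, hψ⟩ := exists_inverseNormSq_mul hO g hr hdr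
    have hr1 (y : halfBall (extChartAt (𝓡∂ d) x₀ x₀) ε) :
        (coordFn hO hr).1 y = 0 ↔ y.1 0 = 0 :=
      (hr0 _).trans (hO.symm_mem_boundary_iff y.2)
    refine PartialDerivatives.exists_lowerCurrent_eq_pow_succ
      (coordDerivatives F hO.tangent) (isSymm_metricMatrix hO.tangent g)
      (metricMatrix_mul_inv hO.tangent g) (SmoothFn.eq_zero_of_smul_eq_zero hr1) hm
      (coordCurrent_eq hO g hr hA hκ (hO.contDiffOn_formRep hk) hj) hψ fun i ↦ ?_
    refine SmoothFn.ext fun y hy ↦ ?_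
    refine (congrArg (fun T : EuclideanSpace ℝ (Fin d) →L[ℝ] F →L[ℝ] F ↦
      T (EuclideanSpace.single i 1)) (hO.connectionForm_eq_add
        (fun s x _ u ↦ addForm_apply A _ s x u) hy)).trans ?_
    rw [add_apply]
    refine congrArg (fun z ↦ _ + z) ?_
    refine (congrArg (fun T : EuclideanSpace ℝ (Fin d) →L[ℝ] F →L[ℝ] F ↦
      T (EuclideanSpace.single i 1)) (formRep_smul x₀ f k y)).trans ?_
    rw [smul_apply, hfdef, mul_smul]
    rfl
  refine ⟨_, k', hA', fun s x hx ↦ ContinuousLinearMap.ext fun u ↦ ?_, hk', hj'⟩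
  rw [addForm_apply, smul_apply, smul_apply]
  have : f x = 0 := by rw [hfdef]; simp [hx]
  rw [this, zero_smul, add_zero]

/-- Every smooth connection can be modified away from the zero set of `r` such that its current is
divisible by `r ^ (d - 4)`. -/
lemma exists_current_eq_pow (g : Metric d M)
    {r : M → ℝ} (hr : ContMDiff (𝓡∂ d) 𝓘(ℝ, ℝ) ∞ r)
    (hr0 : ∀ x, r x = 0 ↔ x ∈ (𝓡∂ d).boundary M)
    (hdr : ∀ x, r x = 0 → mfderiv (𝓡∂ d) 𝓘(ℝ, ℝ) r x ≠ 0) {A : CovariantDerivative (𝓡∂ d) F V}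
    (hA : A.ContMDiffCovariantDerivative ∞) (hκ : κ + 4 = d) :
    ∃ (A' : CovariantDerivative (𝓡∂ d) F V)
      (k' : Π x : M, TangentSpace (𝓡∂ d) x →L[ℝ] V x →L[ℝ] V x),
      A'.ContMDiffCovariantDerivative ∞ ∧ (∀ s x, r x = 0 → A' s x = A s x) ∧
      ContMDiff (𝓡∂ d) ((𝓡∂ d).prod 𝓘(ℝ, EuclideanSpace ℝ (Fin d) →L[ℝ] F →L[ℝ] F)) ∞
        (fun x ↦ TotalSpace.mk' (EuclideanSpace ℝ (Fin d) →L[ℝ] F →L[ℝ] F) x (k' x)) ∧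
      ∀ x v s, current g r A' x v s = r x ^ κ • k' x v s := by
  suffices h : ∀ m ≤ κ, ∃ (A' : CovariantDerivative (𝓡∂ d) F V)
      (k' : Π x : M, TangentSpace (𝓡∂ d) x →L[ℝ] V x →L[ℝ] V x),
      A'.ContMDiffCovariantDerivative ∞ ∧ (∀ s x, r x = 0 → A' s x = A s x) ∧
      ContMDiff (𝓡∂ d) ((𝓡∂ d).prod 𝓘(ℝ, EuclideanSpace ℝ (Fin d) →L[ℝ] F →L[ℝ] F)) ∞
        (fun x ↦ TotalSpace.mk' (EuclideanSpace ℝ (Fin d) →L[ℝ] F →L[ℝ] F) x (k' x)) ∧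
      ∀ x v s, current g r A' x v s = r x ^ m • k' x v s from h κ le_rfl
  intro m
  induction m with
  | zero =>
    intro _
    obtain ⟨k, hk, hj⟩ := exists_current_eq g hr hA hκ
    exact ⟨A, k, hA, fun _ _ _ ↦ rfl, hk, hj⟩
  | succ m ih =>
    intro hm
    obtain ⟨A₁, k₁, hA₁, hAA₁, hk₁, hj₁⟩ := ih (Nat.le_of_succ_le hm)
    obtain ⟨A', k', hA', hAA', hk', hj'⟩ :=
      exists_current_eq_pow_succ g hr hr0 hdr hA₁ hκ (Nat.lt_of_succ_le hm) hk₁ hj₁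
    exact ⟨A', k', hA', fun s x hx ↦ (hAA' s x hx).trans (hAA₁ s x hx), hk', hj'⟩

end Step
end ConformalYangMills

/-! ### Conformal rescaling and the weight of the coefficient. -/

namespace ConformalYangMills

section Rescaling

variable {d : ℕ} [NeZero d] {M : Type*} [TopologicalSpace M]
  [ChartedSpace (EuclideanHalfSpace d) M] [IsManifold (𝓡∂ d) ∞ M]

/-- Positivity of the factors allows the square root to be taken. Chosen factors relative to a fixed
metric are then automatically multiplicative. -/
lemma IsRescaling.unique {Ω Ω' : M → ℝ} {g g' : Metric d M} (h : IsRescaling Ω g g')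
    (h' : IsRescaling Ω' g g') : Ω = Ω' := by
  funext x
  set v : TangentSpace (𝓡∂ d) x := tangentBasis x 0
  have hv : v ≠ 0 := by
    have : tangentBasisBasis (d := d) x 0 = v := congrFun (coe_tangentBasisBasis x) 0
    rw [← this]
    exact (tangentBasisBasis x).ne_zero 0
  have h1 := (h.eq x v v).symm.trans (h'.eq x v v)
  have h2 := mul_right_cancel₀ (g.pos x v hv).ne' h1
  exact (pow_left_inj₀ (h.pos x).le (h'.pos x).le two_ne_zero).1 h2

lemma IsRescaling.comp {Ω Ω' : M → ℝ} {g g' g'' : Metric d M} (h : IsRescaling Ω g g')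
    (h' : IsRescaling Ω' g' g'') : IsRescaling (fun x ↦ Ω' x * Ω x) g g'' where
  smooth := h'.smooth.mul h.smooth
  pos x := mul_pos (h'.pos x) (h.pos x)
  eq x v w := by rw [h'.eq, h.eq]; ring

variable {F : Type*} [NormedAddCommGroup F] [NormedSpace ℝ F] [FiniteDimensional ℝ F]
  {V : M → Type*} [TopologicalSpace (TotalSpace F V)]
  [∀ x, AddCommGroup (V x)] [∀ x, Module ℝ (V x)] [∀ x, TopologicalSpace (V x)]
  [∀ x, IsTopologicalAddGroup (V x)] [∀ x, ContinuousSMul ℝ (V x)]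
  [FiberBundle F V] [VectorBundle ℝ F V] [ContMDiffVectorBundle ∞ F V (𝓡∂ d)]
  {x₀ : M} {O : Set (EuclideanSpace ℝ (Fin d))} {κ : ℕ}

variable (F V) in
lemma exists_isChartDomain_symm_eq (x : M) : ∃ (x₀ : M) (O : Set (EuclideanSpace ℝ (Fin d)))
    (y : EuclideanSpace ℝ (Fin d)), IsChartDomain (𝓡∂ d) F V x₀ O ∧ y ∈ O ∧
      x = (extChartAt (𝓡∂ d) x₀).symm y :=
  ⟨x, _, _, IsChartDomain.maximal (𝓡∂ d) F V x, IsChartDomain.mem_maximal (𝓡∂ d) F V x,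
    (extChartAt_to_inv x).symm⟩

lemma metricMatrix_rescaling (hO : IsChartDomain (𝓡∂ d) F V x₀ O) {Ω : M → ℝ} {g g' : Metric d M}
    (h : IsRescaling Ω g g') :
    metricMatrix hO.tangent g' = coordFn hO h.smooth ^ 2 • metricMatrix hO.tangent g := by
  ext i j : 1
  refine SmoothFn.ext fun x hx ↦ ?_
  change metricRep g' x₀ x _ _ = (Ω ((extChartAt (𝓡∂ d) x₀).symm x)) ^ 2 * metricRep g x₀ x _ _
  rw [metricRep_apply hO.tangent g' hx, metricRep_apply hO.tangent g hx]
  exact h.eq _ _ _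

variable [T2Space M]

/-- The conformal covariance of the current. -/
lemma current_rescaling {Ω : M → ℝ} {g g' : Metric d M}
    (h : IsRescaling Ω g g') {r r' : M → ℝ} (hr : ContMDiff (𝓡∂ d) 𝓘(ℝ, ℝ) ∞ r)
    (hr' : ∀ x, r' x = Ω x * r x) {A : CovariantDerivative (𝓡∂ d) F V}
    (hA : A.ContMDiffCovariantDerivative ∞) (hκ : κ + 4 = d) (x : M)
    (v : TangentSpace (𝓡∂ d) x) (s : V x) :
    current g' r' A x v s = (Ω x)⁻¹ • current g r A x v s := by
  obtain rfl : r' = fun x ↦ Ω x * r x := funext hr'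
  have hr'' : ContMDiff (𝓡∂ d) 𝓘(ℝ, ℝ) ∞ (fun x ↦ Ω x * r x) := h.smooth.mul hr
  have hinv : ContMDiff (𝓡∂ d) 𝓘(ℝ, ℝ) ∞ (fun x ↦ (Ω x)⁻¹) :=
    h.smooth.inv₀ fun x ↦ (h.pos x).ne'
  obtain ⟨x₀, O, y, hO, hy, rfl⟩ := exists_isChartDomain_symm_eq (d := d) F V x
  set w := coordFn hO hinv with hw
  have hwΩ : w * coordFn hO h.smooth = 1 := SmoothFn.ext fun z hz ↦
    inv_mul_cancel₀ (h.pos _).ne'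
  have hG : (metricMatrix hO.tangent g')⁻¹ = w ^ 2 • (metricMatrix hO.tangent g)⁻¹ := by
    refine Matrix.inv_eq_right_inv ?_
    rw [metricMatrix_rescaling hO h, Matrix.smul_mul, Matrix.mul_smul,
      metricMatrix_mul_inv, smul_smul, ← mul_pow, mul_comm, hwΩ, one_pow, one_smul]
  -- The algebraic covariance requires κ + 4 to be the number of coordinates; this is where the
  -- dimension enters the conformal weight.
  have key (b : Fin d) : coordCurrent hO g' κ hr'' hA b = w • coordCurrent hO g κ hr hA b := by
    have := (coordDerivatives F hO.tangent).lowerCurrent_conformal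
      (isSymm_metricMatrix hO.tangent g) (metricMatrix_mul_inv hO.tangent g) (coordFn hO hr)
      (κ := κ) (by rw [Fintype.card_fin]; exact hκ) (components (hO.contDiffOn_connectionForm hA))
      hwΩ b
    rw [← hG, ← metricMatrix_rescaling hO h] at this
    exact this
  obtain ⟨v, rfl⟩ := hO.tangent.fibreMap_surjective hy v
  obtain ⟨f, rfl⟩ := hO.fibreMap_surjective hy s
  obtain ⟨L, hL⟩ := exists_linearMap_current_frame hO g hA hr hy f
  obtain ⟨L', hL'⟩ := exists_linearMap_current_frame hO g' hA hr'' hy f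
  have h1 (b : Fin d) : L' (EuclideanSpace.single b 1) =
      (Ω ((extChartAt (𝓡∂ d) x₀).symm y))⁻¹ • L (EuclideanSpace.single b 1) := by
    refine hO.fibreMap_injective hy ?_
    rw [map_smul, ← hL, ← hL']
    have e1 := current_frame hO g hA (hO.contDiffOn_connectionForm hA) hr (hO.contDiffOn_comp hr)
      hκ ⟨y, hy⟩ b f
    have e2 := current_frame hO g' hA (hO.contDiffOn_connectionForm hA) hr''
      (hO.contDiffOn_comp hr'') hκ ⟨y, hy⟩ b f
    refine e2.trans (Eq.trans ?_ (congrArg _ e1.symm))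
    rw [← map_smul]
    exact congrArg (fun z : SmoothFn O (F →L[ℝ] F) ↦ fibreMap (𝓡∂ d) F V x₀ y (z.1 ⟨y, hy⟩ f))
      (key b)
  rw [hL, hL', ← map_smul]
  refine congrArg _ ?_
  rw [← sum_single v]
  simp only [map_sum, map_smul, h1, Finset.smul_sum]
  exact Finset.sum_congr rfl fun i _ ↦ smul_comm _ _ _

variable [SigmaCompactSpace M]

/-- A smooth connection whose current vanishes to order `d - 4` in one scale is asymptotically
Yang-Mills. -/
lemma exists_isAsymptoticallyYangMills {c : ConformalClass d M} (σ : Density c 1) (g : c.metrics)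
    {A : CovariantDerivative (𝓡∂ d) F V} (hA : A.ContMDiffCovariantDerivative ∞) (hd : 4 ≤ d)
    {k : Π x : M, TangentSpace (𝓡∂ d) x →L[ℝ] V x →L[ℝ] V x}
    (hk : ContMDiff (𝓡∂ d) ((𝓡∂ d).prod 𝓘(ℝ, EuclideanSpace ℝ (Fin d) →L[ℝ] F →L[ℝ] F)) ∞
        (fun x ↦ TotalSpace.mk' (EuclideanSpace ℝ (Fin d) →L[ℝ] F →L[ℝ] F) x (k x)))
    (hj : ∀ x v s, current g.1 (σ.val g) A x v s = σ.val g x ^ (d - 4) • k x v s) :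
    ∃ k' : WeightedEndForm F V c (3 - (d : ℤ)), IsAsymptoticallyYangMills σ A k' := by
  have h1 (g' : c.metrics) : ∃ Ω, IsRescaling Ω g.1 g'.1 := (c.mem_iff g.1 g.2 g'.1).1 g'.2
  choose Ω hΩ using h1
  have hpow (g' : c.metrics) : ContMDiff (𝓡∂ d) 𝓘(ℝ, ℝ) ∞ fun x ↦ Ω g' x ^ (3 - (d : ℤ)) := by
    have h2 : (fun x ↦ Ω g' x ^ (3 - (d : ℤ))) = fun x ↦ Ω g' x ^ 3 * (Ω g' x ^ d)⁻¹ := by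
      funext x
      rw [zpow_sub₀ ((hΩ g').pos x).ne', zpow_natCast]
      rfl
    rw [h2]
    exact ((hΩ g').smooth.pow 3).mul
      (((hΩ g').smooth.pow d).inv₀ fun x ↦ (pow_pos ((hΩ g').pos x) d).ne')
  -- The form found in the scale g is transported to all other scales by its weight.
  refine ⟨⟨fun g' x ↦ Ω g' x ^ (3 - (d : ℤ)) • k x, fun g' ↦ ?_, fun g₁ g₂ Ω' h' x ↦ ?_⟩,
    hA, fun g' x v s ↦ ?_⟩
  · refine contMDiff_of_contDiffOn_formRep fun x₀ ↦ ⟨_, IsChartDomain.maximal (𝓡∂ d) F V x₀,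
      IsChartDomain.mem_maximal (𝓡∂ d) F V x₀, ?_⟩
    have hO := IsChartDomain.maximal (𝓡∂ d) F V x₀
    exact contDiffOn_formRep_smul hO (hpow g') (hO.contDiffOn_formRep hk)
  · have h3 := congrFun ((hΩ g₂).unique ((hΩ g₁).comp h')) x
    rw [smul_smul, h3, mul_zpow]
  · have h4 := σ.rescale g g' (Ω g') (hΩ g')
    simp only [zpow_one] at h4
    rw [current_rescaling (hΩ g') (σ.smooth g) h4 hA (Nat.sub_add_cancel hd) x v s, hj, h4,
      smul_apply, smul_apply, smul_smul, smul_smul]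
    congr 1
    have h5 := ((hΩ g').pos x).ne'
    -- The current contributes the weight -1, and dividing by the power d - 4 of a density of weight
    -- 1 contributes -(d - 4). The truncated subtraction is harmless since 4 ≤ d.
    have h6 : (3 - (d : ℤ)) = -1 - ((d - 4 : ℕ) : ℤ) := by omega
    rw [h6, zpow_sub₀ h5, zpow_natCast, mul_pow, zpow_neg_one]
    field_simp

end Rescaling
end ConformalYangMills

/-! ### Existence of smooth connections. -/

namespace ConformalYangMills

section ExistenceOfConnections

variable {E : Type*} [NormedAddCommGroup E] [NormedSpace ℝ E] [FiniteDimensional ℝ E]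
  {H : Type*} [TopologicalSpace H]
  {I : ModelWithCorners ℝ E H} {M : Type*} [TopologicalSpace M] [ChartedSpace H M]
  [IsManifold I ∞ M]
  {F : Type*} [NormedAddCommGroup F] [NormedSpace ℝ F] [FiniteDimensional ℝ F]
  {V : M → Type*} [TopologicalSpace (TotalSpace F V)]
  [∀ x, AddCommGroup (V x)] [∀ x, Module ℝ (V x)] [∀ x, TopologicalSpace (V x)]
  [FiberBundle F V] [VectorBundle ℝ F V]
  [∀ x, IsTopologicalAddGroup (V x)] [∀ x, ContinuousSMul ℝ (V x)]
  [ContMDiffVectorBundle ∞ F V I]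

lemma IsChartDomain.contDiffOn_localRep_flatDerivative {x₀ : M} {O : Set E}
    (hO : IsChartDomain I F V x₀ O) {s : Π x, V x}
    (hs : ContDiffOn ℝ ∞ (localRep I F x₀ s) O) :
    ContDiffOn ℝ ∞ (localRep I (E →L[ℝ] F) (V := fun x ↦ TangentSpace I x →L[ℝ] V x) x₀
      (flatDerivative F I x₀ s)) O := by
  refine (hs.fderivWithin hO.uniqueDiffOn (m := ∞) (by simp)).congr fun y hy ↦ ?_
  ext v
  rw [hO.tangent.localRep_hom_apply hO hy (flatDerivative F I x₀ s) v]
  refine (congrArg _ (hO.flatDerivative_frame hy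
    ((hs y hy).differentiableWithinAt (by simp)) v)).trans ?_
  exact hO.fibreMap_apply hy _

variable (I F V) in
/-- Every smooth vector bundle has a smooth connection. -/
lemma exists_contMDiffCovariantDerivative [T2Space M] [SigmaCompactSpace M] :
    ∃ A : CovariantDerivative I F V, A.ContMDiffCovariantDerivative ∞ := by
  set U : M → Set M := fun x₀ ↦ {x | x ∈ (extChartAt I x₀).source ∧ extChartAt I x₀ x ∈
    (extChartAt I x₀).target ∩ (extChartAt I x₀).symm ⁻¹' (trivializationAt F V x₀).baseSet} with hU
  have hO (x₀ : M) := IsChartDomain.maximal I F V x₀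
  have hUo (x₀ : M) : IsOpen (U x₀) := (hO x₀).isOpen_preimage
  obtain ⟨ρ, hρ⟩ := SmoothPartitionOfUnity.exists_isSubordinate I isClosed_univ U hUo
    fun x _ ↦ mem_iUnion.2 ⟨x, mem_extChartAt_source x, IsChartDomain.mem_maximal I F V x⟩
  have hsum (x : M) {G : Type _} [AddCommGroup G] [Module ℝ G] (f : M → G) :
      ∑ᶠ i, ρ i x • f i = ∑ i ∈ ρ.finsupport x, ρ i x • f i :=
    finsum_eq_sum_of_support_subset _ fun i hi ↦ by
      rw [SmoothPartitionOfUnity.coe_finsupport]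
      exact fun h0 ↦ hi (by simp only [h0, zero_smul])
  have hmem {i x : M} (hi : i ∈ ρ.finsupport x) : x ∈ U i :=
    hρ i (subset_tsupport _ ((SmoothPartitionOfUnity.mem_finsupport ρ x).1 hi))
  -- A locally finite average of flat derivatives. At x only indices with ρ i x ≠ 0 matter, and for
  -- these x lies in the domain where the flat derivative obeys the Leibniz rule.
  have hcov : IsCovariantDerivativeOn F (I := I) (V := V)
      (fun s x ↦ ∑ᶠ i, ρ i x • flatDerivative F I i s x) := by
    constructor
    · intro s s' x hs hs' _
      rw [hsum, hsum, hsum, ← Finset.sum_add_distrib]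
      refine Finset.sum_congr rfl fun i hi ↦ ?_
      rw [(hO i).isCovariantDerivativeOn_flatDerivative.add hs hs' (hmem hi), smul_add]
    · intro s f x hs hf _
      rw [hsum, hsum, Finset.smul_sum]
      -- The derivative of f occurs once for each index; the weights summing to 1 give it the right
      -- coefficient.
      have h1 : ∀ w : TangentSpace I x →L[ℝ] V x, w = ∑ i ∈ ρ.finsupport x, ρ i x • w := by
        intro w
        rw [← Finset.sum_smul, ρ.sum_finsupport x (mem_univ x), one_smul]
      refine Eq.trans ?_ (congrArg _ (h1 _).symm)
      rw [← Finset.sum_add_distrib]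
      refine Finset.sum_congr rfl fun i hi ↦ ?_
      rw [(hO i).isCovariantDerivativeOn_flatDerivative.leibniz hs hf (hmem hi), smul_add,
        smul_comm]
  refine ⟨⟨_, hcov⟩, ⟨⟨fun {s} hs ↦ contMDiffOn_univ.2 ?_⟩⟩⟩
  have hs' : ContMDiff I (I.prod 𝓘(ℝ, F)) ∞ (fun x ↦ TotalSpace.mk' F x (s x)) := by
    simpa using contMDiffOn_univ.1 hs
  refine ContMDiff.finsum_section_of_locallyFinite (V := fun x ↦ TangentSpace I x →L[ℝ] V x)
    (t := fun i x ↦ ρ i x • flatDerivative F I i s x)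
    (ρ.locallyFinite.subset fun i x hx h0 ↦ hx ?_) fun i ↦ ?_
  · change ρ i x = 0 at h0
    simp only [h0, zero_smul]
  · refine ContMDiffOn.smul_section_of_tsupport (V := fun x ↦ TangentSpace I x →L[ℝ] V x)
      (ρ i).contMDiff.contMDiffOn (hUo i) (hρ i) fun x hx ↦ ContMDiffAt.contMDiffWithinAt ?_
    obtain ⟨z, hz, rfl⟩ := (hO i).exists_symm_eq hx
    exact (((hO i).tangent.hom (hO i)).contMDiffAt_section_iff hz).2
      ((hO i).contDiffOn_localRep_flatDerivative ((hO i).contDiffOn_localRep hs') z hz)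

end ExistenceOfConnections
end ConformalYangMills

/-! ### Local retractions onto an embedded submanifold. -/

namespace ConformalYangMills

section Retractions

variable {E : Type*} [NormedAddCommGroup E] [NormedSpace ℝ E]
  {H : Type*} [TopologicalSpace H]
  {I : ModelWithCorners ℝ E H} {M : Type*} [TopologicalSpace M] [ChartedSpace H M]
  [IsManifold I ∞ M]

lemma exists_isChartDomain_forall
  {F : Type*} [NormedAddCommGroup F] [NormedSpace ℝ F]
  {V : M → Type*} [TopologicalSpace (TotalSpace F V)]
  [∀ x, AddCommGroup (V x)] [∀ x, Module ℝ (V x)] [∀ x, TopologicalSpace (V x)]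
  [FiberBundle F V] [VectorBundle ℝ F V] {x₀ : M} {P : M → Prop} (h : ∀ᶠ x in 𝓝 x₀, P x) :
    ∃ O, IsChartDomain I F V x₀ O ∧ extChartAt I x₀ x₀ ∈ O ∧
      ∀ y ∈ O, P ((extChartAt I x₀).symm y) := by
  have hO := IsChartDomain.maximal I F V x₀
  have hx := IsChartDomain.mem_maximal I F V x₀
  have h1 := hO.eventually_iff (p := P) hx
  rw [extChartAt_to_inv] at h1
  obtain ⟨U, hU, hxU, hUP⟩ := mem_nhdsWithin.1 (h1.1 h)
  exact ⟨_, hO.inter hU, ⟨hx, hxU⟩, fun y hy ↦ hUP ⟨hy.2, hy.1⟩⟩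

variable {E' : Type*} [NormedAddCommGroup E'] [NormedSpace ℝ E']
  {H' : Type*} [TopologicalSpace H']
  {J : ModelWithCorners ℝ E' H'} [J.Boundaryless]
  {S : Type*} [TopologicalSpace S] [ChartedSpace H' S] [IsManifold J ∞ S]

/-- A smooth embedding has a smooth retraction near every point of its image. -/
lemma exists_retraction {ι : S → M} (hι : IsSmoothEmbedding J I ∞ ι) (p₀ : S) :
    ∃ R : M → S, ∀ᶠ x in 𝓝 (ι p₀), ContMDiffAt I J ∞ R x ∧ ∀ p, ι p = x → R x = p := by
  have h := hι.isImmersion.isImmersionAt p₀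
  set e := h.domChart
  set e' := h.codChart
  -- In charts adapted to the immersion the map is an inclusion into a product; the projection to
  -- the first factor is the retraction in coordinates.
  set T : M → E' := fun x ↦ (h.equiv.symm (e'.extend I x)).1 with hT
  have hTs : ∀ x ∈ e'.source, ContMDiffAt I 𝓘(ℝ, E') ∞ T x := by
    intro x hx
    have h1 : ContMDiffAt I 𝓘(ℝ, E) ∞ (e'.extend I) x :=
      OpenPartialHomeomorph.contMDiffAt_extend h.codChart_mem_maximalAtlas hx
    have h2 : ContDiff ℝ ∞ fun z : E ↦ (h.equiv.symm z).1 :=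
      (ContinuousLinearMap.fst ℝ E' h.complement).contDiff.comp h.equiv.symm.contDiff
    exact h2.contMDiff.contMDiffAt.comp x h1
  have hTι : ∀ p ∈ e.source, T (ι p) = e.extend J p := by
    intro p hp
    have hp' : p ∈ (e.extend J).source := by rwa [OpenPartialHomeomorph.extend_source]
    have h1 := h.writtenInCharts ((e.extend J).map_source hp')
    simp only [Function.comp_apply] at h1
    rw [(e.extend J).left_inv hp'] at h1
    rw [hT]
    simp only
    rw [h1, ContinuousLinearEquiv.symm_apply_apply]
  have hto : IsOpen (e.extend J).target := e.isOpen_extend_target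
  refine ⟨fun x ↦ (e.extend J).symm (T x), ?_⟩
  have hp₀ := h.mem_domChart_source
  have h1 : ∀ᶠ x in 𝓝 (ι p₀), x ∈ e'.source := e'.open_source.mem_nhds h.mem_codChart_source
  have h2 : ∀ᶠ x in 𝓝 (ι p₀), T x ∈ (e.extend J).target := by
    refine (hTs _ h.mem_codChart_source).continuousAt (hto.mem_nhds ?_)
    rw [hTι p₀ hp₀]
    exact (e.extend J).map_source (by rwa [OpenPartialHomeomorph.extend_source])
  -- Being an embedding, and not merely an immersion, excludes points of S far from p₀ whose images
  -- are close to ι p₀.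
  have h3 : ∀ᶠ x in 𝓝 (ι p₀), ∀ p, ι p = x → p ∈ e.source := by
    have := e.open_source.mem_nhds hp₀
    rw [hι.isEmbedding.nhds_eq_comap] at this
    obtain ⟨t, ht, hte⟩ := this
    filter_upwards [ht] with x hx p hp
    exact hte (by rw [mem_preimage, hp]; exact hx)
  filter_upwards [h1, h2, h3] with x hx1 hx2 hx3
  refine ⟨?_, fun p hp ↦ ?_⟩
  · have h4 := contMDiffOn_extend_symm (I := J) h.domChart_mem_maximalAtlas
    have h5 : (e.extend J).target = J '' e.target := by
      rw [OpenPartialHomeomorph.extend_target, J.image_eq, J.range_eq_univ, inter_univ]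
    rw [← h5] at h4
    exact (h4.contMDiffAt (hto.mem_nhds hx2)).comp x (hTs x hx1)
  · subst hp
    rw [hTι p (hx3 p rfl)]
    exact (e.extend J).left_inv (by rw [OpenPartialHomeomorph.extend_source]; exact hx3 p rfl)

end Retractions

/-! ### Chart formulas at a point of the manifold rather than at its coordinates. -/

section PointwiseFormulas

variable {E : Type*} [NormedAddCommGroup E] [NormedSpace ℝ E] [FiniteDimensional ℝ E]
  {H : Type*} [TopologicalSpace H]
  {I : ModelWithCorners ℝ E H} {M : Type*} [TopologicalSpace M] [ChartedSpace H M]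
  [IsManifold I ∞ M]
  {F : Type*} [NormedAddCommGroup F] [NormedSpace ℝ F] [FiniteDimensional ℝ F]
  {V : M → Type*} [TopologicalSpace (TotalSpace F V)]
  [∀ x, AddCommGroup (V x)] [∀ x, Module ℝ (V x)] [∀ x, TopologicalSpace (V x)]
  [FiberBundle F V] [VectorBundle ℝ F V]
  [∀ x, IsTopologicalAddGroup (V x)] [∀ x, ContinuousSMul ℝ (V x)]
  [ContMDiffVectorBundle ∞ F V I] {x₀ x : M} {O : Set E}

variable (I) in
/-- The components of a tangent vector in the preferred chart at `x₀`. -/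
noncomputable abbrev tangentCoord (x₀ x : M) : TangentSpace I x →L[ℝ] E :=
  (trivializationAt E (fun x : M ↦ TangentSpace I x) x₀).continuousLinearMapAt ℝ x

variable (F) in
/-- The components of a vector of the fibre in the preferred trivialization at `x₀`. -/
noncomputable abbrev fibreCoord (x₀ x : M) : V x →L[ℝ] F :=
  (trivializationAt F V x₀).continuousLinearMapAt ℝ x

lemma IsChartDomain.fibreCoord_injective (hO : IsChartDomain I F V x₀ O)
    (hx : x ∈ {x | x ∈ (extChartAt I x₀).source ∧ extChartAt I x₀ x ∈ O}) :
    Function.Injective (fibreCoord F (V := V) x₀ x) := by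
  obtain ⟨y, hy, rfl⟩ := hO.exists_symm_eq hx
  exact Function.LeftInverse.injective fun v ↦
    (trivializationAt F V x₀).symmL_continuousLinearMapAt (hO.mem_baseSet y hy) v

lemma IsChartDomain.mfderiv_eq_tangentCoord {F' : Type*} [NormedAddCommGroup F'] [NormedSpace ℝ F']
    (hO : IsChartDomain I F V x₀ O)
    (hx : x ∈ {x | x ∈ (extChartAt I x₀).source ∧ extChartAt I x₀ x ∈ O}) {f : M → F'}
    (hf : MDifferentiableAt I 𝓘(ℝ, F') f x) (v : TangentSpace I x) :
    mfderiv I 𝓘(ℝ, F') f x v =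
      fderivWithin ℝ (f ∘ (extChartAt I x₀).symm) O (extChartAt I x₀ x) (tangentCoord I x₀ x v) := by
  obtain ⟨y, hy, rfl⟩ := hO.exists_symm_eq hx
  obtain ⟨v, rfl⟩ := hO.tangent.fibreMap_surjective hy v
  rw [hO.right_inv hy]
  refine (hO.mfderiv_frame hy hf v).trans (congrArg _ ?_)
  exact (hO.tangent.fibreMap_apply hy v).symm

lemma IsChartDomain.fibreCoord_covariantDerivative (hO : IsChartDomain I F V x₀ O)
    (hx : x ∈ {x | x ∈ (extChartAt I x₀).source ∧ extChartAt I x₀ x ∈ O})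
    (A : CovariantDerivative I F V) {s : Π x, V x}
    (hs : MDifferentiableAt I (I.prod 𝓘(ℝ, F)) (fun x ↦ TotalSpace.mk' F x (s x)) x)
    (v : TangentSpace I x) :
    fibreCoord F x₀ x (A s x v) =
      mvfderiv I (fun z ↦ fibreCoord F x₀ z (s z)) x v +
        connectionForm A x₀ (extChartAt I x₀ x) (tangentCoord I x₀ x v)
          (fibreCoord F x₀ x (s x)) := by
  obtain ⟨y, hy, rfl⟩ := hO.exists_symm_eq hx
  obtain ⟨v, rfl⟩ := hO.tangent.fibreMap_surjective hy v
  rw [hO.mdifferentiableAt_section_iff hy] at hs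
  have h1 := hO.localRep_covariantDerivative A hy hs v
  have h2 := hO.mfderiv_frame (f := fun z ↦ fibreCoord F x₀ z (s z)) hy
    ((hO.mdifferentiableAt_iff hy).2 hs) v
  rw [hO.right_inv hy]
  refine h1.trans (congrArg₂ _ h2.symm ?_)
  exact congrArg (fun w ↦ connectionForm A x₀ y w (localRep I F x₀ s y))
    (hO.tangent.fibreMap_apply hy v).symm

lemma IsChartDomain.fibreCoord_form (hO : IsChartDomain I F V x₀ O)
    (hx : x ∈ {x | x ∈ (extChartAt I x₀).source ∧ extChartAt I x₀ x ∈ O})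
    (k : Π x : M, TangentSpace I x →L[ℝ] V x →L[ℝ] V x) (v : TangentSpace I x) (s : V x) :
    fibreCoord F x₀ x (k x v s) =
      formRep I F x₀ k (extChartAt I x₀ x) (tangentCoord I x₀ x v) (fibreCoord F x₀ x s) := by
  obtain ⟨y, hy, rfl⟩ := hO.exists_symm_eq hx
  obtain ⟨v, rfl⟩ := hO.tangent.fibreMap_surjective hy v
  obtain ⟨s, rfl⟩ := hO.fibreMap_surjective hy s
  have h1 : tangentCoord I x₀ _ (frame I x₀ y v) = v := hO.tangent.fibreMap_apply hy v
  have h2 : fibreCoord F x₀ _ (fibreMap I F V x₀ y s) = s := hO.fibreMap_apply hy s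
  rw [hO.right_inv hy, h2]
  refine (hO.formRep_apply hy k v s).symm.trans ?_
  exact congrArg (fun w ↦ formRep I F x₀ k y w s) h1.symm

lemma IsChartDomain.mdifferentiableAt_fibreCoord (hO : IsChartDomain I F V x₀ O)
    (hx : x ∈ {x | x ∈ (extChartAt I x₀).source ∧ extChartAt I x₀ x ∈ O}) {s : Π x, V x} :
    MDifferentiableAt I (I.prod 𝓘(ℝ, F)) (fun x ↦ TotalSpace.mk' F x (s x)) x ↔
      MDifferentiableAt I 𝓘(ℝ, F) (fun z ↦ fibreCoord F x₀ z (s z)) x := by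
  obtain ⟨y, hy, rfl⟩ := hO.exists_symm_eq hx
  rw [hO.mdifferentiableAt_section_iff hy, hO.mdifferentiableAt_iff hy]
  rfl

lemma IsChartDomain.mfderiv_extChartAt_eq_tangentCoord (hO : IsChartDomain I F V x₀ O)
    (hx : x ∈ {x | x ∈ (extChartAt I x₀).source ∧ extChartAt I x₀ x ∈ O}) (v : TangentSpace I x) :
    mfderiv I 𝓘(ℝ, E) (extChartAt I x₀) x v = tangentCoord I x₀ x v := by
  have h1 : MDifferentiableAt I 𝓘(ℝ, E) (extChartAt I x₀) x :=
    mdifferentiableAt_extChartAt (by rw [← extChartAt_source I]; exact hx.1)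
  refine (hO.mfderiv_eq_tangentCoord hx h1 v).trans ?_
  have h2 : fderivWithin ℝ (extChartAt I x₀ ∘ (extChartAt I x₀).symm) O (extChartAt I x₀ x) =
      ContinuousLinearMap.id ℝ _ :=
    (fderivWithin_congr (fun z hz ↦ hO.right_inv hz) (hO.right_inv hx.2)).trans
      (fderivWithin_id (hO.uniqueDiffOn _ hx.2))
  exact congrArg (fun L : E →L[ℝ] E ↦ L (tangentCoord I x₀ x v)) h2

end PointwiseFormulas
end ConformalYangMills

/-! ### Extending a connection from the boundary. -/

namespace ConformalYangMills

section BoundaryConditions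

variable {d : ℕ} [NeZero d] {M : Type*} [TopologicalSpace M]
  [ChartedSpace (EuclideanHalfSpace d) M] [IsManifold (𝓡∂ d) ∞ M]
  {S : Type*} [TopologicalSpace S] [ChartedSpace (EuclideanSpace ℝ (Fin (d - 1))) S]
  [IsManifold (𝓡 (d - 1)) ∞ S]
  {F : Type*} [NormedAddCommGroup F] [NormedSpace ℝ F] [FiniteDimensional ℝ F]
  {V : M → Type*} [TopologicalSpace (TotalSpace F V)]
  [∀ x, AddCommGroup (V x)] [∀ x, Module ℝ (V x)] [∀ x, TopologicalSpace (V x)]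
  [∀ x, IsTopologicalAddGroup (V x)] [∀ x, ContinuousSMul ℝ (V x)]
  [FiberBundle F V] [VectorBundle ℝ F V] [ContMDiffVectorBundle ∞ F V (𝓡∂ d)]
  {ι : C^∞⟮𝓡 (d - 1), S; 𝓡∂ d, M⟯}

/-- The preferred trivialization of the restricted bundle is the pullback of that of `V`; outside
the base set both coordinate maps are zero. -/
lemma fibreCoord_restrictedBundle (p₀ p : S) (s : V (ι p)) :
    fibreCoord F (V := RestrictedBundle ι V) p₀ p s = fibreCoord F (V := V) (ι p₀) (ι p) s := by
  by_cases h : ι p ∈ (trivializationAt F V (ι p₀)).baseSet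
  · rw [Trivialization.continuousLinearMapAt_apply, Trivialization.continuousLinearMapAt_apply,
      Trivialization.coe_linearMapAt_of_mem _ h]
    exact congrFun (Trivialization.coe_linearMapAt_of_mem
      (trivializationAt F (RestrictedBundle ι V) p₀) h) s
  · rw [Trivialization.continuousLinearMapAt_apply, Trivialization.continuousLinearMapAt_apply,
      Trivialization.linearMapAt_def_of_notMem _ h]
    exact congrArg (fun L : V (ι p) →ₗ[ℝ] F ↦ L s) (Trivialization.linearMapAt_def_of_notMem
      (trivializationAt F (RestrictedBundle ι V) p₀) h)

/-- The boundary condition for a connection, in terms of connection forms. -/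
lemma covariantDerivative_boundary_iff {p₀ p : S} {O : Set (EuclideanSpace ℝ (Fin d))}
    {W : Set (EuclideanSpace ℝ (Fin (d - 1)))}
    (hO : IsChartDomain (𝓡∂ d) F V (ι p₀) O)
    (hW : IsChartDomain (𝓡 (d - 1)) F (RestrictedBundle ι V) p₀ W)
    (hx : ι p ∈ {x | x ∈ (extChartAt (𝓡∂ d) (ι p₀)).source ∧ extChartAt (𝓡∂ d) (ι p₀) x ∈ O})
    (hp : p ∈ {p | p ∈ (extChartAt (𝓡 (d - 1)) p₀).source ∧ extChartAt (𝓡 (d - 1)) p₀ p ∈ W})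
    (A : CovariantDerivative (𝓡∂ d) F V)
    (B : CovariantDerivative (𝓡 (d - 1)) F (RestrictedBundle ι V)) {s : Π x, V x}
    (hs : MDifferentiableAt (𝓡∂ d) ((𝓡∂ d).prod 𝓘(ℝ, F)) (fun x ↦ TotalSpace.mk' F x (s x)) (ι p))
    (v : TangentSpace (𝓡 (d - 1)) p) :
    A s (ι p) (mfderiv (𝓡 (d - 1)) (𝓡∂ d) ι p v) = B (fun q ↦ s (ι q)) p v ↔
      connectionForm A (ι p₀) (extChartAt (𝓡∂ d) (ι p₀) (ι p))
        (tangentCoord (𝓡∂ d) (ι p₀) (ι p) (mfderiv (𝓡 (d - 1)) (𝓡∂ d) ι p v))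
        (fibreCoord F (ι p₀) (ι p) (s (ι p))) =
      connectionForm B p₀ (extChartAt (𝓡 (d - 1)) p₀ p) (tangentCoord (𝓡 (d - 1)) p₀ p v)
        (fibreCoord F (ι p₀) (ι p) (s (ι p))) := by
  have hι : MDifferentiableAt (𝓡 (d - 1)) (𝓡∂ d) ι p := (ι.contMDiff p).mdifferentiableAt (by simp)
  set G : M → F := fun x ↦ fibreCoord F (ι p₀) x (s x) with hG
  have hG' := (hO.mdifferentiableAt_fibreCoord hx).1 hs
  have hGι : (fun q ↦ fibreCoord F (V := RestrictedBundle ι V) p₀ q (s (ι q))) = G ∘ ι :=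
    funext fun q ↦ fibreCoord_restrictedBundle p₀ q (s (ι q))
  have hs' : MDifferentiableAt (𝓡 (d - 1)) ((𝓡 (d - 1)).prod 𝓘(ℝ, F))
      (fun q ↦ TotalSpace.mk' F (E := RestrictedBundle ι V) q (s (ι q))) p := by
    rw [hW.mdifferentiableAt_fibreCoord hp (s := fun q ↦ s (ι q)), hGι]
    exact hG'.comp p hι
  have h1 := hO.fibreCoord_covariantDerivative hx A hs (mfderiv (𝓡 (d - 1)) (𝓡∂ d) ι p v)
  have h2 := hW.fibreCoord_covariantDerivative hp B (s := fun q ↦ s (ι q)) hs' v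
  have h3 : mvfderiv (𝓡∂ d) G (ι p) (mfderiv (𝓡 (d - 1)) (𝓡∂ d) ι p v) =
      mvfderiv (𝓡 (d - 1)) (G ∘ ι) p v :=
    (congrArg (fun L ↦ L v) (mfderiv_comp p hG' hι)).symm
  rw [hGι, fibreCoord_restrictedBundle] at h2
  replace h2 := (fibreCoord_restrictedBundle p₀ p (B (fun q ↦ s (ι q)) p v)).symm.trans h2
  rw [h3] at h1
  refine Iff.trans (hO.fibreCoord_injective hx).eq_iff.symm ?_
  exact ⟨fun h ↦ add_left_cancel (h1.symm.trans (h.trans h2)),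
    fun h ↦ h1.trans ((congrArg _ h).trans h2.symm)⟩

/-- A retraction onto the boundary, in coordinates. -/
lemma exists_coordinate_retraction (hι : IsSmoothEmbedding (𝓡 (d - 1)) (𝓡∂ d) ∞ ι) (p₀ : S) :
    ∃ O, IsChartDomain (𝓡∂ d) F V (ι p₀) O ∧ extChartAt (𝓡∂ d) (ι p₀) (ι p₀) ∈ O ∧
      ∃ R : EuclideanSpace ℝ (Fin d) → EuclideanSpace ℝ (Fin (d - 1)), ContDiffOn ℝ ∞ R O ∧
        MapsTo R O ((extChartAt (𝓡 (d - 1)) p₀).target ∩ (extChartAt (𝓡 (d - 1)) p₀).symm ⁻¹'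
          (trivializationAt F (RestrictedBundle ι V) p₀).baseSet) ∧
        ∀ p, ι p ∈ {x | x ∈ (extChartAt (𝓡∂ d) (ι p₀)).source ∧ extChartAt (𝓡∂ d) (ι p₀) x ∈ O} →
          p ∈ {p | p ∈ (extChartAt (𝓡 (d - 1)) p₀).source ∧ extChartAt (𝓡 (d - 1)) p₀ p ∈
            (extChartAt (𝓡 (d - 1)) p₀).target ∩ (extChartAt (𝓡 (d - 1)) p₀).symm ⁻¹'
              (trivializationAt F (RestrictedBundle ι V) p₀).baseSet} ∧
          R (extChartAt (𝓡∂ d) (ι p₀) (ι p)) = extChartAt (𝓡 (d - 1)) p₀ p ∧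
          ∀ v : TangentSpace (𝓡 (d - 1)) p,
            fderivWithin ℝ R O (extChartAt (𝓡∂ d) (ι p₀) (ι p))
              (tangentCoord (𝓡∂ d) (ι p₀) (ι p) (mfderiv (𝓡 (d - 1)) (𝓡∂ d) ι p v)) =
            tangentCoord (𝓡 (d - 1)) p₀ p v := by
  obtain ⟨R, hR⟩ := exists_retraction hι p₀
  have hW := IsChartDomain.maximal (𝓡 (d - 1)) F (RestrictedBundle ι V) p₀
  have h0 : R (ι p₀) = p₀ := hR.self_of_nhds.2 p₀ rfl
  have h1 : ∀ᶠ x in 𝓝 (ι p₀), R x ∈ {p | p ∈ (extChartAt (𝓡 (d - 1)) p₀).source ∧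
      extChartAt (𝓡 (d - 1)) p₀ p ∈ (extChartAt (𝓡 (d - 1)) p₀).target ∩
        (extChartAt (𝓡 (d - 1)) p₀).symm ⁻¹'
          (trivializationAt F (RestrictedBundle ι V) p₀).baseSet} := by
    refine hR.self_of_nhds.1.continuousAt (hW.isOpen_preimage.mem_nhds ?_)
    rw [h0]
    exact ⟨mem_extChartAt_source p₀,
      IsChartDomain.mem_maximal (𝓡 (d - 1)) F (RestrictedBundle ι V) p₀⟩
  obtain ⟨O, hO, hx, hP⟩ := exists_isChartDomain_forall (I := 𝓡∂ d) (F := F) (V := V) (hR.and h1)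
  set f : M → EuclideanSpace ℝ (Fin (d - 1)) := fun x ↦ extChartAt (𝓡 (d - 1)) p₀ (R x) with hf
  have hf' {y} (hy : y ∈ O) : ContMDiffAt (𝓡∂ d) 𝓘(ℝ, EuclideanSpace ℝ (Fin (d - 1))) ∞ f
      ((extChartAt (𝓡∂ d) (ι p₀)).symm y) := by
    obtain ⟨⟨h2, -⟩, h3⟩ := hP y hy
    exact (contMDiffAt_extChartAt' (by
      rw [← extChartAt_source (𝓡 (d - 1))]; exact h3.1)).comp _ h2
  refine ⟨O, hO, hx, f ∘ (extChartAt (𝓡∂ d) (ι p₀)).symm, fun y hy ↦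
    (hO.contMDiffAt_iff hy).1 (hf' hy), fun y hy ↦ (hP y hy).2.2, fun p hp ↦ ?_⟩
  have h2 {p : S} (hp : ι p ∈ {x | x ∈ (extChartAt (𝓡∂ d) (ι p₀)).source ∧
      extChartAt (𝓡∂ d) (ι p₀) x ∈ O}) : R (ι p) = p := by
    have := (hP _ hp.2).1.2
    rw [(extChartAt (𝓡∂ d) (ι p₀)).left_inv hp.1] at this
    exact this p rfl
  have h3 := hf' hp.2
  have h4 := (hP _ hp.2).2
  rw [(extChartAt (𝓡∂ d) (ι p₀)).left_inv hp.1] at h3 h4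
  rw [h2 hp] at h4
  refine ⟨h4, ?_, fun v ↦ ?_⟩
  · rw [Function.comp_apply, (extChartAt (𝓡∂ d) (ι p₀)).left_inv hp.1, hf]
    simp only [h2 hp]
  · have h5 := hO.mfderiv_eq_tangentCoord hp (h3.mdifferentiableAt (by simp))
      (mfderiv (𝓡 (d - 1)) (𝓡∂ d) ι p v)
    refine h5.symm.trans ?_
    have hι' : MDifferentiableAt (𝓡 (d - 1)) (𝓡∂ d) ι p :=
      (ι.contMDiff p).mdifferentiableAt (by simp)
    have h6 := congrArg (fun L ↦ L v) (mfderiv_comp p (h3.mdifferentiableAt (by simp)) hι')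
    refine h6.symm.trans (Eq.trans ?_ (hW.mfderiv_extChartAt_eq_tangentCoord h4 v))
    have h7 : f ∘ ι =ᶠ[𝓝 p] extChartAt (𝓡 (d - 1)) p₀ := by
      filter_upwards [ι.contMDiff.continuous.continuousAt (hO.isOpen_preimage.mem_nhds hp)]
        with q hq
      simp only [hf, Function.comp_apply, h2 hq]
    rw [h7.mfderiv_eq]
    rfl

/-- The endomorphism valued one-forms at a point of the boundary which have to be added to the
connection `A` in order that it induces the connection `B` there. -/
def boundaryForms (A : CovariantDerivative (𝓡∂ d) F V)
    (B : CovariantDerivative (𝓡 (d - 1)) F (RestrictedBundle ι V)) (p : S) :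
    Set (TangentSpace (𝓡∂ d) (ι p) →L[ℝ] V (ι p) →L[ℝ] V (ι p)) :=
  {T | ∀ s : Π x, V x,
    MDifferentiableAt (𝓡∂ d) ((𝓡∂ d).prod 𝓘(ℝ, F)) (fun x ↦ TotalSpace.mk' F x (s x)) (ι p) →
    ∀ v : TangentSpace (𝓡 (d - 1)) p,
    A s (ι p) (mfderiv (𝓡 (d - 1)) (𝓡∂ d) ι p v) +
      T (mfderiv (𝓡 (d - 1)) (𝓡∂ d) ι p v) (s (ι p)) = B (fun q ↦ s (ι q)) p v}

/-- The condition is affine in T: it fixes T on tangential vectors. -/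
lemma convex_boundaryForms (A : CovariantDerivative (𝓡∂ d) F V)
    (B : CovariantDerivative (𝓡 (d - 1)) F (RestrictedBundle ι V)) (p : S) :
    Convex ℝ (boundaryForms A B p) := by
  intro T hT T' hT' a b _ _ hab s hs v
  have e1 := hT s hs v
  have e2 := hT' s hs v
  have e3 : ∀ w w' t t' : V (ι p), w + t = w' → w + t' = w' → w + (a • t + b • t') = w' := by
    rintro w w' t t' rfl h
    rw [add_left_cancel h, ← add_smul, hab, one_smul]
  exact e3 _ _ _ _ e1 e2

/-- The pullback of the connection form of B by a retraction R is a local extension; subtracting the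
form of A gives the required correction. On the boundary dR inverts dι, so the pullback restricts to
B. -/
lemma exists_mem_boundaryForms [T2Space M] (hι : IsSmoothEmbedding (𝓡 (d - 1)) (𝓡∂ d) ∞ ι)
    {A : CovariantDerivative (𝓡∂ d) F V} (hA : A.ContMDiffCovariantDerivative ∞)
    {B : CovariantDerivative (𝓡 (d - 1)) F (RestrictedBundle ι V)}
    (hB : B.ContMDiffCovariantDerivative ∞) (p₀ : S) :
    ∃ O, IsChartDomain (𝓡∂ d) F V (ι p₀) O ∧ extChartAt (𝓡∂ d) (ι p₀) (ι p₀) ∈ O ∧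
      ∃ Θ : EuclideanSpace ℝ (Fin d) → EuclideanSpace ℝ (Fin d) →L[ℝ] F →L[ℝ] F,
        ContDiffOn ℝ ∞ Θ O ∧
        ∀ p, ι p ∈ {x | x ∈ (extChartAt (𝓡∂ d) (ι p₀)).source ∧ extChartAt (𝓡∂ d) (ι p₀) x ∈ O} →
          formOfRep V (𝓡∂ d) (ι p₀) Θ (ι p) ∈ boundaryForms A B p := by
  have : T2Space S := hι.isEmbedding.t2Space
  obtain ⟨O, hO, hx₀, R, hR, hRW, hRι⟩ :=
    exists_coordinate_retraction (F := F) (V := V) hι p₀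
  have hW := IsChartDomain.maximal (𝓡 (d - 1)) F (RestrictedBundle ι V) p₀
  refine ⟨O, hO, hx₀, fun y ↦
    (connectionForm B p₀ (R y)).comp (fderivWithin ℝ R O y) - connectionForm A (ι p₀) y, ?_, ?_⟩
  · exact (((hW.contDiffOn_connectionForm hB).comp hR hRW).clm_comp
      (hR.fderivWithin hO.uniqueDiffOn (by simp))).sub (hO.contDiffOn_connectionForm hA)
  · intro p hx s hs v
    obtain ⟨hp, hRp, hRv⟩ := hRι p hx
    refine (covariantDerivative_boundary_iff hO hW hx hp (addForm A _) B hs v).2 ?_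
    rw [hO.connectionForm_eq_add (fun s x _ u ↦ addForm_apply A _ s x u) hx.2,
      hO.formRep_formOfRep _ hx.2, add_sub_cancel, ContinuousLinearMap.comp_apply, hRp, hRv]

set_option synthInstance.maxHeartbeats 200000 in
lemma IsChartDomain.contMDiffOn_formOfRep {x₀ : M} {O : Set (EuclideanSpace ℝ (Fin d))}
    (hO : IsChartDomain (𝓡∂ d) F V x₀ O)
    {Θ : EuclideanSpace ℝ (Fin d) → EuclideanSpace ℝ (Fin d) →L[ℝ] F →L[ℝ] F}
    (hΘ : ContDiffOn ℝ ∞ Θ O) :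
    ContMDiffOn (𝓡∂ d) ((𝓡∂ d).prod 𝓘(ℝ, EuclideanSpace ℝ (Fin d) →L[ℝ] F →L[ℝ] F)) ∞
      (fun x ↦ TotalSpace.mk' (EuclideanSpace ℝ (Fin d) →L[ℝ] F →L[ℝ] F) x
        (formOfRep V (𝓡∂ d) x₀ Θ x))
      {x | x ∈ (extChartAt (𝓡∂ d) x₀).source ∧ extChartAt (𝓡∂ d) x₀ x ∈ O} := by
  intro x hx
  obtain ⟨y, hy, rfl⟩ := hO.exists_symm_eq hx
  refine ContMDiffAt.contMDiffWithinAt ?_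
  refine ((hO.tangent.hom (hO.hom hO)).contMDiffAt_section_iff hy).2 ?_
  exact (hΘ y hy).congr (fun z hz ↦ hO.formRep_formOfRep Θ hz) (hO.formRep_formOfRep Θ hy)

variable [T2Space M] [SigmaCompactSpace M]

set_option synthInstance.maxHeartbeats 200000 in
/-- Every smooth connection on the restriction of `V` to the boundary is induced by a smooth
connection on `V`. -/
theorem exists_hasBoundaryCondition (hι : IsBoundaryInclusion ι)
    {B : CovariantDerivative (𝓡 (d - 1)) F (RestrictedBundle ι V)}
    (hB : B.ContMDiffCovariantDerivative ∞) :
    ∃ A : CovariantDerivative (𝓡∂ d) F V, A.ContMDiffCovariantDerivative ∞ ∧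
      HasBoundaryCondition ι A B := by
  obtain ⟨A, hA⟩ := exists_contMDiffCovariantDerivative (𝓡∂ d) F V
  obtain ⟨k, hk⟩ := exists_contMDiffSection_forall_mem_convex_of_local (n := ⊤) (𝓡∂ d)
    (F_fiber := EuclideanSpace ℝ (Fin d) →L[ℝ] F →L[ℝ] F)
    (fun x : M ↦ TangentSpace (𝓡∂ d) x →L[ℝ] V x →L[ℝ] V x)
    -- Away from the boundary the condition is void; the zero form on the open complement serves as
    -- the local solution there.
    (fun x ↦ {T | ∀ p (h : x = ι p), h ▸ T ∈ boundaryForms A B p})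
    (fun x ↦ by
      rintro T hT T' hT' a b ha hb hab p rfl
      exact convex_boundaryForms A B p (hT p rfl) (hT' p rfl) ha hb hab)
    (fun x₀ ↦ by
      by_cases hx₀ : x₀ ∈ range ι
      · obtain ⟨p₀, rfl⟩ := hx₀
        obtain ⟨O, hO, hx₀, Θ, hΘ, h⟩ := exists_mem_boundaryForms hι.isSmoothEmbedding hA hB p₀
        refine ⟨_, hO.isOpen_preimage.mem_nhds ⟨mem_extChartAt_source (ι p₀), hx₀⟩,
          formOfRep V (𝓡∂ d) (ι p₀) Θ, hO.contMDiffOn_formOfRep hΘ, ?_⟩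
        rintro x hx p rfl
        exact h p hx
      · refine ⟨(range ι)ᶜ, ?_, fun x ↦ 0, ?_, ?_⟩
        · rw [hι.range_eq]
          rw [hι.range_eq] at hx₀
          exact (ModelWithCorners.isClosed_boundary (I := 𝓡∂ d) (n := ∞)
            (by simp)).isOpen_compl.mem_nhds hx₀
        · exact (contMDiff_zeroSection ℝ
            (fun x : M ↦ TangentSpace (𝓡∂ d) x →L[ℝ] V x →L[ℝ] V x)).contMDiffOn
        · rintro x hx p rfl
          exact absurd (mem_range_self p) hx)
  refine ⟨addForm A k, contMDiffCovariantDerivative_addForm hA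
    fun x₀ O hO ↦ hO.contDiffOn_formRep k.contMDiff, fun p s hs v ↦ hk (ι p) p rfl s hs v⟩

end BoundaryConditions
end ConformalYangMills

/-! ### The tangent space of the boundary as the kernel of dr. -/

namespace ConformalYangMills

section BoundaryTangentSpace

variable {d : ℕ} [NeZero d] {M : Type*} [TopologicalSpace M]
  [ChartedSpace (EuclideanHalfSpace d) M] [IsManifold (𝓡∂ d) ∞ M]
  {S : Type*} [TopologicalSpace S] [ChartedSpace (EuclideanSpace ℝ (Fin (d - 1))) S]
  [IsManifold (𝓡 (d - 1)) ∞ S]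
  {F : Type*} [NormedAddCommGroup F] [NormedSpace ℝ F] [FiniteDimensional ℝ F]
  {V : M → Type*} [TopologicalSpace (TotalSpace F V)]
  [∀ x, AddCommGroup (V x)] [∀ x, Module ℝ (V x)] [∀ x, TopologicalSpace (V x)]
  [∀ x, IsTopologicalAddGroup (V x)] [∀ x, ContinuousSMul ℝ (V x)]
  [FiberBundle F V] [VectorBundle ℝ F V] [ContMDiffVectorBundle ∞ F V (𝓡∂ d)]
  {ι : C^∞⟮𝓡 (d - 1), S; 𝓡∂ d, M⟯} {x₀ : M} {O : Set (EuclideanSpace ℝ (Fin d))} {p : S}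

/-- The differential of `ι` in the preferred chart at `x₀`. -/
noncomputable def coordDifferential (ι : C^∞⟮𝓡 (d - 1), S; 𝓡∂ d, M⟯) (x₀ : M) (p : S) :
    TangentSpace (𝓡 (d - 1)) p →L[ℝ] EuclideanSpace ℝ (Fin d) :=
  (tangentCoord (𝓡∂ d) x₀ (ι p)).comp (mfderiv (𝓡 (d - 1)) (𝓡∂ d) ι p)

/-- Two connections which induce the same connection on the boundary agree in the directions tangent
to the boundary. -/
lemma connectionForm_eq_of_hasBoundaryCondition (hO : IsChartDomain (𝓡∂ d) F V x₀ O)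
    (hp : ι p ∈ {x | x ∈ (extChartAt (𝓡∂ d) x₀).source ∧ extChartAt (𝓡∂ d) x₀ x ∈ O})
    {A A' : CovariantDerivative (𝓡∂ d) F V}
    {B : CovariantDerivative (𝓡 (d - 1)) F (RestrictedBundle ι V)}
    (hA : HasBoundaryCondition ι A B) (hA' : HasBoundaryCondition ι A' B)
    (v : TangentSpace (𝓡 (d - 1)) p) :
    connectionForm A' x₀ (extChartAt (𝓡∂ d) x₀ (ι p)) (coordDifferential ι x₀ p v) =
      connectionForm A x₀ (extChartAt (𝓡∂ d) x₀ (ι p)) (coordDifferential ι x₀ p v) := by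
  ext f
  set s : Π x : M, V x := fun x ↦ (trivializationAt F V x₀).symmL ℝ x f with hs
  have hsf : fibreCoord F x₀ (ι p) (s (ι p)) = f := by
    have := hO.localRep_symmL (V := V) f _ hp.2
    rwa [localRep, (extChartAt (𝓡∂ d) x₀).left_inv hp.1] at this
  have hsd : MDifferentiableAt (𝓡∂ d) ((𝓡∂ d).prod 𝓘(ℝ, F))
      (fun x ↦ TotalSpace.mk' F x (s x)) (ι p) := by
    have := (hO.mdifferentiableAt_section_iff hp.2 (s := s)).2
      ((differentiableWithinAt_const f).congr (hO.localRep_symmL f) (hO.localRep_symmL f _ hp.2))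
    rwa [(extChartAt (𝓡∂ d) x₀).left_inv hp.1] at this
  have h1 := hO.fibreCoord_covariantDerivative hp A hsd (mfderiv (𝓡 (d - 1)) (𝓡∂ d) ι p v)
  have h2 := hO.fibreCoord_covariantDerivative hp A' hsd (mfderiv (𝓡 (d - 1)) (𝓡∂ d) ι p v)
  have h3 := (hA' p s hsd v).trans (hA p s hsd v).symm
  rw [h3] at h2
  have h4 := add_left_cancel (h2.symm.trans h1)
  rwa [hsf] at h4

/-- The differential of a local retraction is a left inverse of dι. -/
lemma coordDifferential_injective (hι : IsSmoothEmbedding (𝓡 (d - 1)) (𝓡∂ d) ∞ ι)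
    (hO : IsChartDomain (𝓡∂ d) F V x₀ O)
    (hp : ι p ∈ {x | x ∈ (extChartAt (𝓡∂ d) x₀).source ∧ extChartAt (𝓡∂ d) x₀ x ∈ O}) :
    Function.Injective (coordDifferential ι x₀ p) := by
  obtain ⟨O', hO', hx', R, hR, hRW, hRι⟩ :=
    exists_coordinate_retraction (F := F) (V := V) hι p
  obtain ⟨hpW, -, hRv⟩ := hRι p ⟨mem_extChartAt_source (ι p), hx'⟩
  have hW := IsChartDomain.maximal (𝓡 (d - 1)) F (RestrictedBundle ι V) p
  refine (hO.tangent.fibreCoord_injective hp).comp fun v v' h ↦ ?_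
  refine hW.tangent.fibreCoord_injective hpW ?_
  exact (hRv v).symm.trans (Eq.trans (congrArg _ (congrArg _ h)) (hRv v'))

/-- The range of the differential of the inclusion of the boundary. -/
lemma exists_coordDifferential_eq (hι : IsSmoothEmbedding (𝓡 (d - 1)) (𝓡∂ d) ∞ ι)
    (hO : IsChartDomain (𝓡∂ d) F V x₀ O)
    (hp : ι p ∈ {x | x ∈ (extChartAt (𝓡∂ d) x₀).source ∧ extChartAt (𝓡∂ d) x₀ x ∈ O})
    {r : M → ℝ} (hr : ContMDiff (𝓡∂ d) 𝓘(ℝ, ℝ) ∞ r) (hrι : ∀ q, r (ι q) = 0)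
    (hdr : mfderiv (𝓡∂ d) 𝓘(ℝ, ℝ) r (ι p) ≠ 0) {w : EuclideanSpace ℝ (Fin d)}
    (hw : fderivWithin ℝ (r ∘ (extChartAt (𝓡∂ d) x₀).symm) O (extChartAt (𝓡∂ d) x₀ (ι p)) w = 0) :
    ∃ v : TangentSpace (𝓡 (d - 1)) p, coordDifferential ι x₀ p v = w := by
  set L : EuclideanSpace ℝ (Fin d) →L[ℝ] ℝ :=
    fderivWithin ℝ (r ∘ (extChartAt (𝓡∂ d) x₀).symm) O (extChartAt (𝓡∂ d) x₀ (ι p)) with hL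
  have hr1 : MDifferentiableAt (𝓡∂ d) 𝓘(ℝ, ℝ) r (ι p) := (hr _).mdifferentiableAt (by simp)
  have hι' : MDifferentiableAt (𝓡 (d - 1)) (𝓡∂ d) ι p :=
    (ι.contMDiff p).mdifferentiableAt (by simp)
  have hL0 : L ≠ 0 := fun h0 ↦ hdr (ContinuousLinearMap.ext fun u ↦ by
    refine (hO.mfderiv_eq_tangentCoord hp hr1 u).trans ?_
    exact congrArg (fun T : EuclideanSpace ℝ (Fin d) →L[ℝ] ℝ ↦ T (tangentCoord (𝓡∂ d) x₀ _ u)) h0)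
  have hLv (v : TangentSpace (𝓡 (d - 1)) p) : L (coordDifferential ι x₀ p v) = 0 := by
    refine (hO.mfderiv_eq_tangentCoord hp hr1 (mfderiv (𝓡 (d - 1)) (𝓡∂ d) ι p v)).symm.trans ?_
    refine (congrArg (fun T ↦ T v) (mfderiv_comp p hr1 hι')).symm.trans ?_
    have h0 : r ∘ ι = fun _ ↦ 0 := funext hrι
    rw [h0, mfderiv_const]
    rfl
  let D : EuclideanSpace ℝ (Fin (d - 1)) →ₗ[ℝ] EuclideanSpace ℝ (Fin d) :=
    (coordDifferential ι x₀ p : TangentSpace (𝓡 (d - 1)) p →ₗ[ℝ] EuclideanSpace ℝ (Fin d))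
  have hD : Function.Injective D := coordDifferential_injective hι hO hp
  have h1 : LinearMap.range D ≤ LinearMap.ker (L : EuclideanSpace ℝ (Fin d) →ₗ[ℝ] ℝ) := by
    rintro _ ⟨v, rfl⟩
    exact hLv v
  -- The range lies in the kernel since r is zero on the boundary, and both have dimension d - 1:
  -- the first by injectivity, the second because dr ≠ 0.
  have h2 : LinearMap.range D = LinearMap.ker (L : EuclideanSpace ℝ (Fin d) →ₗ[ℝ] ℝ) := by
    refine Submodule.eq_of_le_of_finrank_eq h1 ?_
    rw [LinearMap.finrank_range_of_inj hD, finrank_euclideanSpace_fin]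
    have h3 : (L : EuclideanSpace ℝ (Fin d) →ₗ[ℝ] ℝ) ≠ 0 := fun h ↦
      hL0 (ContinuousLinearMap.coe_injective h)
    have h4 := Module.Dual.finrank_ker_add_one_of_ne_zero h3
    rw [finrank_euclideanSpace_fin] at h4
    omega
  have h3 : w ∈ LinearMap.range D := by
    rw [h2]
    exact hw
  obtain ⟨v, hv⟩ := h3
  exact ⟨v, hv⟩

end BoundaryTangentSpace
end ConformalYangMills

/-! ### Independence of the boundary value of k from the extension. -/

namespace ConformalYangMills

section Uniqueness

variable {d : ℕ} [NeZero d] {M : Type*} [TopologicalSpace M] [T2Space M]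
  [ChartedSpace (EuclideanHalfSpace d) M] [IsManifold (𝓡∂ d) ∞ M]
  {S : Type*} [TopologicalSpace S] [ChartedSpace (EuclideanSpace ℝ (Fin (d - 1))) S]
  [IsManifold (𝓡 (d - 1)) ∞ S]
  {F : Type*} [NormedAddCommGroup F] [NormedSpace ℝ F] [FiniteDimensional ℝ F]
  {V : M → Type*} [TopologicalSpace (TotalSpace F V)]
  [∀ x, AddCommGroup (V x)] [∀ x, Module ℝ (V x)] [∀ x, TopologicalSpace (V x)]
  [∀ x, IsTopologicalAddGroup (V x)] [∀ x, ContinuousSMul ℝ (V x)]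
  [FiberBundle F V] [VectorBundle ℝ F V] [ContMDiffVectorBundle ∞ F V (𝓡∂ d)]
  {ι : C^∞⟮𝓡 (d - 1), S; 𝓡∂ d, M⟯} {p : S} {κ : ℕ}

lemma extChartAt_boundary (hι : IsBoundaryInclusion ι) (p : S) :
    extChartAt (𝓡∂ d) (ι p) (ι p) 0 = 0 := by
  have hO := IsChartDomain.maximal (𝓡∂ d) (EuclideanSpace ℝ (Fin d))
    (fun x : M ↦ TangentSpace (𝓡∂ d) x) (ι p)
  refine (hO.symm_mem_boundary_iff (IsChartDomain.mem_maximal (𝓡∂ d) (EuclideanSpace ℝ (Fin d))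
    (fun x : M ↦ TangentSpace (𝓡∂ d) x) (ι p))).1 ?_
  rw [extChartAt_to_inv, ← hι.range_eq]
  exact mem_range_self p

lemma formRep_eq_zero_of_single (T : EuclideanSpace ℝ (Fin d) →L[ℝ] F →L[ℝ] F)
    (h : ∀ i, T (EuclideanSpace.single i 1) = 0) : T = 0 := by
  ext1 v
  rw [← sum_single v, map_sum]
  simp [map_smul, h]

lemma fderivWithin_extend_coordFn_ne_zero {x₀ : M} {O : Set (EuclideanSpace ℝ (Fin d))}
    (hO : IsChartDomain (𝓡∂ d) F V x₀ O) {r : M → ℝ} (hr : ContMDiff (𝓡∂ d) 𝓘(ℝ, ℝ) ∞ r)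
    {y : EuclideanSpace ℝ (Fin d)} (hy : y ∈ O)
    (hdr : mfderiv (𝓡∂ d) 𝓘(ℝ, ℝ) r ((extChartAt (𝓡∂ d) x₀).symm y) ≠ 0) :
    fderivWithin ℝ (coordFn hO hr).extend O y ≠ 0 := by
  intro h0
  have h1 : fderivWithin ℝ (r ∘ (extChartAt (𝓡∂ d) x₀).symm) O y = 0 :=
    (fderivWithin_congr (fun z hz ↦ (SmoothFn.extend_of_mem (coordFn hO hr) hz).symm)
      (SmoothFn.extend_of_mem (coordFn hO hr) hy).symm).trans h0
  refine hdr (ContinuousLinearMap.ext fun u ↦ ?_)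
  obtain ⟨v, rfl⟩ := hO.tangent.fibreMap_surjective hy u
  refine (hO.mfderiv_frame hy ((hr _).mdifferentiableAt (by simp)) v).trans ?_
  exact congrArg (fun T : EuclideanSpace ℝ (Fin d) →L[ℝ] ℝ ↦ T v) h1

/-- Two connections which induce the same connection on the boundary agree in the kernel of the
differential of a defining function. -/
lemma connectionForm_eq_of_fderivWithin_eq_zero (hι : IsBoundaryInclusion ι) {x₀ : M}
    {O : Set (EuclideanSpace ℝ (Fin d))} (hO : IsChartDomain (𝓡∂ d) F V x₀ O)
    {r : M → ℝ} (hr : ContMDiff (𝓡∂ d) 𝓘(ℝ, ℝ) ∞ r)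
    (hr0 : ∀ x, r x = 0 ↔ x ∈ (𝓡∂ d).boundary M)
    (hdr : ∀ x, r x = 0 → mfderiv (𝓡∂ d) 𝓘(ℝ, ℝ) r x ≠ 0) {A A' : CovariantDerivative (𝓡∂ d) F V}
    {B : CovariantDerivative (𝓡 (d - 1)) F (RestrictedBundle ι V)}
    (hAB : HasBoundaryCondition ι A B) (hAB' : HasBoundaryCondition ι A' B)
    {y : EuclideanSpace ℝ (Fin d)} (hy : y ∈ O) (hy0 : y 0 = 0) {w : EuclideanSpace ℝ (Fin d)}
    (hw : fderivWithin ℝ (r ∘ (extChartAt (𝓡∂ d) x₀).symm) O y w = 0) :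
    connectionForm A' x₀ y w = connectionForm A x₀ y w := by
  have hrι (q : S) : r (ι q) = 0 := (hr0 _).2 (hι.range_eq ▸ mem_range_self q)
  have h2 : (extChartAt (𝓡∂ d) x₀).symm y ∈ range ι := by
    rw [hι.range_eq]
    exact (hO.symm_mem_boundary_iff hy).2 hy0
  obtain ⟨q, hq⟩ := h2
  have hqy : extChartAt (𝓡∂ d) x₀ (ι q) = y := by rw [hq, hO.right_inv hy]
  have hqO := hO.symm_mem_preimage hy
  rw [← hq] at hqO
  obtain ⟨v, rfl⟩ := exists_coordDifferential_eq (w := w) hι.isSmoothEmbedding hO hqO hr hrι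
    (hdr _ (hrι q)) (by rw [hqy]; exact hw)
  have h3 := connectionForm_eq_of_hasBoundaryCondition hO hqO hAB hAB' v
  rwa [hqy] at h3

/-- A linear map which vanishes on the kernel of L factors through L; N with c L(N) = 1 is a vector
transversal to the kernel, later the gradient of r. -/
lemma eq_smul_of_ker_le {E Z : Type*} [AddCommGroup E] [Module ℝ E] [AddCommGroup Z] [Module ℝ Z]
    (L : E →ₗ[ℝ] ℝ) (δ : E →ₗ[ℝ] Z) (h : ∀ w, L w = 0 → δ w = 0) {N : E} {c : ℝ}
    (hN : c * L N = 1) (w : E) : δ w = L w • c • δ N := by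
  have h1 := h (w - (c * L w) • N) (by
    rw [map_sub, map_smul, smul_eq_mul]
    linear_combination (-L w) * hN)
  rw [map_sub, map_smul, sub_eq_zero] at h1
  rw [h1, smul_smul, mul_comm]

set_option maxHeartbeats 1000000 in
/-- Two connections which induce the same connection on the boundary agree along the boundary, up to
a multiple of the differential of a defining function. -/
lemma exists_components_sub_eq (hι : IsBoundaryInclusion ι) (g : Metric d M) {x₀ : M} {ε : ℝ}
    (hO : IsChartDomain (𝓡∂ d) F V x₀ (halfBall (extChartAt (𝓡∂ d) x₀ x₀) ε))
    (hx₀ : extChartAt (𝓡∂ d) x₀ x₀ 0 = 0)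
    {r : M → ℝ} (hr : ContMDiff (𝓡∂ d) 𝓘(ℝ, ℝ) ∞ r)
    (hr0 : ∀ x, r x = 0 ↔ x ∈ (𝓡∂ d).boundary M)
    (hdr : ∀ x, r x = 0 → mfderiv (𝓡∂ d) 𝓘(ℝ, ℝ) r x ≠ 0) {A A' : CovariantDerivative (𝓡∂ d) F V}
    (hA : A.ContMDiffCovariantDerivative ∞) (hA' : A'.ContMDiffCovariantDerivative ∞)
    {B : CovariantDerivative (𝓡 (d - 1)) F (RestrictedBundle ι V)}
    (hAB : HasBoundaryCondition ι A B) (hAB' : HasBoundaryCondition ι A' B) :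
    ∃ χ : SmoothFn (halfBall (extChartAt (𝓡∂ d) x₀ x₀) ε) (F →L[ℝ] F), ∀ i, ∃ c,
      components (hO.contDiffOn_connectionForm hA') i -
        components (hO.contDiffOn_connectionForm hA) i =
        (coordDerivatives F hO.tangent).dR i (coordFn hO hr) • χ + coordFn hO hr • c := by
  obtain ⟨ψ, hψ⟩ := exists_inverseNormSq_mul hO g hr hdr
  set φ := coordFn hO (contMDiff_inverseNormSq g hr hdr)
  have hr1 (y : halfBall (extChartAt (𝓡∂ d) x₀ x₀) ε) : (coordFn hO hr).1 y = 0 ↔ y.1 0 = 0 :=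
    (hr0 _).trans (hO.symm_mem_boundary_iff y.2)
  set P := coordDerivatives F hO.tangent
  set G := (metricMatrix hO.tangent g)⁻¹
  set θ := components (hO.contDiffOn_connectionForm hA)
  set θ' := components (hO.contDiffOn_connectionForm hA')
  -- χ is the contraction of θ' - θ with the gradient, divided by |n|² along the boundary. There the
  -- difference vanishes on the kernel of dr, hence equals dr χ.
  refine ⟨φ • ∑ a, (∑ c, G a c * P.dR c (coordFn hO hr)) • (θ' a - θ a), fun i ↦ ?_⟩
  set χ : SmoothFn _ (F →L[ℝ] F) :=
    φ • ∑ a, (∑ c, G a c * P.dR c (coordFn hO hr)) • (θ' a - θ a) with hχ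
  have hvan (y : halfBall (extChartAt (𝓡∂ d) x₀ x₀) ε) (hy : y.1 0 = 0) :
      (θ' i - θ i - P.dR i (coordFn hO hr) • χ).1 y = 0 := by
    obtain ⟨L, hL⟩ : ∃ L, L = fderivWithin ℝ (r ∘ (extChartAt (𝓡∂ d) x₀).symm)
      (halfBall (extChartAt (𝓡∂ d) x₀ x₀) ε) y := ⟨_, rfl⟩
    obtain ⟨δ, hδ⟩ : ∃ δ, δ = connectionForm A' x₀ y - connectionForm A x₀ y := ⟨_, rfl⟩
    have hdR (c : Fin d) : SmoothFn.eval y (P.dR c (coordFn hO hr)) =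
        L (EuclideanSpace.single c 1) := by
      rw [hL]
      exact coordDerivatives_dR_mk (F := F) hO.tangent c _ _ y
    have hθ (a : Fin d) : SmoothFn.evalEnd y (θ' a - θ a) = δ (EuclideanSpace.single a 1) := by
      rw [hδ]
      rfl
    have h1 (w : EuclideanSpace ℝ (Fin d)) (hw : L w = 0) : δ w = 0 := by
      rw [hL] at hw
      rw [hδ, sub_apply, sub_eq_zero]
      exact connectionForm_eq_of_fderivWithin_eq_zero hι hO hr hr0 hdr hAB hAB' y.2 hy hw
    clear_value χ θ θ' P G φ
    set N : EuclideanSpace ℝ (Fin d) := ∑ a, (∑ c, SmoothFn.eval y (G a c) *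
      L (EuclideanSpace.single c 1)) • EuclideanSpace.single a 1 with hN
    have h4 : SmoothFn.eval y φ * L N = 1 := by
      have h5 := congrArg (SmoothFn.eval y) hψ
      rw [map_mul, map_add, map_mul, map_one] at h5
      have h6 : SmoothFn.eval y (coordFn hO hr) = 0 := (hr1 y).2 hy
      rw [h6, zero_mul, add_zero] at h5
      rw [← h5, hN, PartialDerivatives.normSq]
      simp only [map_sum, map_mul, map_smul, hdR, smul_eq_mul]
      exact congrArg _ (Finset.sum_congr rfl fun a _ ↦ mul_comm _ _)
    have h7 := eq_smul_of_ker_le (L : EuclideanSpace ℝ (Fin d) →ₗ[ℝ] ℝ)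
      (δ : EuclideanSpace ℝ (Fin d) →ₗ[ℝ] F →L[ℝ] F) h1 h4 (EuclideanSpace.single i 1)
    change δ _ = L _ • _ • δ _ at h7
    rw [← SmoothFn.evalEnd_apply, map_sub, hθ, SmoothFn.evalEnd_smul, hχ, SmoothFn.evalEnd_smul,
      hdR, map_sum, h7, sub_eq_zero]
    simp only [SmoothFn.evalEnd_smul, hθ, map_sum, map_mul, hdR, hN, map_smul]
  -- Hadamard's lemma turns vanishing on the boundary into divisibility by r.
  obtain ⟨q, hq⟩ := SmoothFn.exists_eq_smul hx₀ hr1 (fun y hy hy0 ↦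
    fderivWithin_extend_coordFn_ne_zero hO hr hy (hdr _ ((hr1 ⟨y, hy⟩).2 hy0))) hvan
  exact ⟨q, by rw [← hq, add_sub_cancel]⟩

/-- The coefficient of the current is determined along the boundary by the connection induced on
the boundary. -/
theorem form_eq_of_hasBoundaryCondition (hι : IsBoundaryInclusion ι) (g : Metric d M)
    {r : M → ℝ} (hr : ContMDiff (𝓡∂ d) 𝓘(ℝ, ℝ) ∞ r)
    (hr0 : ∀ x, r x = 0 ↔ x ∈ (𝓡∂ d).boundary M)
    (hdr : ∀ x, r x = 0 → mfderiv (𝓡∂ d) 𝓘(ℝ, ℝ) r x ≠ 0) {A A' : CovariantDerivative (𝓡∂ d) F V}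
    (hA : A.ContMDiffCovariantDerivative ∞) (hA' : A'.ContMDiffCovariantDerivative ∞)
    {B : CovariantDerivative (𝓡 (d - 1)) F (RestrictedBundle ι V)}
    (hAB : HasBoundaryCondition ι A B) (hAB' : HasBoundaryCondition ι A' B) (hκ : κ + 4 = d)
    {k k' : Π x : M, TangentSpace (𝓡∂ d) x →L[ℝ] V x →L[ℝ] V x}
    (hk : ContMDiff (𝓡∂ d) ((𝓡∂ d).prod 𝓘(ℝ, EuclideanSpace ℝ (Fin d) →L[ℝ] F →L[ℝ] F)) ∞
        (fun x ↦ TotalSpace.mk' (EuclideanSpace ℝ (Fin d) →L[ℝ] F →L[ℝ] F) x (k x)))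
    (hk' : ContMDiff (𝓡∂ d) ((𝓡∂ d).prod 𝓘(ℝ, EuclideanSpace ℝ (Fin d) →L[ℝ] F →L[ℝ] F)) ∞
        (fun x ↦ TotalSpace.mk' (EuclideanSpace ℝ (Fin d) →L[ℝ] F →L[ℝ] F) x (k' x)))
    (hj : ∀ x v s, current g r A x v s = r x ^ κ • k x v s)
    (hj' : ∀ x v s, current g r A' x v s = r x ^ κ • k' x v s) (p : S) :
    k' (ι p) = k (ι p) := by
  obtain ⟨ε, hε, hO⟩ := exists_isChartDomain_halfBall (d := d) (F := F) (V := V) (ι p)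
  have hp0 := extChartAt_boundary hι p
  have hp : extChartAt (𝓡∂ d) (ι p) (ι p) ∈ halfBall (extChartAt (𝓡∂ d) (ι p) (ι p)) ε := by
    rw [mem_halfBall]
    exact ⟨hp0.ge, Metric.mem_ball_self hε⟩
  obtain ⟨ψ, hψ⟩ := exists_inverseNormSq_mul hO g hr hdr
  have hr1 (y : halfBall (extChartAt (𝓡∂ d) (ι p) (ι p)) ε) :
      (coordFn hO hr).1 y = 0 ↔ y.1 0 = 0 :=
    (hr0 _).trans (hO.symm_mem_boundary_iff y.2)
  obtain ⟨χ, hc⟩ := exists_components_sub_eq hι g hO hp0 hr hr0 hdr hA hA' hAB hAB'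
  choose c hc using hc
  -- No gauge transformation of the bundle has to be built: the homomorphism 1 + r η is internal to
  -- the algebra on the half ball.
  have key (b : Fin d) := PartialDerivatives.exists_sub_eq_smul_of_lowerCurrent
    (coordDerivatives F hO.tangent)
    (isSymm_metricMatrix hO.tangent g)
    (metricMatrix_mul_inv hO.tangent g) (SmoothFn.eq_zero_of_smul_eq_zero hr1)
    (coordCurrent_eq hO g hr hA hκ (hO.contDiffOn_formRep hk) hj)
    (coordCurrent_eq hO g hr hA' hκ (hO.contDiffOn_formRep hk') hj') hψ hc b
  have hrep : formRep (𝓡∂ d) F (ι p) k' (extChartAt (𝓡∂ d) (ι p) (ι p)) -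
      formRep (𝓡∂ d) F (ι p) k (extChartAt (𝓡∂ d) (ι p) (ι p)) = 0 := by
    refine formRep_eq_zero_of_single _ fun b ↦ ?_
    obtain ⟨q, hq⟩ := key b
    refine (congrArg (SmoothFn.evalEnd ⟨_, hp⟩) hq).trans ?_
    rw [SmoothFn.evalEnd_smul]
    have : SmoothFn.eval ⟨_, hp⟩ (coordFn hO hr) = 0 := (hr1 _).2 hp0
    rw [this, zero_smul]
  have hx : ι p ∈ {x | x ∈ (extChartAt (𝓡∂ d) (ι p)).source ∧ extChartAt (𝓡∂ d) (ι p) x ∈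
      halfBall (extChartAt (𝓡∂ d) (ι p) (ι p)) ε} := ⟨mem_extChartAt_source (ι p), hp⟩
  ext v s
  refine hO.fibreCoord_injective hx ?_
  rw [hO.fibreCoord_form hx, hO.fibreCoord_form hx, sub_eq_zero.1 hrep]

end Uniqueness
end ConformalYangMills

/-! ### Restriction of forms to the boundary. -/

namespace ConformalYangMills

section RestrictionToBoundary

variable {d : ℕ} [NeZero d] {M : Type*} [TopologicalSpace M]
  [ChartedSpace (EuclideanHalfSpace d) M] [IsManifold (𝓡∂ d) ∞ M]
  {S : Type*} [TopologicalSpace S] [ChartedSpace (EuclideanSpace ℝ (Fin (d - 1))) S]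
  [IsManifold (𝓡 (d - 1)) ∞ S]
  {F : Type*} [NormedAddCommGroup F] [NormedSpace ℝ F] [FiniteDimensional ℝ F]
  {V : M → Type*} [TopologicalSpace (TotalSpace F V)]
  [∀ x, AddCommGroup (V x)] [∀ x, Module ℝ (V x)] [∀ x, TopologicalSpace (V x)]
  [∀ x, IsTopologicalAddGroup (V x)] [∀ x, ContinuousSMul ℝ (V x)]
  [FiberBundle F V] [VectorBundle ℝ F V] [ContMDiffVectorBundle ∞ F V (𝓡∂ d)]
  {ι : C^∞⟮𝓡 (d - 1), S; 𝓡∂ d, M⟯}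

/-- The tangential part of an endomorphism valued one-form along the boundary. -/
noncomputable def restrictForm (ι : C^∞⟮𝓡 (d - 1), S; 𝓡∂ d, M⟯)
    (k : Π x : M, TangentSpace (𝓡∂ d) x →L[ℝ] V x →L[ℝ] V x) (p : S) :
    TangentSpace (𝓡 (d - 1)) p →L[ℝ] RestrictedBundle ι V p →L[ℝ] RestrictedBundle ι V p :=
  ContinuousLinearMap.comp (k (ι p)) (mfderiv (𝓡 (d - 1)) (𝓡∂ d) ι p)

set_option synthInstance.maxHeartbeats 200000 in
-- In charts this is the pullback of the local representative by the coordinate expression of ι,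
-- composed with its derivative.
lemma contMDiff_restrictForm {k : Π x : M, TangentSpace (𝓡∂ d) x →L[ℝ] V x →L[ℝ] V x}
    (hk : ContMDiff (𝓡∂ d) ((𝓡∂ d).prod 𝓘(ℝ, EuclideanSpace ℝ (Fin d) →L[ℝ] F →L[ℝ] F)) ∞
        (fun x ↦ TotalSpace.mk' (EuclideanSpace ℝ (Fin d) →L[ℝ] F →L[ℝ] F) x (k x))) :
    ContMDiff (𝓡 (d - 1))
      ((𝓡 (d - 1)).prod 𝓘(ℝ, EuclideanSpace ℝ (Fin (d - 1)) →L[ℝ] F →L[ℝ] F)) ∞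
      (fun p ↦ TotalSpace.mk' (EuclideanSpace ℝ (Fin (d - 1)) →L[ℝ] F →L[ℝ] F) p
        (restrictForm ι k p)) := by
  refine contMDiff_of_contDiffOn_formRep fun p₀ ↦ ?_
  have hO := IsChartDomain.maximal (𝓡∂ d) F V (ι p₀)
  obtain ⟨W, hW, hp₀, hWO⟩ := exists_isChartDomain_forall (I := 𝓡 (d - 1)) (F := F)
    (V := RestrictedBundle ι V) (ι.contMDiff.continuous.continuousAt.preimage_mem_nhds
    (hO.isOpen_preimage.mem_nhds ⟨mem_extChartAt_source (ι p₀),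
      IsChartDomain.mem_maximal (𝓡∂ d) F V (ι p₀)⟩))
  refine ⟨W, hW, hp₀, ?_⟩
  set f : S → EuclideanSpace ℝ (Fin d) := fun p ↦ extChartAt (𝓡∂ d) (ι p₀) (ι p) with hf
  have hsrc {z} (hz : z ∈ W) : ι ((extChartAt (𝓡 (d - 1)) p₀).symm z) ∈
      (chartAt (EuclideanHalfSpace d) (ι p₀)).source := by
    rw [← extChartAt_source (𝓡∂ d)]
    exact (hWO z hz).1
  have hf1 {z} (hz : z ∈ W) : ContMDiffAt (𝓡 (d - 1)) 𝓘(ℝ, EuclideanSpace ℝ (Fin d)) ∞ f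
      ((extChartAt (𝓡 (d - 1)) p₀).symm z) :=
    (contMDiffAt_extChartAt' (hsrc hz)).comp _ (ι.contMDiff _)
  have hf2 : ContDiffOn ℝ ∞ (f ∘ (extChartAt (𝓡 (d - 1)) p₀).symm) W := fun z hz ↦
    (hW.contMDiffAt_iff hz).1 (hf1 hz)
  have hk1 : ContDiffOn ℝ ∞ (fun z ↦ formRep (𝓡∂ d) F (ι p₀) k
      ((f ∘ (extChartAt (𝓡 (d - 1)) p₀).symm) z)) W :=
    (hO.contDiffOn_formRep hk).comp hf2 fun z hz ↦ (hWO z hz).2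
  refine (hk1.clm_comp (hf2.fderivWithin hW.uniqueDiffOn (m := ∞) (by simp))).congr fun z hz ↦ ?_
  have hp := hW.symm_mem_preimage hz
  ext v s
  obtain ⟨v, rfl⟩ : ∃ u, tangentCoord (𝓡 (d - 1)) p₀ ((extChartAt (𝓡 (d - 1)) p₀).symm z) u = v :=
    ⟨frame (𝓡 (d - 1)) p₀ z v, hW.tangent.fibreMap_apply hz v⟩
  obtain ⟨s, rfl⟩ : ∃ t, fibreCoord F (V := RestrictedBundle ι V) p₀
      ((extChartAt (𝓡 (d - 1)) p₀).symm z) t = s :=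
    ⟨fibreMap (𝓡 (d - 1)) F (RestrictedBundle ι V) p₀ z s, hW.fibreMap_apply hz s⟩
  have h1 := hW.fibreCoord_form hp (restrictForm ι k) v s
  have h2 := hO.fibreCoord_form (hWO z hz) k (mfderiv (𝓡 (d - 1)) (𝓡∂ d) ι _ v) s
  rw [hW.right_inv hz] at h1
  have h3 := (fibreCoord_restrictedBundle p₀ _ (restrictForm ι k _ v s)).trans h2
  have h4 : tangentCoord (𝓡∂ d) (ι p₀) _ (mfderiv (𝓡 (d - 1)) (𝓡∂ d) ι _ v) =
      fderivWithin ℝ (f ∘ (extChartAt (𝓡 (d - 1)) p₀).symm) W z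
        (tangentCoord (𝓡 (d - 1)) p₀ ((extChartAt (𝓡 (d - 1)) p₀).symm z) v) := by
    have h5 := hW.mfderiv_eq_tangentCoord hp ((hf1 hz).mdifferentiableAt (by simp)) v
    rw [hW.right_inv hz] at h5
    refine Eq.trans ?_ h5
    refine (hO.mfderiv_extChartAt_eq_tangentCoord (hWO z hz) _).symm.trans ?_
    exact (congrArg (fun L ↦ L v) (mfderiv_comp ((extChartAt (𝓡 (d - 1)) p₀).symm z)
      (mdifferentiableAt_extChartAt (hsrc hz))
      ((ι.contMDiff _).mdifferentiableAt (by simp)))).symm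
  refine h1.symm.trans (h3.trans ?_)
  rw [h4]
  exact congrArg _ (fibreCoord_restrictedBundle p₀ _ s).symm

end RestrictionToBoundary

/-! ### Vanishing of the normal component. -/

section NormalComponent

variable {d : ℕ} [NeZero d] {M : Type*} [TopologicalSpace M] [T2Space M]
  [ChartedSpace (EuclideanHalfSpace d) M] [IsManifold (𝓡∂ d) ∞ M]
  {F : Type*} [NormedAddCommGroup F] [NormedSpace ℝ F] [FiniteDimensional ℝ F]
  {V : M → Type*} [TopologicalSpace (TotalSpace F V)]
  [∀ x, AddCommGroup (V x)] [∀ x, Module ℝ (V x)] [∀ x, TopologicalSpace (V x)]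
  [∀ x, IsTopologicalAddGroup (V x)] [∀ x, ContinuousSMul ℝ (V x)]
  [FiberBundle F V] [VectorBundle ℝ F V] [ContMDiffVectorBundle ∞ F V (𝓡∂ d)] {κ : ℕ}

/-- The normal component of the coefficient of the current vanishes along the boundary. -/
theorem form_gradient_eq_zero (g : Metric d M)
    {r : M → ℝ} (hr : ContMDiff (𝓡∂ d) 𝓘(ℝ, ℝ) ∞ r)
    (hr0 : ∀ x, r x = 0 ↔ x ∈ (𝓡∂ d).boundary M) {A : CovariantDerivative (𝓡∂ d) F V}
    (hA : A.ContMDiffCovariantDerivative ∞) (hκ : κ + 4 = d)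
    {k : Π x : M, TangentSpace (𝓡∂ d) x →L[ℝ] V x →L[ℝ] V x}
    (hk : ContMDiff (𝓡∂ d) ((𝓡∂ d).prod 𝓘(ℝ, EuclideanSpace ℝ (Fin d) →L[ℝ] F →L[ℝ] F)) ∞
        (fun x ↦ TotalSpace.mk' (EuclideanSpace ℝ (Fin d) →L[ℝ] F →L[ℝ] F) x (k x)))
    (hj : ∀ x v s, current g r A x v s = r x ^ κ • k x v s) {x₀ : M}
    (hx₀ : r x₀ = 0) : k x₀ (gradient g r x₀) = 0 := by
  obtain ⟨ε, hε, hO⟩ := exists_isChartDomain_halfBall (d := d) (F := F) (V := V) x₀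
  have hr1 (y : halfBall (extChartAt (𝓡∂ d) x₀ x₀) ε) :
      (coordFn hO hr).1 y = 0 ↔ y.1 0 = 0 :=
    (hr0 _).trans (hO.symm_mem_boundary_iff y.2)
  have hp : extChartAt (𝓡∂ d) x₀ x₀ ∈ halfBall (extChartAt (𝓡∂ d) x₀ x₀) ε := by
    rw [mem_halfBall]
    refine ⟨?_, Metric.mem_ball_self hε⟩
    have := extChartAt_target_subset_range (I := 𝓡∂ d) x₀ (mem_extChartAt_target (I := 𝓡∂ d) x₀)
    rwa [range_modelWithCornersEuclideanHalfSpace] at this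
  obtain ⟨q, hq⟩ := PartialDerivatives.exists_sum_eq_smul_of_lowerCurrent
    (coordDerivatives F hO.tangent) (isSymm_metricMatrix hO.tangent g)
    (metricMatrix_mul_inv hO.tangent g) (SmoothFn.eq_zero_of_smul_eq_zero hr1) le_rfl
    (coordCurrent_eq hO g hr hA hκ (hO.contDiffOn_formRep hk) hj)
  set y : halfBall (extChartAt (𝓡∂ d) x₀ x₀) ε := ⟨_, hp⟩ with hy
  have hr2 : MDifferentiableAt (𝓡∂ d) 𝓘(ℝ, ℝ) r ((extChartAt (𝓡∂ d) x₀).symm y) :=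
    (hr _).mdifferentiableAt (by simp)
  have h1 := congrArg (SmoothFn.evalEnd y) hq
  have h2 : SmoothFn.eval y (coordFn hO hr) = 0 := by
    change r ((extChartAt (𝓡∂ d) x₀).symm (extChartAt (𝓡∂ d) x₀ x₀)) = 0
    rwa [extChartAt_to_inv]
  have hdR (c : Fin d) : SmoothFn.eval y
      ((coordDerivatives F hO.tangent).dR c (coordFn hO hr)) =
        fderivWithin ℝ (r ∘ (extChartAt (𝓡∂ d) x₀).symm) _ y (EuclideanSpace.single c 1) :=
    coordDerivatives_dR_mk (F := F) hO.tangent c _ _ y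
  have hG (a c : Fin d) : SmoothFn.eval y ((metricMatrix hO.tangent g)⁻¹ a c) =
      inverseMetricRep g x₀ y a c := metricMatrix_inv_apply hO.tangent g y a c
  have hk1 (a : Fin d) : SmoothFn.evalEnd y (components (hO.contDiffOn_formRep hk) a) =
      formRep (𝓡∂ d) F x₀ k y (EuclideanSpace.single a 1) := rfl
  rw [SmoothFn.evalEnd_smul, h2, zero_smul, map_sum] at h1
  simp only [SmoothFn.evalEnd_smul, map_sum, map_mul, hdR, hG, hk1] at h1
  have h3 : k ((extChartAt (𝓡∂ d) x₀).symm y)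
      (gradient g r ((extChartAt (𝓡∂ d) x₀).symm y)) = 0 := by
    ext s
    obtain ⟨f, rfl⟩ := hO.fibreMap_surjective y.2 s
    rw [gradient_eq hO.tangent g y.2 hr2]
    refine (hO.fibreMap_formRep y.2 k _ f).symm.trans ?_
    rw [zero_apply]
    refine (congrArg _ ?_).trans (map_zero (fibreMap (𝓡∂ d) F V x₀ y))
    refine congrArg (fun T : F →L[ℝ] F ↦ T f) (Eq.trans ?_ h1)
    simp only [map_sum, map_smul, Finset.sum_smul]
  have h4 : (extChartAt (𝓡∂ d) x₀).symm y = x₀ := extChartAt_to_inv x₀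
  rwa [h4] at h3

end NormalComponent
end ConformalYangMills

/-! ### Existence and uniqueness of the obstruction current. -/

namespace ConformalYangMills

section Main

variable {d : ℕ} [NeZero d] {M : Type*} [TopologicalSpace M] [T2Space M]
  [ChartedSpace (EuclideanHalfSpace d) M] [IsManifold (𝓡∂ d) ∞ M]
  {S : Type*} [TopologicalSpace S] [ChartedSpace (EuclideanSpace ℝ (Fin (d - 1))) S]
  [IsManifold (𝓡 (d - 1)) ∞ S]
  {F : Type*} [NormedAddCommGroup F] [NormedSpace ℝ F] [FiniteDimensional ℝ F]
  {V : M → Type*} [TopologicalSpace (TotalSpace F V)]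
  [∀ x, AddCommGroup (V x)] [∀ x, Module ℝ (V x)] [∀ x, TopologicalSpace (V x)]
  [∀ x, IsTopologicalAddGroup (V x)] [∀ x, ContinuousSMul ℝ (V x)]
  [FiberBundle F V] [VectorBundle ℝ F V] [ContMDiffVectorBundle ∞ F V (𝓡∂ d)]
  {ι : C^∞⟮𝓡 (d - 1), S; 𝓡∂ d, M⟯} {c : ConformalClass d M}

lemma IsDefiningDensity.mfderiv_ne_zero {σ : Density c 1} (hσ : IsDefiningDensity σ)
    (g : c.metrics) (x : M) (hx : σ.val g x = 0) :
    mfderiv (𝓡∂ d) 𝓘(ℝ, ℝ) (σ.val g) x ≠ 0 :=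
  hσ.deriv_ne_zero g x ((hσ.zero_iff g x).1 hx)

/-- Every smooth connection on the boundary has an asymptotically Yang-Mills extension. -/
theorem exists_asymptoticallyYangMills_extension [SigmaCompactSpace M] (hd : 4 ≤ d)
    (hι : IsBoundaryInclusion ι) {σ : Density c 1} (hσ : IsDefiningDensity σ)
    {B : CovariantDerivative (𝓡 (d - 1)) F (RestrictedBundle ι V)}
    (hB : B.ContMDiffCovariantDerivative ∞) :
    ∃ (A : CovariantDerivative (𝓡∂ d) F V) (k : WeightedEndForm F V c (3 - (d : ℤ))),
      HasBoundaryCondition ι A B ∧ IsAsymptoticallyYangMills σ A k := by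
  obtain ⟨g, hg⟩ := c.nonempty
  obtain ⟨A₀, hA₀, hAB₀⟩ := exists_hasBoundaryCondition (V := V) hι hB
  obtain ⟨A, k, hA, hAA₀, hk, hj⟩ := exists_current_eq_pow g (σ.smooth ⟨g, hg⟩)
    (hσ.zero_iff ⟨g, hg⟩) (hσ.mfderiv_ne_zero ⟨g, hg⟩) hA₀ (Nat.sub_add_cancel hd)
  obtain ⟨k', hk'⟩ := exists_isAsymptoticallyYangMills σ ⟨g, hg⟩ hA hd hk hj
  refine ⟨A, k', fun p s hs v ↦ ?_, hk'⟩
  rw [hAA₀ s (ι p) ((hσ.zero_iff ⟨g, hg⟩ _).2 (hι.range_eq ▸ mem_range_self p))]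
  exact hAB₀ p s hs v

/-- The tangential part along the boundary of an endomorphism valued one-form with a conformal
weight. -/
noncomputable def WeightedEndForm.restrict {w : ℤ} (k : WeightedEndForm F V c w)
    (ι : C^∞⟮𝓡 (d - 1), S; 𝓡∂ d, M⟯) : BoundaryWeightedEndForm F V c ι w where
  val g := restrictForm ι (k.val g)
  smooth g := contMDiff_restrictForm (k.smooth g)
  rescale g g' Ω h p := by
    rw [restrictForm, k.rescale g g' Ω h (ι p)]
    rfl

/-- The coefficient of the current of an asymptotically Yang-Mills connection is determined along
the boundary by the connection on the boundary. -/
theorem IsAsymptoticallyYangMills.restrictsTo (hd : 4 ≤ d) (hι : IsBoundaryInclusion ι)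
    {σ : Density c 1} (hσ : IsDefiningDensity σ)
    {B : CovariantDerivative (𝓡 (d - 1)) F (RestrictedBundle ι V)}
    {A A' : CovariantDerivative (𝓡∂ d) F V} {k k' : WeightedEndForm F V c (3 - (d : ℤ))}
    (hAB : HasBoundaryCondition ι A B) (h : IsAsymptoticallyYangMills σ A k)
    (hAB' : HasBoundaryCondition ι A' B) (h' : IsAsymptoticallyYangMills σ A' k') :
    RestrictsTo σ k' (k.restrict ι) where
  normal g p := form_gradient_eq_zero g.1 (σ.smooth g) (hσ.zero_iff g) h'.smooth
    (Nat.sub_add_cancel hd) (k'.smooth g) (h'.current_eq g)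
    ((hσ.zero_iff g _).2 (hι.range_eq ▸ mem_range_self p))
  tangential g p v s := by
    rw [form_eq_of_hasBoundaryCondition hι g.1 (σ.smooth g) (hσ.zero_iff g)
      (hσ.mfderiv_ne_zero g) h.smooth h'.smooth hAB hAB' (Nat.sub_add_cancel hd) (k.smooth g)
      (k'.smooth g) (h.current_eq g) (h'.current_eq g) p]
    rfl

lemma RestrictsTo.unique {σ : Density c 1} {w : ℤ} {k : WeightedEndForm F V c w}
    {κ κ' : BoundaryWeightedEndForm F V c ι w} (h : RestrictsTo σ k κ) (h' : RestrictsTo σ k κ') :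
    κ = κ' := by
  refine BoundaryWeightedEndForm.ext (funext fun g ↦ funext fun p ↦ ?_)
  ext v s
  exact (h.tangential g p v s).symm.trans (h'.tangential g p v s)

end Main
end ConformalYangMills

theorem corollary4p2 {d : ℕ} [NeZero d] (hd : 5 ≤ d)
    {M : Type*} [TopologicalSpace M] [T2Space M] [SigmaCompactSpace M]
    [ChartedSpace (EuclideanHalfSpace d) M] [IsManifold (𝓡∂ d) ∞ M]
    {S : Type*} [TopologicalSpace S] [ChartedSpace (EuclideanSpace ℝ (Fin (d - 1))) S]
    [IsManifold (𝓡 (d - 1)) ∞ S]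
    (ι : C^∞⟮𝓡 (d - 1), S; 𝓡∂ d, M⟯) (hι : ConformalYangMills.IsBoundaryInclusion ι)
    (c : ConformalYangMills.ConformalClass d M)
    (σ : ConformalYangMills.Density c 1) (hσ : ConformalYangMills.IsDefiningDensity σ)
    {F : Type*} [NormedAddCommGroup F] [NormedSpace ℝ F] [FiniteDimensional ℝ F]
    {V : M → Type*} [TopologicalSpace (TotalSpace F V)]
    [∀ x, AddCommGroup (V x)] [∀ x, Module ℝ (V x)] [∀ x, TopologicalSpace (V x)]
    [∀ x, IsTopologicalAddGroup (V x)] [∀ x, ContinuousSMul ℝ (V x)]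
    [FiberBundle F V] [VectorBundle ℝ F V] [ContMDiffVectorBundle ∞ F V (𝓡∂ d)]
    (B : CovariantDerivative (𝓡 (d - 1)) F (ConformalYangMills.RestrictedBundle ι V))
    (hB : B.ContMDiffCovariantDerivative ∞) :
    (∃ (A : CovariantDerivative (𝓡∂ d) F V)
        (k : ConformalYangMills.WeightedEndForm F V c (3 - (d : ℤ))),
      ConformalYangMills.HasBoundaryCondition ι A B ∧
        ConformalYangMills.IsAsymptoticallyYangMills σ A k) ∧
    ∃! κ : ConformalYangMills.BoundaryWeightedEndForm F V c ι (3 - (d : ℤ)),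
      ∀ (A : CovariantDerivative (𝓡∂ d) F V)
        (k : ConformalYangMills.WeightedEndForm F V c (3 - (d : ℤ))),
        ConformalYangMills.HasBoundaryCondition ι A B →
        ConformalYangMills.IsAsymptoticallyYangMills σ A k →
        ConformalYangMills.RestrictsTo σ k κ := by
  have hd4 : 4 ≤ d := Nat.le_of_succ_le hd
  obtain ⟨A, k, hAB, hA⟩ :=
    ConformalYangMills.exists_asymptoticallyYangMills_extension (V := V) hd4 hι hσ hB
  -- The obstruction current is the tangential restriction of k for one extension. Independence
  -- makes it valid for all extensions, and existence of that one extension forces uniqueness.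
  refine ⟨⟨A, k, hAB, hA⟩, k.restrict ι, fun A' k' hAB' hA' ↦
    hA.restrictsTo hd4 hι hσ hAB hAB' hA', fun κ hκ ↦ ?_⟩
  exact (hκ A k hAB hA).unique (hA.restrictsTo hd4 hι hσ hAB hAB hA)
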